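/- \textbf{Conventions.} Composition is written in diagrammatic order. A \emph{Cartesian restriction category} is a restriction category (with restriction operator $f\mapsto\overline f$) with a chosen restriction terminal object $1$ and chosen binary restriction products $X\times Y$, with total projections $\pi_0,\pi_1$; a map $f:X\to Y$ is \emph{total} if $\overline f=1_X$. Morphisms of Cartesian restriction categories are functors that preserve restrictions and the chosen finite products exactly. A (total) commutative monoid $(A,+,0)$ has total maps $+:A\times A\to A$ and $0:1\to A$; for $f,g:Z\to A$ put $f+g=\langle f,g\rangle +$ and write $0:Z\to A$ for $!\,0$. In $A^n\times X$ let $\pi_0,\dots,\pi_{n-1}$ be the projections to $A$ and $\pi_n$ the projection to $X$. \textbf{Generalized differential restriction categories.} A \emph{generalized differential restriction category} is a Cartesian restriction category with, for each object $X$, a total commutative monoid $L(X)=(L_0(X),+_X,0_X)$ such that $L(L_0(X))=L(X)$, $L(1)=1$ and $L(X\times Y)=L(X)\times L(Y)$, and, for each $f:X\to Y$, a map $D[f]:L_0(X)\times X\to L_0(Y)$, such that (1) $D[+_X]=\pi_0+_X$ and $D[0_X]=\pi_0 0_X$; (2) $\langle a+b,c\rangle D[f]=\langle a,c\rangle D[f]+\langle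 b,c\rangle D[f]$ and $\langle 0,a\rangle D[f]=\overline{af}\,0$; (3) $D[\pi_0]=\pi_0\pi_0$ and $D[\pi_1]=\pi_0\pi_1$; (4) $D[\langle f,g\rangle]=\langle D[f],D[g]\rangle$; (5) $D[fg]=\langle D[f],\pi_1f\rangle D[g]$; (6) $\langle\langle a,0\rangle,\langle c,d\rangle\rangle D[D[f]]=\overline c\,\langle a,d\rangle D[f]$; (7) $\langle\langle 0,b\rangle,\langle c,d\rangle\rangle D[D[f]]=\langle\langle 0,c\rangle,\langle b,d\rangle\rangle D[D[f]]$; (8) $D[\overline f]=\overline{\pi_1f}\,\pi_0$; (9) $\overline{D[f]}=\overline{\pi_1f}$. \textbf{The Fa\`a di Bruno construction.} For a Cartesian restriction category $\mathbb X$, the objects of $\mathrm{Fa\grave a}(\mathbb X)$ are the pairs $((A,+,0),X)$ of a total commutative monoid and an object of $\mathbb X$. A map $((A,+,0),X)\to((B,+,0),Y)$ is a sequence $f=(f_*,f_1,f_2,\dots)$ with $f_*:X\to Y$ and $f_n:A^n\times X\to B$, where each $f_n$ is symmetric and additive in each of its first $n$ variables (in the sense of (2): sums go to sums, and inserting $0$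 gives a restriction of $0$) and $\overline{f_n}=\overline{\pi_nf_*}$. Identities are $(1,\pi_0,0,0,\dots)$; composition is $(fg)_*=f_*g_*$ and \[(fg)_n=\sum_{\{b_1,\dots,b_k\}}\langle p_{b_1}f_{|b_1|},\dots,p_{b_k}f_{|b_k|},\pi_nf_*\rangle g_k ,\] the sum over all partitions of $\{0,\dots,n-1\}$ into nonempty blocks, where $p_b=\langle(\pi_j)_{j\in b},\pi_n\rangle$; the restriction is $\overline f=(\overline{f_*},\overline{\pi_1f_*}\,\pi_0,\overline{\pi_2f_*}\,0,\overline{\pi_3f_*}\,0,\dots)$. Products are taken componentwise, $(A,X)\times(B,Y)=(A\times B,X\times Y)$, with projections $(\pi_i,\pi_0\pi_i,0,0,\dots)$ and $\langle f,g\rangle=(\langle f_*,g_*\rangle,\langle f_1,g_1\rangle,\dots)$. A morphism $F$ acts by $\mathrm{Fa\grave a}(F)((A,+,0),X)=((FA,F{+},F0),FX)$ and $\mathrm{Fa\grave a}(F)(f_*,f_1,\dots)=(F f_*,F f_1,\dots)$. The counit is $\epsilon((A,+,0),X)=X$, $\epsilon(f)=f_*$. The comultiplication $\delta:\mathrm{Fa\grave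 a}(\mathbb X)\to\mathrm{Fa\grave a}(\mathrm{Fa\grave a}(\mathbb X))$ is \[\delta((A,+,0),X)=\Big(\big(((A,+,0),A),(+,\pi_0+,0,\dots),(0,\pi_00,0,\dots)\big),((A,+,0),X)\Big),\] $\delta(f)_*=f$, $(\delta(f)_n)_*=f_n$, and, in variables $(a_j^1,\dots,a_j^n,b_j)$ $(1\le j\le m)$ and $(v^1,\dots,v^n,x)$, \[(\delta(f)_n)_m=\sum_{\varphi}f_{n+k}\big(w^1,\dots,w^n,b_{j_1},\dots,b_{j_k};x\big),\] the sum over all injective partial maps $\varphi$ from $\{1,\dots,n\}$ to $\{1,\dots,m\}$, where $w^i=a_{\varphi(i)}^i$ if $\varphi(i)$ is defined and $w^i=v^i$ otherwise, and $j_1<\dots<j_k$ are the elements that are not values of $\varphi$. \textbf{Corollary.} $(\mathrm{Fa\grave a},\epsilon,\delta)$ is well defined and is a comonad on the category of Cartesian restriction categories. If $\mathbb X$ is any Cartesian restriction category, then the Cartesian restriction category $\mathrm{Fa\grave a}(\mathbb X)$ is a generalized differential restriction category, with \[D[f]=[\delta(f)]_1\] and $L((A,+,0),X)$ the monoid $\big(((A,+,0),A),(+,\pi_0+,0,\dots),(0,\pi_00,0,\dots)\big)$,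 i.e. the monoid part of $\delta((A,+,0),X)$. This structure is the one given by the cofree coalgebra on $\mathbb X$: $(\mathrm{Fa\grave a}(\mathbb X),\delta)$ is a coalgebra for the comonad, and for every coalgebra $(\mathbb Y,\mathcal D)$ and every morphism $F:\mathbb Y\to\mathbb X$ of Cartesian restriction categories there is a unique coalgebra morphism $H:(\mathbb Y,\mathcal D)\to(\mathrm{Fa\grave a}(\mathbb X),\delta)$ with $\epsilon\circ H=F$. -/

import Mathlib

open CategoryTheory

universe v u v' u' v'' u''

noncomputable section

namespace FaaDiBruno

/-! ### Cartesian restriction categories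

Composition is written in diagrammatic order throughout. -/

/-- The shape of a category with chosen finite products: objects, maps, a chosen terminal object
and chosen binary products of objects (no operations on maps yet). -/
class CartQuiver (C : Type u) extends Quiver.{v} C where
  one : C
  prod : C → C → C

/-- A Cartesian restriction category on a given shape: a category with a restriction operator
`rst` satisfying the four restriction axioms, a chosen restriction terminal object and chosen
binary restriction products. -/
class CartRestrCat (C : Type u) [CartQuiver.{v} C] where
  idm (X : C) : X ⟶ X
  comp {X Y Z : C} (f : X ⟶ Y) (g : Y ⟶ Z) : X ⟶ Z
  rst {X Y : C} (f : X ⟶ Y) : X ⟶ X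
  bang (X : C) : X ⟶ CartQuiver.one
  fst (X Y : C) : CartQuiver.prod X Y ⟶ X
  snd (X Y : C) : CartQuiver.prod X Y ⟶ Y
  pair {Z X Y : C} (f : Z ⟶ X) (g : Z ⟶ Y) : Z ⟶ CartQuiver.prod X Y
  -- the category axioms
  idm_comp {X Y : C} (f : X ⟶ Y) : comp (idm X) f = f
  comp_idm {X Y : C} (f : X ⟶ Y) : comp f (idm Y) = f
  comp_assoc {W X Y Z : C} (f : W ⟶ X) (g : X ⟶ Y) (h : Y ⟶ Z) :
    comp (comp f g) h = comp f (comp g h)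
  -- the four restriction axioms
  rst_self {X Y : C} (f : X ⟶ Y) : comp (rst f) f = f
  rst_comm {X Y Z : C} (f : X ⟶ Y) (g : X ⟶ Z) : comp (rst f) (rst g) = comp (rst g) (rst f)
  rst_rst_comp {X Y Z : C} (f : X ⟶ Y) (g : X ⟶ Z) :
    rst (comp (rst f) g) = comp (rst f) (rst g)
  comp_rst {X Y Z : C} (f : X ⟶ Y) (g : Y ⟶ Z) :
    comp f (rst g) = comp (rst (comp f g)) f
  -- the restriction terminal object
  rst_bang (X : C) : rst (bang X) = idm X
  bang_unique {X : C} (f : X ⟶ CartQuiver.one) : f = comp (rst f) (bang X)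
  -- binary restriction products: total projections, and `pair f g` is the unique map `k` with
  -- `k π₀ ≤ f`, `k π₁ ≤ g` and `rst k = rst f rst g`, where `a ≤ b` means `rst a b = a`
  rst_fst (X Y : C) : rst (fst X Y) = idm _
  rst_snd (X Y : C) : rst (snd X Y) = idm _
  pair_comp_fst_le {Z X Y : C} (f : Z ⟶ X) (g : Z ⟶ Y) :
    comp (rst (comp (pair f g) (fst X Y))) f = comp (pair f g) (fst X Y)
  pair_comp_snd_le {Z X Y : C} (f : Z ⟶ X) (g : Z ⟶ Y) :
    comp (rst (comp (pair f g) (snd X Y))) g = comp (pair f g) (snd X Y)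
  rst_pair {Z X Y : C} (f : Z ⟶ X) (g : Z ⟶ Y) : rst (pair f g) = comp (rst f) (rst g)
  pair_unique {Z X Y : C} (f : Z ⟶ X) (g : Z ⟶ Y) (k : Z ⟶ CartQuiver.prod X Y)
    (hf : comp (rst (comp k (fst X Y))) f = comp k (fst X Y))
    (hg : comp (rst (comp k (snd X Y))) g = comp k (snd X Y))
    (hk : rst k = comp (rst f) (rst g)) : k = pair f g

instance {C : Type u} [CartQuiver.{v} C] [CartRestrCat C] : Category.{v} C where
  id := CartRestrCat.idm
  comp := CartRestrCat.comp
  id_comp := CartRestrCat.idm_comp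
  comp_id := CartRestrCat.comp_idm
  assoc := CartRestrCat.comp_assoc

open CartQuiver CartRestrCat

section Basic

variable {C : Type u} [CartQuiver.{v} C] [CartRestrCat C]

/-- Equality of maps whose sources and targets are equal, but perhaps not definitionally. -/
def SameArrow {X Y X' Y' : C} (f : X ⟶ Y) (g : X' ⟶ Y') : Prop :=
  ∃ (hX : X = X') (hY : Y = Y'), f = eqToHom hX ≫ g ≫ eqToHom hY.symm

lemma SameArrow.rfl' {X Y : C} (f : X ⟶ Y) : SameArrow f f := ⟨rfl, rfl, by simp⟩

lemma SameArrow.trans' {X Y X' Y' X'' Y'' : C} {f : X ⟶ Y} {g : X' ⟶ Y'} {h : X'' ⟶ Y''}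
    (a : SameArrow f g) (b : SameArrow g h) : SameArrow f h := by
  obtain ⟨rfl, rfl, rfl⟩ := a
  obtain ⟨rfl, rfl, rfl⟩ := b
  exact ⟨rfl, rfl, by simp⟩

/-- A map is total when its restriction is an identity. -/
def Total {X Y : C} (f : X ⟶ Y) : Prop := rst f = 𝟙 X

lemma rst_id (X : C) : rst (𝟙 X) = 𝟙 X := by
  have h : rst (𝟙 X) ≫ 𝟙 X = 𝟙 X := rst_self (𝟙 X)
  simpa using h

lemma rst_self' {X Y : C} (f : X ⟶ Y) : rst f ≫ f = f := rst_self f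

lemma rst_self_assoc {X Y Z : C} (f : X ⟶ Y) (g : Y ⟶ Z) : rst f ≫ f ≫ g = f ≫ g := by
  rw [← Category.assoc, rst_self']

lemma rst_comm' {X Y Z : C} (f : X ⟶ Y) (g : X ⟶ Z) : rst f ≫ rst g = rst g ≫ rst f :=
  rst_comm f g

lemma comp_rst' {X Y Z : C} (f : X ⟶ Y) (g : Y ⟶ Z) : f ≫ rst g = rst (f ≫ g) ≫ f :=
  comp_rst f g

lemma rst_rst_comp' {X Y Z : C} (f : X ⟶ Y) (g : X ⟶ Z) :
    rst (rst f ≫ g) = rst f ≫ rst g := rst_rst_comp f g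

lemma rst_idem {X Y Z : C} (f : X ⟶ Y) (g : X ⟶ Z) : rst f ≫ rst f ≫ g = rst f ≫ g := by
  rw [← Category.assoc, ← rst_rst_comp', rst_self']

lemma rst_left_comm {X Y Z W : C} (f : X ⟶ Y) (g : X ⟶ Z) (h : X ⟶ W) :
    rst f ≫ rst g ≫ h = rst g ≫ rst f ≫ h := by
  rw [← Category.assoc, rst_comm', Category.assoc]

lemma rst_comp_absorb {X Y Z : C} (f : X ⟶ Y) (g : Y ⟶ Z) :
    rst f ≫ rst (f ≫ g) = rst (f ≫ g) := by
  rw [← rst_rst_comp', rst_self_assoc]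

lemma rst_comp_rst {X Y Z : C} (f : X ⟶ Y) (g : Y ⟶ Z) : rst (f ≫ rst g) = rst (f ≫ g) := by
  rw [comp_rst', rst_rst_comp', rst_comm', rst_comp_absorb]

lemma rst_comp_total {X Y Z : C} (f : X ⟶ Y) {g : Y ⟶ Z} (hg : Total g) :
    rst (f ≫ g) = rst f := by
  rw [← rst_comp_rst, show rst g = 𝟙 _ from hg, Category.comp_id]

lemma total_comp {X Y Z : C} {f : X ⟶ Y} {g : Y ⟶ Z} (hf : Total f) (hg : Total g) :
    Total (f ≫ g) := (rst_comp_total f hg).trans hf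

lemma total_id (X : C) : Total (𝟙 X) := rst_id X
lemma total_fst (X Y : C) : Total (fst X Y) := rst_fst X Y
lemma total_snd (X Y : C) : Total (snd X Y) := rst_snd X Y
lemma total_bang (X : C) : Total (bang X) := rst_bang X

lemma rst_pair' {Z X Y : C} (f : Z ⟶ X) (g : Z ⟶ Y) : rst (pair f g) = rst f ≫ rst g :=
  rst_pair f g

lemma total_pair {Z X Y : C} {f : Z ⟶ X} {g : Z ⟶ Y} (hf : Total f) (hg : Total g) :
    Total (pair f g) := by
  unfold Total at *
  rw [rst_pair', hf, hg, Category.comp_id]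

lemma pair_fst {Z X Y : C} (f : Z ⟶ X) (g : Z ⟶ Y) : pair f g ≫ fst X Y = rst g ≫ f := by
  have h : rst (pair f g ≫ fst X Y) ≫ f = pair f g ≫ fst X Y := pair_comp_fst_le f g
  rw [← h, rst_comp_total _ (total_fst X Y), rst_pair', rst_comm', Category.assoc, rst_self']

lemma pair_snd {Z X Y : C} (f : Z ⟶ X) (g : Z ⟶ Y) : pair f g ≫ snd X Y = rst f ≫ g := by
  have h : rst (pair f g ≫ snd X Y) ≫ g = pair f g ≫ snd X Y := pair_comp_snd_le f g
  rw [← h, rst_comp_total _ (total_snd X Y), rst_pair', Category.assoc, rst_self']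

lemma pair_unique' {Z X Y : C} {f : Z ⟶ X} {g : Z ⟶ Y} {k : Z ⟶ prod X Y}
    (hf : k ≫ fst X Y = rst g ≫ f) (hg : k ≫ snd X Y = rst f ≫ g)
    (hk : rst k = rst f ≫ rst g) : k = pair f g := by
  refine pair_unique f g k ?_ ?_ hk
  · change rst (k ≫ fst X Y) ≫ f = k ≫ fst X Y
    rw [rst_comp_total _ (total_fst X Y), hk, hf, rst_comm', Category.assoc, rst_self']
  · change rst (k ≫ snd X Y) ≫ g = k ≫ snd X Y
    rw [rst_comp_total _ (total_snd X Y), hk, hg, Category.assoc, rst_self']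

lemma comp_pair {W Z X Y : C} (h : W ⟶ Z) (f : Z ⟶ X) (g : Z ⟶ Y) :
    h ≫ pair f g = pair (h ≫ f) (h ≫ g) := by
  apply pair_unique'
  · rw [Category.assoc, pair_fst, ← Category.assoc, comp_rst', Category.assoc]
  · rw [Category.assoc, pair_snd, ← Category.assoc, comp_rst', Category.assoc]
  · rw [← rst_comp_rst, rst_pair', ← Category.assoc, comp_rst' h f, Category.assoc,
      rst_rst_comp', rst_comp_rst]

lemma pair_rst_left {Z W X Y : C} (e : Z ⟶ W) (f : Z ⟶ X) (g : Z ⟶ Y) :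
    pair (rst e ≫ f) g = rst e ≫ pair f g := by
  symm
  apply pair_unique'
  · rw [Category.assoc, pair_fst, ← Category.assoc, rst_comm', Category.assoc]
  · rw [Category.assoc, pair_snd, rst_rst_comp', Category.assoc]
  · rw [rst_rst_comp', rst_pair', rst_rst_comp', Category.assoc]

lemma pair_rst_right {Z W X Y : C} (e : Z ⟶ W) (f : Z ⟶ X) (g : Z ⟶ Y) :
    pair f (rst e ≫ g) = rst e ≫ pair f g := by
  symm
  apply pair_unique'
  · rw [Category.assoc, pair_fst, rst_rst_comp', Category.assoc]
  · rw [Category.assoc, pair_snd, ← Category.assoc, rst_comm', Category.assoc]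
  · rw [rst_rst_comp', rst_pair', rst_rst_comp', ← Category.assoc, rst_comm', Category.assoc]

/-- Maps into the terminal object. -/
lemma to_one {X : C} (f : X ⟶ one) : f = rst f ≫ bang X := bang_unique f

lemma to_one_unique {X : C} {f g : X ⟶ one} (hf : Total f) (hg : Total g) : f = g := by
  rw [to_one f, to_one g, show rst f = 𝟙 X from hf, show rst g = 𝟙 X from hg]

end Basic

/-! ### Total commutative monoids -/

/-- A total commutative monoid in a Cartesian restriction category. -/
@[ext]
structure CMon (C : Type u) [CartQuiver.{v} C] [CartRestrCat C] where
  car : C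
  add : prod car car ⟶ car
  zero : one ⟶ car
  add_total : Total add
  zero_total : Total zero
  zero_add : pair (bang car ≫ zero) (𝟙 car) ≫ add = 𝟙 car
  add_comm : pair (snd car car) (fst car car) ≫ add = add
  add_assoc :
    pair (pair (fst (prod car car) car ≫ fst car car) (fst (prod car car) car ≫ snd car car) ≫ add)
        (snd (prod car car) car) ≫ add =
      pair (fst (prod car car) car ≫ fst car car)
        (pair (fst (prod car car) car ≫ snd car car) (snd (prod car car) car) ≫ add) ≫ add

namespace CMon

variable {C : Type u} [CartQuiver.{v} C] [CartRestrCat C]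

/-- The sum `f + g = ⟨f, g⟩ +` of two maps into a commutative monoid. -/
def plus (A : CMon C) {Z : C} (f g : Z ⟶ A.car) : Z ⟶ A.car := pair f g ≫ A.add

/-- The map `0 = ! 0` into a commutative monoid. -/
def zeroMap (A : CMon C) (Z : C) : Z ⟶ A.car := bang Z ≫ A.zero

variable (A : CMon C) {Z : C}

lemma comp_plus {W : C} (h : W ⟶ Z) (f g : Z ⟶ A.car) :
    h ≫ A.plus f g = A.plus (h ≫ f) (h ≫ g) := by
  unfold plus; rw [← Category.assoc, comp_pair]

lemma comp_zeroMap {W : C} (h : W ⟶ Z) : h ≫ A.zeroMap Z = rst h ≫ A.zeroMap W := by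
  unfold zeroMap
  rw [← Category.assoc, to_one (h ≫ bang Z), rst_comp_total _ (total_bang Z), Category.assoc]

lemma plus_comm (f g : Z ⟶ A.car) : A.plus f g = A.plus g f := by
  have h := congrArg (fun k => pair f g ≫ k) A.add_comm
  simp only [← Category.assoc, comp_pair, pair_fst, pair_snd] at h
  rw [pair_rst_left, pair_rst_right] at h
  simp only [Category.assoc] at h
  unfold plus
  rw [← h, ← rst_self' (pair g f), rst_pair']
  simp only [Category.assoc]
  simp only [rst_left_comm, rst_idem]

lemma rst_plus (f g : Z ⟶ A.car) : rst (A.plus f g) = rst f ≫ rst g := by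
  unfold plus; rw [rst_comp_total _ A.add_total, rst_pair']

lemma zero_plus (f : Z ⟶ A.car) : A.plus (A.zeroMap Z) f = f := by
  have h := congrArg (fun k => f ≫ k) A.zero_add
  have e : f ≫ bang A.car ≫ A.zero = rst f ≫ A.zeroMap Z := A.comp_zeroMap f
  simp only [← Category.assoc, comp_pair, Category.comp_id] at h
  rw [Category.assoc, e, pair_rst_left, ← pair_rst_right, rst_self'] at h
  exact h

lemma rst_left_plus {W : C} (e : Z ⟶ W) (f g : Z ⟶ A.car) :
    A.plus (rst e ≫ f) g = rst e ≫ A.plus f g := by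
  unfold plus; rw [pair_rst_left, Category.assoc]

lemma rst_right_plus {W : C} (e : Z ⟶ W) (f g : Z ⟶ A.car) :
    A.plus f (rst e ≫ g) = rst e ≫ A.plus f g := by
  unfold plus; rw [pair_rst_right, Category.assoc]

lemma plus_assoc (f g h : Z ⟶ A.car) : A.plus (A.plus f g) h = A.plus f (A.plus g h) := by
  have k := congrArg (fun t => pair (pair f g) h ≫ t) A.add_assoc
  change _ ≫ A.plus (A.plus _ _) _ = _ ≫ A.plus _ (A.plus _ _) at k
  simp only [comp_plus] at k
  have e1 : pair (pair f g) h ≫ fst _ _ ≫ fst A.car A.car = rst h ≫ rst g ≫ f := by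
    rw [← Category.assoc, pair_fst, Category.assoc, pair_fst]
  have e2 : pair (pair f g) h ≫ fst _ _ ≫ snd A.car A.car = rst h ≫ rst f ≫ g := by
    rw [← Category.assoc, pair_fst, Category.assoc, pair_snd]
  have e3 : pair (pair f g) h ≫ snd (prod A.car A.car) A.car = rst f ≫ rst g ≫ h := by
    rw [pair_snd, rst_pair', Category.assoc]
  rw [e1, e2, e3] at k
  simp only [rst_left_plus, rst_right_plus] at k
  have h1 : rst (A.plus (A.plus f g) h) = rst f ≫ rst g ≫ rst h := by
    rw [rst_plus, rst_plus, Category.assoc]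
  have h2 : rst (A.plus f (A.plus g h)) = rst f ≫ rst g ≫ rst h := by
    rw [rst_plus, rst_plus]
  rw [← rst_self' (A.plus (A.plus f g) h), ← rst_self' (A.plus f (A.plus g h)), h1, h2]
  simp only [Category.assoc]
  simpa only [rst_left_comm, rst_idem] using k

/-- Maps into a commutative monoid form a commutative monoid. -/
abbrev homMonoid (A : CMon C) (Z : C) : AddCommMonoid (Z ⟶ A.car) where
  add := A.plus
  zero := A.zeroMap Z
  add_assoc := A.plus_assoc
  zero_add := A.zero_plus
  add_zero f := (A.plus_comm f _).trans (A.zero_plus f)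
  add_comm := A.plus_comm
  nsmul := @nsmulRec _ ⟨A.zeroMap Z⟩ ⟨A.plus⟩

/-- The finite sum of a family of maps into a commutative monoid. -/
def sum (A : CMon C) {Z : C} {ι : Type} [Fintype ι] (g : ι → (Z ⟶ A.car)) : Z ⟶ A.car :=
  letI := A.homMonoid Z
  ∑ i, g i

lemma rst_comp_fst {X Y : C} (f : Z ⟶ prod X Y) : rst (f ≫ fst X Y) = rst f :=
  rst_comp_total f (total_fst X Y)

lemma rst_comp_snd {X Y : C} (f : Z ⟶ prod X Y) : rst (f ≫ snd X Y) = rst f :=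
  rst_comp_total f (total_snd X Y)

lemma pair_comp_prodAdd (A B : CMon C) (f g : Z ⟶ prod A.car B.car) :
    pair f g ≫ pair
      (A.plus (fst _ _ ≫ fst A.car B.car) (snd _ _ ≫ fst A.car B.car))
      (B.plus (fst _ _ ≫ snd A.car B.car) (snd _ _ ≫ snd A.car B.car)) =
    pair (A.plus (f ≫ fst _ _) (g ≫ fst _ _)) (B.plus (f ≫ snd _ _) (g ≫ snd _ _)) := by
  rw [comp_pair]
  simp only [comp_plus]
  simp only [← Category.assoc, pair_fst, pair_snd]
  simp only [Category.assoc, rst_left_plus, rst_right_plus, pair_rst_left, pair_rst_right,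
    rst_idem, rst_left_comm]
  rw [← rst_self' (pair (A.plus _ _) (B.plus _ _))]
  simp only [rst_pair', rst_plus, rst_comp_fst, rst_comp_snd, Category.assoc, rst_idem,
    rst_left_comm]

lemma fst_total' (X Y : C) : rst (fst X Y) = 𝟙 _ := rst_fst X Y
lemma snd_total' (X Y : C) : rst (snd X Y) = 𝟙 _ := rst_snd X Y

/-- The product of two commutative monoids, with componentwise addition. -/
def prod (A B : CMon C) : CMon C where
  car := CartQuiver.prod A.car B.car
  add := pair
    (pair (fst _ _ ≫ fst A.car B.car) (snd _ _ ≫ fst A.car B.car) ≫ A.add)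
    (pair (fst _ _ ≫ snd A.car B.car) (snd _ _ ≫ snd A.car B.car) ≫ B.add)
  zero := pair A.zero B.zero
  add_total := by
    refine total_pair (total_comp (total_pair ?_ ?_) A.add_total)
      (total_comp (total_pair ?_ ?_) B.add_total) <;>
    first
      | exact total_comp (total_fst _ _) (total_fst _ _)
      | exact total_comp (total_fst _ _) (total_snd _ _)
      | exact total_comp (total_snd _ _) (total_fst _ _)
      | exact total_comp (total_snd _ _) (total_snd _ _)
  zero_total := total_pair A.zero_total B.zero_total
  zero_add := by
    refine (pair_comp_prodAdd A B _ _).trans ?_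
    have hA : rst A.zero = 𝟙 _ := A.zero_total
    have hB : rst B.zero = 𝟙 _ := B.zero_total
    simp only [Category.assoc, pair_fst, pair_snd, hA, hB, Category.id_comp]
    change pair (A.plus (A.zeroMap _) _) (B.plus (B.zeroMap _) _) = _
    rw [zero_plus, zero_plus]
    symm
    apply pair_unique' <;> simp [fst_total', snd_total', rst_id]
  add_comm := by
    refine (pair_comp_prodAdd A B _ _).trans ?_
    change _ = pair (A.plus _ _) (B.plus _ _)
    rw [A.plus_comm, B.plus_comm]
  add_assoc := by
    refine (pair_comp_prodAdd A B _ _).trans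
      (Eq.trans ?_ (pair_comp_prodAdd A B _ _).symm)
    have h1 := pair_comp_prodAdd A B
      (fst (CartQuiver.prod (CartQuiver.prod A.car B.car) (CartQuiver.prod A.car B.car))
        (CartQuiver.prod A.car B.car) ≫ fst _ _) (fst _ _ ≫ snd _ _)
    have h2 := pair_comp_prodAdd A B
      (fst (CartQuiver.prod (CartQuiver.prod A.car B.car) (CartQuiver.prod A.car B.car))
        (CartQuiver.prod A.car B.car) ≫ snd _ _) (snd _ _)
    unfold plus at h1 h2
    rw [h1, h2]
    change pair (A.plus (pair (A.plus _ _) (B.plus _ _) ≫ _) _)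
        (B.plus (pair (A.plus _ _) (B.plus _ _) ≫ _) _) =
      pair (A.plus _ (pair (A.plus _ _) (B.plus _ _) ≫ _))
        (B.plus _ (pair (A.plus _ _) (B.plus _ _) ≫ _))
    simp only [pair_fst, pair_snd, rst_plus, rst_comp_fst, rst_comp_snd, fst_total', snd_total',
      Category.id_comp, plus_assoc]

/-- The trivial commutative monoid on the terminal object. -/
def triv (C : Type u) [CartQuiver.{v} C] [CartRestrCat C] : CMon C where
  car := one
  add := bang _
  zero := 𝟙 _
  add_total := total_bang _
  zero_total := total_id _
  zero_add := to_one_unique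
    (total_comp (total_pair (total_comp (total_bang _) (total_id _)) (total_id _)) (total_bang _))
    (total_id _)
  add_comm := to_one_unique
    (total_comp (total_pair (total_snd _ _) (total_fst _ _)) (total_bang _)) (total_bang _)
  add_assoc := by
    have ff := total_comp (total_fst (CartQuiver.prod (one : C) one) one) (total_fst one one)
    have fs := total_comp (total_fst (CartQuiver.prod (one : C) one) one) (total_snd one one)
    have s := total_snd (CartQuiver.prod (one : C) one) one
    exact to_one_unique
      (total_comp (total_pair (total_comp (total_pair ff fs) (total_bang _)) s) (total_bang _))
      (total_comp (total_pair ff (total_comp (total_pair fs s) (total_bang _))) (total_bang _))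

end CMon

/-! ### Strict functors and the category of Cartesian restriction categories -/

/-- A functor between Cartesian restriction categories that preserves restrictions and the chosen
finite products exactly. -/
@[ext]
structure CRFunctor (C : Type u) [CartQuiver.{v} C] [CartRestrCat C]
    (D : Type u') [CartQuiver.{v'} D] [CartRestrCat D] extends C ⥤ D where
  map_rst {X Y : C} (f : X ⟶ Y) : map (rst f) = rst (map f)
  obj_one : obj one = one
  obj_prod (X Y : C) : obj (prod X Y) = prod (obj X) (obj Y)
  map_fst (X Y : C) : SameArrow (map (fst X Y)) (fst (obj X) (obj Y))
  map_snd (X Y : C) : SameArrow (map (snd X Y)) (snd (obj X) (obj Y))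

/-- The identity functor. -/
def CRFunctor.id (C : Type u) [CartQuiver.{v} C] [CartRestrCat C] : CRFunctor C C where
  toFunctor := 𝟭 C
  map_rst _ := rfl
  obj_one := rfl
  obj_prod _ _ := rfl
  map_fst _ _ := SameArrow.rfl' _
  map_snd _ _ := SameArrow.rfl' _

lemma SameArrow.map {C : Type u} [CartQuiver.{v} C] [CartRestrCat C]
    {D : Type u'} [CartQuiver.{v'} D] [CartRestrCat D] (F : C ⥤ D) {X Y X' Y' : C}
    {f : X ⟶ Y} {g : X' ⟶ Y'} (h : SameArrow f g) : SameArrow (F.map f) (F.map g) := by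
  obtain ⟨rfl, rfl, rfl⟩ := h
  exact ⟨rfl, rfl, by simp⟩

/-- Composition of functors, in diagrammatic order. -/
def CRFunctor.comp {C : Type u} [CartQuiver.{v} C] [CartRestrCat C]
    {D : Type u'} [CartQuiver.{v'} D] [CartRestrCat D]
    {E : Type u''} [CartQuiver.{v''} E] [CartRestrCat E]
    (F : CRFunctor C D) (G : CRFunctor D E) : CRFunctor C E where
  toFunctor := F.toFunctor ⋙ G.toFunctor
  map_rst f := by simp [F.map_rst, G.map_rst]
  obj_one := by simp [F.obj_one, G.obj_one]
  obj_prod X Y := by simp [F.obj_prod, G.obj_prod]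
  map_fst X Y := ((F.map_fst X Y).map G.toFunctor).trans' (G.map_fst _ _)
  map_snd X Y := ((F.map_snd X Y).map G.toFunctor).trans' (G.map_snd _ _)

/-- A bundled Cartesian restriction category. -/
structure CRCat where
  carrier : Type u
  [shape : CartQuiver.{v} carrier]
  [str : CartRestrCat carrier]

instance : CoeSort CRCat.{v, u} (Type u) := ⟨CRCat.carrier⟩

attribute [instance] CRCat.shape CRCat.str

/-- The category of Cartesian restriction categories and functors preserving restrictions and
products exactly. -/
instance : Category CRCat.{v, u} where
  Hom X Y := CRFunctor X Y
  id X := CRFunctor.id X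
  comp F G := CRFunctor.comp F G

/-! ### Generalized differential restriction categories -/

/-- A generalized differential restriction category structure: commutative monoids
`L X = (L₀ X, +, 0)`, where `L₀ X` is `(L X).car`, and derivatives `D f : L₀ X × X ⟶ L₀ Y`. -/
structure GenDiffRestr (C : Type u) [CartQuiver.{v} C] [CartRestrCat C] where
  L : C → CMon C
  L_L (X : C) : L (L X).car = L X
  L_one : L one = CMon.triv C
  L_prod (X Y : C) : L (prod X Y) = (L X).prod (L Y)
  D {X Y : C} (f : X ⟶ Y) : prod (L X).car X ⟶ (L Y).car
  D_add (X : C) : SameArrow (D (L X).add)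
    (fst (prod (L X).car (L X).car) (prod (L X).car (L X).car) ≫ (L X).add)
  D_zero (X : C) : SameArrow (D (L X).zero) (fst one one ≫ (L X).zero)
  plus_D {Z X Y : C} (f : X ⟶ Y) (a b : Z ⟶ (L X).car) (c : Z ⟶ X) :
    pair ((L X).plus a b) c ≫ D f = (L Y).plus (pair a c ≫ D f) (pair b c ≫ D f)
  zero_D {Z X Y : C} (f : X ⟶ Y) (a : Z ⟶ X) :
    pair ((L X).zeroMap Z) a ≫ D f = rst (a ≫ f) ≫ (L Y).zeroMap Z
  D_fst (X Y : C) : SameArrow (D (fst X Y))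
    (fst (prod (L X).car (L Y).car) (prod X Y) ≫ fst (L X).car (L Y).car)
  D_snd (X Y : C) : SameArrow (D (snd X Y))
    (fst (prod (L X).car (L Y).car) (prod X Y) ≫ snd (L X).car (L Y).car)
  D_pair {Z X Y : C} (f : Z ⟶ X) (g : Z ⟶ Y) : SameArrow (D (pair f g)) (pair (D f) (D g))
  D_comp {X Y Z : C} (f : X ⟶ Y) (g : Y ⟶ Z) :
    D (f ≫ g) = pair (D f) (snd (L X).car X ≫ f) ≫ D g
  /-- `D (D f)`, along the identifications `L₀ (L₀ X × X) = L₀ X × L₀ X` and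
  `L₀ (L₀ Y) = L₀ Y`. -/
  DD {X Y : C} (f : X ⟶ Y) :
    prod (prod (L X).car (L X).car) (prod (L X).car X) ⟶ (L Y).car
  DD_eq {X Y : C} (f : X ⟶ Y) : SameArrow (DD f) (D (D f))
  DD_zero {Z X Y : C} (f : X ⟶ Y) (a c : Z ⟶ (L X).car) (d : Z ⟶ X) :
    pair (pair a ((L X).zeroMap Z)) (pair c d) ≫ DD f = rst c ≫ pair a d ≫ D f
  DD_symm {Z X Y : C} (f : X ⟶ Y) (b c : Z ⟶ (L X).car) (d : Z ⟶ X) :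
    pair (pair ((L X).zeroMap Z) b) (pair c d) ≫ DD f =
      pair (pair ((L X).zeroMap Z) c) (pair b d) ≫ DD f
  D_rst {X Y : C} (f : X ⟶ Y) :
    D (rst f) = rst (snd (L X).car X ≫ f) ≫ fst (L X).car X
  rst_D {X Y : C} (f : X ⟶ Y) : rst (D f) = rst (snd (L X).car X ≫ f)

/-! ### The objects and maps of the Faà di Bruno category -/

section Faa

variable {C : Type u} [CartQuiver.{v} C] [CartRestrCat C]

/-- `vars A X n` is `A × (A × ⋯ × (A × X))`, with `n` factors `A`. -/
def vars (A X : C) : ℕ → C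
  | 0 => X
  | n + 1 => prod A (vars A X n)

/-- The projection of `vars A X n` to its `i`-th factor `A`. -/
def proj (A X : C) : ∀ n : ℕ, Fin n → (vars A X n ⟶ A)
  | n + 1, i => Fin.cases (fst A (vars A X n)) (fun j => snd A (vars A X n) ≫ proj A X n j) i

/-- The projection of `vars A X n` to its last factor `X`. -/
def base (A X : C) : ∀ n : ℕ, vars A X n ⟶ X
  | 0 => 𝟙 X
  | n + 1 => snd A (vars A X n) ≫ base A X n

/-- The map `⟨a 0, …, a (n - 1), x⟩` into `vars A X n`. -/
def tuple {A X Z : C} : ∀ {n : ℕ}, (Fin n → (Z ⟶ A)) → (Z ⟶ X) → (Z ⟶ vars A X n)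
  | 0, _, x => x
  | _ + 1, a, x => pair (a 0) (tuple (fun i => a i.succ) x)

variable (C) in
/-- An object `((A, +, 0), X)` of the Faà di Bruno category. -/
@[ext]
structure FaaObj where
  vec : CMon C
  pt : C

/-- A map `(f_*, f₁, f₂, …)` of the Faà di Bruno category; `term n` is `f_n` for `n ≥ 1`. Each
`f_n` satisfies the restriction condition, and is additive and symmetric in its first `n`
variables. -/
@[ext]
structure FaaHom (P Q : FaaObj C) where
  star : P.pt ⟶ Q.pt
  term (n : ℕ) (hn : 0 < n) : vars P.vec.car P.pt n ⟶ Q.vec.car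
  rst_term (n : ℕ) (hn : 0 < n) : rst (term n hn) = rst (base P.vec.car P.pt n ≫ star)
  term_plus (n : ℕ) (hn : 0 < n) {Z : C} (a : Fin n → (Z ⟶ P.vec.car)) (x : Z ⟶ P.pt)
    (i : Fin n) (b c : Z ⟶ P.vec.car) :
    tuple (Function.update a i (P.vec.plus b c)) x ≫ term n hn =
      Q.vec.plus (tuple (Function.update a i b) x ≫ term n hn)
        (tuple (Function.update a i c) x ≫ term n hn)
  term_zero (n : ℕ) (hn : 0 < n) {Z : C} (a : Fin n → (Z ⟶ P.vec.car)) (x : Z ⟶ P.pt)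
    (i : Fin n) :
    tuple (Function.update a i (P.vec.zeroMap Z)) x ≫ term n hn =
      rst (tuple (Function.update a i (P.vec.zeroMap Z)) x ≫ term n hn) ≫ Q.vec.zeroMap Z
  term_symm (n : ℕ) (hn : 0 < n) (σ : Equiv.Perm (Fin n)) :
    tuple (fun i => proj P.vec.car P.pt n (σ i)) (base P.vec.car P.pt n) ≫ term n hn = term n hn

/-- The objects, maps, terminal object and products of objects of the Faà di Bruno category. -/
instance : CartQuiver.{v} (FaaObj C) where
  Hom P Q := FaaHom P Q
  one := ⟨CMon.triv C, one⟩
  prod P Q := ⟨P.vec.prod Q.vec, prod P.pt Q.pt⟩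

/-- The `n`-th term of the sequence `(h, π₀ h, 0, 0, …)`. -/
def linTerm {A : C} (X : C) (B : CMon C) (h : A ⟶ B.car) (n : ℕ) (hn : 0 < n) :
    vars A X n ⟶ B.car :=
  if n = 1 then proj A X n ⟨0, hn⟩ ≫ h else B.zeroMap _

/-- The `n`-th term of a composite: the Faà di Bruno formula
`(f g)_n = ∑ ⟨p₁ f_{i₁}, …, p_k f_{i_k}, π_n f_*⟩ g_k`, a sum over all partitions of the `n`
vector variables into `k` blocks, of sizes `i₁, …, i_k`, where `p_m` selects the vector variables
in the `m`-th block and the base point. -/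
def compTerm {P Q R : FaaObj C} (f : FaaHom P Q) (g : FaaHom Q R) (n : ℕ) (hn : 0 < n) :
    vars P.vec.car P.pt n ⟶ R.vec.car :=
  R.vec.sum fun c : OrderedFinpartition n =>
    tuple
      (fun m => tuple (fun j => proj P.vec.car P.pt n (c.emb m j)) (base P.vec.car P.pt n) ≫
        f.term (c.partSize m) (c.partSize_pos m))
      (base P.vec.car P.pt n ≫ f.star) ≫ g.term c.length (c.length_pos hn)

/-- The operations of a Cartesian restriction category on the objects and maps of the Faà di Bruno
category are the Faà di Bruno ones. As a map is determined by its terms, this determines all the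
operations. -/
structure IsFaa (C : Type u) [CartQuiver.{v} C] [CartRestrCat C] [CartRestrCat (FaaObj C)] :
    Prop where
  id_star (P : FaaObj C) : FaaHom.star (𝟙 P) = 𝟙 P.pt
  id_term (P : FaaObj C) (n : ℕ) (hn : 0 < n) :
    FaaHom.term (𝟙 P) n hn = linTerm P.pt P.vec (𝟙 P.vec.car) n hn
  comp_star {P Q R : FaaObj C} (f : P ⟶ Q) (g : Q ⟶ R) :
    FaaHom.star (f ≫ g) = FaaHom.star f ≫ FaaHom.star g
  comp_term {P Q R : FaaObj C} (f : P ⟶ Q) (g : Q ⟶ R) (n : ℕ) (hn : 0 < n) :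
    FaaHom.term (f ≫ g) n hn = compTerm f g n hn
  rst_star {P Q : FaaObj C} (f : P ⟶ Q) : FaaHom.star (rst f) = rst (FaaHom.star f)
  rst_term {P Q : FaaObj C} (f : P ⟶ Q) (n : ℕ) (hn : 0 < n) :
    FaaHom.term (rst f) n hn =
      rst (base P.vec.car P.pt n ≫ FaaHom.star f) ≫ linTerm P.pt P.vec (𝟙 P.vec.car) n hn
  bang_star (P : FaaObj C) : FaaHom.star (bang P) = bang P.pt
  bang_term (P : FaaObj C) (n : ℕ) (hn : 0 < n) : FaaHom.term (bang P) n hn = bang _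
  fst_star (P Q : FaaObj C) : FaaHom.star (fst P Q) = fst P.pt Q.pt
  fst_term (P Q : FaaObj C) (n : ℕ) (hn : 0 < n) :
    FaaHom.term (fst P Q) n hn =
      linTerm (prod P.pt Q.pt) P.vec (fst P.vec.car Q.vec.car) n hn
  snd_star (P Q : FaaObj C) : FaaHom.star (snd P Q) = snd P.pt Q.pt
  snd_term (P Q : FaaObj C) (n : ℕ) (hn : 0 < n) :
    FaaHom.term (snd P Q) n hn =
      linTerm (prod P.pt Q.pt) Q.vec (snd P.vec.car Q.vec.car) n hn
  pair_star {R P Q : FaaObj C} (f : R ⟶ P) (g : R ⟶ Q) :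
    FaaHom.star (pair f g) = pair (FaaHom.star f) (FaaHom.star g)
  pair_term {R P Q : FaaObj C} (f : R ⟶ P) (g : R ⟶ Q) (n : ℕ) (hn : 0 < n) :
    FaaHom.term (pair f g) n hn = pair (FaaHom.term f n hn) (FaaHom.term g n hn)

/-- `F'` is the action of the Faà di Bruno construction on `F`:
`((A, +, 0), X) ↦ ((F A, F +, F 0), F X)` and `(f_*, f₁, …) ↦ (F f_*, F f₁, …)`. -/
structure IsFaaMap {D : Type u} [CartQuiver.{v} D] [CartRestrCat D]
    [CartRestrCat (FaaObj C)] [CartRestrCat (FaaObj D)]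
    (F : CRFunctor C D) (F' : CRFunctor (FaaObj C) (FaaObj D)) : Prop where
  obj_pt (P : FaaObj C) : (F'.obj P).pt = F.obj P.pt
  obj_car (P : FaaObj C) : (F'.obj P).vec.car = F.obj P.vec.car
  obj_add (P : FaaObj C) : SameArrow (F'.obj P).vec.add (F.map P.vec.add)
  obj_zero (P : FaaObj C) : SameArrow (F'.obj P).vec.zero (F.map P.vec.zero)
  map_star {P Q : FaaObj C} (f : P ⟶ Q) :
    SameArrow (FaaHom.star (F'.map f)) (F.map (FaaHom.star f))
  map_term {P Q : FaaObj C} (f : P ⟶ Q) (n : ℕ) (hn : 0 < n) :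
    SameArrow (FaaHom.term (F'.map f) n hn) (F.map (FaaHom.term f n hn))

/-- The counit, `((A, +, 0), X) ↦ X` and `(f_*, f₁, f₂, …) ↦ f_*`. -/
def counit [CartRestrCat (FaaObj C)] (h : IsFaa C) : CRFunctor (FaaObj C) C where
  obj P := P.pt
  map f := FaaHom.star f
  map_id := h.id_star
  map_comp := h.comp_star
  map_rst := h.rst_star
  obj_one := rfl
  obj_prod _ _ := rfl
  map_fst P Q := ⟨rfl, rfl, by simp [h.fst_star]⟩
  map_snd P Q := ⟨rfl, rfl, by simp [h.snd_star]⟩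

/-- The `m`-th term of the `n`-th term of `δ f`. Its variables are `m` directions
`(a_j 0, …, a_j (n - 1), b_j)` and a base point `(v 0, …, v (n - 1), x)`. It is the sum of the
`f_{n + k} (w 0, …, w (n - 1), b_{j₁}, …, b_{j_k}, x)` over all ways to replace some of the `v i`
by an `a_j i`, each `j` being used at most once: `w i` is `a_j i` if `φ i = some j` and
`v i` if `φ i = none`, and `j₁ < ⋯ < j_k` are the directions that are not used. -/
def deltaTerm {P Q : FaaObj C} (f : FaaHom P Q) (n : ℕ) (hn : 0 < n) (m : ℕ) :
    vars (vars P.vec.car P.vec.car n) (vars P.vec.car P.pt n) m ⟶ Q.vec.car :=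
  Q.vec.sum fun φ : {φ : Fin n → Option (Fin m) //
      ∀ i i' j, φ i = some j → φ i' = some j → i = i'} =>
    let unused : Finset (Fin m) := {j | ∀ i, φ.1 i ≠ some j}
    let dir := proj (vars P.vec.car P.vec.car n) (vars P.vec.car P.pt n) m
    let pt := base (vars P.vec.car P.vec.car n) (vars P.vec.car P.pt n) m
    tuple
      (Fin.append
        (fun i => (φ.1 i).elim (pt ≫ proj P.vec.car P.pt n i)
          (fun j => dir j ≫ proj P.vec.car P.vec.car n i))
        (fun k => dir (unused.orderEmbOfFin rfl k) ≫ base P.vec.car P.vec.car n))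
      (pt ≫ base P.vec.car P.pt n) ≫ f.term (n + unused.card) (Nat.add_pos_left hn _)

/-- `δ` is the comultiplication: it sends `((A, +, 0), X)` to
`((((A, +, 0), A), (+, π₀ +, 0, …), (0, π₀ 0, 0, …)), ((A, +, 0), X))`, and its action on maps is
given by the terms above. -/
structure IsComult [CartRestrCat (FaaObj C)] [CartRestrCat (FaaObj (FaaObj C))]
    (δ : CRFunctor (FaaObj C) (FaaObj (FaaObj C))) : Prop where
  obj_pt (P : FaaObj C) : (δ.obj P).pt = P
  obj_car (P : FaaObj C) : (δ.obj P).vec.car = ⟨P.vec, P.vec.car⟩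
  obj_add_star (P : FaaObj C) : SameArrow (FaaHom.star (δ.obj P).vec.add) P.vec.add
  obj_add_term (P : FaaObj C) (n : ℕ) (hn : 0 < n) :
    SameArrow (FaaHom.term (δ.obj P).vec.add n hn)
      (linTerm (prod P.vec.car P.vec.car) P.vec P.vec.add n hn)
  obj_zero_star (P : FaaObj C) : SameArrow (FaaHom.star (δ.obj P).vec.zero) P.vec.zero
  obj_zero_term (P : FaaObj C) (n : ℕ) (hn : 0 < n) :
    SameArrow (FaaHom.term (δ.obj P).vec.zero n hn) (linTerm one P.vec P.vec.zero n hn)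
  map_star {P Q : FaaObj C} (f : P ⟶ Q) : SameArrow (FaaHom.star (δ.map f)) f
  map_term_star {P Q : FaaObj C} (f : P ⟶ Q) (n : ℕ) (hn : 0 < n) :
    SameArrow (FaaHom.star (FaaHom.term (δ.map f) n hn)) (FaaHom.term f n hn)
  map_term_term {P Q : FaaObj C} (f : P ⟶ Q) (n : ℕ) (hn : 0 < n) (m : ℕ) (hm : 0 < m) :
    SameArrow (FaaHom.term (FaaHom.term (δ.map f) n hn) m hm) (deltaTerm f n hn m)

end Faa

/-! ### The Faà di Bruno comonad -/

/-- Faà di Bruno structures on all Cartesian restriction categories, the action of the Faà di Bruno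
construction on functors, and the comultiplications. All of these are determined by explicit
formulas, so there is at most one such structure; that there is one is a claim. -/
structure FaaData where
  str (X : CRCat.{v, max u v}) : CartRestrCat (FaaObj X)
  isFaa (X : CRCat.{v, max u v}) : IsFaa X
  map {X Y : CRCat.{v, max u v}} (F : X ⟶ Y) : CRFunctor (FaaObj X) (FaaObj Y)
  isFaaMap {X Y : CRCat.{v, max u v}} (F : X ⟶ Y) : IsFaaMap F (map F)
  comult (X : CRCat.{v, max u v}) :
    letI := str ⟨FaaObj X⟩
    CRFunctor (FaaObj X) (FaaObj (FaaObj X))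
  isComult (X : CRCat.{v, max u v}) :
    letI := str ⟨FaaObj X⟩
    IsComult (comult X)

/-- The Cartesian restriction category `Faà(X)`. -/
def FaaData.faa (T : FaaData.{v, u}) (X : CRCat.{v, max u v}) : CRCat.{v, max u v} :=
  letI := T.str X
  ⟨FaaObj X⟩

/-- The functor `Faà(F)`. -/
def FaaData.faaMap (T : FaaData.{v, u}) {X Y : CRCat.{v, max u v}} (F : X ⟶ Y) :
    T.faa X ⟶ T.faa Y := T.map F

/-- The counit `ε : Faà(X) ⟶ X`. -/
def FaaData.ε (T : FaaData.{v, u}) (X : CRCat.{v, max u v}) : T.faa X ⟶ X :=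
  letI := T.str X
  counit (T.isFaa X)

/-- The comultiplication `δ : Faà(X) ⟶ Faà(Faà(X))`. -/
def FaaData.δ (T : FaaData.{v, u}) (X : CRCat.{v, max u v}) : T.faa X ⟶ T.faa (T.faa X) :=
  T.comult X

/-- The functor laws, the naturality of the counit and the comultiplication, and the comonad laws
for the Faà di Bruno construction. -/
structure FaaData.IsComonad (T : FaaData.{v, u}) : Prop where
  map_id (X : CRCat.{v, max u v}) : T.faaMap (𝟙 X) = 𝟙 (T.faa X)
  map_comp {X Y Z : CRCat.{v, max u v}} (F : X ⟶ Y) (G : Y ⟶ Z) :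
    T.faaMap (F ≫ G) = T.faaMap F ≫ T.faaMap G
  ε_naturality {X Y : CRCat.{v, max u v}} (F : X ⟶ Y) : T.faaMap F ≫ T.ε Y = T.ε X ≫ F
  δ_naturality {X Y : CRCat.{v, max u v}} (F : X ⟶ Y) :
    T.faaMap F ≫ T.δ Y = T.δ X ≫ T.faaMap (T.faaMap F)
  coassoc (X : CRCat.{v, max u v}) : T.δ X ≫ T.faaMap (T.δ X) = T.δ X ≫ T.δ (T.faa X)
  left_counit (X : CRCat.{v, max u v}) : T.δ X ≫ T.ε (T.faa X) = 𝟙 (T.faa X)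
  right_counit (X : CRCat.{v, max u v}) : T.δ X ≫ T.faaMap (T.ε X) = 𝟙 (T.faa X)

/-- The Faà di Bruno comonad on the category of Cartesian restriction categories. -/
def FaaData.comonad (T : FaaData.{v, u}) (h : T.IsComonad) : Comonad CRCat.{v, max u v} where
  obj := T.faa
  map := T.faaMap
  map_id := h.map_id
  map_comp := h.map_comp
  ε := { app := T.ε, naturality := fun _ _ F => h.ε_naturality F }
  δ := { app := T.δ, naturality := fun _ _ F => h.δ_naturality F }
  coassoc := h.coassoc
  left_counit := h.left_counit
  right_counit := h.right_counit

end FaaDiBruno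

end

open FaaDiBruno

/-!
The proof works with generalized elements. A stage is an object with a restriction idempotent `e`; a
point (`Pt`) or vector (`Vec`) at a stage is a partial map whose domain is exactly `e`, so that
vectors at a stage form an honest commutative monoid. At a point of the domain of its base map
`f_*`, a map `f` of the Faà di Bruno category gives a sequence of symmetric multiadditive functions
of vectors, which is encoded as one function of multisets, the jet of `f` (`FaaHom.jet`). Conversely
a natural family of such functions over a base map is a map (`FaaHom.ofJets`), by evaluation at the
generic point, and maps with the same base map and jets are equal (`FaaHom.ext_jet`). All the
equations between partial maps thus become equations between functions of multisets.

The jets of a composite are given by a sum over set partitions (`compJ`). Partitions of a multiset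
are generated by adding one element at a time, which gives a derivative of jets (`dirJ`) and the
chain rule `dirJ_compJ`; associativity (`compJ_assoc`) follows by induction on the number of
vectors, because by the chain rule one more vector on either side amounts to taking derivatives of
the factors. This yields the Cartesian restriction category (`faaCat`, `isFaa`).

The derivative `diff f` has the first term of `f` as its base map, and the derivatives `dirJ` of the
jets of `f` as jets. The chain rule, the vanishing and the symmetry of second derivatives are then
identities for `dirJ` (`diff_comp`, `diff_diff_zero`, `diff_diff_comm`), and give the generalized
differential structure `genDiff`.

The comultiplication is obtained from the derivative: the first term of `δ f` is `diff f`, and each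
further term is the derivative of the one before in the direction of the base point (`deltaT`). So
`D f = [δ f]₁` holds by definition. The terms are symmetric because second derivatives are
(`deltaE_perm`), and their derivatives in all variables are again terms (`dirv_deltaT`).
Functoriality (`delta_comp`) is the higher chain rule, by induction on the number of the term. The
explicit formula for `δ f` follows by computing base maps and jets (`deltaT_star_jet`): each
derivative either replaces one of the earlier variables or adds a new one, and the recursion for
these choices enumerates the partial injections (`matchSum_eq_sum`).

A strict functor `F` acts on maps term by term (`CRFunctor.mapFaa`). Additivity of the image of a
term has to be checked at elements that do not come from the domain of `F`; these are obtained by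
substitution from the generic ones, which do. Naturality of `δ` then follows from the explicit
formula. For coassociativity, `δ` commutes with derivatives (`delta_diff`), hence with the iterated
derivatives that are its own terms (`delta_deltaT`). The universal property of the cofree coalgebra
is the adjunction of a comonad with its coalgebras (`existsUnique_hom_cofree`).
-/

-- `vars` and products of objects of the Faà di Bruno category are identified by unfolding.
attribute [reducible] FaaDiBruno.vars FaaDiBruno.CMon.prod FaaDiBruno.CMon.triv

noncomputable section

namespace FaaDiBruno

open CartQuiver CartRestrCat

/-! ### Sums over set partitions of a multiset -/

section Combinatorics

variable {M M' N K K' : Type*}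

section Pick

variable [AddCommMonoid K] [AddCommMonoid K']

open Classical in
/-- The sum of `F a t` over all ways to pick an element `a` of `s`, with remainder `t`. -/
def pickSum (s : Multiset M) (F : M → Multiset M → K) : K :=
  (s.map fun a => F a (s.erase a)).sum

@[simp] lemma pickSum_zero (F : M → Multiset M → K) : pickSum 0 F = 0 := by simp [pickSum]

@[simp] lemma pickSum_cons (a : M) (s : Multiset M) (F : M → Multiset M → K) :
    pickSum (a ::ₘ s) F = F a s + pickSum s fun b t => F b (a ::ₘ t) := by
  classical
  unfold pickSum
  rw [Multiset.map_cons, Multiset.sum_cons, Multiset.erase_cons_head]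
  congr 2
  refine Multiset.map_congr rfl fun b hb => ?_
  by_cases h : a = b
  · subst h
    simp only [Multiset.erase_cons_head, Multiset.cons_erase hb]
  · simp only [Multiset.erase_cons_tail _ h]

@[simp] lemma pickSum_singleton (a : M) (F : M → Multiset M → K) : pickSum {a} F = F a 0 := by
  rw [← Multiset.cons_zero, pickSum_cons, pickSum_zero, add_zero]

lemma pickSum_congr {s : Multiset M} {F F' : M → Multiset M → K}
    (h : ∀ a t, a ::ₘ t = s → F a t = F' a t) : pickSum s F = pickSum s F' := by
  classical
  unfold pickSum
  congr 1
  exact Multiset.map_congr rfl fun b hb => h _ _ (Multiset.cons_erase hb)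

lemma pickSum_map (g : M → N) (s : Multiset M) (F : N → Multiset N → K) :
    pickSum (s.map g) F = pickSum s fun a t => F (g a) (t.map g) := by
  induction s using Multiset.induction_on generalizing F with
  | empty => simp
  | cons a s ih => simp [ih]

lemma pickSum_add (s : Multiset M) (F F' : M → Multiset M → K) :
    pickSum s (fun a t => F a t + F' a t) = pickSum s F + pickSum s F' := by
  simp [pickSum, Multiset.sum_map_add]

@[simp] lemma pickSum_const_zero (s : Multiset M) :
    pickSum s (fun _ _ => (0 : K)) = 0 := by simp [pickSum]

lemma map_pickSum (f : K →+ K') (s : Multiset M) (F : M → Multiset M → K) :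
    f (pickSum s F) = pickSum s fun a t => f (F a t) := by
  simp [pickSum, map_multiset_sum]

lemma pickSum_pickSum_comm (s : Multiset M) (F : M → M → Multiset M → K) :
    (pickSum s fun a t => pickSum t fun b u => F a b u) =
      pickSum s fun a t => pickSum t fun b u => F b a u := by
  induction s using Multiset.induction_on generalizing F with
  | empty => simp
  | cons a s ih =>
    simp only [pickSum_cons, pickSum_add]
    rw [ih fun b c u => F b c (a ::ₘ u)]
    abel

lemma pickSum_fubini (s : Multiset M) (t : Multiset N)
    (F : M → Multiset M → N → Multiset N → K) :
    (pickSum s fun a s' => pickSum t fun b t' => F a s' b t') =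
      pickSum t fun b t' => pickSum s fun a s' => F a s' b t' := by
  induction s using Multiset.induction_on generalizing F with
  | empty => simp
  | cons a s ih => simp only [pickSum_cons, pickSum_add, ih]

/-- Picking an element of the multiset of values of a family is picking an index. -/
lemma pickSum_univ {n : ℕ} (a : Fin n → M) (F : M → Multiset M → K) :
    pickSum (Finset.univ.val.map a) F =
      ∑ i, F (a i) ((Finset.univ.erase i).val.map a) := by
  rw [pickSum_map]
  unfold pickSum
  rw [Finset.sum_eq_multiset_sum]
  simp only [Finset.erase_val]
  congr 1
  refine Multiset.map_congr rfl fun i _ => ?_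
  congr!

end Pick

section Part

variable [AddCommMonoid K] [AddCommMonoid K']

/-- The change of a function of set partitions by one more element `v`, which either forms a block
of its own or joins one of the blocks. -/
def partStep (v : M) (G : Multiset (Multiset M) → K) (π : Multiset (Multiset M)) : K :=
  G ({v} ::ₘ π) + pickSum π fun b r => G ((v ::ₘ b) ::ₘ r)

/-- The order in which elements are added to a partition does not matter, so that `partSum` is well
defined on multisets. -/
lemma partStep_comm (v w : M) (G : Multiset (Multiset M) → K) :
    partStep v (partStep w G) = partStep w (partStep v G) := by
  funext π
  simp only [partStep, pickSum_cons, pickSum_add]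
  rw [pickSum_pickSum_comm]
  have h0 : ({v} : Multiset M) ::ₘ {w} ::ₘ π = {w} ::ₘ {v} ::ₘ π := Multiset.cons_swap _ _ _
  have h0' : v ::ₘ ({w} : Multiset M) = w ::ₘ {v} := Multiset.cons_swap _ _ _
  have h0'' (b : Multiset M) : v ::ₘ w ::ₘ b = w ::ₘ v ::ₘ b := Multiset.cons_swap _ _ _
  have h1 (b r) : G ((w ::ₘ b) ::ₘ {v} ::ₘ r) = G ({v} ::ₘ (w ::ₘ b) ::ₘ r) := by
    rw [Multiset.cons_swap]
  have h2 (b r) : G ((v ::ₘ b) ::ₘ {w} ::ₘ r) = G ({w} ::ₘ (v ::ₘ b) ::ₘ r) := by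
    rw [Multiset.cons_swap]
  have h3 (b c r) : G ((w ::ₘ b) ::ₘ (v ::ₘ c) ::ₘ r) = G ((v ::ₘ c) ::ₘ (w ::ₘ b) ::ₘ r) := by
    rw [Multiset.cons_swap]
  simp only [h0, h0', h0'', h1, h2, h3]
  abel

instance partStep_rightCommutative : RightCommutative
    (fun (G : Multiset (Multiset M) → K) (v : M) => partStep v G) :=
  ⟨fun G v w => partStep_comm w v G⟩

/-- The sum of `G π` over all partitions `π` of the occurrences in `s` into nonempty blocks. -/
def partSum (s : Multiset M) (G : Multiset (Multiset M) → K) : K :=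
  s.foldl (fun (G : Multiset (Multiset M) → K) (v : M) => partStep v G) G 0

@[simp] lemma partSum_zero (G : Multiset (Multiset M) → K) : partSum 0 G = G 0 := rfl

@[simp] lemma partSum_cons (v : M) (s : Multiset M) (G : Multiset (Multiset M) → K) :
    partSum (v ::ₘ s) G = partSum s (partStep v G) := by
  unfold partSum; rw [Multiset.foldl_cons]

lemma partSum_congr' {s : Multiset M} {G G' : Multiset (Multiset M) → K}
    (h : ∀ π, (∀ b ∈ π, b ≠ 0) → G π = G' π) : partSum s G = partSum s G' := by
  induction s using Multiset.induction_on generalizing G G' with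
  | empty => exact h 0 (by simp)
  | cons v s ih =>
    rw [partSum_cons, partSum_cons]
    refine ih fun π hπ => ?_
    unfold partStep
    rw [h _ (by simpa using hπ)]
    congr 1
    refine pickSum_congr fun b r hb => h _ ?_
    subst hb
    simp only [Multiset.mem_cons, forall_eq_or_imp] at hπ ⊢
    exact ⟨by simp, hπ.2⟩

/-- Only nonempty sets of nonempty blocks matter for the partitions of a nonempty multiset. -/
lemma partSum_congr {s : Multiset M} (hs : s ≠ 0) {G G' : Multiset (Multiset M) → K}
    (h : ∀ π, π ≠ 0 → (∀ b ∈ π, b ≠ 0) → G π = G' π) : partSum s G = partSum s G' := by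
  obtain ⟨v, s, rfl⟩ : ∃ v t, s = v ::ₘ t := by
    obtain ⟨v, hv⟩ := Multiset.exists_mem_of_ne_zero hs
    exact ⟨v, Multiset.exists_cons_of_mem hv⟩
  rw [partSum_cons, partSum_cons]
  refine partSum_congr' fun π hπ => ?_
  unfold partStep
  rw [h _ (by simp) (by simpa using hπ)]
  congr 1
  refine pickSum_congr fun b r hb => h _ (by simp) ?_
  subst hb
  simp only [Multiset.mem_cons, forall_eq_or_imp] at hπ ⊢
  exact ⟨by simp, hπ.2⟩

lemma partStep_add (v : M) (G G' : Multiset (Multiset M) → K) :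
    partStep v (fun π => G π + G' π) = fun π => partStep v G π + partStep v G' π := by
  funext π
  simp only [partStep, pickSum_add]
  abel

lemma partSum_add (s : Multiset M) (G G' : Multiset (Multiset M) → K) :
    partSum s (fun π => G π + G' π) = partSum s G + partSum s G' := by
  induction s using Multiset.induction_on generalizing G G' with
  | empty => rfl
  | cons v s ih => simp only [partSum_cons, partStep_add, ih]

lemma map_partSum (f : K →+ K') (s : Multiset M) (G : Multiset (Multiset M) → K) :
    f (partSum s G) = partSum s fun π => f (G π) := by
  induction s using Multiset.induction_on generalizing G with
  | empty => rfl
  | cons v s ih =>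
    rw [partSum_cons, partSum_cons, ih]
    congr 1
    funext π
    simp only [partStep, map_add, map_pickSum]

@[simp] lemma partSum_const_zero (s : Multiset M) : partSum s (fun _ => (0 : K)) = 0 := by
  simpa using (map_partSum (0 : K →+ K) s fun _ => 0).symm

lemma partSum_map (g : M → N) (s : Multiset M) (G : Multiset (Multiset N) → K) :
    partSum (s.map g) G = partSum s fun π => G (π.map (Multiset.map g)) := by
  induction s using Multiset.induction_on generalizing G with
  | empty => rfl
  | cons v s ih =>
    rw [Multiset.map_cons, partSum_cons, partSum_cons, ih]
    congr 1
    funext π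
    simp only [partStep, pickSum_map, Multiset.map_cons, Multiset.map_singleton]

/-- The sum over all ways to mark one element of one block of a set partition. -/
def markSum (p q : M' → M) (G : Multiset (Multiset M) → K) (π : Multiset (Multiset M')) : K :=
  pickSum π fun b r => pickSum b fun d b' =>
    G ((p d ::ₘ b'.map q) ::ₘ r.map (Multiset.map q))

lemma partStep_markSum (p q : M' → M) (c : M') (G : Multiset (Multiset M) → K)
    (π : Multiset (Multiset M')) :
    partStep c (markSum p q G) π =
      partStep (p c) G (π.map (Multiset.map q)) + markSum p q (partStep (q c) G) π := by
  simp only [partStep, markSum, pickSum_cons, pickSum_add, pickSum_map, Multiset.map_cons,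
    ← Multiset.cons_zero, Multiset.map_zero, pickSum_zero, add_zero]
  have h1 (x y : Multiset M) (r : Multiset (Multiset M)) :
    G (x ::ₘ y ::ₘ r) = G (y ::ₘ x ::ₘ r) := by rw [Multiset.cons_swap]
  -- the marked element and the new element may lie in different blocks, picked in either order
  have h2 : (pickSum π fun b r => pickSum r fun b2 r2 => pickSum b2 fun d b' =>
      G ((p d ::ₘ b'.map q) ::ₘ (q c ::ₘ b.map q) ::ₘ r2.map (Multiset.map q))) =
      pickSum π fun b r => pickSum b fun d b' => pickSum r fun b2 r2 =>
        G ((q c ::ₘ b2.map q) ::ₘ (p d ::ₘ b'.map q) ::ₘ r2.map (Multiset.map q)) := by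
    rw [pickSum_pickSum_comm]
    refine pickSum_congr fun b r _ => ?_
    rw [pickSum_fubini]
    refine pickSum_congr fun d b' _ => pickSum_congr fun b2 r2 _ => h1 _ _ _
  rw [h2]
  simp only [h1 _ (q c ::ₘ 0), Multiset.cons_swap (p _) (q c)]
  abel

/-- Marking an element of a multiset and partitioning it afterwards is the same as partitioning it
and marking an element of a block afterwards. -/
lemma partSum_markSum (p q : M' → M) (s : Multiset M') (G : Multiset (Multiset M) → K) :
    partSum s (markSum p q G) =
      pickSum s fun d s' => partSum (p d ::ₘ s'.map q) G := by
  induction s using Multiset.induction_on generalizing G with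
  | empty => simp [markSum]
  | cons c s ih =>
    rw [partSum_cons, funext (partStep_markSum p q c G), partSum_add, ih, pickSum_cons]
    congr 1
    · rw [partSum_cons, partSum_map]
    · refine pickSum_congr fun d s' _ => ?_
      rw [Multiset.map_cons, Multiset.cons_swap, partSum_cons (q c)]

/-- If `G` vanishes on partitions with at least two blocks, then only the partition with a single
block contributes. -/
lemma partSum_of_card_le_one {s : Multiset M} (hs : s ≠ 0) {G : Multiset (Multiset M) → K}
    (hG : ∀ b c r, G (b ::ₘ c ::ₘ r) = 0) : partSum s G = G {s} := by
  have key : ∀ (s : Multiset M) (G : Multiset (Multiset M) → K),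
      (∀ b c r, G (b ::ₘ c ::ₘ r) = 0) → ∀ v, partSum (v ::ₘ s) G = G {v ::ₘ s} := by
    intro s
    induction s using Multiset.induction_on with
    | empty => intro G _ v; rw [partSum_cons]; simp [partStep]
    | cons w s ih =>
      intro G hG v
      rw [partSum_cons, ih _ ?_ w]
      · simp [partStep, ← Multiset.cons_zero, hG]
      · intro b c r
        simp [partStep, hG]
  obtain ⟨v, hv⟩ := Multiset.exists_mem_of_ne_zero hs
  obtain ⟨t, rfl⟩ := Multiset.exists_cons_of_mem hv
  exact key t G hG v

/-- If `G` vanishes whenever some block has at least two elements, then only the partition into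
singletons contributes. -/
lemma partSum_of_singletons (s : Multiset M) {G : Multiset (Multiset M) → K}
    (hG : ∀ a b t r, G ((a ::ₘ b ::ₘ t) ::ₘ r) = 0) :
    partSum s G = G (s.map fun a => {a}) := by
  have key : ∀ (s : Multiset M) (ρ : Multiset (Multiset M)),
      partSum s (fun π => G (π + ρ)) = G (s.map (fun a => {a}) + ρ) := by
    intro s
    induction s using Multiset.induction_on with
    | empty => intro ρ; simp
    | cons v s ih =>
      intro ρ
      rw [partSum_cons, Multiset.map_cons, Multiset.cons_add, ← Multiset.add_cons, ← ih]
      refine partSum_congr' fun π hπ => ?_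
      unfold partStep
      simp only [Multiset.cons_add, Multiset.add_cons]
      convert add_zero _
      rw [← pickSum_const_zero π]
      refine pickSum_congr fun b r hb => ?_
      subst hb
      obtain ⟨w, hw⟩ := Multiset.exists_mem_of_ne_zero (hπ b (by simp))
      obtain ⟨t, rfl⟩ := Multiset.exists_cons_of_mem hw
      exact hG _ _ _ _
  simpa using key s 0

end Part

/-- The blocks of an ordered partition of the indices of a family, as a partition of the family. -/
def blocks {n : ℕ} (c : OrderedFinpartition n) (a : Fin n → M) : Multiset (Multiset M) :=
  Finset.univ.val.map fun m => Finset.univ.val.map fun j => a (c.emb m j)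

lemma univ_map_succ {n : ℕ} (a : Fin (n + 1) → M) :
    (Finset.univ : Finset (Fin (n + 1))).val.map a =
      a 0 ::ₘ (Finset.univ : Finset (Fin n)).val.map fun i => a i.succ := by
  rw [Fin.univ_succ]
  simp only [Finset.cons_val, Multiset.map_cons, Finset.map_val, Multiset.map_map]
  rfl

lemma univ_map_cast {n m : ℕ} (h : n = m) (a : Fin m → M) :
    (Finset.univ : Finset (Fin n)).val.map (fun i => a (Fin.cast h i)) =
      (Finset.univ : Finset (Fin m)).val.map a := by
  subst h; rfl

lemma blocks_extendLeft {n : ℕ} (c : OrderedFinpartition n) (a : Fin (n + 1) → M) :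
    blocks c.extendLeft a = {a 0} ::ₘ blocks c fun i => a i.succ := by
  unfold blocks
  refine (univ_map_succ (n := c.length) _).trans ?_
  rfl

lemma blocks_extendMiddle {n : ℕ} (c : OrderedFinpartition n) (k : Fin c.length)
    (a : Fin (n + 1) → M) :
    blocks (c.extendMiddle k) a =
      (a 0 ::ₘ Finset.univ.val.map fun j => a (c.emb k j).succ) ::ₘ
        (Finset.univ.erase k).val.map
          fun m => Finset.univ.val.map fun j => a (c.emb m j).succ := by
  have h0 : ∀ m : Fin c.length,
      (Finset.univ.val.map fun j => a ((c.extendMiddle k).emb m j)) =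
        if m = k then a 0 ::ₘ Finset.univ.val.map fun j => a (c.emb k j).succ
        else Finset.univ.val.map fun j => a (c.emb m j).succ := by
    intro m
    split_ifs with h
    · subst h
      have e : (c.extendMiddle m).partSize m = c.partSize m + 1 := by simp
      have h2 := univ_map_succ
        (fun j => a (Fin.cases (motive := fun _ => Fin (n + 1)) 0 (Fin.succ ∘ c.emb m) j))
      refine Eq.trans ?_ h2
      refine Eq.trans ?_ (univ_map_cast e _)
      refine Multiset.map_congr rfl fun j _ => ?_
      simp only [OrderedFinpartition.extendMiddle, dif_pos]
      rfl
    · have e : (c.extendMiddle k).partSize m = c.partSize m := by simp [h]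
      refine Eq.trans ?_ (univ_map_cast e _)
      refine Multiset.map_congr rfl fun j _ => ?_
      simp only [OrderedFinpartition.extendMiddle, h, dif_neg, not_false_eq_true]
      rfl
  unfold blocks
  refine (Multiset.map_congr rfl fun m _ => h0 m).trans ?_
  have h1 : (Finset.univ : Finset (Fin c.length)).val = k ::ₘ (Finset.univ.erase k).val := by
    rw [Finset.erase_val, Multiset.cons_erase (Finset.mem_univ_val k)]
  change Multiset.map _ (Finset.univ : Finset (Fin c.length)).val = _
  rw [h1, Multiset.map_cons, if_pos rfl]
  congr 1
  refine Multiset.map_congr rfl fun m hm => ?_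
  have hm' : m ∈ Finset.univ.erase k := hm
  exact if_neg (Finset.ne_of_mem_erase hm')

/-- Ordered partitions of the indices enumerate the set partitions of a family. -/
lemma sum_orderedFinpartition [AddCommMonoid K] {n : ℕ} (a : Fin n → M)
    (G : Multiset (Multiset M) → K) :
    ∑ c : OrderedFinpartition n, G (blocks c a) = partSum (Finset.univ.val.map a) G := by
  induction n generalizing G with
  | zero =>
    rw [Fintype.sum_unique]
    have h : (default : OrderedFinpartition 0).length = 0 :=
      Nat.le_zero.1 (default : OrderedFinpartition 0).length_le
    have : IsEmpty (Fin (default : OrderedFinpartition 0).length) := by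
      rw [h]; infer_instance
    simp [blocks]
  | succ n ih =>
    rw [univ_map_succ, partSum_cons, ← ih,
      ← (OrderedFinpartition.extendEquiv n).sum_comp, Fintype.sum_sigma]
    refine Finset.sum_congr rfl fun c _ => ?_
    rw [Fintype.sum_option, partStep]
    simp only [OrderedFinpartition.extendEquiv_apply, OrderedFinpartition.extend_none,
      OrderedFinpartition.extend_some]
    rw [blocks_extendLeft]
    congr 1
    conv_rhs => rw [blocks, pickSum_univ]
    refine Finset.sum_congr rfl fun k _ => ?_
    rw [blocks_extendMiddle]

end Combinatorics

/-! ### Composition and derivatives of multiadditive functions of multisets -/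

section JetCalculus

set_option linter.unusedSectionVars false

variable {M M' N N' K K' : Type*} [AddCommMonoid M] [AddCommMonoid M'] [AddCommMonoid N]
  [AddCommMonoid N'] [AddCommMonoid K] [AddCommMonoid K']

/-- A function of multisets, that is, a sequence of symmetric functions of `n` variables, is
multiadditive when each of them is additive in each variable. -/
structure MultiAdd (φ : Multiset M → N) : Prop where
  add (a b : M) (s : Multiset M) : φ ((a + b) ::ₘ s) = φ (a ::ₘ s) + φ (b ::ₘ s)
  zero (s : Multiset M) : φ (0 ::ₘ s) = 0

/-- A multiadditive function, as an additive map in one variable. -/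
def MultiAdd.hom {φ : Multiset M → N} (h : MultiAdd φ) (s : Multiset M) : M →+ N where
  toFun a := φ (a ::ₘ s)
  map_zero' := h.zero s
  map_add' a b := h.add a b s

/-- The Faà di Bruno composite of two sequences of symmetric functions. -/
def compJ (φ : Multiset M → N) (ψ : Multiset N → K) (s : Multiset M) : K :=
  partSum s fun π => ψ (π.map φ)

/-- The derivative of the sequence `φ`, seen as the sequence of higher derivatives of a function at
a point `x`: the directions are given by `d`, with component `q d` in the direction of `x` and
component `p d` in the direction of the vector `v` at which a first derivative has been taken. -/
def dirJ (φ : Multiset M → N) (v : M) (p q : M' → M) (s : Multiset M') : N :=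
  φ (v ::ₘ s.map q) + pickSum s fun d r => φ (p d ::ₘ r.map q)

/-- The sequence whose only nonzero term is the linear function `h`. -/
def linJ (h : M → N) (s : Multiset M) : N := if s.card = 1 then (s.map h).sum else 0

@[simp] lemma linJ_singleton (h : M → N) (a : M) : linJ h {a} = h a := by simp [linJ]

lemma linJ_cons_cons (h : M → N) (a b : M) (s : Multiset M) : linJ h (a ::ₘ b ::ₘ s) = 0 := by
  simp [linJ]

@[simp] lemma linJ_zero (h : M → N) : linJ h 0 = 0 := by simp [linJ]

lemma MultiAdd.linJ (h : M →+ N) : MultiAdd (linJ h) where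
  add a b s := by
    unfold FaaDiBruno.linJ
    by_cases hs : s = 0
    · simp [hs]
    · simp [hs]
  zero s := by
    unfold FaaDiBruno.linJ
    by_cases hs : s = 0
    · simp [hs]
    · simp [hs]

lemma MultiAdd.pickSum_left {ψ : Multiset N → K} (hψ : MultiAdd ψ) (s : Multiset M)
    (F : M → Multiset M → N) (t : Multiset N) :
    ψ (pickSum s F ::ₘ t) = pickSum s fun a r => ψ (F a r ::ₘ t) :=
  map_pickSum (hψ.hom t) s F

lemma MultiAdd.compJ {φ : Multiset M → N} {ψ : Multiset N → K} (hφ : MultiAdd φ)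
    (hψ : MultiAdd ψ) : MultiAdd (compJ φ ψ) where
  add a b s := by
    simp only [FaaDiBruno.compJ, partSum_cons]
    rw [← partSum_add]
    congr 1
    funext π
    simp only [partStep, Multiset.map_cons, hφ.add, hψ.add, ← Multiset.cons_zero, pickSum_add]
    abel
  zero s := by
    simp only [FaaDiBruno.compJ, partSum_cons]
    refine Eq.trans ?_ (partSum_const_zero (K := K) s)
    congr 1
    funext π
    simp only [partStep, Multiset.map_cons, hφ.zero, hψ.zero, ← Multiset.cons_zero,
      pickSum_const_zero, add_zero]

lemma MultiAdd.dirJ {φ : Multiset M → N} (hφ : MultiAdd φ) (v : M) (p q : M' →+ M) :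
    MultiAdd (dirJ φ v p q) where
  add a b s := by
    simp only [FaaDiBruno.dirJ, pickSum_cons, Multiset.map_cons, map_add, hφ.add,
      Multiset.cons_swap _ (q a), Multiset.cons_swap _ (q b),
      Multiset.cons_swap _ (q a + q b), pickSum_add]
    abel
  zero s := by
    simp [FaaDiBruno.dirJ, Multiset.cons_swap _ (0 : M), hφ.zero]

/-- The chain rule: the derivative of a Faà di Bruno composite is the composite of the derivatives.
Here `Φ` is the pair of the derivative of `φ` and of `φ` itself. -/
lemma dirJ_compJ {φ : Multiset M → N} {ψ : Multiset N → K} (hψ : MultiAdd ψ) (v : M)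
    (p q : M' → M) {Φ : Multiset M' → N'} (p' q' : N' → N) (s : Multiset M')
    (hp : ∀ b, b ≠ 0 → p' (Φ b) = dirJ φ v p q b) (hq : ∀ b, b ≠ 0 → q' (Φ b) = φ (b.map q)) :
    compJ Φ (dirJ ψ (φ {v}) p' q') s = dirJ (compJ φ ψ) v p q s := by
  -- the new vector `v` is a block of its own or joins a block, or else a direction is marked
  have h1 : compJ Φ (dirJ ψ (φ {v}) p' q') s = partSum s fun π =>
      partStep v (fun π => ψ (π.map φ)) (π.map (Multiset.map q)) +
        markSum p q (fun π => ψ (π.map φ)) π := by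
    refine partSum_congr' fun π hπ => ?_
    have hq' (r : Multiset (Multiset M')) (hr : ∀ b ∈ r, b ≠ 0) :
        (r.map Φ).map q' = r.map fun b => φ (b.map q) := by
      rw [Multiset.map_map]
      exact Multiset.map_congr rfl fun b hb => hq b (hr b hb)
    have h2 : (pickSum (π.map Φ) fun d r => ψ (p' d ::ₘ r.map q')) = pickSum π fun b r =>
        ψ (φ (v ::ₘ b.map q) ::ₘ r.map fun b => φ (b.map q)) +
          pickSum b fun d b' => ψ (φ (p d ::ₘ b'.map q) ::ₘ r.map fun b => φ (b.map q)) := by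
      rw [pickSum_map]
      refine pickSum_congr fun b r hb => ?_
      subst hb
      simp only [Multiset.mem_cons, forall_eq_or_imp] at hπ
      rw [hq' r hπ.2, hp b hπ.1, dirJ, hψ.add, hψ.pickSum_left]
    rw [dirJ, h2, hq' π hπ, pickSum_add]
    simp only [partStep, markSum, pickSum_map, Multiset.map_cons, Multiset.map_map,
      Function.comp_def]
    abel
  rw [h1, partSum_add, partSum_markSum, dirJ]
  congr 1
  rw [compJ, partSum_cons, partSum_map]

lemma dirJ_zero_id {φ : Multiset M → N} (hφ : MultiAdd φ) (v : M) (s : Multiset M) :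
    dirJ φ v 0 id s = φ (v ::ₘ s) := by
  simp [dirJ, hφ.zero]

@[simp] lemma compJ_zero (φ : Multiset M → N) (ψ : Multiset N → K) : compJ φ ψ 0 = ψ 0 := by
  simp [compJ]

@[simp] lemma compJ_singleton (φ : Multiset M → N) (ψ : Multiset N → K) (a : M) :
    compJ φ ψ {a} = ψ {φ {a}} := by
  rw [compJ, ← Multiset.cons_zero, partSum_cons, partSum_zero]; simp [partStep]

/-- Faà di Bruno composition is associative. By the chain rule, the derivatives of both sides in a
direction are composites of the same shape, of multisets with one element less. -/
lemma compJ_assoc {M N K K' : Type u} [AddCommMonoid M] [AddCommMonoid N] [AddCommMonoid K]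
    [AddCommMonoid K'] {φ : Multiset M → N} {ψ : Multiset N → K} {χ : Multiset K → K'}
    (hφ : MultiAdd φ) (hψ : MultiAdd ψ) (hχ : MultiAdd χ) (s : Multiset M) :
    compJ (compJ φ ψ) χ s = compJ φ (compJ ψ χ) s := by
  induction s using Multiset.induction_on generalizing N K K' with
  | empty => simp
  | cons v s ih =>
    -- with `p = 0` and `q = id`, the derivative `dirJ φ v p q s` is `φ (v ::ₘ s)`
    let Φ : Multiset M → N × N := fun b => (dirJ φ v 0 id b, φ b)
    let Ψ : Multiset (N × N) → K × K := fun b =>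
      (dirJ ψ (φ {v}) Prod.fst Prod.snd b, ψ (b.map Prod.snd))
    have hΦ : MultiAdd Φ :=
      ⟨fun a b s => Prod.ext ((hφ.dirJ v 0 (AddMonoidHom.id M)).add a b s) (hφ.add a b s),
        fun s => Prod.ext ((hφ.dirJ v 0 (AddMonoidHom.id M)).zero s) (hφ.zero s)⟩
    have hΨ₁ := hψ.dirJ (φ {v}) (AddMonoidHom.fst N N) (AddMonoidHom.snd N N)
    have hΨ : MultiAdd Ψ :=
      ⟨fun a b s => Prod.ext (hΨ₁.add a b s) (by simp [Ψ, hψ.add]),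
        fun s => Prod.ext (hΨ₁.zero s) (by simp [Ψ, hψ.zero])⟩
    have hX := hχ.dirJ (ψ {φ {v}}) (AddMonoidHom.fst K K) (AddMonoidHom.snd K K)
    have snd_compJ (b : Multiset M) : (compJ Φ Ψ b).2 = compJ φ ψ b := by
      have := map_partSum (AddMonoidHom.snd K K) b fun π => Ψ (π.map Φ)
      refine this.trans ?_
      simp [Φ, Ψ, compJ]
    have fst_compJ (b : Multiset M) : (compJ Φ Ψ b).1 = dirJ (compJ φ ψ) v 0 id b := by
      have := map_partSum (AddMonoidHom.fst K K) b fun π => Ψ (π.map Φ)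
      refine this.trans ?_
      exact dirJ_compJ (Φ := Φ) hψ v 0 id Prod.fst Prod.snd b (fun _ _ => rfl)
        (fun b _ => by simp [Φ])
    rw [← dirJ_zero_id ((hφ.compJ hψ).compJ hχ), ← dirJ_zero_id (hφ.compJ (hψ.compJ hχ)),
      ← dirJ_compJ (Φ := Φ) (hψ.compJ hχ) v 0 id Prod.fst Prod.snd s (fun _ _ => rfl)
        (fun b _ => by simp [Φ]),
      ← dirJ_compJ (Φ := compJ Φ Ψ) hχ v 0 id Prod.fst Prod.snd s (fun b _ => fst_compJ b)
        (fun b _ => by simp [snd_compJ]), compJ_singleton]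
    refine (ih hΦ hΨ hX).trans ?_
    congr 1
    funext b
    exact (dirJ_compJ (Φ := Ψ) hχ (φ {v}) Prod.fst Prod.snd Prod.fst Prod.snd b
      (fun _ _ => rfl) (fun _ _ => rfl))

lemma linJ_compJ (h : M → N) {ψ : Multiset N → K} (hψ : MultiAdd ψ) (s : Multiset M) :
    compJ (linJ h) ψ s = ψ (s.map h) := by
  rw [compJ, partSum_of_singletons]
  · simp [Multiset.map_map]
  · intro a b t r
    rw [Multiset.map_cons, linJ_cons_cons, hψ.zero]

lemma compJ_linJ (φ : Multiset M → N) (h : N → K) {s : Multiset M} (hs : s ≠ 0) :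
    compJ φ (linJ h) s = h (φ s) := by
  rw [compJ, partSum_of_card_le_one hs]
  · simp
  · intro b c r
    simp [linJ_cons_cons]

lemma dirJ_linJ (h : M → N) (v : M) (p q : M' → M) {s : Multiset M'} (hs : s ≠ 0) :
    dirJ (linJ h) v p q s = linJ (fun d => h (p d)) s := by
  obtain ⟨d, hd⟩ := Multiset.exists_mem_of_ne_zero hs
  obtain ⟨t, rfl⟩ := Multiset.exists_cons_of_mem hd
  rw [dirJ, Multiset.map_cons, linJ_cons_cons, zero_add]
  by_cases ht : t = 0
  · subst ht
    simp
  · obtain ⟨d', hd'⟩ := Multiset.exists_mem_of_ne_zero ht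
    obtain ⟨t, rfl⟩ := Multiset.exists_cons_of_mem hd'
    rw [linJ_cons_cons]
    simp only [pickSum_cons, Multiset.map_cons, linJ_cons_cons, pickSum_const_zero, add_zero]

end JetCalculus

/-! ### Tuples -/

section Tuples

variable {C : Type u} [CartQuiver.{v} C] [CartRestrCat C] {A X Z W : C}

lemma rst_pair_comp_left {Z X Y : C} (f : Z ⟶ X) (g : Z ⟶ Y) :
    rst (pair f g) ≫ f = rst g ≫ f := by
  rw [rst_pair', rst_comm', Category.assoc, rst_self']

lemma rst_rst (f : Z ⟶ W) : rst (rst f) = rst f := by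
  have := rst_rst_comp' f (𝟙 Z)
  rwa [Category.comp_id, rst_id, Category.comp_id] at this

lemma rst_rst_same (f : Z ⟶ W) : rst f ≫ rst f = rst f := by
  rw [← rst_rst_comp', rst_self']

lemma comp_tuple {n : ℕ} (k : W ⟶ Z) (a : Fin n → (Z ⟶ A)) (x : Z ⟶ X) :
    k ≫ tuple a x = tuple (fun i => k ≫ a i) (k ≫ x) := by
  induction n with
  | zero => rfl
  | succ n ih => simp only [tuple, comp_pair, ih]

lemma tuple_proj {n : ℕ} (a : Fin n → (Z ⟶ A)) (x : Z ⟶ X) (i : Fin n) :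
    tuple a x ≫ proj A X n i = rst (tuple a x) ≫ a i := by
  induction n with
  | zero => exact i.elim0
  | succ n ih =>
    refine Fin.cases ?_ (fun j => ?_) i
    · simp only [tuple, proj, Fin.cases_zero]
      rw [pair_fst, rst_pair_comp_left]
    · simp only [tuple, proj, Fin.cases_succ]
      rw [← Category.assoc, pair_snd, Category.assoc, ih, rst_pair', Category.assoc]

lemma tuple_base {n : ℕ} (a : Fin n → (Z ⟶ A)) (x : Z ⟶ X) :
    tuple a x ≫ base A X n = rst (tuple a x) ≫ x := by
  induction n with
  | zero => simp only [tuple, base]; rw [Category.comp_id, rst_self']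
  | succ n ih =>
    simp only [tuple, base]
    rw [← Category.assoc, pair_snd, Category.assoc, ih, rst_pair', Category.assoc]

lemma rst_tuple_le {n : ℕ} (a : Fin n → (Z ⟶ A)) (x : Z ⟶ X) (i : Fin n) :
    rst (tuple a x) ≫ rst (a i) = rst (tuple a x) := by
  induction n with
  | zero => exact i.elim0
  | succ n ih =>
    refine Fin.cases ?_ (fun j => ?_) i
    · simp only [tuple]
      rw [rst_pair', Category.assoc, rst_comm', ← Category.assoc, rst_rst_same]
    · simp only [tuple]
      rw [rst_pair', Category.assoc, ih (fun i => a i.succ)]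

lemma rst_tuple_le_base {n : ℕ} (a : Fin n → (Z ⟶ A)) (x : Z ⟶ X) :
    rst (tuple a x) ≫ rst x = rst (tuple a x) := by
  induction n with
  | zero => exact rst_rst_same x
  | succ n ih =>
    simp only [tuple]
    rw [rst_pair', Category.assoc, ih]

lemma le_rst_tuple {n : ℕ} (a : Fin n → (Z ⟶ A)) (x : Z ⟶ X) (e : Z ⟶ Z)
    (ha : ∀ i, e ≫ rst (a i) = e) (hx : e ≫ rst x = e) : e ≫ rst (tuple a x) = e := by
  induction n with
  | zero => exact hx
  | succ n ih =>
    simp only [tuple]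
    rw [rst_pair', ← Category.assoc, ha, ih _ fun i => ha i.succ]

lemma total_proj (n : ℕ) (i : Fin n) : Total (proj A X n i) := by
  induction n with
  | zero => exact i.elim0
  | succ n ih =>
    refine Fin.cases ?_ (fun j => ?_) i
    · exact total_fst _ _
    · exact total_comp (total_snd _ _) (ih j)

lemma total_base (n : ℕ) : Total (base A X n) := by
  induction n with
  | zero => exact total_id _
  | succ n ih => exact total_comp (total_snd _ _) ih

lemma tuple_proj_base (n : ℕ) : tuple (proj A X n) (base A X n) = 𝟙 (vars A X n) := by
  induction n with
  | zero => rfl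
  | succ n ih =>
    have h : tuple (fun i : Fin n => proj A X (n + 1) i.succ) (base A X (n + 1)) =
        snd A (vars A X n) := by
      rw [← Category.comp_id (snd A (vars A X n)), ← ih, comp_tuple]
      rfl
    change pair (fst A (vars A X n)) _ = _
    rw [h]
    symm
    apply pair_unique' <;>
      simp only [CMon.fst_total', CMon.snd_total', rst_id, Category.id_comp]

end Tuples

/-! ### Stages, points and vectors -/

section Stages

variable (C : Type u) [CartQuiver.{v} C] [CartRestrCat C]

/-- A stage of definition for generalized elements: an object together with a restriction
idempotent on it. Maps with this restriction are the total maps out of the splitting of the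
idempotent. -/
structure Stage where
  obj : C
  dom : obj ⟶ obj
  rst_dom : rst dom = dom

variable {C}

/-- A generalized element of `X` which is defined on the whole stage `S`. -/
@[ext]
structure Pt (S : Stage C) (X : C) where
  map : S.obj ⟶ X
  rst_map : rst map = S.dom

/-- The generalized elements of a commutative monoid which are defined on the whole stage `S`. -/
@[ext]
structure Vec (A : CMon C) (S : Stage C) extends Pt S A.car

lemma Stage.dom_dom (S : Stage C) : S.dom ≫ S.dom = S.dom := by
  rw [← S.rst_dom, rst_rst_same]

lemma Stage.dom_comp (S : Stage C) {X : C} {f : S.obj ⟶ X} (h : rst f = S.dom) :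
    S.dom ≫ f = f := by rw [← h, rst_self']

lemma Pt.dom_map {S : Stage C} {X : C} (x : Pt S X) : S.dom ≫ x.map = x.map :=
  S.dom_comp x.rst_map

namespace Vec

variable {A B : CMon C} {S : Stage C}

lemma dom_map (a : Vec A S) : S.dom ≫ a.map = a.map := a.toPt.dom_map

lemma ext_map {a b : Vec A S} (h : a.map = b.map) : a = b := Vec.ext h

instance : Add (Vec A S) :=
  ⟨fun a b => ⟨⟨A.plus a.map b.map, by rw [A.rst_plus, a.rst_map, b.rst_map, S.dom_dom]⟩⟩⟩

instance : Zero (Vec A S) :=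
  ⟨⟨⟨S.dom ≫ A.zeroMap S.obj, by
    rw [← S.rst_dom, rst_rst_comp', show rst (A.zeroMap S.obj) = 𝟙 _ from
      total_comp (total_bang _) A.zero_total, Category.comp_id]⟩⟩⟩

lemma map_add (a b : Vec A S) : (a + b).map = A.plus a.map b.map := rfl

lemma map_zero : (0 : Vec A S).map = S.dom ≫ A.zeroMap S.obj := rfl

instance : AddCommMonoid (Vec A S) where
  add_assoc a b c := Vec.ext (A.plus_assoc _ _ _)
  zero_add a := Vec.ext (by
    rw [map_add, map_zero, ← S.rst_dom, A.rst_left_plus, A.zero_plus, S.rst_dom, dom_map])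
  add_zero a := Vec.ext (by
    rw [map_add, map_zero, A.plus_comm, ← S.rst_dom, A.rst_left_plus, A.zero_plus, S.rst_dom,
      dom_map])
  add_comm a b := Vec.ext (A.plus_comm _ _)
  nsmul := nsmulRec

/-- A sum over a nonempty index type, computed among all partial maps. -/
lemma map_sum {ι : Type} [Fintype ι] [Nonempty ι] (a : ι → Vec A S) :
    (∑ i, a i).map = A.sum fun i => (a i).map := by
  let := A.homMonoid S.obj
  change _ = ∑ i, (a i).map
  have key : ∀ (s : Finset ι), s.Nonempty → (∑ i ∈ s, a i).map = ∑ i ∈ s, (a i).map := by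
    intro s hs
    induction hs using Finset.Nonempty.cons_induction with
    | singleton i => rw [Finset.sum_singleton, Finset.sum_singleton]
    | cons i s hi hs ih =>
      rw [Finset.sum_cons, Finset.sum_cons, ← ih]
      rfl
  exact key _ Finset.univ_nonempty

end Vec

/-- Composition of a point with a map which is defined on it. -/
def Pt.to {S : Stage C} {X Y : C} (x : Pt S X) (f : X ⟶ Y) (h : rst (x.map ≫ f) = S.dom) :
    Pt S Y := ⟨x.map ≫ f, h⟩

lemma Pt.rst_comp_total {S : Stage C} {X Y : C} (x : Pt S X) {f : X ⟶ Y} (hf : Total f) :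
    rst (x.map ≫ f) = S.dom := (FaaDiBruno.rst_comp_total _ hf).trans x.rst_map

/-- A map defined on the whole of the stage after composing with another one is itself so. -/
lemma Pt.rst_of_comp {S : Stage C} {X Y Z : C} (x : Pt S X) (f : X ⟶ Y) (g : Y ⟶ Z)
    (h : rst (x.map ≫ f ≫ g) = S.dom) : rst (x.map ≫ f) = S.dom := by
  have h1 := rst_comp_absorb x.map f
  have h2 := rst_comp_absorb (x.map ≫ f) g
  rw [Category.assoc, h] at h2
  rw [x.rst_map] at h1
  rw [← h1, ← S.rst_dom, rst_comm', S.rst_dom, h2]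

/-- The pair of two points. -/
def Pt.pair {S : Stage C} {X Y : C} (x : Pt S X) (y : Pt S Y) : Pt S (prod X Y) :=
  ⟨CartRestrCat.pair x.map y.map, by rw [rst_pair', x.rst_map, y.rst_map, S.dom_dom]⟩

/-- The first component of a point of a product. -/
def Pt.fst {S : Stage C} {X Y : C} (x : Pt S (prod X Y)) : Pt S X :=
  ⟨x.map ≫ CartRestrCat.fst X Y, x.rst_comp_total (total_fst _ _)⟩

/-- The second component of a point of a product. -/
def Pt.snd {S : Stage C} {X Y : C} (x : Pt S (prod X Y)) : Pt S Y :=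
  ⟨x.map ≫ CartRestrCat.snd X Y, x.rst_comp_total (total_snd _ _)⟩

section Prod
variable {S : Stage C} {X Y : C}

@[simp] lemma Pt.fst_pair (x : Pt S X) (y : Pt S Y) : (x.pair y).fst = x :=
  Pt.ext ((pair_fst _ _).trans (by rw [y.rst_map, x.dom_map]))

@[simp] lemma Pt.snd_pair (x : Pt S X) (y : Pt S Y) : (x.pair y).snd = y :=
  Pt.ext ((pair_snd _ _).trans (by rw [x.rst_map, y.dom_map]))

@[simp] lemma Pt.pair_fst_snd (x : Pt S (prod X Y)) : x.fst.pair x.snd = x := by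
  refine Pt.ext (pair_unique' ?_ ?_ ?_).symm
  · rw [x.snd.rst_map, x.fst.dom_map]; rfl
  · rw [x.fst.rst_map, x.snd.dom_map]; rfl
  · rw [x.snd.rst_map, x.fst.rst_map, x.rst_map, S.dom_dom]

lemma Pt.prod_ext {x y : Pt S (prod X Y)} (h1 : x.fst = y.fst) (h2 : x.snd = y.snd) : x = y := by
  rw [← x.pair_fst_snd, h1, h2, y.pair_fst_snd]

end Prod

/-- A point of `vars A X n`, from its components. -/
def Pt.tuple {S : Stage C} {A X : C} {n : ℕ} (a : Fin n → Pt S A) (x : Pt S X) :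
    Pt S (vars A X n) :=
  ⟨FaaDiBruno.tuple (fun i => (a i).map) x.map, by
    have h1 := rst_tuple_le_base (fun i => (a i).map) x.map
    have h2 := le_rst_tuple (fun i => (a i).map) x.map S.dom
      (fun i => by rw [(a i).rst_map, S.dom_dom]) (by rw [x.rst_map, S.dom_dom])
    rw [x.rst_map] at h1
    rw [← S.rst_dom, rst_comm', S.rst_dom, h1] at h2
    exact h2⟩

lemma Pt.tuple_proj {S : Stage C} {A X : C} {n : ℕ} (a : Fin n → Pt S A) (x : Pt S X)
    (i : Fin n) : (Pt.tuple a x).map ≫ proj A X n i = (a i).map := by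
  refine (FaaDiBruno.tuple_proj _ _ _).trans ?_
  exact (congrArg (· ≫ (a i).map) (Pt.tuple a x).rst_map).trans (a i).dom_map

lemma Pt.tuple_base {S : Stage C} {A X : C} {n : ℕ} (a : Fin n → Pt S A) (x : Pt S X) :
    (Pt.tuple a x).map ≫ base A X n = x.map := by
  refine (FaaDiBruno.tuple_base _ _).trans ?_
  exact (congrArg (· ≫ x.map) (Pt.tuple a x).rst_map).trans x.dom_map

/-- A change of stage. -/
@[ext]
structure StageHom (S T : Stage C) where
  map : S.obj ⟶ T.obj
  rst_map : rst map = S.dom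
  map_dom : map ≫ T.dom = map

section Pull
variable {S T U : Stage C} (k : StageHom S T) {X Y : C} {A B : CMon C}

/-- Restriction of points along a change of stage. -/
def StageHom.pt (x : Pt T X) : Pt S X :=
  ⟨k.map ≫ x.map, by rw [← rst_comp_rst, x.rst_map, k.map_dom, k.rst_map]⟩

/-- Restriction of vectors along a change of stage. -/
def StageHom.vec : Vec A T →+ Vec A S where
  toFun a := ⟨k.pt a.toPt⟩
  map_zero' := Vec.ext (by
    change k.map ≫ T.dom ≫ _ = S.dom ≫ _
    rw [← Category.assoc, k.map_dom, A.comp_zeroMap, k.rst_map])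
  map_add' a b := Vec.ext (A.comp_plus _ _ _)

lemma StageHom.map_pt (x : Pt T X) : (k.pt x).map = k.map ≫ x.map := rfl
lemma StageHom.map_vec (a : Vec A T) : (k.vec a).map = k.map ≫ a.map := rfl

end Pull

end Stages

/-! ### The jets of a map of the Faà di Bruno category -/

lemma exists_fin_map {M : Type*} (s : Multiset M) :
    ∃ a : Fin s.card → M, Finset.univ.val.map a = s := by
  induction s using Quotient.inductionOn with
  | h l =>
    refine ⟨fun i => l.get i, ?_⟩
    simp only [Fin.univ_val_map]
    exact congrArg _ (List.ofFn_get l)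

/-- Families with the same multiset of values differ by a permutation, so a symmetric function of a
family is a function of a multiset. -/
lemma exists_perm_of_map_eq {M : Type*} {n : ℕ} {a b : Fin n → M}
    (h : (Finset.univ : Finset (Fin n)).val.map a = Finset.univ.val.map b) :
    ∃ σ : Equiv.Perm (Fin n), a ∘ σ = b := by
  classical
  have hc : ∀ m, Nonempty ({i // b i = m} ≃ {i // a i = m}) := by
    intro m
    refine Fintype.card_eq.1 ?_
    have := congrArg (Multiset.count m) h
    rw [Multiset.count_map, Multiset.count_map] at this
    rw [Fintype.card_subtype, Fintype.card_subtype]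
    simp only [eq_comm (a := m)] at this
    exact this.symm
  have e := fun m => (hc m).some
  refine ⟨(Equiv.sigmaFiberEquiv b).symm.trans
    ((Equiv.sigmaCongrRight e).trans (Equiv.sigmaFiberEquiv a)), funext fun i => ?_⟩
  exact (e (b i) ⟨i, rfl⟩).2

lemma multiset_eq_cons {M : Type*} (s : Multiset M) :
    ∃ a : Fin s.card → M, Finset.univ.val.map a = s ∧
      ∀ v, (Finset.univ : Finset (Fin (s.card + 1))).val.map
        (Fin.cons (α := fun _ => M) v a) = v ::ₘ s := by
  obtain ⟨a, ha⟩ := exists_fin_map s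
  refine ⟨a, ha, fun v => ?_⟩
  rw [univ_map_succ]
  simp [ha]

section Jets

variable {C : Type u} [CartQuiver.{v} C] [CartRestrCat C] {P Q R : FaaObj C}

/-- A point of `vars A X n`, from its components, the first `n` of which are vectors. -/
def vtuple {S : Stage C} {A : CMon C} {X : C} {n : ℕ} (a : Fin n → Vec A S) (x : Pt S X) :
    Pt S (vars A.car X n) := Pt.tuple (fun i => (a i).toPt) x

section
variable {S T : Stage C} {A : CMon C} {X Y : C} {n : ℕ} (a : Fin n → Vec A S) (x : Pt S X)

lemma vtuple_map : (vtuple a x).map = tuple (fun i => (a i).map) x.map := rfl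

lemma vtuple_proj (i : Fin n) : (vtuple a x).map ≫ proj A.car X n i = (a i).map :=
  Pt.tuple_proj _ _ i

lemma vtuple_base : (vtuple a x).map ≫ base A.car X n = x.map := Pt.tuple_base _ _

lemma StageHom.pt_vtuple (k : StageHom T S) :
    k.pt (vtuple a x) = vtuple (fun i => k.vec (a i)) (k.pt x) :=
  Pt.ext (comp_tuple _ _ _)

lemma vtuple_perm (σ : Equiv.Perm (Fin n)) :
    (vtuple a x).map ≫ tuple (fun i => proj A.car X n (σ i)) (base A.car X n) =
      (vtuple (a ∘ σ) x).map := by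
  rw [comp_tuple, vtuple_base]
  simp only [vtuple_proj]
  rfl

lemma rst_vtuple_comp {B : C} {f : X ⟶ Y} {t : vars A.car X n ⟶ B}
    (ht : rst t = rst (base A.car X n ≫ f)) (y : Pt S Y) (h : x.map ≫ f = y.map) :
    rst ((vtuple a x).map ≫ t) = S.dom := by
  rw [← rst_comp_rst, ht, rst_comp_rst, ← Category.assoc, vtuple_base, h, y.rst_map]
end

/-- The value of `f_n` at a base point and `n` vectors. -/
def FaaHom.eval (f : FaaHom P Q) {S : Stage C} (x : Pt S P.pt) (y : Pt S Q.pt)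
    (h : x.map ≫ f.star = y.map) {n : ℕ} (hn : 0 < n) (a : Fin n → Vec P.vec S) : Vec Q.vec S :=
  ⟨⟨(vtuple a x).map ≫ f.term n hn, rst_vtuple_comp a x (f.rst_term n hn) y h⟩⟩

lemma FaaHom.eval_map (f : FaaHom P Q) {S : Stage C} (x : Pt S P.pt) (y : Pt S Q.pt)
    (h : x.map ≫ f.star = y.map) {n : ℕ} (hn : 0 < n) (a : Fin n → Vec P.vec S) :
    (f.eval x y h hn a).map = (vtuple a x).map ≫ f.term n hn := rfl

section Jet
variable (f : FaaHom P Q) {S T : Stage C} (x : Pt S P.pt) (y : Pt S Q.pt)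
  (h : x.map ≫ f.star = y.map)

lemma FaaHom.eval_perm {n : ℕ} (hn : 0 < n) (a : Fin n → Vec P.vec S) (σ : Equiv.Perm (Fin n)) :
    f.eval x y h hn (a ∘ σ) = f.eval x y h hn a := by
  refine Vec.ext_map ?_
  rw [FaaHom.eval_map, FaaHom.eval_map, ← vtuple_perm, Category.assoc, f.term_symm]

/-- The sequence of symmetric multiadditive functions on vectors that a map `f` of the Faà di Bruno
category defines at a base point `x`, where `y = x f_*`. Its value at the empty multiset is a junk
value. -/
def FaaHom.jet (s : Multiset (Vec P.vec S)) : Vec Q.vec S :=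
  if hs : 0 < s.card then f.eval x y h hs (exists_fin_map s).choose else 0

lemma FaaHom.jet_univ {n : ℕ} (hn : 0 < n) (a : Fin n → Vec P.vec S) :
    f.jet x y h (Finset.univ.val.map a) = f.eval x y h hn a := by
  have key : ∀ (m : ℕ) (hm : 0 < m) (b : Fin m → Vec P.vec S),
      Finset.univ.val.map b = Finset.univ.val.map a → f.eval x y h hm b = f.eval x y h hn a := by
    intro m hm b hb
    have e : m = n := by simpa using congrArg Multiset.card hb
    subst e
    obtain ⟨σ, rfl⟩ := exists_perm_of_map_eq hb
    rw [FaaHom.eval_perm]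
  have hs : 0 < (Finset.univ.val.map a).card := by simpa using hn
  unfold FaaHom.jet
  rw [dif_pos hs]
  exact key _ _ _ (exists_fin_map _).choose_spec

@[simp] lemma FaaHom.jet_zero : f.jet x y h 0 = 0 := by simp [FaaHom.jet]

lemma FaaHom.eval_cons_add {n : ℕ} (a : Fin n → Vec P.vec S) (b c : Vec P.vec S) :
    f.eval x y h n.succ_pos (Fin.cons (b + c) a) =
      f.eval x y h n.succ_pos (Fin.cons b a) + f.eval x y h n.succ_pos (Fin.cons c a) := by
  have e (d : Vec P.vec S) : (fun i => (Fin.cons (α := fun _ => Vec P.vec S) d a i).map) =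
      Function.update (fun i => (Fin.cons (α := fun _ => Vec P.vec S) 0 a i).map) 0 d.map := by
    funext i
    refine Fin.cases ?_ (fun j => ?_) i <;> simp
  refine Vec.ext_map ?_
  rw [Vec.map_add, FaaHom.eval_map, FaaHom.eval_map, FaaHom.eval_map, vtuple_map, vtuple_map,
    vtuple_map, e, e, e, Vec.map_add]
  exact f.term_plus _ n.succ_pos _ _ _ _ _

lemma FaaHom.eval_cons_zero {n : ℕ} (a : Fin n → Vec P.vec S) :
    f.eval x y h n.succ_pos (Fin.cons 0 a) = 0 := by
  refine Vec.ext_map ?_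
  have e : ((vtuple (Fin.cons (α := fun _ => Vec P.vec S) 0 a) x).map :
      S.obj ⟶ vars P.vec.car P.pt (n + 1)) = S.dom ≫ tuple (Function.update
        (fun i => (Fin.cons (α := fun _ => Vec P.vec S) 0 a i).map) 0 (P.vec.zeroMap S.obj))
        x.map := by
    rw [comp_tuple, x.dom_map, vtuple_map]
    congr 1
    funext i
    refine Fin.cases ?_ (fun j => ?_) i
    · simp [Vec.map_zero]
    · simp [Vec.dom_map]
  have hr := (f.eval x y h n.succ_pos (Fin.cons 0 a)).rst_map
  rw [FaaHom.eval_map] at hr ⊢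
  rw [e, Category.assoc] at hr ⊢
  rw [f.term_zero _ n.succ_pos, Vec.map_zero, ← Category.assoc, ← S.rst_dom, ← rst_rst_comp',
    S.rst_dom, hr]

lemma FaaHom.jet_multiAdd : MultiAdd (f.jet x y h) where
  add a b s := by
    obtain ⟨c, hc, hcons⟩ := multiset_eq_cons s
    rw [← hcons, ← hcons, ← hcons, f.jet_univ _ _ _ s.card.succ_pos,
        f.jet_univ _ _ _ s.card.succ_pos,
      f.jet_univ _ _ _ s.card.succ_pos]
    exact f.eval_cons_add x y h c a b
  zero s := by
    obtain ⟨c, hc, hcons⟩ := multiset_eq_cons s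
    rw [← hcons, f.jet_univ _ _ _ s.card.succ_pos]
    exact f.eval_cons_zero x y h c

/-- The hypothesis of naturality for base points. -/
lemma FaaHom.pull_star {f : FaaHom P Q} {x : Pt S P.pt} {y : Pt S Q.pt}
    (h : x.map ≫ f.star = y.map) (k : StageHom T S) :
    (k.pt x).map ≫ f.star = (k.pt y).map := by
  rw [k.map_pt, k.map_pt, Category.assoc, h]

/-- Jets are natural in the stage. -/
lemma FaaHom.vec_jet (k : StageHom T S) (s : Multiset (Vec P.vec S)) :
    k.vec (f.jet x y h s) = f.jet (k.pt x) (k.pt y) (FaaHom.pull_star h k) (s.map k.vec) := by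
  by_cases hs : s = 0
  · simp [hs]
  · obtain ⟨a, ha⟩ := exists_fin_map s
    have hn : 0 < s.card := Multiset.card_pos.2 hs
    rw [← ha, Multiset.map_map, f.jet_univ _ _ _ hn, f.jet_univ _ _ _ hn]
    refine Vec.ext_map ?_
    rw [k.map_vec, f.eval_map, f.eval_map, ← Category.assoc]
    congr 1
    exact congrArg Pt.map (k.pt_vtuple a x)

end Jet

/-- The generic stage for `n` vectors and a base point at which `f` is defined. -/
abbrev Stage.gen (A X : C) {Y : C} (f : X ⟶ Y) (n : ℕ) : Stage C where
  obj := vars A X n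
  dom := rst (base A X n ≫ f)
  rst_dom := rst_rst _

section Gen
variable (P) {Y : C} (f : P.pt ⟶ Y) (n : ℕ)

/-- The generic base point. -/
def genPt : Pt (Stage.gen P.vec.car P.pt f n) P.pt where
  map := rst (base P.vec.car P.pt n ≫ f) ≫ base P.vec.car P.pt n
  rst_map := rst_comp_total _ (total_base _) |>.trans (rst_rst _)

/-- The image of the generic base point. -/
def genTo : Pt (Stage.gen P.vec.car P.pt f n) Y where
  map := base P.vec.car P.pt n ≫ f
  rst_map := rfl

/-- The generic vectors. -/
def genVec (i : Fin n) : Vec P.vec (Stage.gen P.vec.car P.pt f n) where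
  map := rst (base P.vec.car P.pt n ≫ f) ≫ proj P.vec.car P.pt n i
  rst_map := rst_comp_total _ (total_proj _ _) |>.trans (rst_rst _)

lemma genPt_map : (genPt P f n).map =
    rst (base P.vec.car P.pt n ≫ f) ≫ base P.vec.car P.pt n := rfl
lemma genTo_map : (genTo P f n).map = base P.vec.car P.pt n ≫ f := rfl
lemma genVec_map (i : Fin n) : (genVec P f n i).map =
    rst (base P.vec.car P.pt n ≫ f) ≫ proj P.vec.car P.pt n i := rfl

lemma genPt_to : (genPt P f n).map ≫ f = (genTo P f n).map := by
  rw [genPt_map, genTo_map, Category.assoc, rst_self']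

lemma vtuple_gen : (vtuple (genVec P f n) (genPt P f n)).map = rst (base P.vec.car P.pt n ≫ f) := by
  have h := comp_tuple (rst (base P.vec.car P.pt n ≫ f)) (proj P.vec.car P.pt n)
    (base P.vec.car P.pt n)
  rw [tuple_proj_base, Category.comp_id] at h
  exact h.symm

variable {P} {f} {n}

lemma vtuple_comp_dom {S : Stage C} (a : Fin n → Vec P.vec S) (x : Pt S P.pt) (y : Pt S Y)
    (h : x.map ≫ f = y.map) :
    (vtuple a x).map ≫ rst (base P.vec.car P.pt n ≫ f) = (vtuple a x).map := by
  rw [comp_rst', ← Category.assoc, vtuple_base, h, y.rst_map, (vtuple a x).dom_map]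

/-- Any base point and vectors are obtained from the generic ones by a change of stage. -/
def genHom {S : Stage C} (a : Fin n → Vec P.vec S) (x : Pt S P.pt) (y : Pt S Y)
    (h : x.map ≫ f = y.map) : StageHom S (Stage.gen P.vec.car P.pt f n) where
  map := (vtuple a x).map
  rst_map := (vtuple a x).rst_map
  map_dom := vtuple_comp_dom a x y h

variable {S : Stage C} (a : Fin n → Vec P.vec S) (x : Pt S P.pt) (y : Pt S Y)
    (h : x.map ≫ f = y.map)

lemma genHom_map : (genHom a x y h).map = (vtuple a x).map := rfl

lemma genHom_pt : (genHom a x y h).pt (genPt P f n) = x := by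
  refine Pt.ext ?_
  rw [StageHom.map_pt, genHom_map, genPt_map, ← Category.assoc, vtuple_comp_dom a x y h,
    vtuple_base]

lemma genHom_to : (genHom a x y h).pt (genTo P f n) = y := by
  refine Pt.ext ?_
  rw [StageHom.map_pt, genHom_map, genTo_map, ← Category.assoc, vtuple_base, h]

lemma genHom_vec (i : Fin n) : (genHom a x y h).vec (genVec P f n i) = a i := by
  refine Vec.ext_map ?_
  rw [StageHom.map_vec, genHom_map, genVec_map, ← Category.assoc, vtuple_comp_dom a x y h,
    vtuple_proj]

end Gen

/-- A term is recovered from its values as the value at the generic point and vectors. -/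
lemma FaaHom.term_eq_eval (f : FaaHom P Q) (n : ℕ) (hn : 0 < n) :
    f.term n hn = (f.eval (genPt P f.star n) (genTo P f.star n) (genPt_to P f.star n) hn
      (genVec P f.star n)).map := by
  rw [FaaHom.eval_map, vtuple_gen, ← f.rst_term n hn, rst_self']

/-- Maps of the Faà di Bruno category are determined by their base maps and their jets. -/
lemma FaaHom.ext_jet {f g : FaaHom P Q} (hs : f.star = g.star)
    (hj : ∀ {S : Stage C} (x : Pt S P.pt) (y : Pt S Q.pt) (h : x.map ≫ f.star = y.map)
      (h' : x.map ≫ g.star = y.map) (s : Multiset (Vec P.vec S)), s ≠ 0 →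
      f.jet x y h s = g.jet x y h' s) : f = g := by
  refine FaaHom.ext hs ?_
  funext n hn
  have h' : (genPt P f.star n).map ≫ g.star = (genTo P f.star n).map := by
    rw [← hs]; exact genPt_to P f.star n
  have key := hj (genPt P f.star n) (genTo P f.star n) (genPt_to P f.star n) h'
    (Finset.univ.val.map (genVec P f.star n)) (fun h0 => by
      have := congrArg Multiset.card h0
      simp at this
      omega)
  rw [f.jet_univ _ _ _ hn, g.jet_univ _ _ _ hn] at key
  have key' := congrArg (fun w => w.map) key
  rw [f.term_eq_eval, key', FaaHom.eval_map, vtuple_gen, hs, ← g.rst_term n hn, rst_self']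

/-- A family of vectors with one entry replaced by the restriction of a partial map to a stage. -/
lemma vtuple_update {S : Stage C} {A : CMon C} {X : C} {n : ℕ} (i : Fin n)
    (a : Fin n → (S.obj ⟶ A.car)) (x : S.obj ⟶ X) (ha : ∀ j, j ≠ i → S.dom ≫ rst (a j) = S.dom)
    (hx : S.dom ≫ rst x = S.dom) : ∃ (a' : Fin n → Vec A S) (x' : Pt S X),
      x'.map = S.dom ≫ x ∧ ∀ (v : Vec A S) (w : S.obj ⟶ A.car), v.map = S.dom ≫ w →
        (vtuple (Function.update a' i v) x').map = S.dom ≫ tuple (Function.update a i w) x := by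
  have e {W : C} (f : S.obj ⟶ W) (hf : S.dom ≫ rst f = S.dom) : rst (S.dom ≫ f) = S.dom := by
    rw [← S.rst_dom, rst_rst_comp', S.rst_dom, hf]
  refine ⟨fun j => if hj : j = i then 0 else ⟨⟨S.dom ≫ a j, e _ (ha j hj)⟩⟩, ⟨S.dom ≫ x, e _ hx⟩,
    rfl, fun v w hv => ?_⟩
  rw [comp_tuple, vtuple_map]
  congr 1
  funext j
  by_cases hj : j = i
  · subst hj
    simp [hv]
  · simp [hj]

/-- A restriction-order antisymmetry: `f ≤ g`, and `f` agrees with `g` on the domain of `g`. -/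
lemma rst_antisymm {X Y : C} {f g : X ⟶ Y} (h1 : f = rst f ≫ g) (h2 : rst g ≫ f = g) :
    f = g := by
  have h : rst f ≫ rst g ≫ f = f := by rw [h2, ← h1]
  rw [rst_left_comm, rst_self', h2] at h
  exact h.symm

lemma total_tuple {Z A X : C} {n : ℕ} {a : Fin n → (Z ⟶ A)} {x : Z ⟶ X} (ha : ∀ i, Total (a i))
    (hx : Total x) : Total (tuple a x) := by
  induction n with
  | zero => exact hx
  | succ n ih => exact total_pair (ha 0) (ih fun i => ha i.succ)

section OfTerms

variable {star : P.pt ⟶ Q.pt} {n : ℕ} {t : vars P.vec.car P.pt n ⟶ Q.vec.car}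

/-- The domain of a term, at given elements. -/
lemma rst_tuple_comp_term (ht : rst t = rst (base P.vec.car P.pt n ≫ star)) {Z : C}
    (a : Fin n → (Z ⟶ P.vec.car)) (x : Z ⟶ P.pt) :
    rst (tuple a x ≫ t) = rst (tuple a x) ≫ rst (x ≫ star) := by
  rw [← rst_comp_rst, ht, rst_comp_rst, ← Category.assoc, tuple_base, Category.assoc,
    rst_rst_comp']

lemma le_of_rst_tuple_comp_term (ht : rst t = rst (base P.vec.car P.pt n ≫ star)) {Z : C}
    (a : Fin n → (Z ⟶ P.vec.car)) (x : Z ⟶ P.pt) (i : Fin n) :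
    rst (tuple a x ≫ t) ≫ rst (a i) = rst (tuple a x ≫ t) ∧
      rst (tuple a x ≫ t) ≫ rst x = rst (tuple a x ≫ t) ∧
      rst (tuple a x ≫ t) ≫ rst (x ≫ star) = rst (tuple a x ≫ t) := by
  rw [rst_tuple_comp_term ht]
  refine ⟨?_, ?_, ?_⟩
  · rw [Category.assoc, rst_comm' (x ≫ star), ← Category.assoc, rst_tuple_le]
  · rw [Category.assoc, rst_comm' (x ≫ star), ← Category.assoc, rst_tuple_le_base]
  · rw [Category.assoc, rst_rst_same]

/-- Additivity of a term needs to be tested only on elements that are all defined on the same stage,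
because both sides are restricted to the common domain of the variables and of `star`. -/
lemma term_plus_of_vec (ht : rst t = rst (base P.vec.car P.pt n ≫ star))
    (i : Fin n)
    (plus : ∀ {S : Stage C} (x : Pt S P.pt) (y : Pt S Q.pt), x.map ≫ star = y.map →
      ∀ (c : Fin n → Vec P.vec S) (a b : Vec P.vec S),
      (vtuple (Function.update c i (a + b)) x).map ≫ t = Q.vec.plus
          ((vtuple (Function.update c i a) x).map ≫ t)
          ((vtuple (Function.update c i b) x).map ≫ t))
    {Z : C} (a : Fin n → (Z ⟶ P.vec.car)) (x : Z ⟶ P.pt) (b c : Z ⟶ P.vec.car) :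
    tuple (Function.update a i (P.vec.plus b c)) x ≫ t =
      Q.vec.plus (tuple (Function.update a i b) x ≫ t) (tuple (Function.update a i c) x ≫ t) := by
  -- the two sides agree on every restriction idempotent on which all the maps involved are defined
  have key (e : Z ⟶ Z) (he : rst e = e) (ha : ∀ j, j ≠ i → e ≫ rst (a j) = e)
      (hx : e ≫ rst x = e) (hy : e ≫ rst (x ≫ star) = e) (hb : e ≫ rst b = e)
      (hc : e ≫ rst c = e) :
      e ≫ tuple (Function.update a i (P.vec.plus b c)) x ≫ t =
        e ≫ Q.vec.plus (tuple (Function.update a i b) x ≫ t)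
          (tuple (Function.update a i c) x ≫ t) := by
    have e' {W : C} (f : Z ⟶ W) (hf : e ≫ rst f = e) : rst (e ≫ f) = e := by
      rw [← he, rst_rst_comp', he, hf]
    let S : Stage C := ⟨Z, e, he⟩
    obtain ⟨a', x', hx', h⟩ := vtuple_update (S := S) i a x ha hx
    let b' : Vec P.vec S := ⟨⟨e ≫ b, e' _ hb⟩⟩
    let c' : Vec P.vec S := ⟨⟨e ≫ c, e' _ hc⟩⟩
    have := plus x' ⟨e ≫ x ≫ star, e' _ hy⟩ (by rw [hx', Category.assoc]) a' b' c'
    rw [h b' b rfl, h c' c rfl, h (b' + c') (P.vec.plus b c) (P.vec.comp_plus _ _ _).symm,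
      Category.assoc, Category.assoc, Category.assoc] at this
    exact this.trans (Q.vec.comp_plus _ _ _).symm
  have le (v : Z ⟶ P.vec.car) :
      (∀ j, j ≠ i → rst (tuple (Function.update a i v) x ≫ t) ≫ rst (a j) =
        rst (tuple (Function.update a i v) x ≫ t)) ∧
      rst (tuple (Function.update a i v) x ≫ t) ≫ rst v =
        rst (tuple (Function.update a i v) x ≫ t) ∧
      rst (tuple (Function.update a i v) x ≫ t) ≫ rst x =
        rst (tuple (Function.update a i v) x ≫ t) ∧
      rst (tuple (Function.update a i v) x ≫ t) ≫ rst (x ≫ star) =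
        rst (tuple (Function.update a i v) x ≫ t) := by
    refine ⟨fun j hj => ?_, ?_, (le_of_rst_tuple_comp_term ht _ x i).2.1,
      (le_of_rst_tuple_comp_term ht _ x i).2.2⟩
    · have := (le_of_rst_tuple_comp_term ht (Function.update a i v) x j).1
      rwa [Function.update_of_ne hj] at this
    · have := (le_of_rst_tuple_comp_term ht (Function.update a i v) x i).1
      rwa [Function.update_self] at this
  obtain ⟨l1, l2, l3, l4⟩ := le (P.vec.plus b c)
  obtain ⟨b1, b2, b3, b4⟩ := le b
  obtain ⟨c1, c2, c3, c4⟩ := le c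
  generalize tuple (Function.update a i (P.vec.plus b c)) x ≫ t = u at *
  generalize tuple (Function.update a i b) x ≫ t = v at *
  generalize tuple (Function.update a i c) x ≫ t = w at *
  -- the two sides are compared on the domain of each of them
  have k1 := key (rst u) (rst_rst _) l1 l3 l4
    (by
      rw [P.vec.rst_plus] at l2
      rw [← l2, Category.assoc, Category.assoc, rst_comm' c b, ← Category.assoc (rst b),
        rst_rst_same])
    (by
      rw [P.vec.rst_plus] at l2
      rw [← l2, Category.assoc, Category.assoc, rst_rst_same])
  have swap {W : C} (f : Z ⟶ W) (hf : rst v ≫ rst f = rst v) :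
      (rst v ≫ rst w) ≫ rst f = rst v ≫ rst w := by
    rw [Category.assoc, rst_comm' w f, ← Category.assoc, hf]
  have k2 := key (rst v ≫ rst w) (by rw [rst_rst_comp', rst_rst])
    (fun j hj => swap _ (b1 j hj)) (swap _ b3) (swap _ b4) (swap _ b2)
    (by rw [Category.assoc, c2])
  rw [rst_self'] at k1
  rw [← Q.vec.rst_plus, rst_self'] at k2
  exact rst_antisymm k1 k2

/-- The analogue of `term_plus_of_vec` for the insertion of zero. -/
lemma term_zero_of_vec (ht : rst t = rst (base P.vec.car P.pt n ≫ star)) (i : Fin n)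
    (zero : ∀ {S : Stage C} (x : Pt S P.pt) (y : Pt S Q.pt), x.map ≫ star = y.map →
      ∀ (c : Fin n → Vec P.vec S),
      (vtuple (Function.update c i 0) x).map ≫ t = S.dom ≫ Q.vec.zeroMap S.obj)
    {Z : C} (a : Fin n → (Z ⟶ P.vec.car)) (x : Z ⟶ P.pt) :
    tuple (Function.update a i (P.vec.zeroMap Z)) x ≫ t =
      rst (tuple (Function.update a i (P.vec.zeroMap Z)) x ≫ t) ≫ Q.vec.zeroMap Z := by
  have l (j : Fin n) := le_of_rst_tuple_comp_term ht
    (Function.update a i (P.vec.zeroMap Z)) x j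
  have l1 (j : Fin n) (hj : j ≠ i) := (l j).1
  have l3 := (l i).2.1
  have l4 := (l i).2.2
  generalize hu : tuple (Function.update a i (P.vec.zeroMap Z)) x ≫ t = u at *
  let S : Stage C := ⟨Z, rst u, rst_rst u⟩
  obtain ⟨a', x', hx', h⟩ := vtuple_update (S := S) i a x
    (fun j hj => by have := l1 j hj; rwa [Function.update_of_ne hj] at this) l3
  have := zero x' ⟨rst u ≫ x ≫ star, by rw [rst_rst_comp', l4]⟩
    (by rw [hx', Category.assoc]) a'
  rw [h 0 (P.vec.zeroMap Z) rfl, Category.assoc] at this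
  rw [← this]
  change u = rst u ≫ _ ≫ t
  rw [hu, rst_self']

/-- By a transposition, additivity in the `i`-th variable of a symmetric map follows from additivity
in the first one. -/
lemma update_comp_swap {α : Type*} {n : ℕ} (a : Fin (n + 1) → α) (i : Fin (n + 1)) :
    ∃ c : Fin n → α, ∀ v, Function.update a i v ∘ Equiv.swap 0 i =
      (Fin.cons v c : Fin (n + 1) → α) := by
  refine ⟨fun j => a (Equiv.swap 0 i j.succ), fun v => funext fun j => ?_⟩
  refine Fin.cases ?_ (fun j => ?_) j
  · simp
  · have : Equiv.swap 0 i j.succ ≠ i := by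
      intro h
      have := congrArg (Equiv.swap 0 i) h
      simp at this
    simp [Function.update_of_ne this]

/-- A map of the Faà di Bruno category, from terms which are symmetric, and additive in their first
variable at points that are defined on a whole stage. -/
def FaaHom.ofTerms (star : P.pt ⟶ Q.pt)
    (term : ∀ n : ℕ, 0 < n → (vars P.vec.car P.pt n ⟶ Q.vec.car))
    (rst_term : ∀ n hn, rst (term n hn) = rst (base P.vec.car P.pt n ≫ star))
    (symm : ∀ n hn (σ : Equiv.Perm (Fin n)),
      tuple (fun i => proj P.vec.car P.pt n (σ i)) (base P.vec.car P.pt n) ≫ term n hn =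
        term n hn)
    (plus : ∀ {S : Stage C} (x : Pt S P.pt) (y : Pt S Q.pt), x.map ≫ star = y.map →
      ∀ (n : ℕ) (c : Fin n → Vec P.vec S) (a b : Vec P.vec S),
      (vtuple (Fin.cons (a + b) c : Fin (n + 1) → Vec P.vec S) x).map ≫ term (n + 1) n.succ_pos =
        Q.vec.plus
          ((vtuple (Fin.cons a c : Fin (n + 1) → Vec P.vec S) x).map ≫ term (n + 1) n.succ_pos)
          ((vtuple (Fin.cons b c : Fin (n + 1) → Vec P.vec S) x).map ≫ term (n + 1) n.succ_pos))
    (zero : ∀ {S : Stage C} (x : Pt S P.pt) (y : Pt S Q.pt), x.map ≫ star = y.map →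
      ∀ (n : ℕ) (c : Fin n → Vec P.vec S),
      (vtuple (Fin.cons 0 c : Fin (n + 1) → Vec P.vec S) x).map ≫ term (n + 1) n.succ_pos =
        S.dom ≫ Q.vec.zeroMap S.obj) : FaaHom P Q where
  star := star
  term := term
  rst_term := rst_term
  term_symm := symm
  term_plus n hn Z a x i b c := by
    refine term_plus_of_vec (rst_term n hn) i (fun {S} x y h a' b c => ?_) a x b c
    obtain ⟨m, rfl⟩ : ∃ m, n = m + 1 := ⟨n - 1, by omega⟩
    obtain ⟨c', hc'⟩ := update_comp_swap a' i
    have e (v : Vec P.vec S) : (vtuple (Function.update a' i v) x).map ≫ term (m + 1) hn =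
        (vtuple (Fin.cons v c' : Fin (m + 1) → Vec P.vec S) x).map ≫ term (m + 1) hn := by
      rw [← hc', ← vtuple_perm, Category.assoc, symm]
    rw [e, e, e]
    exact plus x y h m c' b c
  term_zero n hn Z a x i := by
    refine term_zero_of_vec (rst_term n hn) i (fun {S} x y h a' => ?_) a x
    obtain ⟨m, rfl⟩ : ∃ m, n = m + 1 := ⟨n - 1, by omega⟩
    obtain ⟨c', hc'⟩ := update_comp_swap a' i
    rw [← zero x y h m c', ← hc', ← vtuple_perm, Category.assoc, symm]

end OfTerms

section OfJets

/-- A natural family of symmetric multiadditive functions on vectors, over the base map `star`. -/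
structure JetFamily (star : P.pt ⟶ Q.pt) where
  J {S : Stage C} (x : Pt S P.pt) (y : Pt S Q.pt) :
    x.map ≫ star = y.map → Multiset (Vec P.vec S) → Vec Q.vec S
  multiAdd {S : Stage C} (x : Pt S P.pt) (y : Pt S Q.pt) (h : x.map ≫ star = y.map) :
    MultiAdd (J x y h)
  natural {S T : Stage C} (k : StageHom T S) (x : Pt S P.pt) (y : Pt S Q.pt)
    (h : x.map ≫ star = y.map) (h' : (k.pt x).map ≫ star = (k.pt y).map)
    (s : Multiset (Vec P.vec S)) : k.vec (J x y h s) = J (k.pt x) (k.pt y) h' (s.map k.vec)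

variable {star : P.pt ⟶ Q.pt} (F : JetFamily star)

/-- The value of the family `F` at the generic base point and vectors. -/
def jetTerm (n : ℕ) : vars P.vec.car P.pt n ⟶ Q.vec.car :=
  (F.J (genPt P star n) (genTo P star n) (genPt_to P star n)
    (Finset.univ.val.map (genVec P star n))).map

/-- By naturality, the value of the family at the generic point determines it at all points. -/
lemma vtuple_jetTerm {n : ℕ} {S : Stage C} (a : Fin n → Vec P.vec S) (x : Pt S P.pt)
    (y : Pt S Q.pt) (h : x.map ≫ star = y.map) :
    (vtuple a x).map ≫ jetTerm F n = (F.J x y h (Finset.univ.val.map a)).map := by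
  have h1 := genHom_pt a x y h
  have h2 := genHom_to a x y h
  have h0 : ((genHom a x y h).pt (genPt P star n)).map ≫ star =
    ((genHom a x y h).pt (genTo P star n)).map := by rw [h1, h2, h]
  have h3 := F.natural (genHom a x y h) (genPt P star n) (genTo P star n) (genPt_to P star n)
    h0 (Finset.univ.val.map (genVec P star n))
  rw [Multiset.map_map, show (genHom a x y h).vec ∘ genVec P star n = a from
    funext fun i => genHom_vec a x y h i] at h3
  have h4 : ∀ (x' : Pt S P.pt) (y' : Pt S Q.pt) (h' : x'.map ≫ star = y'.map), x' = x → y' = y →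
      F.J x' y' h' = F.J x y h := by
    rintro _ _ _ rfl rfl; rfl
  rw [h4 _ _ h0 h1 h2] at h3
  exact congrArg (fun v => v.map) h3

/-- A map of the Faà di Bruno category, from a natural family of symmetric multiadditive functions
on vectors. -/
def FaaHom.ofJets : FaaHom P Q :=
  FaaHom.ofTerms star (fun n _ => jetTerm F n)
    (fun n _ => (F.J (genPt P star n) (genTo P star n) (genPt_to P star n)
      (Finset.univ.val.map (genVec P star n))).rst_map)
    (fun n _ σ => by
      have e : (F.J (genPt P star n) (genTo P star n) (genPt_to P star n)
          (Finset.univ.val.map (genVec P star n))).map =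
            rst (base P.vec.car P.pt n ≫ star) ≫ jetTerm F n := (Vec.dom_map _).symm
      have hσ : Finset.univ.val.map (genVec P star n ∘ σ) =
          Finset.univ.val.map (genVec P star n) := by
        rw [← Multiset.map_map, Multiset.map_univ_val_equiv]
      have h1 := vtuple_jetTerm F (genVec P star n ∘ σ) (genPt P star n)
        (genTo P star n) (genPt_to P star n)
      rw [hσ, ← vtuple_perm, vtuple_gen] at h1
      have hb : tuple (fun i => proj P.vec.car P.pt n (σ i)) (base P.vec.car P.pt n) ≫
          base P.vec.car P.pt n = base P.vec.car P.pt n := by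
        rw [tuple_base, show rst (tuple (fun i => proj P.vec.car P.pt n (σ i))
          (base P.vec.car P.pt n)) = 𝟙 _ from total_tuple (fun i => total_proj n (σ i))
            (total_base n), Category.id_comp]
      have hr : rst (tuple (fun i => proj P.vec.car P.pt n (σ i)) (base P.vec.car P.pt n) ≫
          jetTerm F n) = rst (base P.vec.car P.pt n ≫ star) := by
        rw [← rst_comp_rst, show rst (jetTerm F n) = rst (base P.vec.car P.pt n ≫ star) from
          (F.J (genPt P star n) (genTo P star n) (genPt_to P star n)
            (Finset.univ.val.map (genVec P star n))).rst_map, rst_comp_rst, ← Category.assoc, hb]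
      rw [Category.assoc, ← hr, rst_self'] at h1
      exact h1)
    (fun x y h n c a b => by
      rw [vtuple_jetTerm F _ x y h, vtuple_jetTerm F _ x y h,
        vtuple_jetTerm F _ x y h, univ_map_succ, univ_map_succ, univ_map_succ]
      simp only [Fin.cons_zero, Fin.cons_succ]
      rw [(F.multiAdd x y h).add, Vec.map_add])
    (fun x y h n c => by
      rw [vtuple_jetTerm F _ x y h, univ_map_succ]
      simp only [Fin.cons_zero, Fin.cons_succ]
      rw [(F.multiAdd x y h).zero, Vec.map_zero])

lemma FaaHom.ofJets_term (n : ℕ) (hn : 0 < n) :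
    (FaaHom.ofJets F).term n hn = jetTerm F n := rfl

lemma FaaHom.ofJets_jet {S : Stage C} (x : Pt S P.pt) (y : Pt S Q.pt)
    (h : x.map ≫ star = y.map) {s : Multiset (Vec P.vec S)} (hs : s ≠ 0) :
    (FaaHom.ofJets F).jet x y h s = F.J x y h s := by
  obtain ⟨a, ha⟩ := exists_fin_map s
  rw [← ha, FaaHom.jet_univ _ x y h (Multiset.card_pos.2 hs)]
  exact Vec.ext_map (vtuple_jetTerm F a x y h)

end OfJets

end Jets

/-! ### The Faà di Bruno category -/

section FaaCat

variable {C : Type u} [CartQuiver.{v} C] [CartRestrCat C]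

/-- A total homomorphism of commutative monoids. -/
structure CMonHom (A B : CMon C) where
  map : A.car ⟶ B.car
  total : Total map
  plus_comp {Z : C} (f g : Z ⟶ A.car) : A.plus f g ≫ map = B.plus (f ≫ map) (g ≫ map)
  zero_comp : A.zero ≫ map = B.zero

namespace CMonHom
variable {A B : CMon C}

/-- The identity homomorphism. -/
def id (A : CMon C) : CMonHom A A where
  map := 𝟙 _
  total := total_id _
  plus_comp f g := by simp only [Category.comp_id]
  zero_comp := Category.comp_id _

/-- The homomorphism to the trivial monoid. -/
def bang (A : CMon C) : CMonHom A (CMon.triv C) where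
  map := CartRestrCat.bang _
  total := total_bang _
  plus_comp f g := by
    rw [to_one (A.plus f g ≫ _), to_one ((CMon.triv C).plus _ _),
      rst_comp_total _ (total_bang _), A.rst_plus, CMon.rst_plus, rst_comp_total _ (total_bang _),
      rst_comp_total _ (total_bang _)]
  zero_comp := to_one_unique (total_comp A.zero_total (total_bang _)) (total_id _)

lemma prod_plus {Z : C} (f g : Z ⟶ (A.prod B).car) : (A.prod B).plus f g =
    pair (A.plus (f ≫ CartRestrCat.fst _ _) (g ≫ CartRestrCat.fst _ _))
      (B.plus (f ≫ CartRestrCat.snd _ _) (g ≫ CartRestrCat.snd _ _)) :=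
  CMon.pair_comp_prodAdd A B f g

/-- The first projection. -/
def fst (A B : CMon C) : CMonHom (A.prod B) A where
  map := CartRestrCat.fst _ _
  total := total_fst _ _
  plus_comp f g := by
    rw [prod_plus, pair_fst, B.rst_plus, CMon.rst_comp_snd, CMon.rst_comp_snd, Category.assoc,
      ← A.rst_right_plus, ← A.rst_left_plus, ← Category.assoc, ← Category.assoc, rst_self',
      rst_self']
  zero_comp := by
    change pair A.zero B.zero ≫ _ = _
    rw [pair_fst, show rst B.zero = 𝟙 _ from B.zero_total, Category.id_comp]

/-- The second projection. -/
def snd (A B : CMon C) : CMonHom (A.prod B) B where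
  map := CartRestrCat.snd _ _
  total := total_snd _ _
  plus_comp f g := by
    rw [prod_plus, pair_snd, A.rst_plus, CMon.rst_comp_fst, CMon.rst_comp_fst, Category.assoc,
      ← B.rst_right_plus, ← B.rst_left_plus, ← Category.assoc, ← Category.assoc, rst_self',
      rst_self']
  zero_comp := by
    change pair A.zero B.zero ≫ _ = _
    rw [pair_snd, show rst A.zero = 𝟙 _ from A.zero_total, Category.id_comp]

variable {S T : Stage C}

/-- The additive map on vectors defined by a homomorphism. -/
def vec (φ : CMonHom A B) : Vec A S →+ Vec B S where
  toFun a := ⟨⟨a.map ≫ φ.map, a.toPt.rst_comp_total φ.total⟩⟩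
  map_zero' := Vec.ext_map (by
    change (S.dom ≫ CartRestrCat.bang _ ≫ A.zero) ≫ φ.map = S.dom ≫ CartRestrCat.bang _ ≫ B.zero
    rw [Category.assoc, Category.assoc, φ.zero_comp])
  map_add' a b := Vec.ext_map (φ.plus_comp _ _)

lemma vec_map (φ : CMonHom A B) (a : Vec A S) : (φ.vec a).map = a.map ≫ φ.map := rfl

lemma vec_pull (φ : CMonHom A B) (k : StageHom S T) (a : Vec A T) :
    k.vec (φ.vec a) = φ.vec (k.vec a) :=
  Vec.ext_map (Category.assoc _ _ _).symm

@[simp] lemma id_vec (a : Vec A S) : (id A).vec a = a := Vec.ext_map (Category.comp_id _)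

end CMonHom

namespace Vec
variable {A B : CMon C} {S T : Stage C}

/-- The pair of two vectors. -/
def pair (a : Vec A S) (b : Vec B S) : Vec (A.prod B) S := ⟨a.toPt.pair b.toPt⟩

/-- The first component of a vector. -/
def fst : Vec (A.prod B) S →+ Vec A S := (CMonHom.fst A B).vec

/-- The second component of a vector. -/
def snd : Vec (A.prod B) S →+ Vec B S := (CMonHom.snd A B).vec

@[simp] lemma fst_pair (a : Vec A S) (b : Vec B S) : (a.pair b).fst = a :=
  Vec.ext_map (congrArg Pt.map (Pt.fst_pair a.toPt b.toPt))

@[simp] lemma snd_pair (a : Vec A S) (b : Vec B S) : (a.pair b).snd = b :=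
  Vec.ext_map (congrArg Pt.map (Pt.snd_pair a.toPt b.toPt))

lemma prod_ext {a b : Vec (A.prod B) S} (h1 : a.fst = b.fst) (h2 : a.snd = b.snd) : a = b :=
  Vec.ext_map (congrArg Pt.map (Pt.prod_ext (X := A.car) (Y := B.car)
    (x := a.toPt) (y := b.toPt) (Pt.ext (congrArg (·.map) h1)) (Pt.ext (congrArg (·.map) h2))))

lemma pair_add (a a' : Vec A S) (b b' : Vec B S) :
    pair (a + a') (b + b') = pair a b + pair a' b' := prod_ext (by simp) (by simp)

lemma pair_zero : pair (0 : Vec A S) (0 : Vec B S) = 0 := prod_ext (by simp) (by simp)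

lemma vec_fst (k : StageHom S T) (a : Vec (A.prod B) T) : k.vec (fst a) = fst (k.vec a) :=
  CMonHom.vec_pull _ k a

lemma vec_snd (k : StageHom S T) (a : Vec (A.prod B) T) : k.vec (snd a) = snd (k.vec a) :=
  CMonHom.vec_pull _ k a

lemma vec_pair (k : StageHom S T) (a : Vec A T) (b : Vec B T) :
    k.vec (pair a b) = pair (k.vec a) (k.vec b) :=
  prod_ext (by simp [← vec_fst]) (by simp [← vec_snd])

instance : Subsingleton (Vec (CMon.triv C) S) :=
  ⟨fun a b => Vec.ext_map (by rw [to_one a.map, to_one b.map, a.rst_map, b.rst_map])⟩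

end Vec

section Points

variable {S T : Stage C} {X Y Z : C}

lemma Pt.comp_rst_eq (x : Pt S X) {f : X ⟶ Y} (h : rst (x.map ≫ f) = S.dom) :
    x.map ≫ rst f = x.map := by
  rw [comp_rst', h, x.dom_map]

lemma Pt.rst_comp_of_eq (x : Pt S X) {f : X ⟶ Y} {g : Y ⟶ Z} (z : Pt S Z)
    (h : x.map ≫ f ≫ g = z.map) : rst (x.map ≫ f) = S.dom :=
  x.rst_of_comp f g (by rw [h, z.rst_map])

lemma Pt.to_comp (x : Pt S X) {f : X ⟶ Y} {g : Y ⟶ Z} (z : Pt S Z)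
    (h : x.map ≫ f ≫ g = z.map) : (x.to f (x.rst_comp_of_eq z h)).map ≫ g = z.map :=
  (Category.assoc _ _ _).trans h

/-- If `rst f ≫ g` is defined at a point, then so is `f`, and `g` takes the same value. -/
lemma Pt.of_rst_comp (x : Pt S X) {f : X ⟶ Y} {g : X ⟶ Z} {z : Pt S Z}
    (h : x.map ≫ rst f ≫ g = z.map) : x.map ≫ rst f = x.map ∧ x.map ≫ g = z.map := by
  have h1 := x.rst_comp_of_eq z h
  rw [rst_comp_rst] at h1
  have h2 := x.comp_rst_eq h1
  refine ⟨h2, ?_⟩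
  rw [← h, ← Category.assoc, h2]

lemma Pt.of_comp_rst (x : Pt S X) {f : X ⟶ Y} {g : Y ⟶ Z} {y : Pt S Y}
    (h : x.map ≫ f ≫ rst g = y.map) : x.map ≫ f = y.map ∧ y.map ≫ rst g = y.map := by
  have h0 := h
  rw [comp_rst'] at h
  have h2 := (x.of_rst_comp h).2
  refine ⟨h2, ?_⟩
  rw [← Category.assoc, h2] at h0
  exact h0

lemma Pt.of_pair (x : Pt S X) {f : X ⟶ Y} {g : X ⟶ Z} {w : Pt S (CartQuiver.prod Y Z)}
    (h : x.map ≫ CartRestrCat.pair f g = w.map) :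
    x.map ≫ f = w.fst.map ∧ x.map ≫ g = w.snd.map := by
  have hf : w.fst.map = x.map ≫ rst g ≫ f := by
    change w.map ≫ _ = _
    rw [← h, Category.assoc, pair_fst]
  have hg : w.snd.map = x.map ≫ rst f ≫ g := by
    change w.map ≫ _ = _
    rw [← h, Category.assoc, pair_snd]
  exact ⟨(x.of_rst_comp hf.symm).2, (x.of_rst_comp hg.symm).2⟩

end Points

variable {P Q R : FaaObj C}

namespace FaaHom

lemma jet_congr {f g : FaaHom P Q} (e : f = g) {S : Stage C} (x : Pt S P.pt) (y : Pt S Q.pt)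
    (h : x.map ≫ f.star = y.map) (h' : x.map ≫ g.star = y.map) (s : Multiset (Vec P.vec S)) :
    f.jet x y h s = g.jet x y h' s := by
  subst e; rfl

lemma jet_congr_pt (f : FaaHom P Q) {S : Stage C} {x x' : Pt S P.pt} {y y' : Pt S Q.pt}
    (h : x.map ≫ f.star = y.map) (h' : x'.map ≫ f.star = y'.map) (hx : x = x') (hy : y = y')
    (s : Multiset (Vec P.vec S)) : f.jet x y h s = f.jet x' y' h' s := by
  subst hx hy; rfl

/-- The map `(f, π₀ h, 0, 0, …)`, restricted to the domain of `f`. -/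
def linear (f : P.pt ⟶ Q.pt) (φ : CMonHom P.vec Q.vec) : FaaHom P Q :=
  FaaHom.ofJets (star := f)
    { J := fun _ _ _ => linJ φ.vec
      multiAdd := fun _ _ _ => MultiAdd.linJ _
      natural := fun k x y h h' s => by
        unfold linJ
        rw [Multiset.card_map]
        split_ifs
        · rw [map_multiset_sum, Multiset.map_map, Multiset.map_map]
          exact congrArg _ (Multiset.map_congr rfl fun a _ => φ.vec_pull k a)
        · exact map_zero _ }

@[simp] lemma linear_jet (f : P.pt ⟶ Q.pt) (φ : CMonHom P.vec Q.vec) {S : Stage C}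
    (x : Pt S P.pt) (y : Pt S Q.pt) (h : x.map ≫ (linear f φ).star = y.map)
    (s : Multiset (Vec P.vec S)) : (linear f φ).jet x y h s = linJ φ.vec s := by
  by_cases hs : s = 0
  · simp [hs]
  · exact ofJets_jet _ x y h hs

lemma linear_term (f : P.pt ⟶ Q.pt) (φ : CMonHom P.vec Q.vec) (n : ℕ) (hn : 0 < n) :
    (linear f φ).term n hn =
      rst (base P.vec.car P.pt n ≫ f) ≫ linTerm P.pt Q.vec φ.map n hn := by
  refine (ofJets_term _ n hn).trans ?_
  unfold jetTerm linTerm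
  change (linJ φ.vec _).map = _
  by_cases h1 : n = 1
  · subst h1
    rw [if_pos rfl]
    have : (Finset.univ : Finset (Fin 1)).val.map (genVec P f 1) = {genVec P f 1 0} := rfl
    rw [this, linJ_singleton, CMonHom.vec_map, genVec_map, Category.assoc]
    rfl
  · rw [if_neg h1]
    unfold linJ
    rw [if_neg (by simpa using h1), Vec.map_zero]

/-- Faà di Bruno composition. -/
def comp (f : FaaHom P Q) (g : FaaHom Q R) : FaaHom P R :=
  FaaHom.ofJets (star := f.star ≫ g.star)
    { J := fun {S} x z h => compJ
        (f.jet x (x.to f.star (x.rst_comp_of_eq z h)) rfl)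
        (g.jet (x.to f.star (x.rst_comp_of_eq z h)) z (x.to_comp z h))
      multiAdd := fun x z h => (f.jet_multiAdd _ _ _).compJ (g.jet_multiAdd _ _ _)
      natural := fun {S T} k x z h h' s => by
        unfold compJ
        rw [map_partSum, partSum_map]
        congr 1
        funext π
        have e : k.pt (x.to f.star (x.rst_comp_of_eq z h)) =
            (k.pt x).to f.star ((k.pt x).rst_comp_of_eq (k.pt z) h') :=
          Pt.ext (Category.assoc _ _ _).symm
        rw [g.vec_jet, Multiset.map_map, Multiset.map_map]
        have e2 : k.vec ∘ f.jet x (x.to f.star (x.rst_comp_of_eq z h)) rfl =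
            f.jet (k.pt x) ((k.pt x).to f.star ((k.pt x).rst_comp_of_eq (k.pt z) h')) rfl ∘
              Multiset.map k.vec := by
          funext b
          exact (f.vec_jet _ _ _ k b).trans (f.jet_congr_pt _ _ rfl e _)
        rw [e2]
        exact g.jet_congr_pt _ _ e rfl _ }

lemma comp_jet (f : FaaHom P Q) (g : FaaHom Q R) {S : Stage C} (x : Pt S P.pt) (y : Pt S Q.pt)
    (z : Pt S R.pt) (h : x.map ≫ (comp f g).star = z.map) (hf : x.map ≫ f.star = y.map)
    (hg : y.map ≫ g.star = z.map) (s : Multiset (Vec P.vec S)) :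
    (comp f g).jet x z h s = compJ (f.jet x y hf) (g.jet y z hg) s := by
  by_cases hs : s = 0
  · simp [hs]
  · refine (ofJets_jet _ x z h hs).trans ?_
    have e : x.to f.star (x.rst_comp_of_eq z h) = y := Pt.ext hf
    subst e
    rfl

/-- The summands of a composite all have the domain of its base map. -/
lemma rst_tuple_comp_le {W : C} {n k : ℕ} (f : FaaHom P Q) {g : Q.pt ⟶ W}
    {t : vars Q.vec.car Q.pt k ⟶ R.vec.car} (ht : rst t = rst (base Q.vec.car Q.pt k ≫ g))
    (a : Fin k → (vars P.vec.car P.pt n ⟶ Q.vec.car))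
    (ha : ∀ i, rst (a i) = rst (base P.vec.car P.pt n ≫ f.star)) :
    rst (tuple a (base P.vec.car P.pt n ≫ f.star) ≫ t) =
      rst (base P.vec.car P.pt n ≫ f.star ≫ g) := by
  have h1 : rst (tuple a (base P.vec.car P.pt n ≫ f.star) ≫ t) =
      rst (tuple a (base P.vec.car P.pt n ≫ f.star)) ≫
        rst (base P.vec.car P.pt n ≫ f.star ≫ g) := by
    rw [← rst_comp_rst, ht, rst_comp_rst, ← Category.assoc, tuple_base, Category.assoc,
      rst_rst_comp', Category.assoc]
  have h2 : rst (base P.vec.car P.pt n ≫ f.star ≫ g) ≫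
      rst (base P.vec.car P.pt n ≫ f.star) = rst (base P.vec.car P.pt n ≫ f.star ≫ g) := by
    have := rst_comp_absorb (base P.vec.car P.pt n ≫ f.star) g
    rwa [rst_comm', Category.assoc] at this
  rw [h1, rst_comm']
  exact le_rst_tuple _ _ _ (fun i => by rw [ha, h2]) h2

lemma comp_term (f : FaaHom P Q) (g : FaaHom Q R) (n : ℕ) (hn : 0 < n) :
    (comp f g).term n hn = compTerm f g n hn := by
  have : Nonempty (OrderedFinpartition n) := ⟨default⟩
  set X := genPt P (f.star ≫ g.star) n with hX
  set Z := genTo P (f.star ≫ g.star) n with hZ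
  have hXZ : X.map ≫ f.star ≫ g.star = Z.map := genPt_to P (f.star ≫ g.star) n
  set Y := X.to f.star (X.rst_comp_of_eq Z hXZ) with hY
  have hXY : X.map ≫ f.star = Y.map := rfl
  have hYZ : Y.map ≫ g.star = Z.map := (Category.assoc _ _ _).trans hXZ
  have h1 : (comp f g).term n hn = ((comp f g).jet X Z hXZ
      (Finset.univ.val.map (genVec P (f.star ≫ g.star) n))).map := by
    rw [jet_univ _ X Z hXZ hn]
    exact term_eq_eval _ n hn
  rw [h1, comp_jet f g X Y Z hXZ hXY hYZ, compJ, ← sum_orderedFinpartition, Vec.map_sum]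
  unfold compTerm
  congr 1
  funext c
  unfold blocks
  rw [Multiset.map_map]
  have h2 : (f.jet X Y hXY ∘ fun m => Finset.univ.val.map fun j =>
      genVec P (f.star ≫ g.star) n (c.emb m j)) = fun m =>
        f.eval X Y hXY (c.partSize_pos m) fun j => genVec P (f.star ≫ g.star) n (c.emb m j) := by
    funext m
    exact f.jet_univ X Y hXY (c.partSize_pos m) _
  rw [h2, g.jet_univ _ _ _ (c.length_pos hn), eval_map, vtuple_map]
  set e : vars P.vec.car P.pt n ⟶ vars P.vec.car P.pt n :=
    rst (base P.vec.car P.pt n ≫ f.star ≫ g.star) with he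
  have h3 (m : Fin c.length) : (f.eval X Y hXY (c.partSize_pos m) fun j =>
      genVec P (f.star ≫ g.star) n (c.emb m j)).map = e ≫
        tuple (fun j => proj P.vec.car P.pt n (c.emb m j)) (base P.vec.car P.pt n) ≫
          f.term (c.partSize m) (c.partSize_pos m) := by
    rw [eval_map, ← Category.assoc, comp_tuple]
    rfl
  simp only [h3]
  have h4 : Y.map = e ≫ base P.vec.car P.pt n ≫ f.star := by
    rw [← hXY, hX, genPt_map, Category.assoc]
  rw [h4, ← comp_tuple, Category.assoc, he, ← rst_tuple_comp_le f (g.rst_term _ _) _ ?_, rst_self']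
  intro m
  rw [← rst_comp_rst, f.rst_term, rst_comp_rst, ← Category.assoc, tuple_base]
  have : rst (tuple (fun j => proj P.vec.car P.pt n (c.emb m j)) (base P.vec.car P.pt n)) = 𝟙 _ :=
    total_tuple (fun _ => total_proj _ _) (total_base _)
  rw [this, Category.id_comp]

/-- The pairing of two maps of the Faà di Bruno category. -/
def pair (f : FaaHom R P) (g : FaaHom R Q) : FaaHom R (prod P Q) :=
  FaaHom.ofJets (Q := prod P Q) (star := CartRestrCat.pair f.star g.star)
    { J := fun x y h s => Vec.pair
        (f.jet x y.fst (x.of_pair h).1 s) (g.jet x y.snd (x.of_pair h).2 s)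
      multiAdd := fun x y h =>
        ⟨fun a b s => by
          rw [(f.jet_multiAdd _ _ _).add, (g.jet_multiAdd _ _ _).add, Vec.pair_add],
        fun s => by
          rw [(f.jet_multiAdd _ _ _).zero, (g.jet_multiAdd _ _ _).zero]; exact Vec.pair_zero⟩
      natural := fun k x y h h' s => by
        refine (Vec.vec_pair k _ _).trans ?_
        rw [f.vec_jet, g.vec_jet]
        congr 1 }

@[simp] lemma pair_star (f : FaaHom R P) (g : FaaHom R Q) :
    (pair f g).star = CartRestrCat.pair f.star g.star := rfl

lemma pair_jet (f : FaaHom R P) (g : FaaHom R Q) {S : Stage C} (x : Pt S R.pt)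
    (y : Pt S (prod P Q).pt) (h : x.map ≫ (pair f g).star = y.map) (s : Multiset (Vec R.vec S)) :
    (pair f g).jet x y h s = Vec.pair
      (f.jet x (Pt.fst (X := P.pt) (Y := Q.pt) y) (x.of_pair h).1 s)
      (g.jet x (Pt.snd (X := P.pt) (Y := Q.pt) y) (x.of_pair h).2 s) := by
  by_cases hs : s = 0
  · subst hs
    simp only [jet_zero]
    exact Vec.pair_zero.symm
  · exact ofJets_jet _ x y h hs

lemma pair_term (f : FaaHom R P) (g : FaaHom R Q) (n : ℕ) (hn : 0 < n) :
    (pair f g).term n hn = CartRestrCat.pair (f.term n hn) (g.term n hn) := by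
  have h := (genPt R (pair f g).star n).of_pair (genPt_to R (pair f g).star n)
  have h1 : (pair f g).term n hn = ((pair f g).jet _ _ (genPt_to R (pair f g).star n)
      (Finset.univ.val.map (genVec R (pair f g).star n))).map := by
    refine (term_eq_eval _ n hn).trans (congrArg (fun a => Pt.map (Vec.toPt a)) ?_)
    exact ((pair f g).jet_univ _ _ _ hn _).symm
  rw [h1, pair_jet]
  change CartRestrCat.pair (Pt.map _) (Pt.map _) = _
  rw [f.jet_univ _ _ _ hn, g.jet_univ _ _ _ hn, eval_map, eval_map, vtuple_gen, pair_star,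
    comp_pair, rst_pair', ← f.rst_term n hn, ← g.rst_term n hn]
  rw [Category.assoc, Category.assoc, rst_self',
    pair_rst_left, pair_rst_left, pair_rst_right, rst_left_comm (g.term n hn), rst_idem,
    ← Category.assoc, ← rst_pair', rst_self']

end FaaHom

end FaaCat

section FaaStr

variable {C : Type u} [CartQuiver.{v} C] [CartRestrCat C]

/-- Composition of homomorphisms. -/
def CMonHom.comp {A B D : CMon C} (φ : CMonHom A B) (ψ : CMonHom B D) : CMonHom A D where
  map := φ.map ≫ ψ.map
  total := total_comp φ.total ψ.total
  plus_comp f g := by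
    rw [← Category.assoc, φ.plus_comp, ψ.plus_comp, Category.assoc, Category.assoc]
  zero_comp := by rw [← Category.assoc, φ.zero_comp, ψ.zero_comp]

/-- An element which is sent to a total one by a composite is sent to a total one halfway. -/
lemma Pt.exists_mid {S : Stage C} {X Y Z : C} (x : Pt S X) {f : X ⟶ Y} {g : Y ⟶ Z} {z : Pt S Z}
    (h : x.map ≫ f ≫ g = z.map) : ∃ y : Pt S Y, x.map ≫ f = y.map ∧ y.map ≫ g = z.map :=
  ⟨_, rfl, x.to_comp z h⟩

namespace FaaHom

variable {P Q R : FaaObj C}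

lemma linear_jet_eq (f : P.pt ⟶ Q.pt) (φ : CMonHom P.vec Q.vec) {S : Stage C}
    (x : Pt S P.pt) (y : Pt S Q.pt) (h : x.map ≫ f = y.map) :
    (linear f φ).jet x y h = linJ φ.vec := funext (linear_jet f φ x y h)

lemma linear_congr {f g : P.pt ⟶ Q.pt} {φ ψ : CMonHom P.vec Q.vec} (h : f = g)
    (h' : φ.map = ψ.map) : linear f φ = linear g ψ := by
  obtain ⟨m, _⟩ := φ
  obtain ⟨m', _⟩ := ψ
  change m = m' at h'
  subst h h'
  rfl

lemma linear_comp_jet (f : P.pt ⟶ Q.pt) (φ : CMonHom P.vec Q.vec) (g : FaaHom Q R) {S : Stage C}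
    (x : Pt S P.pt) (y : Pt S Q.pt) (z : Pt S R.pt)
    (h : x.map ≫ (comp (linear f φ) g).star = z.map) (hf : x.map ≫ f = y.map)
    (hg : y.map ≫ g.star = z.map) (s : Multiset (Vec P.vec S)) :
    (comp (linear f φ) g).jet x z h s = g.jet y z hg (s.map φ.vec) := by
  rw [comp_jet _ _ x y z h hf hg, linear_jet_eq]
  exact linJ_compJ _ (g.jet_multiAdd _ _ _) s

lemma comp_linear_jet (f : FaaHom P Q) (g : Q.pt ⟶ R.pt) (φ : CMonHom Q.vec R.vec) {S : Stage C}
    (x : Pt S P.pt) (y : Pt S Q.pt) (z : Pt S R.pt)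
    (h : x.map ≫ (comp f (linear g φ)).star = z.map) (hf : x.map ≫ f.star = y.map)
    (hg : y.map ≫ g = z.map) (s : Multiset (Vec P.vec S)) :
    (comp f (linear g φ)).jet x z h s = φ.vec (f.jet x y hf s) := by
  by_cases hs : s = 0
  · simp [hs]
  · rw [comp_jet _ _ x y z h hf hg, linear_jet_eq]
    exact compJ_linJ _ _ hs

lemma linear_id_comp_jet (f : P.pt ⟶ P.pt) (g : FaaHom P R) {S : Stage C}
    (x : Pt S P.pt) (z : Pt S R.pt)
    (h : x.map ≫ (comp (linear f (CMonHom.id P.vec)) g).star = z.map) (hf : x.map ≫ f = x.map)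
    (hg : x.map ≫ g.star = z.map) (s : Multiset (Vec P.vec S)) :
    (comp (linear f (CMonHom.id P.vec)) g).jet x z h s = g.jet x z hg s := by
  rw [linear_comp_jet _ _ _ x x z h hf hg]
  simp

lemma linear_comp (f : P.pt ⟶ Q.pt) (φ : CMonHom P.vec Q.vec) (g : Q.pt ⟶ R.pt)
    (ψ : CMonHom Q.vec R.vec) :
    comp (linear f φ) (linear g ψ) = linear (f ≫ g) (φ.comp ψ) := by
  refine ext_jet rfl fun x z h h' s hs => ?_
  obtain ⟨y, h1, h2⟩ := x.exists_mid (f := f) (g := g) (z := z) h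
  refine (comp_linear_jet _ _ _ x y z h h1 h2 s).trans ?_
  rw [linear_jet_eq]
  refine Eq.trans ?_ (linear_jet _ _ x z h' s).symm
  unfold linJ
  split_ifs
  · rw [map_multiset_sum, Multiset.map_map]
    exact congrArg _ (Multiset.map_congr rfl fun a _ => Vec.ext_map (Category.assoc _ _ _))
  · exact map_zero _

variable (P Q) in
/-- The map `(f, π₀, 0, …)`, restricted to the domain of `f`: the identity if `f` is, and the
restriction idempotent of a map with base map `g` if `f = rst g`. -/
def dom (f : P.pt ⟶ P.pt) : FaaHom P P := linear f (CMonHom.id P.vec)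

lemma dom_comp (f g : P.pt ⟶ P.pt) : comp (dom P f) (dom P g) = dom P (f ≫ g) :=
  (linear_comp _ _ _ _).trans (linear_congr rfl (Category.comp_id _))

variable (P Q) in
/-- The first projection. -/
def fst : FaaHom (prod P Q) P := linear (CartRestrCat.fst P.pt Q.pt) (CMonHom.fst P.vec Q.vec)

variable (P Q) in
/-- The second projection. -/
def snd : FaaHom (prod P Q) Q := linear (CartRestrCat.snd P.pt Q.pt) (CMonHom.snd P.vec Q.vec)

lemma comp_fst_jet (k : FaaHom R (prod P Q)) {S : Stage C} (x : Pt S R.pt)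
    (y : Pt S (CartQuiver.prod P.pt Q.pt)) (z : Pt S P.pt)
    (h : x.map ≫ k.star ≫ CartRestrCat.fst P.pt Q.pt = z.map)
    (hk : x.map ≫ k.star = y.map) (s : Multiset (Vec R.vec S)) :
    (comp k (fst P Q)).jet x z h s = Vec.fst (k.jet x y hk s) := by
  refine comp_linear_jet k _ _ x y z h hk ?_ s
  have h' := h
  rw [← Category.assoc] at h'
  rw [← hk]
  exact h'

lemma comp_snd_jet (k : FaaHom R (prod P Q)) {S : Stage C} (x : Pt S R.pt)
    (y : Pt S (CartQuiver.prod P.pt Q.pt)) (z : Pt S Q.pt)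
    (h : x.map ≫ k.star ≫ CartRestrCat.snd P.pt Q.pt = z.map)
    (hk : x.map ≫ k.star = y.map) (s : Multiset (Vec R.vec S)) :
    (comp k (snd P Q)).jet x z h s = Vec.snd (k.jet x y hk s) := by
  refine comp_linear_jet k _ _ x y z h hk ?_ s
  have h' := h
  rw [← Category.assoc] at h'
  rw [← hk]
  exact h'

end FaaHom

open FaaHom in
/-- The Faà di Bruno category is a Cartesian restriction category. -/
instance faaCat : CartRestrCat (FaaObj C) where
  idm P := dom P (𝟙 _)
  comp := FaaHom.comp
  rst {P Q} f := dom P (CartRestrCat.rst (FaaHom.star f))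
  bang P := linear (Q := one) (bang P.pt) (CMonHom.bang P.vec)
  fst := FaaHom.fst
  snd := FaaHom.snd
  pair := FaaHom.pair
  idm_comp {P Q} f := by
    refine ext_jet (Category.id_comp _) fun x y h h' s _ => ?_
    exact linear_id_comp_jet _ f x y h (Category.comp_id _) h' s
  comp_idm {P Q} f := by
    refine ext_jet (Category.comp_id _) fun x y h h' s _ => ?_
    exact (comp_linear_jet f _ _ x y y h h' (Category.comp_id _) s).trans (CMonHom.id_vec _)
  comp_assoc {P Q R R'} f g k := by
    refine ext_jet (Category.assoc _ _ _) fun {S} x z h h' s _ => ?_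
    obtain ⟨y, h1, h2⟩ := x.exists_mid h'
    obtain ⟨w, h3, h4⟩ := y.exists_mid h2
    have h5 : x.map ≫ FaaHom.star f ≫ FaaHom.star g = w.map := by
      rw [← Category.assoc, h1, h3]
    rw [FaaHom.comp_jet _ _ x w z h h5 h4, FaaHom.comp_jet _ _ x y z h' h1 h2]
    have e1 : (FaaHom.comp f g).jet x w h5 =
        compJ (FaaHom.jet f x y h1) (FaaHom.jet g y w h3) :=
      funext (FaaHom.comp_jet f g x y w h5 h1 h3)
    have e2 : (FaaHom.comp g k).jet y z h2 =
        compJ (FaaHom.jet g y w h3) (FaaHom.jet k w z h4) :=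
      funext (FaaHom.comp_jet g k y w z h2 h3 h4)
    rw [e1, e2]
    exact compJ_assoc (jet_multiAdd _ _ _ _) (jet_multiAdd _ _ _ _) (jet_multiAdd _ _ _ _) s
  rst_self {P Q} f := by
    refine ext_jet (rst_self' _) fun x y h h' s _ => ?_
    exact linear_id_comp_jet _ f x y h (x.of_rst_comp h).1 h' s
  rst_comm {P Q R} f g :=
    (dom_comp _ _).trans ((congrArg (dom P) (rst_comm' _ _)).trans (dom_comp _ _).symm)
  rst_rst_comp {P Q R} f g :=
    (congrArg (dom P) (rst_rst_comp' _ _)).trans (dom_comp _ _).symm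
  comp_rst {P Q R} f g := by
    refine ext_jet (comp_rst' _ _) fun x y h h' s _ => ?_
    have h1 := x.of_comp_rst h
    refine (comp_linear_jet f _ _ x y y h h1.1 h1.2 s).trans ((CMonHom.id_vec _).trans ?_)
    exact (linear_id_comp_jet _ f x y h' (x.of_rst_comp h').1 h1.1 s).symm
  rst_bang P := congrArg (dom P) (total_bang _)
  bang_unique {P} f := ext_jet (to_one _) fun x y h h' s _ => Subsingleton.elim (α := Vec
      (CMon.triv C) _) _ _
  rst_fst P Q := congrArg (dom (prod P Q)) (total_fst _ _)
  rst_snd P Q := congrArg (dom (prod P Q)) (total_snd _ _)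
  pair_comp_fst_le {R P Q} f g := by
    refine ext_jet (CartRestrCat.pair_comp_fst_le _ _) fun x z h h' s _ => ?_
    have h1 := x.of_rst_comp h
    obtain ⟨y, h2, h3⟩ := x.exists_mid h'
    have e : y.fst = z := Pt.ext h3
    subst e
    refine (linear_id_comp_jet _ f x _ h h1.1 h1.2 s).trans ?_
    refine Eq.symm ((comp_fst_jet _ x y _ h' h2 s).trans ?_)
    exact (congrArg Vec.fst (pair_jet f g x y h2 s)).trans (Vec.fst_pair _ _)
  pair_comp_snd_le {R P Q} f g := by
    refine ext_jet (CartRestrCat.pair_comp_snd_le _ _) fun x z h h' s _ => ?_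
    have h1 := x.of_rst_comp h
    obtain ⟨y, h2, h3⟩ := x.exists_mid h'
    have e : y.snd = z := Pt.ext h3
    subst e
    refine (linear_id_comp_jet _ g x _ h h1.1 h1.2 s).trans ?_
    refine Eq.symm ((comp_snd_jet _ x y _ h' h2 s).trans ?_)
    exact (congrArg Vec.snd (pair_jet f g x y h2 s)).trans (Vec.snd_pair _ _)
  rst_pair {R P Q} f g := (congrArg (dom R) (rst_pair' _ _)).trans (dom_comp _ _).symm
  pair_unique {R P Q} f g k hf hg hk := by
    refine ext_jet (CartRestrCat.pair_unique _ _ _ (congrArg FaaHom.star hf)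
      (congrArg FaaHom.star hg) (congrArg FaaHom.star hk)) fun {S} x y h h' s _ => ?_
    have h1 := x.of_pair h'
    have h2 : x.map ≫ CartRestrCat.rst (FaaHom.star k) = x.map :=
      x.comp_rst_eq (by rw [h]; exact y.rst_map)
    refine Eq.trans ?_ (pair_jet f g x y h' s).symm
    refine Vec.prod_ext (A := P.vec) (B := Q.vec) ?_ ?_
    · refine Eq.trans ?_ (Vec.fst_pair _ _).symm
      have hx : x.map ≫ FaaHom.star k ≫ CartRestrCat.fst P.pt Q.pt =
        (Pt.fst (X := P.pt) (Y := Q.pt) y).map :=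
        (Category.assoc _ _ _).symm.trans (congrArg (· ≫ CartRestrCat.fst P.pt Q.pt) h)
      refine (comp_fst_jet k x y y.fst hx h s).symm.trans ?_
      refine (FaaHom.jet_congr hf x _ ?_ hx s).symm.trans ?_
      · rw [hf]; exact hx
      · refine linear_id_comp_jet _ f x _ _ ?_ h1.1 s
        exact x.comp_rst_eq ((congrArg rst hx).trans (Pt.rst_map _))
    · refine Eq.trans ?_ (Vec.snd_pair _ _).symm
      have hx : x.map ≫ FaaHom.star k ≫ CartRestrCat.snd P.pt Q.pt =
        (Pt.snd (X := P.pt) (Y := Q.pt) y).map :=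
        (Category.assoc _ _ _).symm.trans (congrArg (· ≫ CartRestrCat.snd P.pt Q.pt) h)
      refine (comp_snd_jet k x y y.snd hx h s).symm.trans ?_
      refine (FaaHom.jet_congr hg x _ ?_ hx s).symm.trans ?_
      · rw [hg]; exact hx
      · refine linear_id_comp_jet _ g x _ _ ?_ h1.2 s
        exact x.comp_rst_eq ((congrArg rst hx).trans (Pt.rst_map _))

end FaaStr

section IsFaa

variable {C : Type u} [CartQuiver.{v} C] [CartRestrCat C] {P Q R : FaaObj C}

lemma FaaHom.linear_term_of_total {f : P.pt ⟶ Q.pt} (hf : Total f) (φ : CMonHom P.vec Q.vec)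
    (n : ℕ) (hn : 0 < n) : (linear f φ).term n hn = linTerm P.pt Q.vec φ.map n hn := by
  rw [linear_term, show rst (base P.vec.car P.pt n ≫ f) = 𝟙 _ from
    total_comp (total_base _) hf, Category.id_comp]

variable (C) in
lemma isFaa : IsFaa C where
  id_star P := rfl
  id_term P n hn := FaaHom.linear_term_of_total (total_id _) _ n hn
  comp_star f g := rfl
  comp_term f g n hn := FaaHom.comp_term f g n hn
  rst_star f := rfl
  rst_term f n hn := by
    refine (FaaHom.linear_term _ _ n hn).trans ?_
    rw [rst_comp_rst]
    rfl
  bang_star P := rfl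
  bang_term P n hn := to_one_unique
    ((FaaHom.rst_term (bang P) n hn).trans (total_comp (total_base _) (total_bang _)))
    (total_bang _)
  fst_star P Q := rfl
  fst_term P Q n hn := FaaHom.linear_term_of_total (P := prod P Q) (total_fst _ _) _ n hn
  snd_star P Q := rfl
  snd_term P Q n hn := FaaHom.linear_term_of_total (P := prod P Q) (total_snd _ _) _ n hn
  pair_star f g := rfl
  pair_term f g n hn := FaaHom.pair_term f g n hn

/-- Maps are equal if they have the same values at all points. -/
lemma map_ext_pt {X Y : C} {a b : X ⟶ Y}
    (h : ∀ {S : Stage C} (x : Pt S X) (y : Pt S Y), x.map ≫ a = y.map ↔ x.map ≫ b = y.map) :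
    a = b := by
  have h1 := (h (S := ⟨X, rst a, rst_rst a⟩) ⟨rst a, rst_rst a⟩ ⟨a, rfl⟩).1 (rst_self' a)
  have h2 := (h (S := ⟨X, rst b, rst_rst b⟩) ⟨rst b, rst_rst b⟩ ⟨b, rfl⟩).2 (rst_self' b)
  exact rst_antisymm h1.symm h2

/-- Maps of the Faà di Bruno category are equal if they have the same values and jets at all
points. -/
lemma FaaHom.ext_pt {f g : FaaHom P Q}
    (hs : ∀ {S : Stage C} (x : Pt S P.pt) (y : Pt S Q.pt),
      x.map ≫ f.star = y.map ↔ x.map ≫ g.star = y.map)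
    (hj : ∀ {S : Stage C} (x : Pt S P.pt) (y : Pt S Q.pt) (h : x.map ≫ f.star = y.map)
      (h' : x.map ≫ g.star = y.map) (s : Multiset (Vec P.vec S)), s ≠ 0 →
      f.jet x y h s = g.jet x y h' s) : f = g :=
  FaaHom.ext_jet (map_ext_pt hs) hj

/-! ### Linear maps and tangent monoids -/

/-- Addition, as a homomorphism. -/
def CMonHom.add (A : CMon C) : CMonHom (A.prod A) A where
  map := A.add
  total := A.add_total
  plus_comp f g := by
    have h {W : C} (f : W ⟶ (A.prod A).car) : f ≫ A.add =
        A.plus (f ≫ CartRestrCat.fst A.car A.car) (f ≫ CartRestrCat.snd A.car A.car) := by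
      rw [← A.comp_plus]
      unfold CMon.plus
      rw [← pair_unique' (f := CartRestrCat.fst A.car A.car) (g := CartRestrCat.snd A.car A.car)
        (k := 𝟙 (prod A.car A.car)), Category.id_comp]
      · rw [total_snd]
      · rw [total_fst]
      · rw [total_fst, total_snd, Category.comp_id]; exact total_id _
    have h1 : (A.prod A).plus f g ≫ CartRestrCat.fst A.car A.car = _ := (fst A A).plus_comp f g
    have h2 : (A.prod A).plus f g ≫ CartRestrCat.snd A.car A.car = _ := (snd A A).plus_comp f g
    rw [h, h f, h g, h1, h2]
    rw [A.plus_assoc, A.plus_assoc, ← A.plus_assoc (g ≫ _), A.plus_comm (g ≫ _) (f ≫ _),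
      A.plus_assoc]
    rfl
  zero_comp := by
    have h := A.zero_plus A.zero
    have e : A.zeroMap one = A.zero := by
      unfold CMon.zeroMap
      rw [to_one_unique (total_bang (one : C)) (total_id _), Category.id_comp]
    rwa [e] at h

/-- Zero, as a homomorphism from the trivial monoid. -/
def CMonHom.zero (A : CMon C) : CMonHom (CMon.triv C) A where
  map := A.zero
  total := A.zero_total
  plus_comp f g := by
    have h {W : C} (f : W ⟶ (CMon.triv C).car) : f ≫ A.zero = rst f ≫ A.zeroMap _ := by
      conv_lhs => rw [to_one f]
      exact Category.assoc _ _ _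
    rw [h, h f, h g, CMon.rst_plus, A.rst_left_plus, A.rst_right_plus, A.zero_plus, Category.assoc]
  zero_comp := Category.id_comp _

/-- The pairing of homomorphisms. -/
def CMonHom.pair {A B D : CMon C} (φ : CMonHom A B) (ψ : CMonHom A D) :
    CMonHom A (B.prod D) where
  map := CartRestrCat.pair φ.map ψ.map
  total := total_pair φ.total ψ.total
  plus_comp f g := by
    rw [CMonHom.prod_plus, comp_pair, φ.plus_comp, ψ.plus_comp, Category.assoc, Category.assoc,
      Category.assoc, Category.assoc, pair_fst, pair_snd, φ.total, ψ.total, Category.id_comp,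
      Category.id_comp]
  zero_comp := by
    rw [comp_pair, φ.zero_comp, ψ.zero_comp]

namespace FaaHom

lemma pair_linear (f : R.pt ⟶ P.pt) (φ : CMonHom R.vec P.vec) (g : R.pt ⟶ Q.pt)
    (ψ : CMonHom R.vec Q.vec) : pair (linear f φ) (linear g ψ) =
      linear (Q := prod P Q) (CartRestrCat.pair f g) (φ.pair ψ) := by
  refine ext_jet rfl fun {S} x y h h' s _ => ?_
  refine (pair_jet _ _ x y h s).trans (Eq.trans ?_ (linear_jet (Q := prod P Q) _ _ x y h' s).symm)
  rw [linear_jet, linear_jet]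
  unfold linJ
  have e1 : ∀ a : Vec R.vec S, (φ.pair ψ).vec a = Vec.pair (φ.vec a) (ψ.vec a) :=
    fun a => Vec.ext_map (comp_pair _ _ _)
  split_ifs
  · rw [← map_multiset_sum, ← map_multiset_sum, ← map_multiset_sum, e1]
  · exact Vec.pair_zero

end FaaHom

/-- The object of tangent vectors at a point of an object with vectors `A`. -/
abbrev tang (A : CMon C) : FaaObj C := ⟨A, A.car⟩

/-- A homomorphism, as a map between objects of tangent vectors. -/
abbrev lin {A B : CMon C} (φ : CMonHom A B) : tang A ⟶ tang B :=
  FaaHom.linear (P := tang A) (Q := tang B) φ.map φ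

lemma lin_congr {A B : CMon C} {φ ψ : CMonHom A B} (h : φ.map = ψ.map) : lin φ = lin ψ :=
  FaaHom.linear_congr h h

lemma lin_comp {A B D : CMon C} (φ : CMonHom A B) (ψ : CMonHom B D) :
    lin φ ≫ lin ψ = lin (φ.comp ψ) := FaaHom.linear_comp _ _ _ _

lemma lin_pair {A B D : CMon C} (φ : CMonHom A B) (ψ : CMonHom A D) :
    CartRestrCat.pair (lin φ) (lin ψ) = lin (φ.pair ψ) := FaaHom.pair_linear _ _ _ _

lemma lin_total {A B : CMon C} (φ : CMonHom A B) : Total (lin φ) :=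
  congrArg (FaaHom.dom (tang A)) φ.total

/-- The commutative monoid `((A, A), (+, π₀ +, 0, …), (0, π₀ 0, 0, …))` of tangent vectors. -/
abbrev tangMon (A : CMon C) : CMon (FaaObj C) where
  car := tang A
  add := lin (CMonHom.add A)
  zero := lin (CMonHom.zero A)
  add_total := lin_total _
  zero_total := lin_total _
  zero_add := by
    have h := lin_congr (φ := (((CMonHom.bang A).comp (CMonHom.zero A)).pair (CMonHom.id A)).comp
      (CMonHom.add A)) (ψ := CMonHom.id A) A.zero_add
    rw [← lin_comp, ← lin_pair, ← lin_comp] at h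
    exact h
  add_comm := by
    have h := lin_congr (φ := ((CMonHom.snd A A).pair (CMonHom.fst A A)).comp (CMonHom.add A))
      (ψ := CMonHom.add A) A.add_comm
    rw [← lin_comp, ← lin_pair] at h
    exact h
  add_assoc := by
    have h := lin_congr (φ := (((((CMonHom.fst (A.prod A) A).comp (CMonHom.fst A A)).pair
      ((CMonHom.fst (A.prod A) A).comp (CMonHom.snd A A))).comp (CMonHom.add A)).pair
        (CMonHom.snd (A.prod A) A)).comp (CMonHom.add A))
      (ψ := (((CMonHom.fst (A.prod A) A).comp (CMonHom.fst A A)).pair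
        ((((CMonHom.fst (A.prod A) A).comp (CMonHom.snd A A)).pair
          (CMonHom.snd (A.prod A) A)).comp (CMonHom.add A))).comp (CMonHom.add A)) A.add_assoc
    simp only [← lin_comp, ← lin_pair] at h
    exact h

lemma tangMon_triv : tangMon (CMon.triv C) = CMon.triv (FaaObj C) := by
  refine CMon.ext rfl (heq_of_eq ?_) (heq_of_eq ?_)
  · exact to_one_unique (lin_total _) (total_bang _)
  · exact to_one_unique (lin_total _) (total_id _)

lemma tangMon_prod_add (A B : CMon C) :
    (tangMon (A.prod B)).add = ((tangMon A).prod (tangMon B)).add := by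
  have h := lin_congr (φ := CMonHom.add (A.prod B)) (ψ :=
      ((((CMonHom.fst (A.prod B) (A.prod B)).comp (CMonHom.fst A B)).pair
        ((CMonHom.snd (A.prod B) (A.prod B)).comp (CMonHom.fst A B))).comp (CMonHom.add A)).pair
      ((((CMonHom.fst (A.prod B) (A.prod B)).comp (CMonHom.snd A B)).pair
        ((CMonHom.snd (A.prod B) (A.prod B)).comp (CMonHom.snd A B))).comp (CMonHom.add B))) rfl
  simp only [← lin_comp, ← lin_pair] at h
  exact h

lemma tangMon_prod_zero (A B : CMon C) :
    (tangMon (A.prod B)).zero = ((tangMon A).prod (tangMon B)).zero := by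
  have h := lin_congr (φ := CMonHom.zero (A.prod B)) (ψ :=
      (CMonHom.zero A).pair (CMonHom.zero B)) rfl
  rw [← lin_pair] at h
  exact h

lemma tangMon_prod (A B : CMon C) : tangMon (A.prod B) = (tangMon A).prod (tangMon B) :=
  CMon.ext rfl (heq_of_eq (tangMon_prod_add A B)) (heq_of_eq (tangMon_prod_zero A B))

end IsFaa

/-! ### Derivatives of jets -/

section Dir
variable {M M' N K : Type*} [AddCommMonoid N] [AddCommMonoid K]

lemma map_dirJ (h : N →+ K) (φ : Multiset M → N) (v : M) (p q : M' → M) (s : Multiset M') :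
    h (dirJ φ v p q s) = dirJ (fun t => h (φ t)) v p q s := by
  simp only [dirJ, map_add, map_pickSum]

lemma dirJ_map {M'' : Type*} (φ : Multiset M → N) (v : M) (p q : M' → M) (g : M'' → M')
    (s : Multiset M'') : dirJ φ v p q (s.map g) = dirJ φ v (p ∘ g) (q ∘ g) s := by
  simp only [dirJ, pickSum_map, Multiset.map_map, Function.comp_def]

/-- Derivatives of jets are compatible with changes of variables and of values. -/
lemma dirJ_naturality {M₁ : Type*} {φ : Multiset M → N}
    {φ' : Multiset M₁ → K} (g : M → M₁) (h : N →+ K)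
    (hφ : ∀ s, h (φ s) = φ' (s.map g)) (v : M) (p q : M' → M) (s : Multiset M') :
    h (dirJ φ v p q s) = dirJ φ' (g v) (g ∘ p) (g ∘ q) s := by
  simp only [dirJ, map_add, map_pickSum, hφ, Multiset.map_cons, Multiset.map_map,
    Function.comp_def]

variable [AddCommMonoid M]

lemma MultiAdd.dirJ_add_left {φ : Multiset M → N} (hφ : MultiAdd φ) (v v' : M)
    (p p' q : M' → M) (s : Multiset M') :
    FaaDiBruno.dirJ φ (v + v') (fun d => p d + p' d) q s =
      FaaDiBruno.dirJ φ v p q s + FaaDiBruno.dirJ φ v' p' q s := by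
  simp only [FaaDiBruno.dirJ, hφ.add, pickSum_add]
  exact add_add_add_comm _ _ _ _

lemma MultiAdd.dirJ_zero_left {φ : Multiset M → N} (hφ : MultiAdd φ) (q : M' → M)
    (s : Multiset M') : FaaDiBruno.dirJ φ 0 (fun _ => 0) q s = 0 := by
  simp [FaaDiBruno.dirJ, hφ.zero, pickSum_const_zero]

/-- The second derivative in a direction with vanishing second-order component. -/
lemma MultiAdd.dirJ_dirJ_zero {φ : Multiset M → N} (hφ : MultiAdd φ) (a c : M) (α γ δ : M' → M)
    (s : Multiset M') :
    FaaDiBruno.dirJ (FaaDiBruno.dirJ φ c (Prod.fst : M × M → M) Prod.snd) (a, 0)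
      (fun d => (α d, 0)) (fun d => (γ d, δ d)) s = FaaDiBruno.dirJ φ a α δ s := by
  have h (x : M) (t : Multiset M') :
      FaaDiBruno.dirJ φ c (Prod.fst : M × M → M) Prod.snd
        ((x, 0) ::ₘ t.map fun d => (γ d, δ d)) = φ (x ::ₘ t.map δ) := by
    simp only [FaaDiBruno.dirJ, Multiset.map_cons, Multiset.map_map, Function.comp_def,
      pickSum_cons, Multiset.cons_swap _ (0 : M), hφ.zero, pickSum_const_zero,
      zero_add, add_zero]
  simp only [FaaDiBruno.dirJ] at h ⊢
  simp only [h]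

/-- The symmetry of the second derivative. -/
lemma MultiAdd.dirJ_dirJ_comm {φ : Multiset M → N} (hφ : MultiAdd φ) (b c : M) (β γ δ : M' → M)
    (s : Multiset M') :
    FaaDiBruno.dirJ (FaaDiBruno.dirJ φ c (Prod.fst : M × M → M) Prod.snd) (0, b)
      (fun d => (0, β d)) (fun d => (γ d, δ d)) s =
    FaaDiBruno.dirJ (FaaDiBruno.dirJ φ b (Prod.fst : M × M → M) Prod.snd) (0, c)
      (fun d => (0, γ d)) (fun d => (β d, δ d)) s := by
  have h (c x : M) (γ : M' → M) (t : Multiset M') :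
      FaaDiBruno.dirJ φ c (Prod.fst : M × M → M) Prod.snd
        ((0, x) ::ₘ t.map fun d => (γ d, δ d)) = φ (c ::ₘ x ::ₘ t.map δ) +
          pickSum t fun d r => φ (γ d ::ₘ x ::ₘ r.map δ) := by
    simp only [FaaDiBruno.dirJ, Multiset.map_cons, Multiset.map_map, Function.comp_def,
      pickSum_cons, pickSum_map, hφ.zero, zero_add]
  have h2 (c b : M) (γ β : M' → M) :
      FaaDiBruno.dirJ (FaaDiBruno.dirJ φ c (Prod.fst : M × M → M) Prod.snd) (0, b)
        (fun d => (0, β d)) (fun d => (γ d, δ d)) s =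
      φ (c ::ₘ b ::ₘ s.map δ) + pickSum s (fun d r => φ (γ d ::ₘ b ::ₘ r.map δ)) +
        (pickSum s (fun d r => φ (c ::ₘ β d ::ₘ r.map δ)) +
          pickSum s fun d r => pickSum r fun d' r' => φ (γ d' ::ₘ β d ::ₘ r'.map δ)) := by
    conv_lhs => rw [FaaDiBruno.dirJ]
    simp only [h, pickSum_add]
  rw [h2, h2, pickSum_pickSum_comm]
  simp only [Multiset.cons_swap c, Multiset.cons_swap (γ _)]
  abel

end Dir

/-! ### The derivative of a map -/

section D

variable {C : Type u} [CartQuiver.{v} C] [CartRestrCat C] {P Q R : FaaObj C}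

namespace FaaHom

/-- The point at which the derivative is taken is in the domain of the map. -/
lemma rst_snd_comp (f : FaaHom P Q) {S : Stage C} (x : Pt S (prod P.vec.car P.pt))
    (y : Pt S Q.vec.car) (h : x.map ≫ f.term 1 Nat.one_pos = y.map) :
    rst (x.snd.map ≫ f.star) = S.dom := by
  have h1 : rst (x.map ≫ f.term 1 Nat.one_pos) = S.dom := by rw [h, y.rst_map]
  rw [← rst_comp_rst, f.rst_term, rst_comp_rst] at h1
  refine Eq.trans ?_ h1
  have e : x.snd.map = x.map ≫ base P.vec.car P.pt 1 :=
    congrArg (x.map ≫ ·) (Category.comp_id _).symm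
  rw [e, Category.assoc]

lemma exists_snd_comp (f : FaaHom P Q) {S : Stage C} (x : Pt S (prod P.vec.car P.pt))
    (y : Pt S Q.vec.car) (h : x.map ≫ f.term 1 Nat.one_pos = y.map) :
    ∃ q : Pt S Q.pt, x.snd.map ≫ f.star = q.map := ⟨x.snd.to f.star (f.rst_snd_comp x y h), rfl⟩

lemma jet_singleton (f : FaaHom P Q) {S : Stage C} (x : Pt S P.pt) (q : Pt S Q.pt)
    (hq : x.map ≫ f.star = q.map) (v : Vec P.vec S) :
    (f.jet x q hq {v}).map = CartRestrCat.pair v.map x.map ≫ f.term 1 Nat.one_pos := by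
  have h : ({v} : Multiset (Vec P.vec S)) = (Finset.univ : Finset (Fin 1)).val.map fun _ => v := rfl
  rw [h, f.jet_univ _ _ _ Nat.one_pos]
  rfl

lemma comp_term_one (f : FaaHom P Q) {S : Stage C} (x : Pt S (prod P.vec.car P.pt))
    (q : Pt S Q.pt) (hq : x.snd.map ≫ f.star = q.map) :
    x.map ≫ f.term 1 Nat.one_pos = (f.jet x.snd q hq {⟨x.fst⟩}).map := by
  rw [jet_singleton]
  exact congrArg (· ≫ f.term 1 Nat.one_pos) (congrArg Pt.map x.pair_fst_snd).symm

end FaaHom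

open FaaHom in
/-- The derivative of a map of the Faà di Bruno category. Its base map is the first term of `f`,
and its jets are obtained by differentiating those of `f`. -/
def diff (f : P ⟶ Q) : prod (tang P.vec) P ⟶ tang Q.vec :=
  FaaHom.ofJets (P := prod (tang P.vec) P) (Q := tang Q.vec) (star := FaaHom.term f 1 Nat.one_pos)
    { J := fun x y h => dirJ (jet f _ _ (f.exists_snd_comp x y h).choose_spec) ⟨x.fst⟩
        Vec.fst Vec.snd
      multiAdd := fun x y h => (jet_multiAdd f _ _ _).dirJ _ _ _
      natural := fun k x y h h' s => by
        refine (dirJ_naturality k.vec k.vec (vec_jet f _ _ _ k) _ _ _ _).trans ?_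
        rw [dirJ_map]
        have e : (f.exists_snd_comp (k.pt x) (k.pt y) h').choose =
            k.pt (f.exists_snd_comp x y h).choose := by
          refine Pt.ext ?_
          rw [← (f.exists_snd_comp (k.pt x) (k.pt y) h').choose_spec, k.map_pt,
            ← (f.exists_snd_comp x y h).choose_spec]
          exact (congrArg (· ≫ FaaHom.star f) (Category.assoc _ _ _)).trans (Category.assoc _ _ _)
        have e2 : (k.pt x).snd = k.pt x.snd := Pt.ext (Category.assoc _ _ _)
        have e3 : (⟨(k.pt x).fst⟩ : Vec P.vec _) = k.vec ⟨x.fst⟩ :=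
          Vec.ext_map (Category.assoc _ _ _)
        rw [e3]
        have e4 : jet f _ _ (f.exists_snd_comp (k.pt x) (k.pt y) h').choose_spec =
            jet f _ _ (FaaHom.pull_star (f.exists_snd_comp x y h).choose_spec k) :=
          funext (f.jet_congr_pt _ _ e2 e)
        rw [e4]
        exact congrArg₂ (fun p q => dirJ _ _ p q s) (funext (Vec.vec_fst k))
          (funext (Vec.vec_snd k)) }

lemma diff_jet (f : P ⟶ Q) {S : Stage C} (x : Pt S (prod P.vec.car P.pt)) (y : Pt S Q.vec.car)
    (h : x.map ≫ FaaHom.star (diff f) = y.map) (q : Pt S Q.pt)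
    (hq : x.snd.map ≫ FaaHom.star f = q.map) {s : Multiset (Vec (P.vec.prod P.vec) S)}
    (hs : s ≠ 0) :
    FaaHom.jet (diff f) x y h s = dirJ (FaaHom.jet f x.snd q hq) ⟨x.fst⟩ Vec.fst Vec.snd s := by
  refine (FaaHom.ofJets_jet (P := prod (tang P.vec) P) (Q := tang Q.vec) _ x y h hs).trans ?_
  have e : (FaaHom.exists_snd_comp f x y h).choose = q :=
    Pt.ext ((FaaHom.exists_snd_comp f x y h).choose_spec.symm.trans hq)
  exact congrArg (fun φ => dirJ φ _ _ _ s) (funext (FaaHom.jet_congr_pt f _ _ rfl e))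

section PairDiff
variable (f : P ⟶ Q) (a : R ⟶ tang P.vec) (c : R ⟶ P) {S : Stage C} (x : Pt S R.pt)
  (y : Pt S Q.vec.car) (v : Vec P.vec S) (w : Pt S P.pt) (q : Pt S Q.pt)

lemma pair_diff_star (hv : x.map ≫ FaaHom.star a = v.map) (hw : x.map ≫ FaaHom.star c = w.map)
    (hq : w.map ≫ FaaHom.star f = q.map) :
    x.map ≫ FaaHom.star (CartRestrCat.pair a c ≫ diff f) = (FaaHom.jet f w q hq {v}).map := by
  change x.map ≫ CartRestrCat.pair (FaaHom.star a) (FaaHom.star c) ≫ FaaHom.term f 1 Nat.one_pos = _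
  rw [FaaHom.jet_singleton, ← Category.assoc, comp_pair, hv, hw]

variable {f a c x y}

/-- The derivative of `f` in the direction `a` is defined at `x` only if `a`, `c` and `c f` are. -/
lemma exists_of_pair_diff (h : x.map ≫ FaaHom.star (CartRestrCat.pair a c ≫ diff f) = y.map) :
    ∃ (v : Vec P.vec S) (w : Pt S P.pt) (q : Pt S Q.pt), x.map ≫ FaaHom.star a = v.map ∧
      x.map ≫ FaaHom.star c = w.map ∧ w.map ≫ FaaHom.star f = q.map := by
  obtain ⟨z, h1, h2⟩ := x.exists_mid
    (f := CartRestrCat.pair (FaaHom.star a) (FaaHom.star c)) (g := FaaHom.term f 1 Nat.one_pos) h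
  obtain ⟨h3, h4⟩ := x.of_pair h1
  obtain ⟨q, hq⟩ := FaaHom.exists_snd_comp f z y h2
  exact ⟨⟨z.fst⟩, z.snd, q, h3, h4, hq⟩

variable {v w q}

/-- The jets of the derivative of `f` in a direction `a` at `c`. -/
lemma pair_diff_jet (h : x.map ≫ FaaHom.star (CartRestrCat.pair a c ≫ diff f) = y.map)
    (hv : x.map ≫ FaaHom.star a = v.map) (hw : x.map ≫ FaaHom.star c = w.map)
    (hq : w.map ≫ FaaHom.star f = q.map) {s : Multiset (Vec R.vec S)} (hs : s ≠ 0) :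
    FaaHom.jet (CartRestrCat.pair a c ≫ diff f) x y h s =
      partSum s (dirJ (FaaHom.jet f w q hq) v (FaaHom.jet a x v.toPt hv)
        (FaaHom.jet c x w hw)) := by
  obtain ⟨z, h1, h2⟩ := x.exists_mid
    (f := CartRestrCat.pair (FaaHom.star a) (FaaHom.star c)) (g := FaaHom.term f 1 Nat.one_pos) h
  obtain ⟨h3, h4⟩ := x.of_pair h1
  have ev : v = ⟨z.fst⟩ := Vec.ext_map (hv.symm.trans h3)
  have ew : w = z.snd := Pt.ext (hw.symm.trans h4)
  subst ev ew
  refine (FaaHom.comp_jet _ _ x z y h h1 h2 s).trans ?_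
  unfold compJ
  refine partSum_congr hs fun π h0 hπ => ?_
  have h0' : π.map (FaaHom.jet (FaaHom.pair a c) x z h1) ≠ 0 := by simpa using h0
  refine (diff_jet f z y h2 q hq h0').trans ?_
  rw [dirJ_map]
  congr 1
  · funext t
    exact (congrArg Vec.fst (FaaHom.pair_jet a c x z h1 t)).trans (Vec.fst_pair _ _)
  · funext t
    exact (congrArg Vec.snd (FaaHom.pair_jet a c x z h1 t)).trans (Vec.snd_pair _ _)

end PairDiff

end D

/-! ### The axioms for the derivative -/

section GenDiff

variable {C : Type u} [CartQuiver.{v} C] [CartRestrCat C] {P Q R : FaaObj C} {A : CMon C}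

section
variable {S : Stage C}

lemma jet_plus (f g : R ⟶ tang A) (x : Pt S R.pt) (y : Pt S A.car) (v w : Vec A S)
    (h : x.map ≫ FaaHom.star ((tangMon A).plus f g) = y.map)
    (hf : x.map ≫ FaaHom.star f = v.map) (hg : x.map ≫ FaaHom.star g = w.map)
    (s : Multiset (Vec R.vec S)) :
    FaaHom.jet ((tangMon A).plus f g) x y h s =
      FaaHom.jet f x v.toPt hf s + FaaHom.jet g x w.toPt hg s := by
  have e : x.map ≫ CartRestrCat.pair (FaaHom.star f) (FaaHom.star g) =
      (v.toPt.pair w.toPt).map := by rw [comp_pair, hf, hg]; rfl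
  have e1 : (v.toPt.pair w.toPt).fst = v.toPt := Pt.fst_pair _ _
  have e2 : (v.toPt.pair w.toPt).snd = w.toPt := Pt.snd_pair _ _
  have e3 : (v.toPt.pair w.toPt).map ≫ A.add = y.map := by
    rw [← e, Category.assoc]; exact h
  refine (FaaHom.comp_linear_jet (Q := prod (tang A) (tang A)) (R := tang A) (FaaHom.pair f g) _ _ x
    (v.toPt.pair w.toPt) y h e e3 s).trans ?_
  refine (congrArg _ (FaaHom.pair_jet f g x _ e s)).trans ?_
  rw [FaaHom.jet_congr_pt f _ _ rfl e1 s, FaaHom.jet_congr_pt g _ _ rfl e2 s]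
  · exact Vec.ext_map rfl
  · exact hg
  · exact hf

lemma jet_zeroMap (x : Pt S R.pt) (y : Pt S A.car)
    (h : x.map ≫ FaaHom.star ((tangMon A).zeroMap R) = y.map) (s : Multiset (Vec R.vec S)) :
    FaaHom.jet ((tangMon A).zeroMap R) x y h s = 0 := by
  obtain ⟨z, h1, h2⟩ := x.exists_mid (f := bang R.pt) (g := A.zero) h
  refine (FaaHom.comp_linear_jet (Q := one) (R := tang A) (bang R) _ _ x z y h h1 h2 s).trans ?_
  refine (congrArg _ (Subsingleton.elim (α := Vec (CMon.triv C) S) _ 0)).trans (map_zero _)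

/-- The value of a map into tangent vectors that is defined at `x`. -/
lemma exists_vec {X : C} (x : Pt S X) {f : X ⟶ A.car} (h : rst (x.map ≫ f) = S.dom) :
    ∃ v : Vec A S, x.map ≫ f = v.map := ⟨⟨x.to f h⟩, rfl⟩

end

/-- The jets of `rst e ≫ f` are those of `f`. -/
lemma rst_comp_jet {e : R ⟶ P} {f : R ⟶ Q} {S : Stage C} (x : Pt S R.pt) (y : Pt S Q.pt)
    (h : x.map ≫ FaaHom.star (rst e ≫ f) = y.map) (h' : x.map ≫ FaaHom.star f = y.map)
    (s : Multiset (Vec R.vec S)) : FaaHom.jet (rst e ≫ f) x y h s = FaaHom.jet f x y h' s :=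
  FaaHom.linear_id_comp_jet _ f x y h (x.of_rst_comp h).1 h' s

lemma rst_diff (f : P ⟶ Q) : rst (diff f) = rst (snd (tang P.vec) P ≫ f) := by
  refine congrArg (FaaHom.dom _) ((FaaHom.rst_term f 1 Nat.one_pos).trans ?_)
  exact congrArg rst (congrArg (· ≫ FaaHom.star f) (Category.comp_id _))

lemma star_comp (f : P ⟶ Q) (g : Q ⟶ R) :
    FaaHom.star (f ≫ g) = FaaHom.star f ≫ FaaHom.star g := rfl
lemma star_pair (f : R ⟶ P) (g : R ⟶ Q) : FaaHom.star (pair f g) =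
    pair (FaaHom.star f) (FaaHom.star g) := rfl

lemma vec_eq_zero {X : C} {S : Stage C} {x : Pt S X} {v : Vec A S}
    (h : x.map ≫ A.zeroMap X = v.map) : v = 0 := by
  refine Vec.ext_map ?_
  rw [← h, A.comp_zeroMap, x.rst_map]
  rfl

lemma exists_of_plus {X : C} {S : Stage C} {x : Pt S X} {y : Vec A S} {f g : X ⟶ A.car}
    (h : x.map ≫ A.plus f g = y.map) :
    ∃ v w : Vec A S, x.map ≫ f = v.map ∧ x.map ≫ g = w.map ∧ y = v + w := by
  obtain ⟨z, h1, h2⟩ := x.exists_mid (f := pair f g) (g := A.add) h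
  obtain ⟨h3, h4⟩ := x.of_pair h1
  refine ⟨⟨z.fst⟩, ⟨z.snd⟩, h3, h4, Vec.ext_map ?_⟩
  rw [← h, A.comp_plus, h3, h4]
  rfl

lemma tuple_one {Z B X : C} (a : Fin 1 → (Z ⟶ B)) (b : Z ⟶ B) (x : Z ⟶ X) :
    tuple (Function.update a 0 b) x = pair b x := by
  simp [tuple]

/-- The derivative of `f` in the direction `0` is zero. -/
lemma zero_comp_diff (f : P ⟶ Q) (a : R ⟶ P) :
    pair ((tangMon P.vec).zeroMap R) a ≫ diff f =
      rst (a ≫ f) ≫ (tangMon Q.vec).zeroMap R := by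
  refine FaaHom.ext_jet ?_ fun {S} x y h h' s hs => ?_
  · have h1 := FaaHom.term_zero f 1 Nat.one_pos (fun _ => P.vec.zeroMap R.pt) (FaaHom.star a) 0
    have h2 := rst_tuple_comp_term (FaaHom.rst_term f 1 Nat.one_pos)
      (Function.update (fun _ => P.vec.zeroMap R.pt) 0 (P.vec.zeroMap R.pt)) (FaaHom.star a)
    rw [h2] at h1
    rw [tuple_one] at h1
    refine h1.trans (congrArg (· ≫ Q.vec.zeroMap R.pt) ?_)
    have h3 : rst (P.vec.zeroMap R.pt) = 𝟙 _ := total_comp (total_bang _) P.vec.zero_total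
    rw [rst_pair', h3, Category.id_comp, rst_comp_absorb]
    rfl
  · obtain ⟨v, w, q, hv, hw, hq⟩ := exists_of_pair_diff h
    have ev : v = 0 := vec_eq_zero hv
    refine (pair_diff_jet h hv hw hq hs).trans ?_
    refine Eq.symm ((rst_comp_jet x y h' (x.of_rst_comp h').2 s).trans ?_)
    refine (jet_zeroMap x y _ s).trans ?_
    have e : FaaHom.jet ((tangMon P.vec).zeroMap R) x v.toPt hv = fun _ => 0 :=
      funext (jet_zeroMap x _ hv)
    rw [e]
    subst ev
    have h4 := (FaaHom.jet_multiAdd f w q hq).dirJ_zero_left (FaaHom.jet a x w hw)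
    exact ((congrArg (partSum s) (funext h4)).trans (partSum_const_zero s)).symm

/-- Additivity of the derivative in its direction. -/
lemma plus_comp_diff (f : P ⟶ Q) (a b : R ⟶ tang P.vec) (c : R ⟶ P) :
    pair ((tangMon P.vec).plus a b) c ≫ diff f =
      (tangMon Q.vec).plus (pair a c ≫ diff f) (pair b c ≫ diff f) := by
  refine FaaHom.ext_jet ?_ fun {S} x y h h' s hs => ?_
  · have h1 := FaaHom.term_plus f 1 Nat.one_pos (fun _ => FaaHom.star a) (FaaHom.star c) 0
      (FaaHom.star a) (FaaHom.star b)
    rw [tuple_one, tuple_one, tuple_one] at h1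
    exact h1
  · obtain ⟨v, w, q, hv, hw, hq⟩ := exists_of_pair_diff h
    obtain ⟨v₁, v₂, h1, h2, rfl⟩ := exists_of_plus hv
    obtain ⟨y₁, y₂, h3, h4, h5⟩ := exists_of_plus (y := ⟨y⟩) h'
    refine (pair_diff_jet h hv hw hq hs).trans ?_
    refine Eq.symm ((jet_plus _ _ x y y₁ y₂ h' h3 h4 s).trans ?_)
    rw [pair_diff_jet h3 h1 hw hq hs, pair_diff_jet h4 h2 hw hq hs]
    have e : FaaHom.jet ((tangMon P.vec).plus a b) x (v₁ + v₂).toPt hv = fun t =>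
        FaaHom.jet a x v₁.toPt h1 t + FaaHom.jet b x v₂.toPt h2 t :=
      funext (jet_plus a b x _ v₁ v₂ hv h1 h2)
    rw [e, ← partSum_add]
    refine congrArg (partSum s) (funext fun π => ?_)
    exact ((FaaHom.jet_multiAdd f w q hq).dirJ_add_left _ _ _ _ _ _).symm

lemma diff_linear (f : P.pt ⟶ Q.pt) (φ : CMonHom P.vec Q.vec) :
    diff (FaaHom.linear f φ) =
      rst (snd (tang P.vec) P ≫ FaaHom.linear f φ) ≫ fst (tang P.vec) P ≫ lin φ := by
  refine FaaHom.ext_jet ?_ fun {S} x y h h' s hs => ?_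
  · refine (FaaHom.linear_term f φ 1 Nat.one_pos).trans ?_
    have : base P.vec.car P.pt 1 = snd P.vec.car P.pt := Category.comp_id _
    rw [this]
    rfl
  · obtain ⟨q, hq⟩ : ∃ q : Pt S Q.pt, x.snd.map ≫ f = q.map :=
      ⟨_, (FaaHom.exists_snd_comp (FaaHom.linear f φ) x y h).choose_spec⟩
    refine (diff_jet (FaaHom.linear f φ) x y h q hq hs).trans ?_
    rw [FaaHom.linear_jet_eq, dirJ_linJ _ _ _ _ hs]
    refine Eq.symm ((rst_comp_jet x y h' (x.of_rst_comp h').2 s).trans ?_)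
    have e : fst (tang P.vec) P ≫ lin φ = FaaHom.linear (P := prod (tang P.vec) P)
      (Q := tang Q.vec) (CartRestrCat.fst P.vec.car P.pt ≫ φ.map)
        ((CMonHom.fst P.vec P.vec).comp φ) := FaaHom.linear_comp (P := prod (tang P.vec) P) _ _ _ _
    refine (FaaHom.jet_congr e x y _ ((x.of_rst_comp h').2) s).trans ?_
    refine (FaaHom.linear_jet (P := prod (tang P.vec) P) (Q := tang Q.vec) _ _ x y _ s).trans ?_
    refine congrArg (fun k => linJ k s) (funext fun d => Vec.ext_map ?_)
    exact (Category.assoc _ _ _).symm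

lemma diff_linear_of_total {f : P.pt ⟶ Q.pt} (hf : Total f) (φ : CMonHom P.vec Q.vec) :
    diff (FaaHom.linear f φ) = fst (tang P.vec) P ≫ lin φ := by
  have h : Total (X := P) (Y := Q) (FaaHom.linear f φ) := congrArg (FaaHom.dom P) hf
  have h2 : rst (snd (tang P.vec) P ≫ FaaHom.linear f φ) = 𝟙 _ :=
    total_comp (total_snd _ _) h
  rw [diff_linear, h2, Category.id_comp]

/-- The derivative of a pair. -/
lemma diff_pair (f : R ⟶ P) (g : R ⟶ Q) :
    diff (pair f g) = pair (diff f) (diff g) := by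
  refine FaaHom.ext_jet (FaaHom.pair_term f g 1 Nat.one_pos) fun {S} x y h h' s hs => ?_
  obtain ⟨q, hq⟩ := FaaHom.exists_snd_comp (pair f g) x y h
  obtain ⟨h1, h2⟩ := x.snd.of_pair hq
  obtain ⟨h3, h4⟩ := x.of_pair h'
  refine (diff_jet (pair f g) x y h q hq hs).trans ?_
  refine Eq.symm ((FaaHom.pair_jet (diff f) (diff g) x y h' s).trans ?_)
  refine (congrArg₂ Vec.pair (diff_jet f x _ h3 _ h1 hs) (diff_jet g x _ h4 _ h2 hs)).trans ?_
  have e : FaaHom.jet (pair f g) x.snd q hq = fun t => Vec.pair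
      (FaaHom.jet f x.snd _ h1 t) (FaaHom.jet g x.snd _ h2 t) :=
    funext (FaaHom.pair_jet f g x.snd q hq)
  rw [e]
  refine Vec.prod_ext (A := P.vec) (B := Q.vec) ((Vec.fst_pair _ _).trans ?_)
    ((Vec.snd_pair _ _).trans ?_)
  · refine Eq.symm ((map_dirJ Vec.fst _ _ _ _ _).trans ?_)
    simp only [Vec.fst_pair]
  · refine Eq.symm ((map_dirJ Vec.snd _ _ _ _ _).trans ?_)
    simp only [Vec.snd_pair]

end GenDiff

section
variable {M M' N : Type*} [AddCommMonoid N]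

lemma dirJ_congr {φ φ' : Multiset M → N} (h : ∀ t, t ≠ 0 → φ t = φ' t) (v : M) (p q : M' → M)
    (s : Multiset M') : dirJ φ v p q s = dirJ φ' v p q s := by
  unfold dirJ
  rw [h _ (Multiset.cons_ne_zero)]
  congr 1
  exact congrArg (pickSum s) (funext fun d => funext fun r => h _ Multiset.cons_ne_zero)

end

section GenDiff

variable {C : Type u} [CartQuiver.{v} C] [CartRestrCat C] {P Q R T : FaaObj C}

lemma FaaHom.jet_congr_pt_fun (f : FaaHom P Q) {S : Stage C} {x x' : Pt S P.pt} {y y' : Pt S Q.pt}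
    (h : x.map ≫ f.star = y.map) (h' : x'.map ≫ f.star = y'.map) (hx : x = x') (hy : y = y') :
    f.jet x y h = f.jet x' y' h' := funext (f.jet_congr_pt h h' hx hy)

/-- The value of the derivative of `f` is given by the jet of `f` on one vector. -/
lemma diff_value (f : P ⟶ Q) {S : Stage C} (x : Pt S (prod P.vec.car P.pt))
    (q : Pt S Q.pt) (hq : x.snd.map ≫ FaaHom.star f = q.map) :
    x.map ≫ FaaHom.star (diff f) = (FaaHom.jet f x.snd q hq {⟨x.fst⟩}).map :=
  FaaHom.comp_term_one f x q hq

/-- The chain rule. -/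
lemma diff_comp (f : P ⟶ Q) (g : Q ⟶ R) :
    diff (f ≫ g) = pair (diff f) (snd (tang P.vec) P ≫ f) ≫ diff g := by
  have key {S : Stage C} (x : Pt S (prod P.vec.car P.pt)) (p : Pt S Q.pt) (q : Pt S R.pt)
      (hp : x.snd.map ≫ FaaHom.star f = p.map) (hq : p.map ≫ FaaHom.star g = q.map) :
      x.map ≫ FaaHom.star (diff (f ≫ g)) =
        x.map ≫ FaaHom.star (pair (diff f) (snd (tang P.vec) P ≫ f) ≫ diff g) := by
    have h1 : x.snd.map ≫ FaaHom.star (f ≫ g) = q.map := by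
      rw [star_comp, ← Category.assoc, hp, hq]
    refine (FaaHom.comp_term_one (f ≫ g) x q h1).trans ?_
    refine Eq.symm ((pair_diff_star g (diff f) (snd (tang P.vec) P ≫ f) x
      (FaaHom.jet f x.snd p hp {⟨x.fst⟩}) p q (diff_value f x p hp) ?_ hq).trans ?_)
    · exact (Category.assoc _ _ _).symm.trans hp
    · refine congrArg (fun a : Vec R.vec S => a.map) ?_
      refine Eq.symm ((FaaHom.comp_jet f g x.snd p q h1 hp hq _).trans ?_)
      exact compJ_singleton _ _ _
  refine FaaHom.ext_pt (fun {S} x y => ⟨fun h => ?_, fun h => ?_⟩) fun {S} x y h h' s hs => ?_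
  · obtain ⟨q, hq⟩ := FaaHom.exists_snd_comp (f ≫ g) x y h
    obtain ⟨p, h1, h2⟩ := x.snd.exists_mid hq
    exact (key x p q h1 h2).symm.trans h
  · obtain ⟨v, p, q, h1, h2, h3⟩ := exists_of_pair_diff h
    refine (key x p q ?_ h3).trans h
    exact (Category.assoc _ _ _).trans h2
  · obtain ⟨q, hq⟩ := FaaHom.exists_snd_comp (f ≫ g) x y h
    obtain ⟨p, h1, h2⟩ := x.snd.exists_mid hq
    have h3 : x.map ≫ FaaHom.star (snd (tang P.vec) P ≫ f) = p.map :=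
      (Category.assoc _ _ _).symm.trans h1
    have h4 := diff_value f x p h1
    refine (diff_jet (f ≫ g) x y h q hq hs).trans ?_
    refine Eq.symm ((pair_diff_jet h' h4 h3 h2 hs).trans ?_)
    have e : FaaHom.jet (f ≫ g) x.snd q hq =
        compJ (FaaHom.jet f x.snd p h1) (FaaHom.jet g p q h2) :=
      funext (FaaHom.comp_jet f g x.snd p q hq h1 h2)
    rw [e]
    have hA (b : Multiset (Vec (P.vec.prod P.vec) S)) (hb : b ≠ 0) :
        FaaHom.jet (diff f) x _ h4 b =
          dirJ (FaaHom.jet f x.snd p h1) ⟨x.fst⟩ Vec.fst Vec.snd b := diff_jet f x _ h4 p h1 hb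
    have hB (b : Multiset (Vec (P.vec.prod P.vec) S)) :
        FaaHom.jet (snd (tang P.vec) P ≫ f) x p h3 b = FaaHom.jet f x.snd p h1 (b.map Vec.snd) :=
      FaaHom.linear_comp_jet (P := prod (tang P.vec) P) _ _ f x x.snd p h3 rfl h1 b
    have k := dirJ_compJ (φ := FaaHom.jet f x.snd p h1) (FaaHom.jet_multiAdd g p q h2)
      (⟨x.fst⟩ : Vec P.vec S) (Vec.fst : Vec (P.vec.prod P.vec) S →+ Vec P.vec S)
      (Vec.snd : Vec (P.vec.prod P.vec) S →+ Vec P.vec S)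
      (Φ := fun t : Multiset (Vec (P.vec.prod P.vec) S) => (FaaHom.jet (diff f) x _ h4 t,
        FaaHom.jet (snd (tang P.vec) P ≫ f) x p h3 t)) Prod.fst Prod.snd s
      hA (fun b _ => hB b)
    refine Eq.trans ?_ k
    refine congrArg (partSum s) (funext fun π => ?_)
    rw [dirJ_map]
    rfl

section Second
variable (f : P ⟶ Q) {a b c : R ⟶ tang P.vec} {d : R ⟶ P} {S : Stage C} {x : Pt S R.pt}
  {y : Pt S Q.vec.car} {va vb vc : Vec P.vec S} {w : Pt S P.pt} {q : Pt S Q.pt}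

variable {f} in
lemma exists_of_pair_diff_diff
    (h : x.map ≫ FaaHom.star (pair (pair a b) (pair c d) ≫ diff (diff f)) = y.map) :
    ∃ (va vb vc : Vec P.vec S) (w : Pt S P.pt) (q : Pt S Q.pt), x.map ≫ FaaHom.star a = va.map ∧
      x.map ≫ FaaHom.star b = vb.map ∧ x.map ≫ FaaHom.star c = vc.map ∧
      x.map ≫ FaaHom.star d = w.map ∧ w.map ≫ FaaHom.star f = q.map := by
  obtain ⟨v, w, q', h1, h2, h3⟩ := exists_of_pair_diff h
  obtain ⟨ha, hb⟩ := x.of_pair (w := v.toPt) h1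
  obtain ⟨hc, hd⟩ := x.of_pair h2
  obtain ⟨q, hq⟩ := FaaHom.exists_snd_comp f w q' h3
  exact ⟨⟨Pt.fst v.toPt⟩, ⟨Pt.snd v.toPt⟩, ⟨w.fst⟩, w.snd, q, ha, hb, hc, hd, hq⟩

lemma dirJ_fst_snd {A B : CMon C} (φ : Multiset (Vec A S) → Vec B S) (c v : Vec A S) (v' : Vec A S)
    {M : Type*} (α β γ δ : M → Vec A S) (s : Multiset M) :
    dirJ (dirJ φ c Vec.fst Vec.snd) (Vec.pair v v') (fun d => Vec.pair (α d) (β d))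
      (fun d => Vec.pair (γ d) (δ d)) s =
    dirJ (dirJ φ c (Prod.fst : _ × Vec A S → _) Prod.snd) (v, v') (fun d => (α d, β d))
      (fun d => (γ d, δ d)) s := by
  have e (t) : dirJ φ c (Vec.fst : Vec (A.prod A) S → Vec A S) Vec.snd t =
      dirJ φ c Prod.fst Prod.snd (t.map fun a => (Vec.fst a, Vec.snd a)) :=
    (dirJ_map φ c Prod.fst Prod.snd
      (fun a : Vec (A.prod A) S => ((Vec.fst a : Vec A S), (Vec.snd a : Vec A S))) t).symm
  have h := dirJ_naturality (fun a : Vec (A.prod A) S => ((Vec.fst a : Vec A S),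
      (Vec.snd a : Vec A S)))
    (AddMonoidHom.id (Vec B S)) e (Vec.pair v v') (fun d => Vec.pair (α d) (β d))
      (fun d => Vec.pair (γ d) (δ d)) s
  refine h.trans ?_
  simp only [Vec.fst_pair, Vec.snd_pair, Function.comp_def]

lemma pair_diff_diff_star
    (ha : x.map ≫ FaaHom.star a = va.map) (hb : x.map ≫ FaaHom.star b = vb.map)
    (hc : x.map ≫ FaaHom.star c = vc.map) (hd : x.map ≫ FaaHom.star d = w.map)
    (hq : w.map ≫ FaaHom.star f = q.map) :
    x.map ≫ FaaHom.star (pair (pair a b) (pair c d) ≫ diff (diff f)) =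
      (FaaHom.jet f w q hq (vc ::ₘ {vb}) + FaaHom.jet f w q hq {va}).map := by
  have e1 : (Pt.pair vc.toPt w).fst = vc.toPt := Pt.fst_pair _ _
  have e2 : (Pt.pair vc.toPt w).snd = w := Pt.snd_pair _ _
  have h1 : x.map ≫ FaaHom.star (pair a b) = (Vec.pair va vb).map := by
    rw [star_pair, comp_pair, ha, hb]; rfl
  have h2 : x.map ≫ FaaHom.star (pair c d) = (Pt.pair vc.toPt w).map := by
    rw [star_pair, comp_pair, hc, hd]; rfl
  have hq' : (Pt.pair vc.toPt w).snd.map ≫ FaaHom.star f = q.map := by rw [e2, hq]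
  have h3 := diff_value f (Pt.pair vc.toPt w) q hq'
  refine (pair_diff_star (diff f) (pair a b) (pair c d) x _ _ _ h1 h2 h3).trans ?_
  refine congrArg (fun a : Vec Q.vec S => a.map) ?_
  refine (diff_jet f _ _ h3 q hq' (Multiset.singleton_ne_zero _)).trans ?_
  rw [FaaHom.jet_congr_pt_fun f hq' hq e2 rfl, e1]
  simp [dirJ]

/-- The jets of a second derivative, as sums over partitions of second derivatives of the jet of
`f`. -/
lemma pair_diff_diff_jet
    (h : x.map ≫ FaaHom.star (pair (pair a b) (pair c d) ≫ diff (diff f)) = y.map)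
    (ha : x.map ≫ FaaHom.star a = va.map) (hb : x.map ≫ FaaHom.star b = vb.map)
    (hc : x.map ≫ FaaHom.star c = vc.map) (hd : x.map ≫ FaaHom.star d = w.map)
    (hq : w.map ≫ FaaHom.star f = q.map) {s : Multiset (Vec R.vec S)} (hs : s ≠ 0) :
    FaaHom.jet (pair (pair a b) (pair c d) ≫ diff (diff f)) x y h s =
      partSum s (dirJ (dirJ (FaaHom.jet f w q hq) vc (Prod.fst : _ × Vec P.vec S → _) Prod.snd)
        (va, vb) (fun t => (FaaHom.jet a x va.toPt ha t, FaaHom.jet b x vb.toPt hb t))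
        (fun t => (FaaHom.jet c x vc.toPt hc t, FaaHom.jet d x w hd t))) := by
  have e1 : (Pt.pair vc.toPt w).fst = vc.toPt := Pt.fst_pair _ _
  have e2 : (Pt.pair vc.toPt w).snd = w := Pt.snd_pair _ _
  have e3 : (Vec.pair va vb).toPt.fst = va.toPt := Pt.fst_pair _ _
  have e4 : (Vec.pair va vb).toPt.snd = vb.toPt := Pt.snd_pair _ _
  have h1 : x.map ≫ FaaHom.star (pair a b) = (Vec.pair va vb).map := by
    rw [star_pair, comp_pair, ha, hb]; rfl
  have h2 : x.map ≫ FaaHom.star (pair c d) = (Pt.pair vc.toPt w).map := by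
    rw [star_pair, comp_pair, hc, hd]; rfl
  have hq' : (Pt.pair vc.toPt w).snd.map ≫ FaaHom.star f = q.map := by rw [e2, hq]
  have h3 := diff_value f (Pt.pair vc.toPt w) q hq'
  refine (pair_diff_jet h h1 h2 h3 hs).trans ?_
  refine congrArg (partSum s) (funext fun π => ?_)
  refine (dirJ_congr (fun t ht => diff_jet f _ _ h3 q hq' ht) _ _ _ _).trans ?_
  rw [FaaHom.jet_congr_pt_fun f hq' hq e2 rfl, e1]
  have k1 : FaaHom.jet (pair a b) x _ h1 =
      fun t => Vec.pair (FaaHom.jet a x va.toPt ha t) (FaaHom.jet b x vb.toPt hb t) :=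
    funext fun t => (FaaHom.pair_jet a b x _ h1 t).trans
      (congrArg₂ Vec.pair (FaaHom.jet_congr_pt a _ _ rfl e3 t)
        (FaaHom.jet_congr_pt b _ _ rfl e4 t))
  have k2 : FaaHom.jet (pair c d) x _ h2 =
      fun t => Vec.pair (FaaHom.jet c x vc.toPt hc t) (FaaHom.jet d x w hd t) :=
    funext fun t => (FaaHom.pair_jet c d x _ h2 t).trans
      (congrArg₂ Vec.pair (FaaHom.jet_congr_pt c _ _ rfl e1 t)
        (FaaHom.jet_congr_pt d _ _ rfl e2 t))
  rw [k1, k2]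
  exact dirJ_fst_snd _ _ _ _ _ _ _ _ _

end Second

/-- The second derivative in a direction with vanishing second-order component. -/
lemma diff_diff_zero (f : P ⟶ Q) (a c : R ⟶ tang P.vec) (d : R ⟶ P) :
    pair (pair a ((tangMon P.vec).zeroMap R)) (pair c d) ≫ diff (diff f) =
      rst c ≫ pair a d ≫ diff f := by
  have star_eq {S : Stage C} (x : Pt S R.pt) (va vb vc : Vec P.vec S) (w : Pt S P.pt)
      (q : Pt S Q.pt) (ha : x.map ≫ FaaHom.star a = va.map)
      (hb : x.map ≫ FaaHom.star ((tangMon P.vec).zeroMap R) = vb.map)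
      (hc : x.map ≫ FaaHom.star c = vc.map) (hd : x.map ≫ FaaHom.star d = w.map)
      (hq : w.map ≫ FaaHom.star f = q.map) :
      x.map ≫ FaaHom.star (pair (pair a ((tangMon P.vec).zeroMap R)) (pair c d) ≫ diff (diff f)) =
        x.map ≫ FaaHom.star (rst c ≫ pair a d ≫ diff f) := by
    have hx : x.map ≫ rst (FaaHom.star c) = x.map := x.comp_rst_eq (by rw [hc, vc.rst_map])
    refine (pair_diff_diff_star f ha hb hc hd hq).trans ?_
    have e : FaaHom.jet f w q hq (vc ::ₘ {vb}) = 0 := by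
      rw [show vb = 0 from vec_eq_zero hb, ← Multiset.cons_zero, Multiset.cons_swap]
      exact (FaaHom.jet_multiAdd f w q hq).zero _
    rw [e, zero_add, ← pair_diff_star f a d x va w q ha hd hq]
    change _ = x.map ≫ rst (FaaHom.star c) ≫ FaaHom.star (pair a d ≫ diff f)
    rw [← Category.assoc, hx]
  refine FaaHom.ext_pt (fun {S} x y => ⟨fun h => ?_, fun h => ?_⟩) fun {S} x y h h' s hs => ?_
  · obtain ⟨va, vb, vc, w, q, ha, hb, hc, hd, hq⟩ := exists_of_pair_diff_diff h
    exact (star_eq x va vb vc w q ha hb hc hd hq).symm.trans h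
  · obtain ⟨h1, h2⟩ := x.of_rst_comp h
    obtain ⟨va, w, q, ha, hd, hq⟩ := exists_of_pair_diff h2
    obtain ⟨vc, hc⟩ : ∃ v : Vec P.vec S, x.map ≫ FaaHom.star c = v.map :=
      exists_vec x (by rw [← rst_comp_rst, h1, x.rst_map])
    obtain ⟨vb, hb⟩ : ∃ v : Vec P.vec S, x.map ≫ FaaHom.star ((tangMon P.vec).zeroMap R) = v.map :=
      exists_vec x (x.rst_comp_total (total_comp (total_bang _) P.vec.zero_total))
    exact (star_eq x va vb vc w q ha hb hc hd hq).trans h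
  · obtain ⟨va, vb, vc, w, q, ha, hb, hc, hd, hq⟩ := exists_of_pair_diff_diff h
    refine (pair_diff_diff_jet f h ha hb hc hd hq hs).trans ?_
    refine Eq.symm ((rst_comp_jet x y h' (x.of_rst_comp h').2 s).trans ?_)
    refine (pair_diff_jet (x.of_rst_comp h').2 ha hd hq hs).trans ?_
    have e : FaaHom.jet ((tangMon P.vec).zeroMap R) x vb.toPt hb = fun _ => 0 :=
      funext (jet_zeroMap x _ hb)
    rw [e, show vb = 0 from vec_eq_zero hb]
    refine congrArg (partSum s) (funext fun π => ?_)
    exact ((FaaHom.jet_multiAdd f w q hq).dirJ_dirJ_zero _ _ _ _ _ _).symm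

/-- Symmetry of the second derivative. -/
lemma diff_diff_comm (f : P ⟶ Q) (b c : R ⟶ tang P.vec) (d : R ⟶ P) :
    pair (pair ((tangMon P.vec).zeroMap R) b) (pair c d) ≫ diff (diff f) =
      pair (pair ((tangMon P.vec).zeroMap R) c) (pair b d) ≫ diff (diff f) := by
  have key (b c : R ⟶ tang P.vec) {S : Stage C} (x : Pt S R.pt) (y : Pt S Q.vec.car)
      (h : x.map ≫ FaaHom.star (pair (pair ((tangMon P.vec).zeroMap R) b) (pair c d) ≫
        diff (diff f)) = y.map) :
      x.map ≫ FaaHom.star (pair (pair ((tangMon P.vec).zeroMap R) c) (pair b d) ≫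
        diff (diff f)) = y.map := by
    obtain ⟨va, vb, vc, w, q, ha, hb, hc, hd, hq⟩ := exists_of_pair_diff_diff h
    rw [← h]
    refine (pair_diff_diff_star f ha hc hb hd hq).trans
      (Eq.trans ?_ (pair_diff_diff_star f ha hb hc hd hq).symm)
    rw [show (vb ::ₘ {vc} : Multiset (Vec P.vec S)) = vc ::ₘ {vb} from Multiset.cons_swap _ _ 0]
  refine FaaHom.ext_pt (fun {S} x y => ⟨key b c x y, key c b x y⟩) fun {S} x y h h' s hs => ?_
  obtain ⟨va, vb, vc, w, q, ha, hb, hc, hd, hq⟩ := exists_of_pair_diff_diff h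
  refine (pair_diff_diff_jet f h ha hb hc hd hq hs).trans
    (Eq.symm ((pair_diff_diff_jet f h' ha hc hb hd hq hs).trans ?_))
  have e : FaaHom.jet ((tangMon P.vec).zeroMap R) x va.toPt ha = fun _ => 0 :=
    funext (jet_zeroMap x _ ha)
  rw [e, show va = 0 from vec_eq_zero ha]
  refine congrArg (partSum s) (funext fun π => ?_)
  exact (FaaHom.jet_multiAdd f w q hq).dirJ_dirJ_comm _ _ _ _ _ _

end GenDiff

/-! ### The generalized differential structure -/

section GenDiffStr

variable {C : Type u} [CartQuiver.{v} C] [CartRestrCat C]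

lemma SameArrow.of_eq {X Y : C} {f g : X ⟶ Y} (h : f = g) : SameArrow f g := h ▸ SameArrow.rfl' f

lemma diff_rst {P Q : FaaObj C} (f : P ⟶ Q) :
    diff (rst f) = rst (snd (tang P.vec) P ≫ f) ≫ fst (tang P.vec) P := by
  refine (diff_linear (Q := P) (rst (FaaHom.star f)) (CMonHom.id P.vec)).trans ?_
  have h1 : rst (snd (tang P.vec) P ≫ rst f) = rst (snd (tang P.vec) P ≫ f) := rst_comp_rst _ _
  have h2 : fst (tang P.vec) P ≫ 𝟙 (tang P.vec) = fst (tang P.vec) P := Category.comp_id _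
  exact congrArg₂ (· ≫ ·) h1 h2

lemma diff_fst (P Q : FaaObj C) : diff (fst P Q) =
    fst (tang (prod P Q).vec) (prod P Q) ≫ lin (CMonHom.fst P.vec Q.vec) :=
  diff_linear_of_total (P := prod P Q) (Q := P) (total_fst _ _) _

lemma diff_snd (P Q : FaaObj C) : diff (snd P Q) =
    fst (tang (prod P Q).vec) (prod P Q) ≫ lin (CMonHom.snd P.vec Q.vec) :=
  diff_linear_of_total (P := prod P Q) (Q := Q) (total_snd _ _) _

lemma diff_lin {A B : CMon C} (φ : CMonHom A B) : diff (lin φ) = fst (tang A) (tang A) ≫ lin φ :=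
  diff_linear_of_total (P := tang A) (Q := tang B) φ.total φ

variable (C) in
/-- The generalized differential structure of the Faà di Bruno category. -/
def genDiff : GenDiffRestr (FaaObj C) where
  L P := tangMon P.vec
  L_L P := rfl
  L_one := tangMon_triv
  L_prod P Q := tangMon_prod P.vec Q.vec
  D f := diff f
  D_add P := SameArrow.of_eq (diff_lin (CMonHom.add P.vec))
  D_zero P := SameArrow.of_eq (diff_lin (CMonHom.zero P.vec))
  plus_D f a b c := plus_comp_diff f a b c
  zero_D f a := zero_comp_diff f a
  D_fst P Q := SameArrow.of_eq (diff_fst P Q)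
  D_snd P Q := SameArrow.of_eq (diff_snd P Q)
  D_pair f g := SameArrow.of_eq (diff_pair f g)
  D_comp f g := diff_comp f g
  DD f := diff (diff f)
  DD_eq f := SameArrow.rfl' _
  DD_zero f a c d := diff_diff_zero f a c d
  DD_symm f b c d := diff_diff_comm f b c d
  D_rst f := diff_rst f
  rst_D f := rst_diff f

end GenDiffStr

/-! ### Derivatives on generalized elements -/

section Dirv

variable {C : Type u} [CartQuiver.{v} C] [CartRestrCat C] {X Y Z W : FaaObj C}
  {S T : Stage (FaaObj C)} {A B : CMon C}

/-- A generalized element is in the domain of a map. -/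
abbrev Def {K : Type*} [CartQuiver K] [CartRestrCat K] {S : Stage K} {X Y : K} (x : Pt S X)
    (h : X ⟶ Y) : Prop := rst (x.map ≫ h) = S.dom

lemma rst_pair_comp_diff (h : X ⟶ W) (x : Pt S X) (hx : Def x h) (u : Pt S (tang X.vec)) :
    rst (pair u.map x.map ≫ diff h) = S.dom := by
  rw [← rst_comp_rst, rst_diff, rst_comp_rst, ← Category.assoc, pair_snd, Category.assoc,
    rst_rst_comp', hx, u.rst_map, S.dom_dom]

/-- The derivative of `h` at `x`, as an additive map on directions. -/
def dirv (h : X ⟶ W) (x : Pt S X) (hx : Def x h) :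
    Vec (tangMon X.vec) S →+ Vec (tangMon W.vec) S where
  toFun u := ⟨⟨pair u.map x.map ≫ diff h, rst_pair_comp_diff h x hx u.toPt⟩⟩
  map_zero' := by
    refine Vec.ext_map ?_
    change pair (S.dom ≫ (tangMon X.vec).zeroMap S.obj) x.map ≫ diff h =
      S.dom ≫ (tangMon W.vec).zeroMap S.obj
    rw [← S.rst_dom, pair_rst_left, Category.assoc, zero_comp_diff]
    rw [show rst (x.map ≫ h) = S.dom from hx, S.rst_dom, ← Category.assoc, S.dom_dom]
  map_add' u u' := Vec.ext_map (plus_comp_diff h u.map u'.map x.map)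

lemma dirv_map (h : X ⟶ W) (x : Pt S X) (hx : Def x h) (u : Vec (tangMon X.vec) S) :
    (dirv h x hx u).map = pair u.map x.map ≫ diff h := rfl

lemma dirv_congr {h h' : X ⟶ W} (e : h = h') {x x' : Pt S X} (e' : x = x') (hx : Def x h)
    (hx' : Def x' h') : dirv h x hx = dirv h' x' hx' := by
  subst e e'; rfl

/-- The tangent vector of a product with the given components. -/
def tpair (a : Vec (tangMon A) S) (b : Vec (tangMon B) S) : Vec (tangMon (A.prod B)) S :=
  ⟨Pt.pair a.toPt b.toPt⟩

lemma tpair_map (a : Vec (tangMon A) S) (b : Vec (tangMon B) S) :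
    (tpair a b).map = pair a.map b.map := rfl

/-- The first component of a tangent vector of a product. -/
def tfst (u : Vec (tangMon (A.prod B)) S) : Vec (tangMon A) S :=
  ⟨Pt.fst (X := tang A) (Y := tang B) u.toPt⟩

/-- The second component of a tangent vector of a product. -/
def tsnd (u : Vec (tangMon (A.prod B)) S) : Vec (tangMon B) S :=
  ⟨Pt.snd (X := tang A) (Y := tang B) u.toPt⟩

lemma tfst_tpair (a : Vec (tangMon A) S) (b : Vec (tangMon B) S) : tfst (tpair a b) = a :=
  congrArg Vec.mk (Pt.fst_pair a.toPt b.toPt)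

lemma tsnd_tpair (a : Vec (tangMon A) S) (b : Vec (tangMon B) S) : tsnd (tpair a b) = b :=
  congrArg Vec.mk (Pt.snd_pair a.toPt b.toPt)

lemma tpair_tfst_tsnd (u : Vec (tangMon (A.prod B)) S) : tpair (tfst u) (tsnd u) = u :=
  congrArg Vec.mk (Pt.pair_fst_snd (X := tang A) (Y := tang B) u.toPt)

lemma tpair_add (a a' : Vec (tangMon A) S) (b b' : Vec (tangMon B) S) :
    tpair (a + a') (b + b') = tpair a b + tpair a' b' := by
  refine Vec.ext_map ?_
  refine (congrArg (fun a : Vec ((tangMon A).prod (tangMon B)) S => a.map)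
    (Vec.pair_add a a' b b')).trans ?_
  exact congrArg (pair (pair a.map b.map) (pair a'.map b'.map) ≫ ·) (tangMon_prod_add A B).symm

lemma tpair_zero : tpair (0 : Vec (tangMon A) S) (0 : Vec (tangMon B) S) = 0 := by
  refine Vec.ext_map ?_
  refine (congrArg (fun a : Vec ((tangMon A).prod (tangMon B)) S => a.map) Vec.pair_zero).trans ?_
  exact congrArg (S.dom ≫ bang S.obj ≫ ·) (tangMon_prod_zero A B).symm

lemma dirv_comp (h : X ⟶ Y) (k : Y ⟶ Z) (x : Pt S X) (y : Pt S Y) (hy : x.map ≫ h = y.map)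
    (hk : Def y k) (hhk : Def x (h ≫ k)) (u : Vec (tangMon X.vec) S) :
    dirv (h ≫ k) x hhk u = dirv k y hk (dirv h x (by rw [Def, hy, y.rst_map]) u) := by
  refine Vec.ext_map ?_
  rw [dirv_map, dirv_map, dirv_map, diff_comp, ← Category.assoc, comp_pair, ← Category.assoc _ _ h,
    pair_snd, u.rst_map, x.dom_map, hy]

lemma dirv_pair (h : X ⟶ Y) (k : X ⟶ Z) (x : Pt S X) (hh : Def x h) (hk : Def x k)
    (hhk : Def x (pair h k)) (u : Vec (tangMon X.vec) S) :
    dirv (pair h k) x hhk u = tpair (dirv h x hh u) (dirv k x hk u) := by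
  refine Vec.ext_map ?_
  rw [dirv_map, diff_pair, tpair_map, dirv_map, dirv_map]
  exact comp_pair _ _ _

lemma dirv_linear_total {f : X.pt ⟶ Y.pt} (hf : Total f) (φ : CMonHom X.vec Y.vec) (x : Pt S X)
    (hx : Def (Y := Y) x (FaaHom.linear f φ)) (u : Vec (tangMon X.vec) S) :
    (dirv (W := Y) (FaaHom.linear f φ) x hx u).map = u.map ≫ lin φ := by
  rw [dirv_map, diff_linear_of_total hf, ← Category.assoc, pair_fst, x.rst_map, u.dom_map]

lemma dirv_fst (x : Pt S (prod X Y)) (hx : Def x (fst X Y))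
    (u : Vec (tangMon (X.vec.prod Y.vec)) S) : dirv (fst X Y) x hx u = tfst u :=
  Vec.ext_map (dirv_linear_total (X := prod X Y) (Y := X) (total_fst _ _) _ x hx u)

lemma dirv_snd (x : Pt S (prod X Y)) (hx : Def x (snd X Y))
    (u : Vec (tangMon (X.vec.prod Y.vec)) S) : dirv (snd X Y) x hx u = tsnd u :=
  Vec.ext_map (dirv_linear_total (X := prod X Y) (Y := Y) (total_snd _ _) _ x hx u)

lemma dirv_id (x : Pt S X) (hx : Def x (𝟙 X)) (u : Vec (tangMon X.vec) S) :
    dirv (𝟙 X) x hx u = u :=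
  Vec.ext_map ((dirv_linear_total (X := X) (Y := X) (total_id _) _ x hx u).trans
    (Category.comp_id _))

/-- The derivative of a total homomorphism is the homomorphism. -/
lemma dirv_lin (φ : CMonHom A B) (x : Pt S (tang A)) (hx : Def x (lin φ))
    (u : Vec (tangMon A) S) : (dirv (lin φ) x hx u).map = u.map ≫ lin φ :=
  dirv_linear_total (X := tang A) (Y := tang B) φ.total φ x hx u

lemma dirv_rst (h : X ⟶ Y) (x : Pt S X) (hx : Def x (rst h)) (u : Vec (tangMon X.vec) S) :
    dirv (rst h) x hx u = u := by
  refine Vec.ext_map ?_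
  have hx' : rst (x.map ≫ h) = S.dom := by rw [← rst_comp_rst]; exact hx
  rw [dirv_map, diff_rst, ← Category.assoc, comp_rst', ← Category.assoc, pair_snd, u.rst_map,
    x.dom_map, hx', Category.assoc, pair_fst, x.rst_map, u.dom_map, u.dom_map]

lemma def_diff {h : X ⟶ W} {x : Pt S X} (hx : Def x h) (c : Vec (tangMon X.vec) S) :
    Def (Pt.pair c.toPt x) (diff h) := rst_pair_comp_diff h x hx c.toPt

lemma dirv_diff_left (h : X ⟶ W) (x : Pt S X) (hx : Def x h) (a c : Vec (tangMon X.vec) S) :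
    dirv (diff h) (Pt.pair c.toPt x) (def_diff hx c) (tpair a 0) = dirv h x hx a := by
  refine Vec.ext_map ?_
  have e := diff_diff_zero h a.map c.map x.map
  change pair (pair a.map (S.dom ≫ (tangMon X.vec).zeroMap S.obj)) (pair c.map x.map) ≫
    diff (diff h) = _
  rw [← S.rst_dom, pair_rst_right, pair_rst_left, Category.assoc, e, c.rst_map, S.rst_dom,
    ← Category.assoc, S.dom_dom, ← Category.assoc, ← S.rst_dom, ← pair_rst_left, S.rst_dom,
    a.dom_map, dirv_map]

lemma dirv_diff_right (h : X ⟶ W) (x : Pt S X) (hx : Def x h) (b c : Vec (tangMon X.vec) S) :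
    dirv (diff h) (Pt.pair c.toPt x) (def_diff hx c) (tpair 0 b) =
      dirv (diff h) (Pt.pair b.toPt x) (def_diff hx b) (tpair 0 c) := by
  refine Vec.ext_map ?_
  have e := diff_diff_comm h b.map c.map x.map
  change pair (pair (S.dom ≫ (tangMon X.vec).zeroMap S.obj) b.map) (pair c.map x.map) ≫
    diff (diff h) = pair (pair (S.dom ≫ (tangMon X.vec).zeroMap S.obj) c.map)
      (pair b.map x.map) ≫ diff (diff h)
  rw [← S.rst_dom, pair_rst_left, pair_rst_left, Category.assoc, e, pair_rst_left, pair_rst_left,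
    Category.assoc]

end Dirv

/-! ### The comultiplication on maps -/

section Tangent

variable {C : Type u} [CartQuiver.{v} C] [CartRestrCat C] {X Y Z W : FaaObj C}
  {S T : Stage (FaaObj C)} {A B : CMon C}

/-- The tangent vector of `vars (tang A) X n` with the given components. -/
def vvec : ∀ {n : ℕ}, (Fin n → Vec (tangMon A) S) → Vec (tangMon X.vec) S →
    Vec (tangMon (vars (tang A) X n).vec) S
  | 0, _, q => q
  | _ + 1, p, q => tpair (p 0) (vvec (fun i => p i.succ) q)

lemma vvec_add {n : ℕ} (p p' : Fin n → Vec (tangMon A) S) (q q' : Vec (tangMon X.vec) S) :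
    vvec (fun i => p i + p' i) (q + q') = vvec p q + vvec p' q' := by
  induction n with
  | zero => rfl
  | succ n ih => exact (congrArg (tpair _) (ih _ _)).trans (tpair_add _ _ _ _)

lemma vvec_zero (n : ℕ) :
    vvec (fun _ : Fin n => (0 : Vec (tangMon A) S)) (0 : Vec (tangMon X.vec) S) = 0 := by
  induction n with
  | zero => rfl
  | succ n ih => exact (congrArg (tpair _) ih).trans tpair_zero

/-- The tangent vector in the direction of the base point. -/
abbrev lastVec (n : ℕ) (a : Vec (tangMon X.vec) S) :
    Vec (tangMon (vars (tang X.vec) X n).vec) S := vvec (fun _ => 0) a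

lemma dirv_proj {n : ℕ} (i : Fin n) (x : Pt S (vars (tang A) X n))
    (hx : Def x (proj (tang A) X n i)) (p : Fin n → Vec (tangMon A) S)
    (q : Vec (tangMon X.vec) S) : dirv (proj (tang A) X n i) x hx (vvec p q) = p i := by
  induction n with
  | zero => exact i.elim0
  | succ n ih =>
    induction i using Fin.cases with
    | zero => exact (dirv_fst x hx _).trans (tfst_tpair _ _)
    | succ i =>
      refine (dirv_comp (snd (tang A) (vars (tang A) X n)) (proj (tang A) X n i) x x.snd rfl
        (x.snd.rst_comp_total (total_proj _ _)) hx _).trans ?_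
      rw [show dirv (snd (tang A) (vars (tang A) X n)) x _ (vvec p q) =
        vvec (fun i => p i.succ) q from (dirv_snd x _ _).trans (tsnd_tpair _ _)]
      exact ih i x.snd _ _

lemma dirv_base {n : ℕ} (x : Pt S (vars (tang A) X n))
    (hx : Def x (base (tang A) X n)) (p : Fin n → Vec (tangMon A) S)
    (q : Vec (tangMon X.vec) S) : dirv (base (tang A) X n) x hx (vvec p q) = q := by
  induction n with
  | zero => exact dirv_id x hx q
  | succ n ih =>
    refine (dirv_comp (snd (tang A) (vars (tang A) X n)) (base (tang A) X n) x x.snd rfl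
      (x.snd.rst_comp_total (total_base _)) hx _).trans ?_
    rw [show dirv (snd (tang A) (vars (tang A) X n)) x _ (vvec p q) =
      vvec (fun i => p i.succ) q from (dirv_snd x _ _).trans (tsnd_tpair _ _)]
    exact ih x.snd _ _

lemma def_tuple {K : Type*} [CartQuiver K] [CartRestrCat K] {S : Stage K} {Z A X : K} {n : ℕ}
    {a : Fin n → (Z ⟶ A)} {b : Z ⟶ X} {z : Pt S Z} (ha : ∀ i, Def z (a i)) (hb : Def z b) :
    Def z (tuple a b) := by
  refine (congrArg rst ?_).trans (Pt.tuple (fun i => z.to (a i) (ha i)) (z.to b hb)).rst_map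
  exact comp_tuple _ _ _

lemma dirv_tuple {n : ℕ} (a : Fin n → (Z ⟶ tang A)) (b : Z ⟶ X) (z : Pt S Z)
    (ha : ∀ i, Def z (a i)) (hb : Def z b) (h : Def z (tuple a b)) (u : Vec (tangMon Z.vec) S) :
    dirv (tuple a b) z h u = vvec (fun i => dirv (a i) z (ha i) u) (dirv b z hb u) := by
  induction n with
  | zero => rfl
  | succ n ih =>
    have h' := def_tuple (fun i : Fin n => ha i.succ) hb
    refine (dirv_pair (a 0) (tuple (fun i => a i.succ) b) z (ha 0) h' h u).trans ?_
    exact congrArg (tpair _) (ih _ _ _)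

lemma Pt.eq_vtuple {K : Type*} [CartQuiver K] [CartRestrCat K] {S : Stage K} {A : CMon K} {X : K}
    {n : ℕ} (x : Pt S (vars A.car X n)) :
    ∃ (a : Fin n → Vec A S) (p : Pt S X), x = vtuple a p := by
  refine ⟨fun i => ⟨x.to (proj A.car X n i) (x.rst_comp_total (total_proj _ _))⟩,
    x.to (base A.car X n) (x.rst_comp_total (total_base _)), Pt.ext ?_⟩
  have h := comp_tuple x.map (proj A.car X n) (base A.car X n)
  rw [tuple_proj_base, Category.comp_id] at h
  exact h

/-- The tangent vector with the given last component, the others being zero, as a homomorphism. -/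
def lastHom (X : FaaObj C) : ∀ n : ℕ, CMonHom X.vec (vars (tang X.vec) X n).vec
  | 0 => CMonHom.id X.vec
  | n + 1 => ((CMonHom.bang X.vec).comp (CMonHom.zero X.vec)).pair (lastHom X n)

lemma comp_lastHom (n : ℕ) (a : Vec (tangMon X.vec) S) :
    a.map ≫ lin (lastHom X n) = (lastVec n a).map := by
  induction n with
  | zero => exact Category.comp_id _
  | succ n ih =>
    have h : lin (lastHom X (n + 1)) = pair (bang (tang X.vec) ≫ (tangMon X.vec).zero)
      (lin (lastHom X n)) := by
      refine (lin_pair _ _).symm.trans ?_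
      rw [← lin_comp]
      rfl
    rw [h, comp_pair, ih]
    refine congrArg (pair · _) ?_
    refine ((tangMon X.vec).comp_zeroMap a.map).trans ?_
    rw [a.rst_map]
    rfl

end Tangent

section Delta

variable {C : Type u} [CartQuiver.{v} C] [CartRestrCat C] {P Q R : FaaObj C}
  {S T : Stage (FaaObj C)}

/-- The terms of `δ f`, starting from the first. Each one is the derivative of the one before, in
the direction of the base point. -/
def deltaT (f : P ⟶ Q) : ∀ n : ℕ, vars (tang P.vec) P (n + 1) ⟶ tang Q.vec
  | 0 => diff f
  | n + 1 => pair (fst (tang P.vec) (vars (tang P.vec) P (n + 1)) ≫ lin (lastHom P (n + 1)))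
      (snd (tang P.vec) (vars (tang P.vec) P (n + 1))) ≫ diff (Q := tang Q.vec) (deltaT f n)

lemma rst_deltaT (f : P ⟶ Q) (n : ℕ) :
    rst (deltaT f n) = rst (base (tang P.vec) P (n + 1) ≫ f) := by
  induction n with
  | zero =>
    refine (rst_diff f).trans (congrArg rst (congrArg (· ≫ f) ?_))
    exact (Category.comp_id _).symm
  | succ n ih =>
    change rst (pair (fst (tang P.vec) (vars (tang P.vec) P (n + 1)) ≫ lin (lastHom P (n + 1)))
      (snd (tang P.vec) (vars (tang P.vec) P (n + 1))) ≫ diff (Q := tang Q.vec) (deltaT f n)) =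
      rst ((snd (tang P.vec) (vars (tang P.vec) P (n + 1)) ≫ base (tang P.vec) P (n + 1)) ≫ f)
    rw [← rst_comp_rst, rst_diff, rst_comp_rst, ← Category.assoc, pair_snd,
      show rst (fst (tang P.vec) (vars (tang P.vec) P (n + 1)) ≫ lin (lastHom P (n + 1))) = 𝟙 _
        from total_comp (total_fst _ _) (lin_total _), Category.id_comp, ← rst_comp_rst, ih,
      rst_comp_rst, Category.assoc]

lemma def_deltaT {f : P ⟶ Q} {x : Pt S P} (hx : Def x f) {n : ℕ}
    (a : Fin (n + 1) → Vec (tangMon P.vec) S) : Def (vtuple a x) (deltaT f n) := by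
  have h := rst_deltaT f n
  refine (rst_comp_rst _ _).symm.trans ?_
  rw [h, rst_comp_rst, ← Category.assoc]
  refine (congrArg (fun k => rst (k ≫ f)) (vtuple_base (A := tangMon P.vec) a x)).trans hx

/-- The value of the `n + 1`-st term of `δ f`. -/
def deltaE (f : P ⟶ Q) (x : Pt S P) (hx : Def x f) {n : ℕ}
    (a : Fin (n + 1) → Vec (tangMon P.vec) S) : Vec (tangMon Q.vec) S :=
  ⟨(vtuple a x).to (deltaT f n) (def_deltaT hx a)⟩

lemma deltaE_zero (f : P ⟶ Q) (x : Pt S P) (hx : Def x f)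
    (a : Fin 1 → Vec (tangMon P.vec) S) : deltaE f x hx a = dirv f x hx (a 0) := rfl

lemma deltaE_cons (f : P ⟶ Q) (x : Pt S P) (hx : Def x f) {n : ℕ} (b : Vec (tangMon P.vec) S)
    (a : Fin (n + 1) → Vec (tangMon P.vec) S) :
    deltaE f x hx (Fin.cons b a : Fin (n + 2) → Vec (tangMon P.vec) S) =
      dirv (W := tang Q.vec) (deltaT f n) (vtuple a x) (def_deltaT hx a) (lastVec (n + 1) b) := by
  refine Vec.ext_map ?_
  rw [dirv_map, ← comp_lastHom]
  change CartRestrCat.pair b.map (vtuple a x).map ≫ CartRestrCat.pair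
    (CartRestrCat.fst (tang P.vec) (vars (tang P.vec) P (n + 1)) ≫ lin (lastHom P (n + 1)))
    (CartRestrCat.snd (tang P.vec) (vars (tang P.vec) P (n + 1))) ≫ diff (Q := tang Q.vec)
        (deltaT f n) = _
  rw [← Category.assoc, comp_pair, ← Category.assoc, pair_fst, pair_snd, (vtuple a x).rst_map,
    b.rst_map, b.dom_map, (vtuple a x).dom_map]

/-- To see that a term of `δ f` is invariant under a permutation of its variables, it is enough to
test it on generalized elements. -/
lemma perm_comp_deltaT (f : P ⟶ Q) {n : ℕ} (σ : Equiv.Perm (Fin (n + 1)))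
    (h : ∀ {S : Stage (FaaObj C)} (x : Pt S P) (hx : Def x f)
      (a : Fin (n + 1) → Vec (tangMon P.vec) S), deltaE f x hx (a ∘ σ) = deltaE f x hx a) :
    tuple (fun i => proj (tang P.vec) P (n + 1) (σ i)) (base (tang P.vec) P (n + 1)) ≫
      deltaT f n = deltaT f n := by
  have hr : rst (tuple (fun i => proj (tang P.vec) P (n + 1) (σ i)) (base (tang P.vec) P (n + 1)) ≫
      deltaT f n) = rst (deltaT f n) := by
    refine (rst_tuple_comp_term (P := ⟨tangMon P.vec, P⟩) (Q := ⟨tangMon Q.vec, Q⟩) (star := f)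
      (t := deltaT f n) (rst_deltaT f n) _ _).trans ?_
    rw [rst_deltaT]
    have h : rst (tuple (fun i => proj (tang P.vec) P (n + 1) (σ i))
        (base (tang P.vec) P (n + 1))) = 𝟙 _ :=
      total_tuple (fun _ => total_proj _ _) (total_base _)
    exact (congrArg (· ≫ rst (base (tang P.vec) P (n + 1) ≫ f)) h).trans (Category.id_comp _)
  have key {S : Stage (FaaObj C)} (x : Pt S (vars (tang P.vec) P (n + 1)))
      (hx : Def x (deltaT f n)) :
      x.map ≫ tuple (fun i => proj (tang P.vec) P (n + 1) (σ i)) (base (tang P.vec) P (n + 1)) ≫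
        deltaT f n = x.map ≫ deltaT f n := by
    obtain ⟨a, p, rfl⟩ := Pt.eq_vtuple (A := tangMon P.vec) x
    have hp : Def p f := by
      refine Eq.trans ?_ hx
      refine Eq.symm ((rst_comp_rst _ _).symm.trans ?_)
      rw [rst_deltaT, rst_comp_rst, ← Category.assoc]
      exact congrArg (fun k => rst (k ≫ f)) (vtuple_base (A := tangMon P.vec) a p)
    rw [← Category.assoc]
    refine (congrArg (· ≫ deltaT f n) (vtuple_perm (A := tangMon P.vec) a p σ)).trans ?_
    exact congrArg (fun b : Vec (tangMon Q.vec) S => b.map) (h p hp a)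
  refine map_ext_pt fun {S} x y => ⟨fun hxy => ?_, fun hxy => ?_⟩
  · refine (key x ?_).symm.trans hxy
    rw [Def, ← rst_comp_rst, ← hr, rst_comp_rst, hxy, y.rst_map]
  · exact (key x (by rw [Def, hxy, y.rst_map])).trans hxy

end Delta

/-! ### Symmetry and derivatives of the terms of the comultiplication -/

section DeltaSymm

variable {C : Type u} [CartQuiver.{v} C] [CartRestrCat C] {P Q R : FaaObj C}
  {S T : Stage (FaaObj C)}

/-- The derivative of a term of `δ f`, through its definition as a derivative of the previous term.
-/
lemma dirv_deltaT_succ (f : P ⟶ Q) {n : ℕ} (c : Vec (tangMon P.vec) S)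
    (w : Pt S (vars (tang P.vec) P (n + 1))) (hw : Def w (deltaT f n))
    (h : Def (Pt.pair c.toPt w) (deltaT f (n + 1))) (a : Vec (tangMon P.vec) S)
    (u : Vec (tangMon (vars (tang P.vec) P (n + 1)).vec) S) :
    dirv (W := tang Q.vec) (deltaT f (n + 1)) (Pt.pair c.toPt w) h (tpair a u) =
      dirv (W := tang Q.vec) (diff (Q := tang Q.vec) (deltaT f n))
        (Pt.pair (lastVec (n + 1) c).toPt w)
        (def_diff hw _) (tpair (lastVec (n + 1) a) u) := by
  set x := Pt.pair c.toPt w with hx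
  have e1 : x.map ≫ fst (tang P.vec) (vars (tang P.vec) P (n + 1)) = c.map :=
    congrArg Pt.map (Pt.fst_pair c.toPt w)
  have e2 : x.map ≫ snd (tang P.vec) (vars (tang P.vec) P (n + 1)) = w.map :=
    congrArg Pt.map (Pt.snd_pair c.toPt w)
  have e3 : x.map ≫ fst (tang P.vec) (vars (tang P.vec) P (n + 1)) ≫ lin (lastHom P (n + 1)) =
      (lastVec (n + 1) c).map := by
    rw [← Category.assoc, e1, comp_lastHom]
  have e4 : x.map ≫ pair (fst (tang P.vec) (vars (tang P.vec) P (n + 1)) ≫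
      lin (lastHom P (n + 1))) (snd (tang P.vec) (vars (tang P.vec) P (n + 1))) =
      (Pt.pair (lastVec (n + 1) c).toPt w).map := by
    rw [comp_pair, e2, e3]
    rfl
  have d1 : Def x (fst (tang P.vec) (vars (tang P.vec) P (n + 1)) ≫ lin (lastHom P (n + 1))) := by
    rw [Def, e3, Pt.rst_map]
  have d2 : Def x (snd (tang P.vec) (vars (tang P.vec) P (n + 1))) := by
    rw [Def, e2, Pt.rst_map]
  refine (dirv_comp _ (diff (Q := tang Q.vec) (deltaT f n)) x _ e4 (def_diff hw _) h _).trans ?_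
  refine congrArg _ ((dirv_pair _ _ x d1 d2 _ _).trans ?_)
  refine congrArg₂ tpair ?_ ((dirv_snd x d2 _).trans (tsnd_tpair _ _))
  refine (dirv_comp (fst (tang P.vec) (vars (tang P.vec) P (n + 1))) (lin (lastHom P (n + 1)))
    x c.toPt e1 (c.toPt.rst_comp_total (lin_total _)) d1 _).trans (Vec.ext_map ?_)
  refine (dirv_lin _ _ _ _).trans ?_
  rw [show dirv (fst (tang P.vec) (vars (tang P.vec) P (n + 1))) x _ (tpair a u) = a from
    (dirv_fst x _ _).trans (tfst_tpair _ _)]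
  exact comp_lastHom _ a

/-- The derivative of a symmetric map is symmetric. -/
lemma dirv_perm (f : P ⟶ Q) {n : ℕ} (σ : Equiv.Perm (Fin (n + 1)))
    (hσ : tuple (fun i => proj (tang P.vec) P (n + 1) (σ i)) (base (tang P.vec) P (n + 1)) ≫
      deltaT f n = deltaT f n) (x : Pt S P) (hx : Def x f)
    (a p : Fin (n + 1) → Vec (tangMon P.vec) S) (q : Vec (tangMon P.vec) S) :
    dirv (W := tang Q.vec) (deltaT f n) (vtuple a x) (def_deltaT hx a) (vvec p q) =
      dirv (W := tang Q.vec) (deltaT f n) (vtuple (a ∘ σ) x) (def_deltaT hx _)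
        (vvec (p ∘ σ) q) := by
  have h1 : Def (vtuple a x) (tuple (fun i => proj (tang P.vec) P (n + 1) (σ i))
      (base (tang P.vec) P (n + 1)) ≫ deltaT f n) := by
    rw [Def, hσ]
    exact def_deltaT hx a
  refine (congrArg (fun k : Vec (tangMon _) S →+ _ => k (vvec p q))
      (dirv_congr hσ.symm rfl _ h1)).trans ?_
  refine (dirv_comp _ (deltaT f n) (vtuple a x) (vtuple (a ∘ σ) x)
    (vtuple_perm (A := tangMon P.vec) a x σ) (def_deltaT hx _) h1 _).trans ?_
  refine congrArg _ ((dirv_tuple _ _ _ (fun i => Pt.rst_comp_total _ (total_proj _ _))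
    (Pt.rst_comp_total _ (total_base _)) _ _).trans ?_)
  exact congrArg₂ vvec (funext fun i => dirv_proj _ _ _ _ _) (dirv_base _ _ _ _)

/-- The first two variables of a term of `δ f` are directions of a second derivative along the base
point, which is symmetric. -/
lemma deltaE_swap (f : P ⟶ Q) (x : Pt S P) (hx : Def x f) {n : ℕ} (b c : Vec (tangMon P.vec) S)
    (t : Fin n → Vec (tangMon P.vec) S) :
    deltaE f x hx (Fin.cons b (Fin.cons c t : Fin (n + 1) → _) : Fin (n + 2) → _) =
      deltaE f x hx (Fin.cons c (Fin.cons b t : Fin (n + 1) → _) : Fin (n + 2) → _) := by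
  rw [deltaE_cons, deltaE_cons]
  cases n with
  | zero => exact dirv_diff_right f x hx b c
  | succ n =>
    refine (dirv_deltaT_succ f c (vtuple t x) (def_deltaT hx t) _ 0 _).trans
      (Eq.trans ?_ (dirv_deltaT_succ f b (vtuple t x) (def_deltaT hx t) _ 0 _).symm)
    rw [show lastVec (n + 1) (0 : Vec (tangMon P.vec) S) = 0 from vvec_zero _]
    exact dirv_diff_right (W := tang Q.vec) (deltaT f n) (vtuple t x) (def_deltaT hx t) _ _

/-- The terms of `δ f` are symmetric. -/
lemma deltaE_perm (f : P ⟶ Q) {n : ℕ} (σ : Equiv.Perm (Fin (n + 1))) (x : Pt S P) (hx : Def x f)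
    (a : Fin (n + 1) → Vec (tangMon P.vec) S) : deltaE f x hx (a ∘ σ) = deltaE f x hx a := by
  induction n generalizing S with
  | zero => rw [show σ = 1 from Equiv.ext fun i => Subsingleton.elim (α := Fin 1) _ _]; rfl
  | succ n ih =>
    have hσ : σ ∈ Submonoid.closure
        (Set.range fun i : Fin (n + 1) => Equiv.swap i.castSucc i.succ) := by
      rw [Equiv.Perm.mclosure_swap_castSucc_succ]; trivial
    induction hσ using Submonoid.closure_induction generalizing a with
    | one => rfl
    | mul σ τ _ _ h1 h2 => exact (h2 (a ∘ σ)).trans (h1 a)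
    | mem τ h =>
      obtain ⟨i, rfl⟩ := h
      obtain ⟨b, t, rfl⟩ : ∃ b t, a = Fin.cons b t := ⟨a 0, Fin.tail a, (Fin.cons_self_tail a).symm⟩
      -- the transposition of the first two variables, or one of later variables
      induction i using Fin.cases with
      | zero =>
        obtain ⟨c, t, rfl⟩ : ∃ c r, t = Fin.cons c r :=
          ⟨t 0, Fin.tail t, (Fin.cons_self_tail t).symm⟩
        refine Eq.trans (congrArg _ ?_) (deltaE_swap f x hx c b t)
        funext k
        refine Fin.cases ?_ (fun k => Fin.cases ?_ (fun k => ?_) k) k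
        · simp
        · simp
        · have h0 : (k.succ.succ : Fin (n + 2)) ≠ 0 := Fin.succ_ne_zero _
          have h1 : (k.succ.succ : Fin (n + 2)) ≠ 1 := by
            rw [← Fin.succ_zero_eq_one]
            exact fun h => Fin.succ_ne_zero _ (Fin.succ_injective _ h)
          simp [Equiv.swap_apply_of_ne_of_ne h0 h1]
      | succ j =>
        set τ := Equiv.swap j.castSucc j.succ with hτ
        have e : (Fin.cons b t : Fin (n + 2) → Vec (tangMon P.vec) S) ∘
            Equiv.swap j.succ.castSucc j.succ.succ = Fin.cons b (t ∘ τ) := by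
          funext k
          refine Fin.cases ?_ (fun k => ?_) k
          · have : Equiv.swap j.succ.castSucc j.succ.succ 0 = 0 :=
              Equiv.swap_apply_of_ne_of_ne (by simp [Fin.ext_iff]) (Fin.succ_ne_zero _).symm
            rw [Function.comp_apply, this]
            rfl
          · have : Equiv.swap j.succ.castSucc j.succ.succ k.succ = (τ k).succ := by
              rw [hτ, Fin.castSucc_succ, ← (Fin.succ_injective _).swap_apply]
            rw [Function.comp_apply, this]
            rfl
        rw [e, deltaE_cons, deltaE_cons]
        have hp := perm_comp_deltaT f τ fun x hx a => ih τ x hx a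
        exact (dirv_perm f τ hp x hx t (fun _ => 0) b).symm

lemma tuple_perm_deltaT (f : P ⟶ Q) {n : ℕ} (σ : Equiv.Perm (Fin (n + 1))) :
    tuple (fun i => proj (tang P.vec) P (n + 1) (σ i)) (base (tang P.vec) P (n + 1)) ≫
      deltaT f n = deltaT f n :=
  perm_comp_deltaT f σ fun x hx a => deltaE_perm f σ x hx a

lemma deltaE_add (f : P ⟶ Q) (x : Pt S P) (hx : Def x f) {n : ℕ} (b c : Vec (tangMon P.vec) S)
    (t : Fin n → Vec (tangMon P.vec) S) :
    deltaE f x hx (Fin.cons (b + c) t : Fin (n + 1) → _) =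
      deltaE f x hx (Fin.cons b t : Fin (n + 1) → _) +
        deltaE f x hx (Fin.cons c t : Fin (n + 1) → _) := by
  cases n with
  | zero => exact map_add (dirv f x hx) b c
  | succ n =>
    rw [deltaE_cons, deltaE_cons, deltaE_cons, ← map_add, ← vvec_add]
    simp only [add_zero]

lemma deltaE_zero_cons (f : P ⟶ Q) (x : Pt S P) (hx : Def x f) {n : ℕ}
    (t : Fin n → Vec (tangMon P.vec) S) :
    deltaE f x hx (Fin.cons 0 t : Fin (n + 1) → _) = 0 := by
  cases n with
  | zero => exact map_zero (dirv f x hx)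
  | succ n => rw [deltaE_cons, show lastVec (n + 1) (0 : Vec (tangMon P.vec) S) =
      0 from vvec_zero _, map_zero]

/-- The derivative of a term of `δ f` in one of its variables replaces that variable by the
direction, since the term is additive in it. By symmetry it suffices to treat the first variable. -/
lemma dirv_deltaT_single (f : P ⟶ Q) (x : Pt S P) (hx : Def x f) {n : ℕ}
    (a : Fin (n + 1) → Vec (tangMon P.vec) S) (i : Fin (n + 1)) (d : Vec (tangMon P.vec) S) :
    dirv (W := tang Q.vec) (deltaT f n) (vtuple a x) (def_deltaT hx a) (vvec (Pi.single i d) 0) =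
      deltaE f x hx (Function.update a i d) := by
  -- the first variable, in which the term is a derivative and hence additive
  have zero_case (a : Fin (n + 1) → Vec (tangMon P.vec) S) :
      dirv (W := tang Q.vec) (deltaT f n) (vtuple a x) (def_deltaT hx a) (vvec (Pi.single 0 d) 0) =
        deltaE f x hx (Function.update a 0 d) := by
    have e : vvec (Pi.single 0 d : Fin (n + 1) → Vec (tangMon P.vec) S)
        (0 : Vec (tangMon P.vec) S) = tpair d 0 := by
      have : (fun i : Fin n => (Pi.single 0 d : Fin (n + 1) → Vec (tangMon P.vec) S) i.succ) =
          fun _ => 0 := funext fun i => Pi.single_eq_of_ne (Fin.succ_ne_zero _) _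
      refine congrArg₂ tpair (Pi.single_eq_same _ _) ?_
      rw [this]
      exact vvec_zero n
    refine (congrArg _ e).trans ?_
    cases n with
    | zero =>
      refine (dirv_diff_left f x hx d (a 0)).trans ?_
      rw [deltaE_zero, Function.update_self]
    | succ n =>
      refine (dirv_deltaT_succ f (a 0) (vtuple (fun i => a i.succ) x)
          (def_deltaT hx _) _ d 0).trans ?_
      refine (dirv_diff_left (W := tang Q.vec) (deltaT f n) (vtuple (fun i => a i.succ) x)
        (def_deltaT hx _) _ _).trans ?_
      refine (deltaE_cons f x hx d _).symm.trans (congrArg _ ?_)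
      funext k
      refine Fin.cases ?_ (fun k => ?_) k
      · simp
      · simp
  rw [dirv_perm f (Equiv.swap 0 i) (tuple_perm_deltaT f _) x hx a]
  have e : (Pi.single i d : Fin (n + 1) → Vec (tangMon P.vec) S) ∘ Equiv.swap 0 i =
      Pi.single 0 d := by
    rw [Pi.single_comp_equiv, Equiv.symm_swap, Equiv.swap_apply_right]
  rw [e, zero_case, ← deltaE_perm f (Equiv.swap 0 i) x hx (Function.update a i d)]
  refine congrArg _ ?_
  rw [Function.update_comp_equiv, Equiv.symm_swap, Equiv.swap_apply_right]

/-- The derivative of the terms of `δ f` in all their variables. -/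
lemma dirv_deltaT (f : P ⟶ Q) (x : Pt S P) (hx : Def x f) {n : ℕ}
    (a p : Fin (n + 1) → Vec (tangMon P.vec) S) (q : Vec (tangMon P.vec) S) :
    dirv (W := tang Q.vec) (deltaT f n) (vtuple a x) (def_deltaT hx a) (vvec p q) =
      deltaE f x hx (Fin.cons q a : Fin (n + 2) → _) +
        ∑ i, deltaE f x hx (Function.update a i (p i)) := by
  let k : (Fin (n + 1) → Vec (tangMon P.vec) S) →+
      Vec (tangMon (vars (tang P.vec) P (n + 1)).vec) S :=
    { toFun := fun p => vvec p 0
      map_zero' := vvec_zero _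
      map_add' := fun p p' => by
        rw [← vvec_add, add_zero]
        rfl }
  have e : vvec p q = vvec (fun _ => 0) q + ∑ i, k (Pi.single i (p i)) := by
    rw [← map_sum, Finset.univ_sum_single]
    change _ = _ + vvec p 0
    rw [← vvec_add]
    simp only [zero_add, add_zero]
  rw [e, map_add, map_sum, deltaE_cons]
  exact congrArg _ (Finset.sum_congr rfl fun i _ => dirv_deltaT_single f x hx a i (p i))

end DeltaSymm

section Delta

variable {C : Type u} [CartQuiver.{v} C] [CartRestrCat C] {P Q R : FaaObj C}
  {S T : Stage (FaaObj C)}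

/-- The comultiplication on objects. -/
abbrev deltaObj (P : FaaObj C) : FaaObj (FaaObj C) := ⟨tangMon P.vec, P⟩

/-- The terms of `δ f`. -/
def deltaTerms (f : P ⟶ Q) : ∀ n : ℕ, 0 < n → (vars (tang P.vec) P n ⟶ tang Q.vec)
  | n + 1, _ => deltaT f n

/-- The comultiplication on maps. -/
def delta (f : P ⟶ Q) : deltaObj P ⟶ deltaObj Q :=
  FaaHom.ofTerms (P := deltaObj P) (Q := deltaObj Q) f (deltaTerms f)
    (fun n hn => by
      obtain ⟨m, rfl⟩ := Nat.exists_eq_add_one.2 hn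
      exact rst_deltaT f m)
    (fun n hn σ => by
      obtain ⟨m, rfl⟩ := Nat.exists_eq_add_one.2 hn
      exact tuple_perm_deltaT f σ)
    (fun x y h n c a b =>
      congrArg (fun k : Vec (tangMon Q.vec) _ => k.map)
        (deltaE_add f x (by rw [Def, h, y.rst_map]) a b c))
    (fun x y h n c =>
      congrArg (fun k : Vec (tangMon Q.vec) _ => k.map)
        (deltaE_zero_cons f x (by rw [Def, h, y.rst_map]) c))

end Delta

/-! ### Functoriality of the comultiplication -/

section

variable {M : Type*}

lemma univ_map_update {n : ℕ} (a : Fin n → M) (i : Fin n) (d : M) :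
    (Finset.univ : Finset (Fin n)).val.map (Function.update a i d) =
      d ::ₘ (Finset.univ.erase i).val.map a := by
  conv_lhs => rw [← Finset.insert_erase (Finset.mem_univ i)]
  rw [Finset.insert_val_of_notMem (by simp),
    Multiset.map_cons, Function.update_self]
  congr 1
  · exact Multiset.map_congr (by simp) fun j hj => Function.update_of_ne (by
      rintro rfl
      exact Finset.univ.nodup.notMem_erase hj) _ _

lemma univ_map_cons {n : ℕ} (b : M) (a : Fin n → M) :
    (Finset.univ : Finset (Fin (n + 1))).val.map (Fin.cons b a : Fin (n + 1) → M) =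
      b ::ₘ Finset.univ.val.map a := by
  rw [Fin.univ_succ]
  simp [Function.comp_def]

end

section Terms

variable {C : Type u} [CartQuiver.{v} C] [CartRestrCat C] {P Q R : FaaObj C}

/-- The `n`-th terms of maps with the same base map agree if their jets on `n` vectors do. -/
lemma FaaHom.term_ext {f g : FaaHom P Q} (hs : f.star = g.star) {n : ℕ} (hn : 0 < n)
    (hj : ∀ {S : Stage C} (x : Pt S P.pt) (y : Pt S Q.pt) (h : x.map ≫ f.star = y.map)
      (h' : x.map ≫ g.star = y.map) (a : Fin n → Vec P.vec S),
      f.jet x y h (Finset.univ.val.map a) = g.jet x y h' (Finset.univ.val.map a)) :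
    f.term n hn = g.term n hn := by
  have h' : (genPt P f.star n).map ≫ g.star = (genTo P f.star n).map := by
    rw [← hs]; exact genPt_to P f.star n
  have h := hj (genPt P f.star n) (genTo P f.star n) (genPt_to P f.star n) h' (genVec P f.star n)
  rw [f.jet_univ _ _ _ hn, g.jet_univ _ _ _ hn] at h
  have h1 := congrArg (fun k : Vec Q.vec _ => k.map) h
  simp only [eval_map, vtuple_gen] at h1
  rw [← f.rst_term n hn, rst_self', f.rst_term n hn, hs, ← g.rst_term n hn, rst_self'] at h1
  exact h1

end Terms

section DirvTools

variable {C : Type u} [CartQuiver.{v} C] [CartRestrCat C] {X Y Z W : FaaObj C}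
  {S T : Stage (FaaObj C)} {A B : CMon C}

lemma dirv_rst_comp {e : X ⟶ Z} {h : X ⟶ Y} (x : Pt S X) (hx : Def x (rst e ≫ h))
    (hx' : Def x h) (u : Vec (tangMon X.vec) S) :
    dirv (rst e ≫ h) x hx u = dirv h x hx' u := by
  have h1 : x.map ≫ rst e = x.map := (x.of_rst_comp (z := x.to _ hx) rfl).1
  refine (dirv_comp (rst e) h x x h1 hx' hx u).trans ?_
  rw [dirv_rst]

/-- The derivative of a homomorphism at any point of its domain. -/
lemma dirv_linear (f : X.pt ⟶ Y.pt) (φ : CMonHom X.vec Y.vec) (x : Pt S X)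
    (hx : Def (Y := Y) x (FaaHom.linear f φ)) (u : Vec (tangMon X.vec) S) :
    (dirv (W := Y) (FaaHom.linear f φ) x hx u).map = u.map ≫ lin φ := by
  have h1 : pair u.map x.map ≫ rst (snd (tang X.vec) X ≫ FaaHom.linear f φ) =
      pair u.map x.map := by
    rw [comp_rst', ← Category.assoc, pair_snd, u.rst_map, x.dom_map]
    exact (congrArg (· ≫ pair u.map x.map) hx).trans (Pt.dom_map (u.toPt.pair x))
  rw [dirv_map, diff_linear, ← Category.assoc, h1, ← Category.assoc, pair_fst, x.rst_map,
    u.dom_map]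

lemma dirv_zeroMap (x : Pt S X) (hx : Def x ((tangMon A).zeroMap X))
    (u : Vec (tangMon X.vec) S) : dirv (W := tang A) ((tangMon A).zeroMap X) x hx u = 0 := by
  have h0 : Def x (bang X) := x.rst_comp_total (total_bang _)
  refine (dirv_comp (bang X) ((tangMon A).zero) x (x.to _ h0) rfl
    (Pt.rst_comp_total _ (tangMon A).zero_total) hx u).trans (Vec.ext_map ?_)
  refine (dirv_lin (CMonHom.zero A) _ _ _).trans ?_
  set w := dirv (bang X) x h0 u
  have : w.map = S.dom ≫ bang S.obj := (to_one w.map).trans (congrArg (· ≫ bang S.obj) w.rst_map)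
  rw [this, Category.assoc]
  rfl

lemma dirv_plus (h k : X ⟶ tang A) (x : Pt S X) (hh : Def x h) (hk : Def x k)
    (hx : Def x ((tangMon A).plus h k)) (u : Vec (tangMon X.vec) S) :
    dirv (W := tang A) ((tangMon A).plus h k) x hx u =
      dirv (W := tang A) h x hh u + dirv (W := tang A) k x hk u := by
  have h0 : Def x (pair h k) := by
    rw [Def, comp_pair]; exact ((x.to h hh).pair (x.to k hk)).rst_map
  refine (dirv_comp (pair h k) (tangMon A).add x (x.to _ h0) rfl
    (Pt.rst_comp_total _ (tangMon A).add_total) hx u).trans (Vec.ext_map ?_)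
  refine (dirv_lin (CMonHom.add A) _ _ _).trans ?_
  rw [dirv_pair h k x hh hk]
  rfl

lemma def_plus {K : Type*} [CartQuiver K] [CartRestrCat K] {S : Stage K} {X : K} {A : CMon K}
    {h k : X ⟶ A.car} {x : Pt S X} (hh : Def x h) (hk : Def x k) : Def x (A.plus h k) := by
  rw [Def, A.comp_plus, A.rst_plus, hh, hk, S.dom_dom]

lemma def_zeroMap {K : Type*} [CartQuiver K] [CartRestrCat K] {S : Stage K} {X : K} {A : CMon K}
    (x : Pt S X) : Def x (A.zeroMap X) :=
  x.rst_comp_total (total_comp (total_bang _) A.zero_total)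

/-- The derivative of a sum. -/
lemma dirv_sum {ι : Type} [Fintype ι] (g : ι → (X ⟶ tang A)) (x : Pt S X)
    (hg : ∀ i, Def x (g i)) (u : Vec (tangMon X.vec) S) (hx : Def x ((tangMon A).sum g)) :
    dirv (W := tang A) ((tangMon A).sum g) x hx u = ∑ i, dirv (W := tang A) (g i) x (hg i) u := by
  let := (tangMon A).homMonoid X
  have key : ∀ s : Finset ι, ∃ h : Def x (∑ i ∈ s, g i),
      dirv (W := tang A) (∑ i ∈ s, g i) x h u = ∑ i ∈ s, dirv (W := tang A) (g i) x (hg i) u := by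
    classical
    intro s
    induction s using Finset.induction_on with
    | empty => exact ⟨def_zeroMap (A := tangMon A) x, dirv_zeroMap x _ u⟩
    | insert i s hi ih =>
      obtain ⟨h, e⟩ := ih
      have hs : ∑ j ∈ insert i s, g j = (tangMon A).plus (g i) (∑ j ∈ s, g j) :=
        Finset.sum_insert hi
      have hd : Def x ((tangMon A).plus (g i) (∑ j ∈ s, g j)) :=
        def_plus (A := tangMon A) (hg i) h
      refine ⟨by rw [hs]; exact hd, ?_⟩
      refine Eq.trans ?_ (Finset.sum_insert hi).symm
      refine Eq.trans ?_ ((dirv_plus (g i) _ x (hg i) h hd u).trans (congrArg _ e))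
      exact congrArg (fun k : Vec (tangMon _) S →+ _ => k u) (dirv_congr hs rfl _ _)
  exact (key Finset.univ).2

end DirvTools

section DeltaComp

variable {C : Type u} [CartQuiver.{v} C] [CartRestrCat C] {P Q R : FaaObj C}
  {S T : Stage (FaaObj C)}

lemma def_of_eq {K : Type*} [CartQuiver K] [CartRestrCat K] {S : Stage K} {X Y : K} {x : Pt S X}
    {y : Pt S Y} {f : X ⟶ Y} (h : x.map ≫ f = y.map) : Def x f := by rw [Def, h, y.rst_map]

lemma delta_jet_univ (f : P ⟶ Q) (x : Pt S P) (y : Pt S Q) (h : x.map ≫ f = y.map) {n : ℕ}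
    (a : Fin (n + 1) → Vec (tangMon P.vec) S) :
    FaaHom.jet (delta f) x y h (Finset.univ.val.map a) = deltaE f x (def_of_eq h) a :=
  FaaHom.jet_univ (delta f) x y h n.succ_pos a

lemma delta_jet_singleton (f : P ⟶ Q) (x : Pt S P) (y : Pt S Q) (h : x.map ≫ f = y.map)
    (a : Vec (tangMon P.vec) S) :
    FaaHom.jet (delta f) x y h {a} = dirv f x (def_of_eq h) a :=
  delta_jet_univ f x y h (fun _ : Fin 1 => a)

lemma def_delta_term {f : P ⟶ Q} {x : Pt S P} (hx : Def x f) {n : ℕ} (hn : 0 < n)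
    (a : Fin n → Vec (tangMon P.vec) S) :
    Def (Y := tang Q.vec) (vtuple a x) (FaaHom.term (delta f) n hn) := by
  obtain ⟨m, rfl⟩ := Nat.exists_eq_add_one.2 hn
  exact def_deltaT hx a

/-- The derivative of a term of `δ f` is the derivative of its jets. -/
lemma dirv_delta_term (f : P ⟶ Q) (x : Pt S P) (y : Pt S Q) (h : x.map ≫ f = y.map) {n : ℕ}
    (hn : 0 < n) (a p : Fin n → Vec (tangMon P.vec) S) (q : Vec (tangMon P.vec) S)
    (hd : Def (Y := tang Q.vec) (vtuple a x) (FaaHom.term (delta f) n hn)) :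
    dirv (W := tang Q.vec) (FaaHom.term (delta f) n hn) (vtuple a x) hd (vvec p q) =
      dirJ (FaaHom.jet (delta f) x y h) q p a Finset.univ.val := by
  obtain ⟨m, rfl⟩ := Nat.exists_eq_add_one.2 hn
  refine (dirv_deltaT f x (def_of_eq h) a p q).trans ?_
  have e := pickSum_univ (fun i : Fin (m + 1) => i)
    fun i r => FaaHom.jet (delta f) x y h (p i ::ₘ r.map a)
  rw [Multiset.map_id'] at e
  unfold dirJ
  rw [e, ← univ_map_cons, delta_jet_univ]
  refine congrArg _ (Finset.sum_congr rfl fun i _ => ?_)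
  rw [Multiset.map_id', ← univ_map_update, delta_jet_univ]

/-- The jets of `δ f` on one more vector are the derivatives in the direction of the base point. -/
lemma delta_jet_cons (f : P ⟶ Q) (x : Pt S P) (y : Pt S Q) (h : x.map ≫ f = y.map) {n : ℕ}
    (hn : 0 < n) (q : Vec (tangMon P.vec) S) (a : Fin n → Vec (tangMon P.vec) S) :
    FaaHom.jet (delta f) x y h (q ::ₘ Finset.univ.val.map a) =
      dirv (W := tang Q.vec) (FaaHom.term (delta f) n hn) (vtuple a x)
        (def_delta_term (def_of_eq h) hn a) (lastVec n q) := by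
  obtain ⟨m, rfl⟩ := Nat.exists_eq_add_one.2 hn
  rw [← univ_map_cons, delta_jet_univ]
  exact deltaE_cons f x (def_of_eq h) q a

/-- The chain rule for a composite with a term of `δ g`. -/
lemma dirv_tuple_delta_term (g : Q ⟶ R) {Z : FaaObj C} (z : Pt S Z) (y : Pt S Q) (w : Pt S R)
    (hg : y.map ≫ g = w.map) {k : ℕ} (hk : 0 < k) (t : Fin k → (Z ⟶ tang Q.vec)) (b : Z ⟶ Q)
    (ht : ∀ m, Def z (t m)) (hb : Def z b) (α : Fin k → Vec (tangMon Q.vec) S)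
    (hα : ∀ m, z.map ≫ t m = (α m).map) (hy : z.map ≫ b = y.map)
    (hd : Def (Y := tang R.vec) z (tuple t b ≫ FaaHom.term (delta g) k hk))
    (u : Vec (tangMon Z.vec) S) :
    dirv (W := tang R.vec) (tuple t b ≫ FaaHom.term (delta g) k hk) z hd u =
      dirJ (FaaHom.jet (delta g) y w hg) (dirv b z hb u)
        (fun m => dirv (W := tang Q.vec) (t m) z (ht m) u) α Finset.univ.val := by
  have htup : z.map ≫ tuple t b = (vtuple α y).map := by
    refine (comp_tuple _ _ _).trans ?_
    rw [hy, funext hα]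
    rfl
  refine (dirv_comp (tuple t b) (FaaHom.term (delta g) k hk) z (vtuple α y) htup
    (def_delta_term (def_of_eq hg) hk _) hd _).trans ?_
  refine Eq.trans (congrArg _ (dirv_tuple t b z ht hb _ u)) ?_
  exact dirv_delta_term g y w hg hk α _ _ _

lemma def_tuple_delta_term (g : Q ⟶ R) {Z : FaaObj C} (z : Pt S Z) (y : Pt S Q) (w : Pt S R)
    (hg : y.map ≫ g = w.map) {k : ℕ} (hk : 0 < k) (t : Fin k → (Z ⟶ tang Q.vec)) (b : Z ⟶ Q)
    (α : Fin k → Vec (tangMon Q.vec) S)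
    (hα : ∀ m, z.map ≫ t m = (α m).map) (hy : z.map ≫ b = y.map) :
    Def (Y := tang R.vec) z (tuple t b ≫ FaaHom.term (delta g) k hk) := by
  have htup : z.map ≫ tuple t b = (vtuple α y).map := by
    refine (comp_tuple _ _ _).trans ?_
    rw [hy, funext hα]
    rfl
  rw [Def, ← Category.assoc, htup]
  exact def_delta_term (def_of_eq hg) hk _

/-- The jets of `δ (f g)` on one more vector, from the Faà di Bruno formula. -/
lemma dirv_compTerm (f : P ⟶ Q) (g : Q ⟶ R) (x : Pt S P) (y : Pt S Q) (z : Pt S R)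
    (hf : x.map ≫ f = y.map) (hg : y.map ≫ g = z.map) {n : ℕ} (hn : 0 < n)
    (a : Fin n → Vec (tangMon P.vec) S) (q : Vec (tangMon P.vec) S)
    (hd : Def (Y := tang R.vec) (vtuple a x) (compTerm (delta f) (delta g) n hn)) :
    dirv (W := tang R.vec) (compTerm (delta f) (delta g) n hn) (vtuple a x) hd (lastVec n q) =
      compJ (FaaHom.jet (delta f) x y hf) (FaaHom.jet (delta g) y z hg)
        (q ::ₘ Finset.univ.val.map a) := by
  set φ := FaaHom.jet (delta f) x y hf
  set ψ := FaaHom.jet (delta g) y z hg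
  have hdf : Def x f := def_of_eq hf
  have hdg : Def y g := def_of_eq hg
  -- In the direction of the base point, the derivative of `f_{|b|}` at the variables in a block `b`
  -- adds the new vector to the block; the derivative of the base map makes it a block of its own.
  have hin (k : ℕ) (e : Fin k → Fin n) :
      (vtuple a x).map ≫ tuple (fun j => proj (tang P.vec) P n (e j)) (base (tang P.vec) P n) =
        (vtuple (fun j => a (e j)) x).map := by
    refine (comp_tuple _ _ _).trans ?_
    have h1 : ∀ j, (vtuple a x).map ≫ proj (tang P.vec) P n (e j) = (a (e j)).map :=
      fun j => vtuple_proj (A := tangMon P.vec) a x (e j)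
    have h2 : (vtuple a x).map ≫ base (tang P.vec) P n = x.map :=
      vtuple_base (A := tangMon P.vec) a x
    rw [h2, funext h1]
    rfl
  have hval (c : OrderedFinpartition n) (m : Fin c.length) :
      (vtuple a x).map ≫ tuple (fun j => proj (tang P.vec) P n (c.emb m j))
        (base (tang P.vec) P n) ≫ FaaHom.term (delta f) (c.partSize m) (c.partSize_pos m) =
      (φ (Finset.univ.val.map fun j => a (c.emb m j))).map := by
    rw [← Category.assoc, hin]
    exact congrArg (fun k : Vec (tangMon Q.vec) S => k.map)
      (FaaHom.jet_univ (delta f) x y hf (c.partSize_pos m) _).symm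
  have hbase : (vtuple a x).map ≫ base (tang P.vec) P n ≫ f = y.map := by
    rw [← Category.assoc, ← hf]
    exact congrArg (· ≫ f) (vtuple_base (A := tangMon P.vec) a x)
  have hdm (c : OrderedFinpartition n) (m : Fin c.length) : Def (Y := tang Q.vec) (vtuple a x)
      (tuple (fun j => proj (tang P.vec) P n (c.emb m j)) (base (tang P.vec) P n) ≫
        FaaHom.term (delta f) (c.partSize m) (c.partSize_pos m)) :=
    (congrArg rst (hval c m)).trans (Pt.rst_map _)
  have hdc (c : OrderedFinpartition n) : Def (Y := tang R.vec) (vtuple a x) (tuple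
      (fun m => tuple (fun j => proj (tang P.vec) P n (c.emb m j)) (base (tang P.vec) P n) ≫
        FaaHom.term (delta f) (c.partSize m) (c.partSize_pos m))
      (base (tang P.vec) P n ≫ f) ≫ FaaHom.term (delta g) c.length (c.length_pos hn)) :=
    def_tuple_delta_term g (vtuple a x) y z hg (c.length_pos hn) _ _ _ (hval c) hbase
  have hdin (c : OrderedFinpartition n) (m : Fin c.length) :
      dirv (W := tang Q.vec) (tuple (fun j => proj (tang P.vec) P n (c.emb m j))
        (base (tang P.vec) P n) ≫ FaaHom.term (delta f) (c.partSize m) (c.partSize_pos m))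
        (vtuple a x) (hdm c m) (lastVec n q) =
      φ (q ::ₘ Finset.univ.val.map fun j => a (c.emb m j)) := by
    refine (dirv_comp _ (FaaHom.term (delta f) (c.partSize m) (c.partSize_pos m)) (vtuple a x) _
      (hin _ (c.emb m)) (def_delta_term hdf (c.partSize_pos m) _) _ _).trans ?_
    refine Eq.trans ?_ (delta_jet_cons f x y hf (c.partSize_pos m) q _).symm
    refine congrArg _ ((dirv_tuple _ _ _ (fun i => Pt.rst_comp_total _ (total_proj _ _))
      (Pt.rst_comp_total _ (total_base _)) _ _).trans ?_)
    exact congrArg₂ vvec (funext fun i => dirv_proj _ _ _ _ _) (dirv_base _ _ _ _)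
  have hdbase (hb : Def (vtuple a x) (base (tang P.vec) P n ≫ f)) :
      dirv (base (tang P.vec) P n ≫ f) (vtuple a x) hb (lastVec n q) = φ {q} := by
    refine (dirv_comp (base (tang P.vec) P n) f (vtuple a x) x
      (vtuple_base (A := tangMon P.vec) a x) hdf hb _).trans ?_
    refine Eq.trans (congrArg _ (dirv_base _ _ _ _)) (delta_jet_singleton f x y hf q).symm
  have hterm (c : OrderedFinpartition n) :
      dirv (W := tang R.vec) (tuple
        (fun m => tuple (fun j => proj (tang P.vec) P n (c.emb m j)) (base (tang P.vec) P n) ≫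
          FaaHom.term (delta f) (c.partSize m) (c.partSize_pos m))
        (base (tang P.vec) P n ≫ f) ≫ FaaHom.term (delta g) c.length (c.length_pos hn))
        (vtuple a x) (hdc c) (lastVec n q) =
      dirJ ψ (φ {q}) (fun b => φ (q ::ₘ b)) φ (blocks c a) := by
    refine (dirv_tuple_delta_term g (vtuple a x) y z hg (c.length_pos hn) _ _ (hdm c)
      (def_of_eq hbase) _ (hval c) hbase (hdc c) _).trans ?_
    rw [hdbase, funext (hdin c), blocks, dirJ_map]
    rfl
  refine (dirv_sum (A := R.vec) _ (vtuple a x) hdc _ hd).trans ?_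
  rw [compJ, partSum_cons, ← sum_orderedFinpartition]
  refine Finset.sum_congr rfl fun c _ => (hterm c).trans ?_
  simp only [dirJ, partStep, Multiset.map_cons]

/-- Functoriality, by induction on the number of the term: the next term of either side is the
derivative of the one before in the direction of the base point, and for the composite it is
computed by the chain rule. -/
lemma delta_comp (f : P ⟶ Q) (g : Q ⟶ R) : delta (f ≫ g) = delta f ≫ delta g := by
  refine FaaHom.ext (P := deltaObj P) (Q := deltaObj R) rfl (funext fun n => funext fun hn => ?_)
  obtain ⟨n, rfl⟩ := Nat.exists_eq_add_one.2 hn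
  induction n with
  | zero =>
    refine FaaHom.term_ext (P := deltaObj P) (Q := deltaObj R) (f := delta (f ≫ g))
      (g := delta f ≫ delta g) rfl hn fun {S} x z h h' a => ?_
    obtain ⟨y, h1, h2⟩ := x.exists_mid (f := f) (g := g) h'
    obtain ⟨b, rfl⟩ : ∃ b, a = fun _ => b := ⟨a 0, funext fun i => by rw [Subsingleton.elim (α :=
        Fin 1) i 0]⟩
    refine (delta_jet_singleton (f ≫ g) x z h b).trans ?_
    refine Eq.symm ((FaaHom.comp_jet (delta f) (delta g) x y z h' h1 h2 {b}).trans ?_)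
    rw [compJ_singleton, delta_jet_singleton, delta_jet_singleton]
    exact (dirv_comp f g x y h1 _ _ b).symm
  | succ n ih =>
    refine FaaHom.term_ext (P := deltaObj P) (Q := deltaObj R) (f := delta (f ≫ g))
      (g := delta f ≫ delta g) rfl hn fun {S} x z h h' a => ?_
    obtain ⟨y, h1, h2⟩ := x.exists_mid (f := f) (g := g) h'
    obtain ⟨b, t, rfl⟩ : ∃ b t, a = Fin.cons b t := ⟨a 0, Fin.tail a, (Fin.cons_self_tail a).symm⟩
    refine Eq.trans ?_ (FaaHom.comp_jet (delta f) (delta g) x y z h' h1 h2 _).symm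
    rw [univ_map_cons]
    refine (delta_jet_cons (f ≫ g) x z h n.succ_pos b t).trans ?_
    have e : FaaHom.term (delta (f ≫ g)) (n + 1) n.succ_pos =
      compTerm (delta f) (delta g) (n + 1) n.succ_pos :=
        (ih n.succ_pos).trans (FaaHom.comp_term (delta f) (delta g) _ _)
    have hd : Def (Y := tang R.vec) (vtuple t x) (compTerm (delta f) (delta g)
        (n + 1) n.succ_pos) := by
      rw [← e]
      exact def_delta_term (def_of_eq h) n.succ_pos t
    refine Eq.trans ?_ (dirv_compTerm f g x y z h1 h2 n.succ_pos t b hd)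
    exact congrArg (fun k : Vec (tangMon _) S →+ _ => k (lastVec (n + 1) b)) (dirv_congr e rfl _ _)

end DeltaComp

section DeltaFunctor

variable {C : Type u} [CartQuiver.{v} C] [CartRestrCat C] {P Q R : FaaObj C} {A B : CMon C}

lemma pair_fst_snd_eq_id (X Y : C) : pair (fst X Y) (snd X Y) = 𝟙 (prod X Y) := by
  refine (pair_unique' ?_ ?_ ?_).symm
  · rw [total_snd]
  · rw [total_fst]
  · rw [total_fst, total_snd, Category.comp_id]; exact total_id _

/-- A homomorphism of commutative monoids, as a homomorphism of tangent monoids. -/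
def tangHom (φ : CMonHom A B) : CMonHom (tangMon A) (tangMon B) where
  map := lin φ
  total := lin_total φ
  plus_comp f g := by
    have h := lin_congr (φ := (CMonHom.add A).comp φ)
      (ψ := (((CMonHom.fst A A).comp φ).pair ((CMonHom.snd A A).comp φ)).comp (CMonHom.add B)) (by
        have h := φ.plus_comp (fst A.car A.car) (snd A.car A.car)
        unfold CMon.plus at h
        rwa [pair_fst_snd_eq_id, Category.id_comp] at h)
    rw [← lin_comp, ← lin_comp, ← lin_pair, ← lin_comp, ← lin_comp] at h
    have h1 : pair f g ≫ pair (fst (tang A) (tang A) ≫ lin φ) (snd (tang A) (tang A) ≫ lin φ) =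
        pair (f ≫ lin φ) (g ≫ lin φ) := by
      rw [comp_pair, ← Category.assoc, ← Category.assoc, pair_fst, pair_snd, Category.assoc,
        Category.assoc, pair_rst_left, pair_rst_right, ← rst_self' (pair _ _), rst_pair',
        rst_comp_total f (lin_total φ), rst_comp_total g (lin_total φ), Category.assoc]
      simp only [rst_left_comm, rst_idem]
    change (pair f g ≫ lin (CMonHom.add A)) ≫ lin φ = _ ≫ lin (CMonHom.add B)
    rw [Category.assoc, h, ← Category.assoc]
    exact congrArg (· ≫ lin (CMonHom.add B)) h1
  zero_comp := by
    have h := lin_congr (φ := (CMonHom.zero A).comp φ) (ψ := CMonHom.zero B) φ.zero_comp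
    rwa [← lin_comp] at h

/-- The comultiplication of a linear map is linear. -/
lemma delta_linear (f : P.pt ⟶ Q.pt) (φ : CMonHom P.vec Q.vec) :
    delta (P := P) (Q := Q) (FaaHom.linear f φ) =
      FaaHom.linear (P := deltaObj P) (Q := deltaObj Q) (FaaHom.linear f φ) (tangHom φ) := by
  refine FaaHom.ext (P := deltaObj P) (Q := deltaObj Q) rfl (funext fun n => funext fun hn => ?_)
  obtain ⟨n, rfl⟩ := Nat.exists_eq_add_one.2 hn
  induction n with
  | zero =>
    refine FaaHom.term_ext (P := deltaObj P) (Q := deltaObj Q)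
      (f := delta (P := P) (Q := Q) (FaaHom.linear f φ)) (g := FaaHom.linear (P := deltaObj P)
        (Q := deltaObj Q) (FaaHom.linear f φ) (tangHom φ)) rfl hn fun {S} x y h h' a => ?_
    obtain ⟨b, rfl⟩ : ∃ b, a = fun _ => b :=
      ⟨a 0, funext fun i => by rw [Subsingleton.elim (α := Fin 1) i 0]⟩
    refine (delta_jet_singleton (P := P) (Q := Q) (FaaHom.linear f φ) x y h b).trans ?_
    refine Eq.trans ?_ (FaaHom.linear_jet (P := deltaObj P) (Q := deltaObj Q)
      (FaaHom.linear f φ) (tangHom φ) x y h' {b}).symm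
    rw [linJ_singleton]
    exact Vec.ext_map (dirv_linear f φ x _ b)
  | succ n ih =>
    refine FaaHom.term_ext (P := deltaObj P) (Q := deltaObj Q)
      (f := delta (P := P) (Q := Q) (FaaHom.linear f φ)) (g := FaaHom.linear (P := deltaObj P)
        (Q := deltaObj Q) (FaaHom.linear f φ) (tangHom φ)) rfl hn fun {S} x y h h' a => ?_
    obtain ⟨b, t, rfl⟩ : ∃ b t, a = Fin.cons b t := ⟨a 0, Fin.tail a, (Fin.cons_self_tail a).symm⟩
    refine Eq.trans ?_ (FaaHom.linear_jet (P := deltaObj P) (Q := deltaObj Q)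
      (FaaHom.linear f φ) (tangHom φ) x y h' _).symm
    have e0 : (Finset.univ : Finset (Fin (n + 1))).val.map t =
        t 0 ::ₘ Finset.univ.val.map (Fin.tail t) := by
      rw [← univ_map_cons, Fin.cons_self_tail]
    rw [univ_map_cons]
    refine Eq.trans ?_ ((congrArg (fun s => linJ (tangHom φ).vec (b ::ₘ s)) e0).trans
      (linJ_cons_cons _ _ _ _)).symm
    refine (delta_jet_cons (P := P) (Q := Q) (FaaHom.linear f φ) x y h n.succ_pos b t).trans ?_
    have e : FaaHom.term (delta (P := P) (Q := Q) (FaaHom.linear f φ)) (n + 1) n.succ_pos =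
      rst (base (tang P.vec) P (n + 1) ≫ (FaaHom.linear f φ : P ⟶ Q)) ≫
        linTerm P (tangMon Q.vec) (lin φ) (n + 1) n.succ_pos :=
      (ih n.succ_pos).trans (FaaHom.linear_term (P := deltaObj P) (Q := deltaObj Q)
        (FaaHom.linear f φ) (tangHom φ) _ _)
    have hd : Def (Y := tang Q.vec) (vtuple t x)
        (FaaHom.term (delta (P := P) (Q := Q) (FaaHom.linear f φ)) (n + 1) n.succ_pos) :=
      def_delta_term (def_of_eq h) n.succ_pos t
    rw [e] at hd
    refine (congrArg (fun k : Vec (tangMon _) S →+ _ => k (lastVec (n + 1) b))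
      (dirv_congr e rfl _ hd)).trans ?_
    by_cases hn : n + 1 = 1
    · have e1 : linTerm P (tangMon Q.vec) (lin φ) (n + 1) n.succ_pos =
        proj (tang P.vec) P (n + 1) 0 ≫ lin φ := if_pos hn
      have d1 : Def (vtuple t x) (proj (tang P.vec) P (n + 1) 0 ≫ lin φ) :=
        Pt.rst_comp_total _ (total_comp (total_proj _ _) (lin_total _))
      have d2 : Def (vtuple t x) (proj (tang P.vec) P (n + 1) 0) :=
        Pt.rst_comp_total _ (total_proj _ _)
      rw [e1] at hd
      refine (congrArg (fun k : Vec (tangMon _) S →+ _ => k (lastVec (n + 1) b))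
        (dirv_congr (congrArg _ e1) rfl _ hd)).trans ?_
      refine (dirv_rst_comp (Y := tang Q.vec) _ hd d1 _).trans ?_
      refine (dirv_comp _ (lin φ) (vtuple t x) ((vtuple t x).to _ d2) rfl
        (Pt.rst_comp_total _ (lin_total _)) d1 _).trans (Vec.ext_map ?_)
      refine (dirv_lin φ _ _ _).trans ?_
      rw [dirv_proj]
      exact congrArg (fun v : Vec (tangMon Q.vec) S => v.map) (map_zero (tangHom φ).vec)
    · have e1 : linTerm P (tangMon Q.vec) (lin φ) (n + 1) n.succ_pos =
        (tangMon Q.vec).zeroMap _ := if_neg hn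
      rw [e1] at hd
      refine (congrArg (fun k : Vec (tangMon _) S →+ _ => k (lastVec (n + 1) b))
        (dirv_congr (congrArg _ e1) rfl _ hd)).trans ?_
      refine (dirv_rst_comp (Y := tang Q.vec) _ hd (def_zeroMap (A := tangMon Q.vec) _) _).trans ?_
      exact dirv_zeroMap _ _ _

lemma linear_sameArrow {A A' : CMon C} (h : A = A') {X : C} (f : X ⟶ Q.pt)
    (φ : CMonHom A Q.vec) (φ' : CMonHom A' Q.vec) (hφ : HEq φ.map φ'.map) :
    SameArrow (C := FaaObj C) (X := ⟨A, X⟩) (X' := ⟨A', X⟩) (Y := Q) (Y' := Q)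
      (FaaHom.linear (P := ⟨A, X⟩) f φ) (FaaHom.linear (P := ⟨A', X⟩) f φ') := by
  subst h
  exact SameArrow.of_eq (FaaHom.linear_congr rfl (eq_of_heq hφ))

lemma delta_fst (P Q : FaaObj C) :
    SameArrow (delta (fst P Q)) (fst (deltaObj P) (deltaObj Q)) := by
  have h := delta_linear (P := prod P Q) (Q := P) (fst P.pt Q.pt) (CMonHom.fst P.vec Q.vec)
  have h' := linear_sameArrow (Q := deltaObj P) (tangMon_prod P.vec Q.vec) (fst P Q)
    (tangHom (CMonHom.fst P.vec Q.vec)) (CMonHom.fst (tangMon P.vec) (tangMon Q.vec)) HEq.rfl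
  exact (SameArrow.of_eq h).trans' h'

lemma delta_snd (P Q : FaaObj C) :
    SameArrow (delta (snd P Q)) (snd (deltaObj P) (deltaObj Q)) := by
  have h := delta_linear (P := prod P Q) (Q := Q) (snd P.pt Q.pt) (CMonHom.snd P.vec Q.vec)
  have h' := linear_sameArrow (Q := deltaObj Q) (tangMon_prod P.vec Q.vec) (snd P Q)
    (tangHom (CMonHom.snd P.vec Q.vec)) (CMonHom.snd (tangMon P.vec) (tangMon Q.vec)) HEq.rfl
  exact (SameArrow.of_eq h).trans' h'

lemma deltaObj_prod (P Q : FaaObj C) : deltaObj (prod P Q) = prod (deltaObj P) (deltaObj Q) :=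
  FaaObj.ext (tangMon_prod P.vec Q.vec) rfl

lemma deltaObj_one : deltaObj (one : FaaObj C) = one := FaaObj.ext tangMon_triv rfl

variable (C) in
/-- The comultiplication of the Faà di Bruno comonad. -/
def deltaFunctor : CRFunctor (FaaObj C) (FaaObj (FaaObj C)) where
  obj := deltaObj
  map := delta
  map_id P := (delta_linear (P := P) (Q := P) _ _).trans (FaaHom.linear_congr rfl rfl)
  map_comp f g := delta_comp f g
  map_rst {P Q} f := (delta_linear (P := P) (Q := P) _ _).trans (FaaHom.linear_congr rfl rfl)
  obj_one := deltaObj_one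
  obj_prod P Q := deltaObj_prod P Q
  map_fst P Q := delta_fst P Q
  map_snd P Q := delta_snd P Q

end DeltaFunctor

/-! ### The comultiplication as a sum over partial injections -/

section MatchSum

variable {M K : Type*} [AddCommMonoid K]

/-- The vector `(a₁, …, a_n, b)` without its first component. -/
def tailD {n : ℕ} (d : (Fin (n + 1) → M) × M) : (Fin n → M) × M := (fun i => d.1 i.succ, d.2)

/-- The sum of `F (w₁, …, w_n, b_{j₁}, …, b_{j_k})` over all ways to replace some of the entries
`v i` of the family `v` by the `i`-th components of pairwise different directions in `s`, where the
`b_j` are the last components of the remaining directions. -/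
def matchSum : ∀ {n : ℕ}, (Multiset M → K) → (Fin n → M) → Multiset ((Fin n → M) × M) → K
  | 0, F, _, s => F (s.map Prod.snd)
  | _ + 1, F, v, s => matchSum (fun t => F (v 0 ::ₘ t)) (fun i => v i.succ) (s.map tailD) +
      pickSum s fun d r => matchSum (fun t => F (d.1 0 ::ₘ t)) (fun i => v i.succ) (r.map tailD)

lemma matchSum_const_zero {n : ℕ} (v : Fin n → M) (s : Multiset ((Fin n → M) × M)) :
    matchSum (fun _ => (0 : K)) v s = 0 := by
  induction n with
  | zero => rfl
  | succ n ih => simp [matchSum, ih]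

lemma MultiAdd.cons [AddCommMonoid M] {F : Multiset M → K} (hF : MultiAdd F) (a : M) :
    MultiAdd fun t => F (a ::ₘ t) where
  add b c t := by simp only [Multiset.cons_swap a, hF.add]
  zero t := by simp only [Multiset.cons_swap a, hF.zero]

/-- A direction along the base point is never used for a replacement. -/
lemma matchSum_cons_zero [AddCommMonoid M] {n : ℕ} {F : Multiset M → K} (hF : MultiAdd F)
    (v : Fin n → M) (u : M)
    (s : Multiset ((Fin n → M) × M)) :
    matchSum F v ((0, u) ::ₘ s) = matchSum (fun t => F (u ::ₘ t)) v s := by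
  induction n generalizing F with
  | zero => simp [matchSum]
  | succ n ih =>
    have e : tailD ((0 : Fin (n + 1) → M), u) = (0, u) := rfl
    simp only [matchSum, Multiset.map_cons, pickSum_cons, e, Pi.zero_apply, hF.zero,
      matchSum_const_zero, zero_add, ih (hF.cons _), Multiset.cons_swap u]

lemma matchSum_zero {n : ℕ} (F : Multiset M → K) (v : Fin n → M) :
    matchSum F v 0 = F (Finset.univ.val.map v) := by
  induction n generalizing F with
  | zero => rfl
  | succ n ih => rw [matchSum, Multiset.map_zero, ih, pickSum_zero, add_zero, univ_map_succ]

end MatchSum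

section DeltaJets

variable {C : Type u} [CartQuiver.{v} C] [CartRestrCat C] {P Q R : FaaObj C} {S : Stage C}
  {A : CMon C}

/-- A base point of `vars (tang A) P n`, from its components. -/
def zpt : ∀ {n : ℕ}, (Fin n → Vec A S) → Pt S P.pt → Pt S (vars (tang A) P n).pt
  | 0, _, x => x
  | _ + 1, a, x => (a 0).toPt.pair (zpt (fun i => a i.succ) x)

/-- A vector of `vars (tang A) P n`, from its components. -/
def zvec : ∀ {n : ℕ}, (Fin n → Vec A S) × Vec P.vec S → Vec (vars (tang A) P n).vec S
  | 0, d => d.2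
  | _ + 1, d => (d.1 0).pair (zvec (fun i => d.1 i.succ, d.2))

lemma CMonHom.pair_vec {A B D : CMon C} (φ : CMonHom A B) (ψ : CMonHom A D) (a : Vec A S) :
    (φ.pair ψ).vec a = (φ.vec a).pair (ψ.vec a) := Vec.ext_map (comp_pair _ _ _)

lemma CMonHom.comp_vec {A B D : CMon C} (φ : CMonHom A B) (ψ : CMonHom B D) (a : Vec A S) :
    (φ.comp ψ).vec a = ψ.vec (φ.vec a) := Vec.ext_map (Category.assoc _ _ _).symm

lemma lastHom_vec (n : ℕ) (u : Vec P.vec S) :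
    (lastHom P n).vec u = zvec (A := P.vec) ((0 : Fin n → Vec P.vec S), u) := by
  induction n with
  | zero => exact CMonHom.id_vec u
  | succ n ih =>
    refine Vec.ext_map ((comp_pair _ _ _).trans ?_)
    refine congrArg₂ CartRestrCat.pair ?_ (congrArg (fun k : Vec _ S => k.map) ih)
    change u.map ≫ bang _ ≫ P.vec.zero = S.dom ≫ bang _ ≫ P.vec.zero
    rw [← Category.assoc, to_one (u.map ≫ bang _), rst_comp_total _ (total_bang _), u.rst_map,
      Category.assoc]

lemma diff_jet_pair (f : P ⟶ Q) (v : Vec P.vec S) (p : Pt S P.pt) (y : Pt S Q.vec.car)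
    (h : (v.toPt.pair p).map ≫ FaaHom.star (diff f) = y.map) (q : Pt S Q.pt)
    (hq : p.map ≫ FaaHom.star f = q.map) {s : Multiset (Vec (P.vec.prod P.vec) S)}
    (hs : s ≠ 0) :
    FaaHom.jet (diff f) (v.toPt.pair p) y h s = dirJ (FaaHom.jet f p q hq) v Vec.fst Vec.snd s := by
  have e := Pt.snd_pair v.toPt p
  refine (diff_jet f (v.toPt.pair p) y h q (by rw [e, hq]) hs).trans ?_
  rw [Pt.fst_pair]
  exact congrArg (fun φ => dirJ φ _ _ _ s) (funext (FaaHom.jet_congr_pt f _ _ e rfl))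

lemma deltaT_zero_star_jet (f : P ⟶ Q) (a : Fin 1 → Vec P.vec S) (x : Pt S P.pt) (q : Pt S Q.pt)
    (hq : x.map ≫ FaaHom.star f = q.map) :
    (zpt a x).map ≫ FaaHom.star (deltaT f 0) = (FaaHom.jet f x q hq (Finset.univ.val.map a)).map :=
  (FaaHom.jet_singleton f x q hq (a 0)).symm

/-- The change of variables in the recursion for the terms of `δ f`, as a linear map. -/
lemma pair_lastHom_eq (P : FaaObj C) (n : ℕ) :
    CartRestrCat.pair (fst (tang P.vec) (vars (tang P.vec) P n) ≫ lin (lastHom P n))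
      (snd (tang P.vec) (vars (tang P.vec) P n)) =
    FaaHom.linear (P := prod (tang P.vec) (vars (tang P.vec) P n))
      (Q := prod (tang (vars (tang P.vec) P n).vec) (vars (tang P.vec) P n))
      (CartRestrCat.pair (fst P.vec.car (vars (tang P.vec) P n).pt ≫ (lastHom P n).map)
        (snd P.vec.car (vars (tang P.vec) P n).pt))
      (((CMonHom.fst P.vec (vars (tang P.vec) P n).vec).comp (lastHom P n)).pair
        (CMonHom.snd P.vec (vars (tang P.vec) P n).vec)) := by
  have h : fst (tang P.vec) (vars (tang P.vec) P n) ≫ lin (lastHom P n) =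
      FaaHom.linear (P := prod (tang P.vec) (vars (tang P.vec) P n))
        (Q := tang (vars (tang P.vec) P n).vec)
        (fst P.vec.car (vars (tang P.vec) P n).pt ≫ (lastHom P n).map)
        ((CMonHom.fst P.vec (vars (tang P.vec) P n).vec).comp (lastHom P n)) :=
    FaaHom.linear_comp _ _ _ _
  rw [h]
  exact FaaHom.pair_linear _ _ _ _

/-- The values and the jets of the terms of `δ f`. -/
lemma deltaT_star_jet (f : P ⟶ Q) {n : ℕ} (v : Fin (n + 1) → Vec P.vec S) (x : Pt S P.pt)
    (q : Pt S Q.pt) (hq : x.map ≫ FaaHom.star f = q.map) :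
    ∃ h : (zpt v x).map ≫ FaaHom.star (deltaT f n) =
        (FaaHom.jet f x q hq (Finset.univ.val.map v)).map,
      ∀ s : Multiset ((Fin (n + 1) → Vec P.vec S) × Vec P.vec S), s ≠ 0 →
        FaaHom.jet (deltaT f n) (zpt v x) (FaaHom.jet f x q hq (Finset.univ.val.map v)).toPt h
          (s.map zvec) = matchSum (FaaHom.jet f x q hq) v s := by
  induction n with
  | zero =>
    refine ⟨deltaT_zero_star_jet f v x q hq, fun s hs => ?_⟩
    refine (diff_jet_pair f (v 0) x _ _ q hq (by simpa using hs)).trans ?_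
    rw [dirJ_map, dirJ]
    simp only [matchSum, Multiset.map_map]
    have e1 : (Vec.snd : Vec (P.vec.prod P.vec) S → Vec P.vec S) ∘ zvec (n := 1) =
        fun d : (Fin 1 → Vec P.vec S) × Vec P.vec S => d.2 :=
      funext fun d => Vec.snd_pair _ _
    have e2 : (Vec.fst : Vec (P.vec.prod P.vec) S → Vec P.vec S) ∘ zvec (n := 1) =
        fun d : (Fin 1 → Vec P.vec S) × Vec P.vec S => d.1 0 :=
      funext fun d => Vec.fst_pair _ _
    refine congrArg₂ (· + ·) ?_ ?_
    · exact congrArg (fun k => FaaHom.jet f x q hq (v 0 ::ₘ s.map k)) e1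
    · exact congrArg₂ (fun k l => pickSum s fun d r => FaaHom.jet f x q hq (k d ::ₘ r.map l)) e2 e1
  | succ n ih =>
    set F := FaaHom.jet f x q hq with hF
    have hFm : MultiAdd F := FaaHom.jet_multiAdd f x q hq
    obtain ⟨h, hj⟩ := ih (fun i => v i.succ)
    set w := F (Finset.univ.val.map fun i : Fin (n + 1) => v i.succ) with hw
    set L := zvec (A := P.vec) ((0 : Fin (n + 1) → Vec P.vec S), v 0) with hL
    -- the point at which the derivative of the previous term is taken
    set z := L.toPt.pair (zpt (fun i => v i.succ) x) with hz
    have hlin : (zpt v x).map ≫ FaaHom.star (CartRestrCat.pair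
        (fst (tang P.vec) (vars (tang P.vec) P (n + 1)) ≫ lin (lastHom P (n + 1)))
        (snd (tang P.vec) (vars (tang P.vec) P (n + 1)))) = z.map := by
      refine (comp_pair _ _ _).trans (congrArg₂ CartRestrCat.pair ?_ ?_)
      · refine (Category.assoc _ _ _).symm.trans ?_
        refine (congrArg (fun k : Pt S P.vec.car => k.map ≫ (lastHom P (n + 1)).map)
          (Pt.fst_pair (v 0).toPt (zpt (fun i => v i.succ) x))).trans ?_
        exact congrArg (fun k : Vec _ S => k.map) (lastHom_vec (n + 1) (v 0))
      · exact congrArg (fun k : Pt S _ => k.map)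
          (Pt.snd_pair (v 0).toPt (zpt (fun i => v i.succ) x))
    have hval : z.map ≫ FaaHom.star (diff (Q := tang Q.vec) (deltaT f n)) =
        (F (Finset.univ.val.map v)).map := by
      refine (FaaHom.jet_singleton (deltaT f n) _ _ h L).symm.trans ?_
      have e := hj {((0 : Fin (n + 1) → Vec P.vec S), v 0)} (by simp)
      rw [Multiset.map_singleton] at e
      rw [e, ← Multiset.cons_zero, matchSum_cons_zero hFm, matchSum_zero, univ_map_succ v]
    have hstar : (zpt v x).map ≫ FaaHom.star (deltaT f (n + 1)) =
        (F (Finset.univ.val.map v)).map :=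
      (Category.assoc _ _ _).symm.trans ((congrArg (· ≫ _) hlin).trans hval)
    refine ⟨hstar, fun s hs => ?_⟩
    -- the two summands of `dirJ` are the two summands in the recursion for `matchSum`
    have e : deltaT f (n + 1) = _ ≫ diff (Q := tang Q.vec) (deltaT f n) :=
      congrArg (· ≫ diff (Q := tang Q.vec) (deltaT f n)) (pair_lastHom_eq P (n + 1))
    have hstar' := hstar
    rw [e] at hstar'
    refine (FaaHom.jet_congr e _ _ hstar hstar' _).trans ?_
    refine (FaaHom.linear_comp_jet _ _ _ _ z _ hstar'
      ((congrArg (fun k => (zpt v x).map ≫ FaaHom.star k) (pair_lastHom_eq P (n + 1))).symm.trans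
        hlin) hval _).trans ?_
    refine (diff_jet_pair (Q := tang Q.vec) (deltaT f n) L _ _ hval w.toPt h
      (by simpa using hs)).trans ?_
    rw [Multiset.map_map, dirJ_map, dirJ]
    have e1 : (Vec.snd : Vec ((vars (tang P.vec) P (n + 1)).vec.prod _) S → _) ∘
        ((((CMonHom.fst P.vec (vars (tang P.vec) P (n + 1)).vec).comp (lastHom P (n + 1))).pair
          (CMonHom.snd P.vec (vars (tang P.vec) P (n + 1)).vec)).vec ∘ zvec (n := n + 2)) =
        fun d : (Fin (n + 2) → Vec P.vec S) × Vec P.vec S => zvec (tailD d) := by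
      funext d
      refine (congrArg Vec.snd (CMonHom.pair_vec _ _ (zvec d))).trans ((Vec.snd_pair _ _).trans ?_)
      exact Vec.snd_pair (d.1 0) (zvec (tailD d))
    have e2 : (Vec.fst : Vec ((vars (tang P.vec) P (n + 1)).vec.prod _) S → _) ∘
        ((((CMonHom.fst P.vec (vars (tang P.vec) P (n + 1)).vec).comp (lastHom P (n + 1))).pair
          (CMonHom.snd P.vec (vars (tang P.vec) P (n + 1)).vec)).vec ∘ zvec (n := n + 2)) =
        fun d : (Fin (n + 2) → Vec P.vec S) × Vec P.vec S => zvec (0, d.1 0) := by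
      funext d
      refine (congrArg Vec.fst (CMonHom.pair_vec _ _ (zvec d))).trans ((Vec.fst_pair _ _).trans ?_)
      refine (CMonHom.comp_vec _ _ (zvec d)).trans ?_
      refine Eq.trans ?_ (lastHom_vec (n + 1) (d.1 0))
      exact congrArg _ (Vec.fst_pair (d.1 0) (zvec (tailD d)))
    have hL' (u : Vec P.vec S) (s : Multiset ((Fin (n + 2) → Vec P.vec S) × Vec P.vec S)) :
        FaaHom.jet (deltaT f n) (zpt (fun i => v i.succ) x) w.toPt h
          (zvec (0, u) ::ₘ s.map fun d => zvec (tailD d)) =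
        matchSum (fun t => F (u ::ₘ t)) (fun i => v i.succ) (s.map tailD) := by
      have := hj ((0, u) ::ₘ s.map tailD) (by simp)
      rw [matchSum_cons_zero hFm, Multiset.map_cons, Multiset.map_map] at this
      exact this
    rw [matchSum]
    refine congrArg₂ (· + ·) ?_ ?_
    · refine Eq.trans ?_ (hL' (v 0) s)
      exact congrArg (fun k => FaaHom.jet (deltaT f n) _ _ h (L ::ₘ s.map k)) e1
    · refine Eq.trans (congrArg₂ (fun k l => pickSum s fun d r =>
        FaaHom.jet (deltaT f n) _ _ h (k d ::ₘ r.map l)) e2 e1) ?_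
      exact congrArg _ (funext fun d => funext fun r => hL' (d.1 0) r)

end DeltaJets

section MatchSumEq

variable {M K : Type*} [AddCommMonoid K]

lemma pickSum_finset {ι : Type*} [DecidableEq ι] (U : Finset ι) (d : ι → M)
    (F : M → Multiset M → K) :
    pickSum (U.val.map d) F = ∑ j ∈ U, F (d j) ((U.erase j).val.map d) := by
  rw [pickSum_map]
  unfold pickSum
  rw [Finset.sum_eq_multiset_sum]
  simp only [Finset.erase_val]
  congr 1
  refine Multiset.map_congr rfl fun i _ => ?_
  congr!

/-- A partial injection with values in `U`. -/
def IsMatching {n m : ℕ} (U : Finset (Fin m)) (φ : Fin n → Option (Fin m)) : Prop :=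
  (∀ i j, φ i = some j → j ∈ U) ∧ ∀ i i' j, φ i = some j → φ i' = some j → i = i'

lemma isMatching_cons_none {n m : ℕ} (U : Finset (Fin m)) (φ : Fin n → Option (Fin m)) :
    IsMatching U (Fin.cons none φ : Fin (n + 1) → Option (Fin m)) ↔ IsMatching U φ := by
  constructor
  · rintro ⟨h1, h2⟩
    exact ⟨fun i j h => h1 i.succ j (by simpa using h), fun i i' j h h' =>
      Fin.succ_injective _ (h2 i.succ i'.succ j (by simpa using h) (by simpa using h'))⟩
  · rintro ⟨h1, h2⟩
    refine ⟨fun i j h => ?_, fun i i' j h h' => ?_⟩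
    · induction i using Fin.cases with
      | zero => simp at h
      | succ i => exact h1 i j (by simpa using h)
    · induction i using Fin.cases with
      | zero => simp at h
      | succ i =>
        induction i' using Fin.cases with
        | zero => simp at h'
        | succ i' => exact congrArg _ (h2 i i' j (by simpa using h) (by simpa using h'))

lemma isMatching_cons_some {n m : ℕ} (U : Finset (Fin m)) (j : Fin m)
    (φ : Fin n → Option (Fin m)) :
    IsMatching U (Fin.cons (some j) φ : Fin (n + 1) → Option (Fin m)) ↔
      j ∈ U ∧ IsMatching (U.erase j) φ := by
  constructor
  · rintro ⟨h1, h2⟩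
    refine ⟨h1 0 j (by simp), fun i k h => Finset.mem_erase.2 ⟨?_, h1 i.succ k (by simpa using h)⟩,
      fun i i' k h h' =>
        Fin.succ_injective _ (h2 i.succ i'.succ k (by simpa using h) (by simpa using h'))⟩
    rintro rfl
    exact Fin.succ_ne_zero _ (h2 i.succ 0 k (by simpa using h) (by simp))
  · rintro ⟨hj, h1, h2⟩
    have h0 (i : Fin n) : φ i ≠ some j := fun h => Finset.notMem_erase _ _ (h1 i j h)
    refine ⟨fun i k h => ?_, fun i i' k h h' => ?_⟩
    · induction i using Fin.cases with
      | zero =>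
        obtain rfl : j = k := by simpa using h
        exact hj
      | succ i => exact Finset.mem_of_mem_erase (h1 i k (by simpa using h))
    · induction i using Fin.cases with
      | zero =>
        obtain rfl : j = k := by simpa using h
        induction i' using Fin.cases with
        | zero => rfl
        | succ i' => exact absurd (by simpa using h') (h0 i')
      | succ i =>
        induction i' using Fin.cases with
        | zero =>
          obtain rfl : j = k := by simpa using h'
          exact absurd (by simpa using h) (h0 i)
        | succ i' => exact congrArg _ (h2 i i' k (by simpa using h) (by simpa using h'))

open Classical in
/-- The recursive sum over replacements is the sum over partial injections. -/
lemma matchSum_eq_sum {n m : ℕ} (F : Multiset M → K) (v : Fin n → M)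
    (d : Fin m → (Fin n → M) × M) (U : Finset (Fin m)) :
    matchSum F v (U.val.map d) = ∑ φ with IsMatching U φ,
      F ((Finset.univ.val.map fun i => (φ i).elim (v i) fun j => (d j).1 i) +
        (U.filter fun j => ∀ i, φ i ≠ some j).val.map fun j => (d j).2) := by
  induction n generalizing U F with
  | zero =>
    have : (Finset.univ.filter (IsMatching U) : Finset (Fin 0 → Option (Fin m))) = Finset.univ :=
      Finset.filter_true_of_mem fun φ _ => ⟨fun i => i.elim0, fun i => i.elim0⟩
    rw [this, Fintype.sum_unique]
    simp [matchSum, Multiset.map_map]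
  | succ n ih =>
    have h1 : matchSum (fun t => F (v 0 ::ₘ t)) (fun i => v i.succ) ((U.val.map d).map tailD) =
        ∑ φ : Fin n → Option (Fin m), if IsMatching U φ then
          F (v 0 ::ₘ ((Finset.univ.val.map fun i => (φ i).elim (v i.succ) fun j => (d j).1 i.succ) +
            (U.filter fun j => ∀ i, φ i ≠ some j).val.map fun j => (d j).2)) else 0 := by
      rw [Multiset.map_map, ih, Finset.sum_filter]
      rfl
    have h2 (k : Fin m) : matchSum (fun t => F ((d k).1 0 ::ₘ t)) (fun i => v i.succ)
        (((U.erase k).val.map d).map tailD) =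
        ∑ φ : Fin n → Option (Fin m), if IsMatching (U.erase k) φ then
          F ((d k).1 0 ::ₘ
            ((Finset.univ.val.map fun i => (φ i).elim (v i.succ) fun j => (d j).1 i.succ) +
            ((U.erase k).filter fun j => ∀ i, φ i ≠ some j).val.map fun j => (d j).2)) else 0 := by
      rw [Multiset.map_map, ih, Finset.sum_filter]
      rfl
    rw [matchSum, pickSum_finset, h1, Finset.sum_congr rfl fun k _ => h2 k, Finset.sum_filter,
      ← Equiv.sum_comp (Fin.consEquiv fun _ => Option (Fin m)), Fintype.sum_prod_type,
      Fintype.sum_option]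
    refine congrArg₂ (· + ·) (Finset.sum_congr rfl fun φ _ => ?_) ?_
    · refine if_congr (isMatching_cons_none U φ).symm ?_ rfl
      rw [univ_map_succ, Multiset.cons_add]
      simp [Fin.forall_fin_succ, Fin.consEquiv]
    · rw [← Finset.univ_inter U, ← Finset.sum_ite_mem, Finset.univ_inter]
      refine Finset.sum_congr rfl fun k _ => ?_
      by_cases hk : k ∈ U
      · rw [if_pos hk]
        refine Finset.sum_congr rfl fun φ _ =>
          if_congr ((isMatching_cons_some U k φ).trans (and_iff_right hk)).symm ?_ rfl
        rw [univ_map_succ, Multiset.cons_add]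
        have e : ((U.erase k).filter fun j => ∀ i, φ i ≠ some j) = U.filter fun j => ∀ i,
            (Fin.cons (some k) φ : Fin (n + 1) → Option (Fin m)) i ≠ some j := by
          ext j
          simp only [Finset.mem_filter, Finset.mem_erase, Fin.forall_fin_succ, Fin.cons_zero,
            Fin.cons_succ, ne_eq, Option.some_inj]
          tauto
        rw [e]
        rfl
      · rw [if_neg hk]
        exact (Finset.sum_eq_zero fun φ _ =>
          if_neg fun h => hk ((isMatching_cons_some U k φ).1 h).1).symm

/-- The multiset of the values of a family, and the values of another one on a finset. -/
lemma univ_map_append {n m : ℕ} (a : Fin n → M) (b : Fin m → M) (U : Finset (Fin m)) :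
    Finset.univ.val.map (Fin.append a fun k : Fin U.card => b (U.orderEmbOfFin rfl k)) =
      Finset.univ.val.map a + U.val.map b := by
  have h : U.val = Finset.univ.val.map (U.orderEmbOfFin rfl) := by
    conv_lhs => rw [← Finset.map_orderEmbOfFin_univ U rfl]
    rfl
  rw [h, Multiset.map_map, Fin.univ_val_map, Fin.univ_val_map, Fin.univ_val_map,
    List.ofFn_fin_append]
  rfl

end MatchSumEq

section Terms

variable {C : Type u} [CartQuiver.{v} C] [CartRestrCat C] {P Q R : FaaObj C} {S : Stage C}
  {A : CMon C}

lemma vars_tang_pt (A : CMon C) (P : FaaObj C) (n : ℕ) :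
    (vars (tang A) P n).pt = vars A.car P.pt n := by
  induction n with
  | zero => rfl
  | succ n ih => exact congrArg (prod A.car) ih

lemma vars_tang_car (A : CMon C) (P : FaaObj C) (n : ℕ) :
    (vars (tang A) P n).vec.car = vars A.car P.vec.car n := by
  induction n with
  | zero => rfl
  | succ n ih => exact congrArg (prod A.car) ih

lemma pair_comp_eqToHom {Z X X' Y Y' : C} (f : Z ⟶ X) (g : Z ⟶ Y) (hX : X = X') (hY : Y = Y')
    (h : prod X Y = prod X' Y') :
    pair f g ≫ eqToHom h = pair (f ≫ eqToHom hX) (g ≫ eqToHom hY) := by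
  subst hX hY
  simp

lemma tuple_comp_eqToHom {Z X X' Y Y' : C} {n : ℕ} (f : Fin n → (Z ⟶ X)) (g : Z ⟶ Y)
    (hX : X = X') (hY : Y = Y') (h : vars X Y n = vars X' Y' n) :
    tuple f g ≫ eqToHom h = tuple (fun i => f i ≫ eqToHom hX) (g ≫ eqToHom hY) := by
  subst hX hY
  simp

lemma eqToHom_base {X X' Y Y' : C} {n : ℕ} (hX : X = X') (hY : Y = Y')
    (h : vars X Y n = vars X' Y' n) :
    eqToHom h ≫ base X' Y' n = base X Y n ≫ eqToHom hY := by
  subst hX hY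
  simp

lemma total_eqToHom {X Y : C} (h : X = Y) : Total (eqToHom h) := by
  subst h
  exact total_id X

lemma zpt_map {n : ℕ} (a : Fin n → Vec A S) (x : Pt S P.pt) :
    (zpt a x).map = (vtuple a x).map ≫ eqToHom (vars_tang_pt A P n).symm := by
  induction n with
  | zero => exact (Category.comp_id _).symm
  | succ n ih =>
    refine Eq.trans ?_ (pair_comp_eqToHom _ _ rfl (vars_tang_pt A P n).symm _).symm
    exact congrArg₂ pair (Category.comp_id _).symm (ih _)

lemma zvec_map {n : ℕ} (d : (Fin n → Vec A S) × Vec P.vec S) :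
    (zvec d).map = (vtuple d.1 d.2.toPt).map ≫ eqToHom (vars_tang_car A P n).symm := by
  induction n with
  | zero => exact (Category.comp_id _).symm
  | succ n ih =>
    refine Eq.trans ?_ (pair_comp_eqToHom _ _ rfl (vars_tang_car A P n).symm _).symm
    exact congrArg₂ pair (Category.comp_id _).symm (ih (fun i => d.1 i.succ, d.2))

lemma eqToHom_star_base (A : CMon C) (P : FaaObj C) (n : ℕ) :
    eqToHom (vars_tang_pt A P n).symm ≫ FaaHom.star (base (tang A) P n) = base A.car P.pt n := by
  induction n with
  | zero => exact Category.comp_id _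
  | succ n ih =>
    have h {X X' Y Y' : C} (hX : X = X') (hY : Y = Y') (h : prod X Y = prod X' Y') :
        eqToHom h ≫ snd X' Y' = snd X Y ≫ eqToHom hY := by
      subst hX hY
      simp
    change eqToHom _ ≫ snd A.car (vars (tang A) P n).pt ≫ FaaHom.star (base (tang A) P n) = _
    rw [← Category.assoc, h rfl (vars_tang_pt A P n).symm, Category.assoc, ih]
    rfl

lemma rst_star_deltaT (f : P ⟶ Q) (n : ℕ) :
    rst (eqToHom (vars_tang_pt P.vec P (n + 1)).symm ≫ FaaHom.star (deltaT f n)) =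
      rst (base P.vec.car P.pt (n + 1) ≫ FaaHom.star f) := by
  have h : rst (FaaHom.star (deltaT f n)) =
      rst (FaaHom.star (base (tang P.vec) P (n + 1)) ≫ FaaHom.star f) :=
    congrArg FaaHom.star (rst_deltaT f n)
  refine (rst_comp_rst _ _).symm.trans ?_
  rw [h, rst_comp_rst, ← Category.assoc, eqToHom_star_base]

/-- The values of the terms of `δ f`. -/
lemma delta_term_star (f : P ⟶ Q) (n : ℕ) (hn : 0 < n) :
    SameArrow (FaaHom.star (FaaHom.term (delta f) n hn)) (FaaHom.term f n hn) := by
  obtain ⟨n, rfl⟩ := Nat.exists_eq_add_one.2 hn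
  refine ⟨vars_tang_pt P.vec P (n + 1), rfl, ?_⟩
  have h := (deltaT_star_jet f (genVec P (FaaHom.star f) (n + 1)) (genPt P (FaaHom.star f) (n + 1))
    (genTo P (FaaHom.star f) (n + 1)) (genPt_to P (FaaHom.star f) (n + 1))).choose
  rw [FaaHom.jet_univ _ _ _ _ hn, ← FaaHom.term_eq_eval, zpt_map, vtuple_gen, Category.assoc,
    ← rst_star_deltaT, rst_self'] at h
  rw [← h, eqToHom_refl, Category.comp_id, ← Category.assoc, eqToHom_trans, eqToHom_refl]
  exact (Category.id_comp _).symm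

/-- The terms of the terms of `δ f`, as a sum over partial injections. -/
lemma delta_term_term (f : P ⟶ Q) (n : ℕ) (hn : 0 < n) (m : ℕ) (hm : 0 < m) :
    SameArrow (FaaHom.term (FaaHom.term (delta f) n hn) m hm) (deltaTerm f n hn m) := by
  obtain ⟨n, rfl⟩ := Nat.exists_eq_add_one.2 hn
  have hc := vars_tang_car P.vec P (n + 1)
  have hp := vars_tang_pt P.vec P (n + 1)
  have hX : vars (vars P.vec.car P.vec.car (n + 1)) (vars P.vec.car P.pt (n + 1)) m =
      vars (vars (tang P.vec) P (n + 1)).vec.car (vars (tang P.vec) P (n + 1)).pt m := by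
    rw [hc, hp]
  suffices h : eqToHom hX ≫ FaaHom.term (deltaT f n) m hm = deltaTerm f (n + 1) hn m by
    refine ⟨hX.symm, rfl, ?_⟩
    rw [← h, eqToHom_refl, Category.comp_id, ← Category.assoc, eqToHom_trans, eqToHom_refl]
    exact (Category.id_comp _).symm
  -- the generic stage for `m` directions and a base point at which `f` is defined
  let K := vars P.vec.car P.vec.car (n + 1)
  let L := vars P.vec.car P.pt (n + 1)
  let b : vars K L m ⟶ P.pt := base K L m ≫ base P.vec.car P.pt (n + 1)
  have hb : Total b := total_comp (total_base _) (total_base _)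
  let S : Stage C := ⟨vars K L m, rst (b ≫ FaaHom.star f), rst_rst _⟩
  have hS {Y : C} {t : vars K L m ⟶ Y} (ht : Total t) :
      rst (rst (b ≫ FaaHom.star f) ≫ t) = rst (b ≫ FaaHom.star f) := by
    rw [rst_comp_total _ ht, rst_rst]
  let x : Pt S P.pt := ⟨S.dom ≫ b, hS hb⟩
  let q : Pt S Q.pt := ⟨b ≫ FaaHom.star f, rfl⟩
  have hq : x.map ≫ FaaHom.star f = q.map := (Category.assoc _ _ _).trans (rst_self' _)
  let v (i : Fin (n + 1)) : Vec P.vec S :=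
    ⟨⟨S.dom ≫ base K L m ≫ proj P.vec.car P.pt (n + 1) i,
      hS (total_comp (total_base _) (total_proj _ _))⟩⟩
  let a (j : Fin m) (i : Fin (n + 1)) : Vec P.vec S :=
    ⟨⟨S.dom ≫ proj K L m j ≫ proj P.vec.car P.vec.car (n + 1) i,
      hS (total_comp (total_proj _ _) (total_proj _ _))⟩⟩
  let c (j : Fin m) : Vec P.vec S :=
    ⟨⟨S.dom ≫ proj K L m j ≫ base P.vec.car P.vec.car (n + 1),
      hS (total_comp (total_proj _ _) (total_base _))⟩⟩
  obtain ⟨h, hj⟩ := deltaT_star_jet f v x q hq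
  have hne : (Finset.univ : Finset (Fin m)).val.map (fun j => (a j, c j)) ≠ 0 := by
    intro h0
    have := congrArg Multiset.card h0
    simp at this
    omega
  have key := hj _ hne
  rw [Multiset.map_map, FaaHom.jet_univ _ _ _ _ hm] at key
  have left : (FaaHom.eval (deltaT f n) _ _ h hm (zvec ∘ fun j => (a j, c j))).map =
      eqToHom hX ≫ FaaHom.term (deltaT f n) m hm := by
    have ha (j : Fin m) : (vtuple (a j) (c j).toPt).map = S.dom ≫ proj K L m j := by
      refine (comp_tuple _ _ _).symm.trans (congrArg (S.dom ≫ ·) ?_)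
      refine (comp_tuple _ _ _).symm.trans ?_
      rw [tuple_proj_base]
      exact Category.comp_id _
    have hv : (vtuple v x).map = S.dom ≫ base K L m := by
      refine (comp_tuple _ _ _).symm.trans (congrArg (S.dom ≫ ·) ?_)
      refine (comp_tuple _ _ _).symm.trans ?_
      rw [tuple_proj_base]
      exact Category.comp_id _
    have e : (vtuple (zvec ∘ fun j => (a j, c j)) (zpt v x)).map = S.dom ≫ eqToHom hX := by
      have h1 : (fun j => (zvec (a j, c j)).map) =
          fun j => (S.dom ≫ proj K L m j) ≫ eqToHom hc.symm :=
        funext fun j => (zvec_map _).trans (congrArg (· ≫ eqToHom hc.symm) (ha j))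
      have h2 : (zpt v x).map = (S.dom ≫ base K L m) ≫ eqToHom hp.symm := by rw [zpt_map, hv]
      refine (congrArg₂ tuple h1 h2).trans ((tuple_comp_eqToHom _ _ _ _ hX).symm.trans ?_)
      refine congrArg (· ≫ eqToHom hX) ((comp_tuple _ _ _).symm.trans ?_)
      rw [tuple_proj_base]
      exact Category.comp_id _
    have hr : rst (eqToHom hX ≫ FaaHom.term (deltaT f n) m hm) = S.dom := by
      rw [← rst_comp_rst, FaaHom.rst_term, rst_comp_rst, ← Category.assoc,
        eqToHom_base hc.symm hp.symm hX, Category.assoc, ← rst_comp_rst]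
      have := rst_star_deltaT f n
      rw [this, rst_comp_rst, ← Category.assoc]
    rw [FaaHom.eval_map, e, Category.assoc, ← hr, rst_self']
  have right' (φ : Fin (n + 1) → Option (Fin m)) (U : Finset (Fin m)) :
      (FaaHom.jet f x q hq ((Finset.univ.val.map fun i => (φ i).elim (v i) fun j => a j i) +
        U.val.map fun j => c j)).map =
      tuple (Fin.append (fun i => (φ i).elim (base K L m ≫ proj P.vec.car P.pt (n + 1) i)
          fun j => proj K L m j ≫ proj P.vec.car P.vec.car (n + 1) i)
        fun k => proj K L m (U.orderEmbOfFin rfl k) ≫ base P.vec.car P.vec.car (n + 1)) b ≫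
      FaaHom.term f (n + 1 + U.card) (Nat.add_pos_left hn _) := by
    rw [← univ_map_append, FaaHom.jet_univ _ _ _ _ (Nat.add_pos_left hn _), FaaHom.eval_map]
    let T : Fin (n + 1 + U.card) → (vars K L m ⟶ P.vec.car) :=
      Fin.append (fun i => (φ i).elim (base K L m ≫ proj P.vec.car P.pt (n + 1) i)
          fun j => proj K L m j ≫ proj P.vec.car P.vec.car (n + 1) i)
        fun k => proj K L m (U.orderEmbOfFin rfl k) ≫ base P.vec.car P.vec.car (n + 1)
    have hT (i) : Total (T i) := by
      refine Fin.addCases (fun i => ?_) (fun k => ?_) i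
      · simp only [T, Fin.append_left]
        cases φ i with
        | none => exact total_comp (total_base _) (total_proj _ _)
        | some j => exact total_comp (total_proj _ _) (total_proj _ _)
      · simp only [T, Fin.append_right]
        exact total_comp (total_proj _ _) (total_base _)
    have e : (vtuple (Fin.append (fun i => (φ i).elim (v i) fun j => a j i)
        fun k => c (U.orderEmbOfFin rfl k)) x).map = S.dom ≫ tuple T b := by
      rw [comp_tuple]
      refine congrArg₂ tuple (funext fun i => ?_) rfl
      refine Fin.addCases (fun i => ?_) (fun k => ?_) i
      · simp only [T, Fin.append_left]
        cases φ i with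
        | none => rfl
        | some j => rfl
      · simp only [T, Fin.append_right]
        rfl
    have hr : rst (tuple T b ≫ FaaHom.term f (n + 1 + U.card) (Nat.add_pos_left hn _)) = S.dom := by
      rw [rst_tuple_comp_term (FaaHom.rst_term f _ _), show rst (tuple T b) = 𝟙 _ from
        total_tuple hT hb, Category.id_comp]
    rw [e, Category.assoc, ← hr, rst_self']
  have right : (matchSum (FaaHom.jet f x q hq) v
      (Finset.univ.val.map fun j => (a j, c j))).map = deltaTerm f (n + 1) hn m := by
    classical
    rw [matchSum_eq_sum, Finset.sum_subtype (p := fun φ : Fin (n + 1) → Option (Fin m) =>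
      ∀ i i' j, φ i = some j → φ i' = some j → i = i') _ (fun φ => by simp [IsMatching])]
    have : Nonempty {φ : Fin (n + 1) → Option (Fin m) //
      ∀ i i' j, φ i = some j → φ i' = some j → i = i'} := ⟨⟨fun _ => none, by simp⟩⟩
    rw [Vec.map_sum]
    unfold deltaTerm
    refine congrArg Q.vec.sum (funext fun φ => ?_)
    exact right' φ.1 _
  rw [← left, ← right]
  exact congrArg (fun k : Vec Q.vec S => k.map) key

end Terms

section IsComult

variable (C : Type u) [CartQuiver.{v} C] [CartRestrCat C]

lemma isComult_deltaFunctor : IsComult (deltaFunctor C) where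
  obj_pt P := rfl
  obj_car P := rfl
  obj_add_star P := SameArrow.rfl' _
  obj_add_term P n hn := SameArrow.of_eq (FaaHom.linear_term_of_total
    (P := tang (P.vec.prod P.vec)) (Q := tang P.vec) P.vec.add_total (CMonHom.add P.vec) n hn)
  obj_zero_star P := SameArrow.rfl' _
  obj_zero_term P n hn := SameArrow.of_eq (FaaHom.linear_term_of_total
    (P := tang (CMon.triv C)) (Q := tang P.vec) P.vec.zero_total (CMonHom.zero P.vec) n hn)
  map_star f := SameArrow.rfl' _
  map_term_star f n hn := delta_term_star f n hn
  map_term_term f n hn m hm := delta_term_term f n hn m hm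

end IsComult

/-! ### The comultiplication commutes with derivatives -/

section DirS

variable {C : Type u} [CartQuiver.{v} C] [CartRestrCat C] {P Q R X Y : FaaObj C}
  {S S' : Stage (FaaObj C)} {A B : CMon C}

/-- A change of stage, as a point. -/
def StageHom.toPt {K : Type*} [CartQuiver K] [CartRestrCat K] {S S' : Stage K}
    (k : StageHom S S') : Pt S S'.obj := ⟨k.map, k.rst_map⟩

lemma StageHom.def_map {K : Type*} [CartQuiver K] [CartRestrCat K] {S S' : Stage K} {X : K}
    (k : StageHom S S') (x : Pt S' X) : Def k.toPt x.map := (k.pt x).rst_map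

/-- The derivative of a generalized vector along a tangent vector of its stage of definition. -/
def dirS (k : StageHom S S') (u : Vec (tangMon S'.obj.vec) S) :
    Vec (tangMon B) S' →+ Vec (tangMon B) S where
  toFun b := dirv (W := tang B) b.map k.toPt (k.def_map b.toPt) u
  map_zero' := by
    have h : Def k.toPt ((tangMon B).zeroMap S'.obj) := def_zeroMap (A := tangMon B) _
    have e : (0 : Vec (tangMon B) S').map = rst S'.dom ≫ (tangMon B).zeroMap S'.obj := by
      rw [S'.rst_dom]; rfl
    have h' : Def (Y := tang B) k.toPt (rst S'.dom ≫ (tangMon B).zeroMap S'.obj) :=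
      e ▸ k.def_map (0 : Vec (tangMon B) S').toPt
    refine (congrArg (fun l : Vec (tangMon _) S →+ _ => l u) (dirv_congr e rfl _ h')).trans ?_
    exact (dirv_rst_comp (Y := tang B) _ h' h u).trans (dirv_zeroMap _ h u)
  map_add' a b := dirv_plus a.map b.map k.toPt _ _ _ u

lemma dirv_eq_dirS (k : StageHom S S') (u : Vec (tangMon S'.obj.vec) S) (b : Vec (tangMon B) S')
    {h : S'.obj ⟶ tang B} (e : h = b.map) (hd : Def k.toPt h) :
    dirv (W := tang B) h k.toPt hd u = dirS k u b := by
  subst e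
  rfl

/-- The case of `dirS_delta_jet` in which the vectors are given as a family. -/
lemma dirS_delta_jet_univ (g : P ⟶ Q) (k : StageHom S S') (u : Vec (tangMon S'.obj.vec) S)
    (x : Pt S' P) (y : Pt S' Q) (h : x.map ≫ g = y.map) (h' : (k.pt x).map ≫ g = (k.pt y).map)
    {n : ℕ} (hn : 0 < n) (a : Fin n → Vec (tangMon P.vec) S') :
    dirS k u (FaaHom.jet (delta g) x y h (Finset.univ.val.map a)) =
      dirJ (FaaHom.jet (delta g) (k.pt x) (k.pt y) h') (dirv x.map k.toPt (k.def_map x) u)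
        (fun i => dirS k u (a i)) (fun i => k.vec (a i)) Finset.univ.val := by
  have e : tuple (fun i => (a i).map) x.map ≫ FaaHom.term (delta g) n hn =
      (FaaHom.jet (delta g) x y h (Finset.univ.val.map a)).map :=
    (congrArg (fun l : Vec (tangMon Q.vec) S' => l.map)
      (FaaHom.jet_univ (delta g) x y h hn a)).symm
  have hd : Def (Y := tang Q.vec) k.toPt (tuple (fun i => (a i).map) x.map ≫
      FaaHom.term (delta g) n hn) :=
    e ▸ k.def_map (FaaHom.jet (delta g) x y h (Finset.univ.val.map a)).toPt
  refine (dirv_eq_dirS k u _ e hd).symm.trans ?_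
  exact dirv_tuple_delta_term g k.toPt (k.pt x) (k.pt y) h' hn (fun i => (a i).map) x.map
    (fun i => k.def_map (a i).toPt) (k.def_map x) (fun i => k.vec (a i)) (fun i => rfl) rfl hd u

/-- The derivative of the jets of `δ g` along a tangent vector of the stage of definition. -/
lemma dirS_delta_jet (g : P ⟶ Q) (k : StageHom S S') (u : Vec (tangMon S'.obj.vec) S)
    (x : Pt S' P) (y : Pt S' Q) (h : x.map ≫ g = y.map) (h' : (k.pt x).map ≫ g = (k.pt y).map)
    {s : Multiset (Vec (tangMon P.vec) S')} (hs : s ≠ 0) :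
    dirS k u (FaaHom.jet (delta g) x y h s) =
      dirJ (FaaHom.jet (delta g) (k.pt x) (k.pt y) h') (dirv x.map k.toPt (k.def_map x) u)
        (dirS k u) k.vec s := by
  obtain ⟨n, a, hn, rfl⟩ : ∃ (n : ℕ) (a : Fin n → Vec (tangMon P.vec) S'),
      0 < n ∧ Finset.univ.val.map a = s := by
    obtain ⟨a, ha⟩ := exists_fin_map s
    exact ⟨_, a, Multiset.card_pos.2 hs, ha⟩
  refine (dirS_delta_jet_univ g k u x y h h' hn a).trans ?_
  rw [dirJ_map]
  rfl

end DirS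

section Combin

variable {M M' K : Type*} [AddCommMonoid M] [AddCommMonoid K]

/-- The derivative of `dirJ φ v p q` in a direction that only moves the base point and the
vector `v`. -/
lemma dirJ_dirJ_last {ι : Type*} {φ : Multiset M → K} (hφ : MultiAdd φ) (b d : M) (D E : M' → M)
    (v : M') (p q : ι → M') (hv : D v = d) (hp : ∀ i, D (p i) = 0) (hq : ∀ i, D (q i) = 0)
    (s : Multiset ι) :
    dirJ φ b D E (v ::ₘ s.map q) + pickSum s (fun i r => dirJ φ b D E (p i ::ₘ r.map q)) =
      φ (E v ::ₘ b ::ₘ s.map fun i => E (q i)) + (φ (d ::ₘ s.map fun i => E (q i)) +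
        pickSum s fun i r => φ (E (p i) ::ₘ b ::ₘ r.map fun i => E (q i))) := by
  simp only [dirJ, Multiset.map_cons, Multiset.map_map, Function.comp_def, pickSum_cons,
    pickSum_map, hv, hp, hq, hφ.zero, pickSum_const_zero, add_zero]
  rw [Multiset.cons_swap b, add_assoc]
  simp only [Multiset.cons_swap b]

end Combin

section DeltaDiff

variable {C : Type u} [CartQuiver.{v} C] [CartRestrCat C] {P Q R : FaaObj C}
  {S : Stage (FaaObj C)}

/-- The case of a single vector of `delta_diff_jet`. -/
lemma delta_diff_jet_one (g : P ⟶ Q) (x : Pt S (prod (tang P.vec) P)) (y : Pt S (tang Q.vec))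
    (h : x.map ≫ diff g = y.map) (q : Pt S Q) (hq : x.snd.map ≫ g = q.map)
    (c : Vec (tangMon (P.vec.prod P.vec)) S) :
    FaaHom.jet (delta (Q := tang Q.vec) (diff g)) x y h {c} =
      dirJ (FaaHom.jet (delta g) x.snd q hq) ⟨x.fst⟩ tfst tsnd {c} := by
  have hx : x = vtuple (A := tangMon P.vec) (fun _ : Fin 1 => ⟨x.fst⟩) x.snd :=
    x.pair_fst_snd.symm
  have hc : c = vvec (X := P) (fun _ : Fin 1 => tfst c) (tsnd c) := (tpair_tfst_tsnd c).symm
  refine (delta_jet_singleton (Q := tang Q.vec) (diff g) x y h c).trans ?_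
  have hd : Def (Y := tang Q.vec) (vtuple (A := tangMon P.vec) (fun _ : Fin 1 => ⟨x.fst⟩) x.snd)
      (FaaHom.term (delta g) 1 Nat.one_pos) := def_delta_term (def_of_eq hq) Nat.one_pos _
  refine (congrArg (fun l : Vec (tangMon _) S →+ _ => l c)
    (dirv_congr (W := tang Q.vec) (h' := FaaHom.term (delta g) 1 Nat.one_pos) rfl hx _ hd)).trans ?_
  refine (congrArg _ hc).trans ?_
  refine (dirv_delta_term g x.snd q hq Nat.one_pos _ _ _ hd).trans ?_
  rw [show (Finset.univ : Finset (Fin 1)).val = {0} from rfl, dirJ, dirJ, Multiset.map_singleton,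
    Multiset.map_singleton, pickSum_singleton, pickSum_singleton, ← Multiset.cons_zero,
    ← Multiset.cons_zero, Multiset.cons_swap]
  rfl

/-- The jets at all points, from those at the generic point. -/
lemma delta_diff_term_of_jet (g : P ⟶ Q) {m : ℕ} (hm : 0 < m)
    (H : ∀ {S : Stage (FaaObj C)} (x : Pt S (prod (tang P.vec) P)) (y : Pt S (tang Q.vec))
      (h : x.map ≫ diff g = y.map) (q : Pt S Q) (hq : x.snd.map ≫ g = q.map)
      (t : Fin m → Vec (tangMon (P.vec.prod P.vec)) S),
      FaaHom.jet (delta (Q := tang Q.vec) (diff g)) x y h (Finset.univ.val.map t) =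
        dirJ (FaaHom.jet (delta g) x.snd q hq) ⟨x.fst⟩ tfst tsnd (Finset.univ.val.map t))
    (q : Pt (Stage.gen (deltaObj (prod (tang P.vec) P)).vec.car (prod (tang P.vec) P) (diff g) m) Q)
    (hq : (genPt (deltaObj (prod (tang P.vec) P)) (diff g) m).snd.map ≫ g = q.map) :
    FaaHom.term (delta (Q := tang Q.vec) (diff g)) m hm =
      (dirJ (FaaHom.jet (delta g) (genPt (deltaObj (prod (tang P.vec) P)) (diff g) m).snd q hq)
        ⟨(genPt (deltaObj (prod (tang P.vec) P)) (diff g) m).fst⟩ tfst tsnd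
        (Finset.univ.val.map (genVec (deltaObj (prod (tang P.vec) P)) (diff g) m))).map := by
  refine (FaaHom.term_eq_eval (delta (Q := tang Q.vec) (diff g)) m hm).trans ?_
  refine congrArg (fun k : Vec (tangMon Q.vec) _ => k.map) ?_
  refine (FaaHom.jet_univ (delta (Q := tang Q.vec) (diff g)) _ _ _ hm _).symm.trans ?_
  exact H _ _ _ q hq _

lemma exists_generic_snd (g : P ⟶ Q) (m : ℕ) :
    ∃ q : Pt (Stage.gen (deltaObj (prod (tang P.vec) P)).vec.car (prod (tang P.vec) P)
      (diff g) m) Q, (genPt (deltaObj (prod (tang P.vec) P)) (diff g) m).snd.map ≫ g = q.map := by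
  refine ⟨Pt.to _ g ?_, rfl⟩
  set z := genPt (deltaObj (prod (tang P.vec) P)) (diff g) m
  have h : rst (z.map ≫ diff g) = _ := def_of_eq (genPt_to (deltaObj (prod (tang P.vec) P))
    (diff g) m)
  rw [← rst_comp_rst, rst_diff, rst_comp_rst, ← Category.assoc] at h
  exact h

lemma tfst_zero {A B : CMon C} : tfst (0 : Vec (tangMon (A.prod B)) S) = 0 := by
  rw [← tpair_zero, tfst_tpair]

lemma tsnd_zero {A B : CMon C} : tsnd (0 : Vec (tangMon (A.prod B)) S) = 0 := by
  rw [← tpair_zero, tsnd_tpair]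

lemma vec_tfst {S' : Stage (FaaObj C)} (k : StageHom S S') {A B : CMon C}
    (t : Vec (tangMon (A.prod B)) S') : k.vec (tfst t) = tfst (k.vec t) :=
  Vec.ext (Category.assoc _ _ _).symm

lemma vec_tsnd {S' : Stage (FaaObj C)} (k : StageHom S S') {A B : CMon C}
    (t : Vec (tangMon (A.prod B)) S') : k.vec (tsnd t) = tsnd (k.vec t) :=
  Vec.ext (Category.assoc _ _ _).symm

lemma dirv_pt_fst {S' : Stage (FaaObj C)} (k : StageHom S S') (u : Vec (tangMon S'.obj.vec) S)
    (x : Pt S' (prod P Q)) :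
    dirv x.fst.map k.toPt (k.def_map x.fst) u = tfst (dirv x.map k.toPt (k.def_map x) u) := by
  refine (dirv_comp x.map (fst P Q) k.toPt (k.pt x) rfl ((k.pt x).rst_comp_total (total_fst _ _))
    (k.def_map x.fst) u).trans ?_
  exact dirv_fst _ _ _

lemma dirv_pt_snd {S' : Stage (FaaObj C)} (k : StageHom S S') (u : Vec (tangMon S'.obj.vec) S)
    (x : Pt S' (prod P Q)) :
    dirv x.snd.map k.toPt (k.def_map x.snd) u = tsnd (dirv x.map k.toPt (k.def_map x) u) := by
  refine (dirv_comp x.map (snd P Q) k.toPt (k.pt x) rfl ((k.pt x).rst_comp_total (total_snd _ _))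
    (k.def_map x.snd) u).trans ?_
  exact dirv_snd _ _ _

section Generic

variable {Y : FaaObj C} {f : P ⟶ Y} {n : ℕ} (a : Fin n → Vec (deltaObj P).vec S)
  (x : Pt S (deltaObj P).pt) (y : Pt S Y) (h : x.map ≫ f = y.map)

/-- The derivative of the generic point in a direction along the base point. -/
lemma dirv_genPt (c : Vec (tangMon P.vec) S) :
    dirv (genPt (deltaObj P) f n).map (genHom (P := deltaObj P) a x y h).toPt
      (StageHom.def_map _ _) (lastVec (X := P) n c) = c := by
  refine (dirv_rst_comp (Y := P) (h := base (tang P.vec) P n)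
    (genHom (P := deltaObj P) a x y h).toPt _ (Pt.rst_comp_total _ (total_base _)) _).trans ?_
  exact dirv_base _ _ _ _

lemma dirS_genVec (c : Vec (tangMon P.vec) S) (i : Fin n) :
    dirS (genHom (P := deltaObj P) a x y h) (lastVec (X := P) n c)
      (genVec (deltaObj P) f n i) = 0 := by
  refine (dirv_rst_comp (Y := tang P.vec) (h := proj (tang P.vec) P n i)
    (genHom (P := deltaObj P) a x y h).toPt
    (StageHom.def_map _ (genVec (deltaObj P) f n i).toPt)
    (Pt.rst_comp_total _ (total_proj _ _)) _).trans ?_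
  exact dirv_proj _ _ _ _ _

end Generic

/-- The derivative of a directional derivative of jets of `δ g` along a tangent vector of the stage
of definition that does not move the variables `t`. -/
lemma dirS_dirJ_delta_jet {S' : Stage (FaaObj C)} (g : P ⟶ Q) (k : StageHom S S')
    (u : Vec (tangMon S'.obj.vec) S) (x : Pt S' P) (q : Pt S' Q) (hq : x.map ≫ g = q.map)
    (h' : (k.pt x).map ≫ g = (k.pt q).map) (v : Vec (tangMon P.vec) S') {m : ℕ}
    (t : Fin m → Vec (tangMon (P.vec.prod P.vec)) S') (ht : ∀ i, dirS k u (t i) = 0) :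
    dirS k u (dirJ (FaaHom.jet (delta g) x q hq) v tfst tsnd (Finset.univ.val.map t)) =
      FaaHom.jet (delta g) (k.pt x) (k.pt q) h' (k.vec v ::ₘ dirv x.map k.toPt (k.def_map x) u ::ₘ
          Finset.univ.val.map fun i => k.vec (tsnd (t i))) +
        (FaaHom.jet (delta g) (k.pt x) (k.pt q) h' (dirS k u v ::ₘ
          Finset.univ.val.map fun i => k.vec (tsnd (t i))) +
        pickSum Finset.univ.val fun i r => FaaHom.jet (delta g) (k.pt x) (k.pt q) h'
          (k.vec (tfst (t i)) ::ₘ dirv x.map k.toPt (k.def_map x) u ::ₘ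
            r.map fun i => k.vec (tsnd (t i)))) := by
  have hp (i : Fin m) : dirS k u (tfst (t i)) = 0 := by
    refine (dirv_pt_fst (P := tang P.vec) (Q := tang P.vec) k u (t i).toPt).trans ?_
    exact (congrArg tfst (ht i)).trans tfst_zero
  have hs (i : Fin m) : dirS k u (tsnd (t i)) = 0 := by
    refine (dirv_pt_snd (P := tang P.vec) (Q := tang P.vec) k u (t i).toPt).trans ?_
    exact (congrArg tsnd (ht i)).trans tsnd_zero
  have key := dirJ_dirJ_last (M := Vec (tangMon P.vec) S) (M' := Vec (tangMon P.vec) S')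
    (K := Vec (tangMon Q.vec) S) (φ := FaaHom.jet (delta g) (k.pt x) (k.pt q) h')
    (FaaHom.jet_multiAdd (delta g) (k.pt x) (k.pt q) h')
    (dirv x.map k.toPt (k.def_map x) u) (dirS k u v) (dirS k u) k.vec v (fun i => tfst (t i))
    (fun i => tsnd (t i)) rfl hp hs Finset.univ.val
  refine Eq.trans ?_ key
  rw [dirJ, pickSum_map, map_add, map_pickSum, Multiset.map_map]
  refine congrArg₂ (· + ·) (dirS_delta_jet g k u x q hq h' (Multiset.cons_ne_zero)) ?_
  refine pickSum_congr fun i r _ => ?_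
  refine (dirS_delta_jet g k u x q hq h' (Multiset.cons_ne_zero)).trans ?_
  rw [Multiset.map_map]
  rfl

/-- The inductive step of `delta_diff_jet`. The directional derivative of jets at the generic point
does not involve the additional vector `c`; differentiating it along `c` in the direction of the
base point gives the directional derivative of jets on one more vector. -/
lemma dirS_dirJ_generic (g : P ⟶ Q) {m : ℕ} (x : Pt S (prod (tang P.vec) P))
    (y : Pt S (tang Q.vec)) (h : x.map ≫ diff g = y.map) (q : Pt S Q)
    (hq : x.snd.map ≫ g = q.map) (c : Vec (tangMon (P.vec.prod P.vec)) S)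
    (t : Fin (m + 1) → Vec (tangMon (P.vec.prod P.vec)) S)
    (q' : Pt (Stage.gen (deltaObj (prod (tang P.vec) P)).vec.car (prod (tang P.vec) P)
      (diff g) (m + 1)) Q)
    (hq' : (genPt (deltaObj (prod (tang P.vec) P)) (diff g) (m + 1)).snd.map ≫ g = q'.map) :
    dirS (genHom (P := deltaObj (prod (tang P.vec) P)) t x y h) (lastVec (m + 1) c)
        (dirJ (FaaHom.jet (delta g) (genPt (deltaObj (prod (tang P.vec) P)) (diff g) (m + 1)).snd
          q' hq') ⟨(genPt (deltaObj (prod (tang P.vec) P)) (diff g) (m + 1)).fst⟩ tfst tsnd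
          (Finset.univ.val.map (genVec (deltaObj (prod (tang P.vec) P)) (diff g) (m + 1)))) =
      dirJ (FaaHom.jet (delta g) x.snd q hq) ⟨x.fst⟩ tfst tsnd
        (c ::ₘ Finset.univ.val.map t) := by
  set z := genPt (deltaObj (prod (tang P.vec) P)) (diff g) (m + 1) with hz
  set k := genHom (P := deltaObj (prod (tang P.vec) P)) t x y h with hk
  have hzx : k.pt z = x := genHom_pt (P := deltaObj (prod (tang P.vec) P)) t x y h
  have hc : dirv z.map k.toPt (k.def_map z) (lastVec (X := prod (tang P.vec) P) (m + 1) c) = c :=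
    dirv_genPt (P := prod (tang P.vec) P) t x y h c
  have hx : k.pt z.snd = x.snd := Pt.ext (by
    change k.map ≫ z.map ≫ _ = x.map ≫ _
    rw [← Category.assoc, ← k.map_pt, hzx])
  have hxf : k.vec (A := tangMon P.vec) ⟨z.fst⟩ = ⟨x.fst⟩ := Vec.ext (by
    change k.map ≫ z.map ≫ _ = x.map ≫ _
    rw [← Category.assoc, ← k.map_pt, hzx])
  have hy : k.pt q' = q := Pt.ext (by
    rw [k.map_pt, ← hq', ← Category.assoc, ← k.map_pt, hx, hq])
  have h' : (k.pt z.snd).map ≫ g = (k.pt q').map := by rw [hx, hy, hq]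
  have hv (i : Fin (m + 1)) : k.vec (genVec (deltaObj (prod (tang P.vec) P)) (diff g) (m + 1) i) =
      t i := genHom_vec (P := deltaObj (prod (tang P.vec) P)) t x y h i
  have hf (i : Fin (m + 1)) :
      k.vec (A := tangMon P.vec) (tfst (genVec (deltaObj (prod (tang P.vec) P)) (diff g)
          (m + 1) i)) = tfst (t i) :=
    (vec_tfst k _).trans (congrArg tfst (hv i))
  have hs (i : Fin (m + 1)) :
      k.vec (A := tangMon P.vec) (tsnd (genVec (deltaObj (prod (tang P.vec) P)) (diff g)
          (m + 1) i)) = tsnd (t i) :=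
    (vec_tsnd k _).trans (congrArg tsnd (hv i))
  refine (dirS_dirJ_delta_jet g k (lastVec (X := prod (tang P.vec) P) (m + 1) c) z.snd q' hq' h'
    ⟨z.fst⟩ _ (dirS_genVec (P := prod (tang P.vec) P) t x y h c)).trans ?_
  have h1 : dirv z.snd.map k.toPt (k.def_map z.snd)
      (lastVec (X := prod (tang P.vec) P) (m + 1) c) = tsnd c :=
    (dirv_pt_snd (P := tang P.vec) (Q := P) k _ z).trans (congrArg tsnd hc)
  have h2 : dirS k (lastVec (X := prod (tang P.vec) P) (m + 1) c)
      (⟨z.fst⟩ : Vec (tangMon P.vec) _) = tfst c :=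
    (dirv_pt_fst (P := tang P.vec) (Q := P) k _ z).trans (congrArg tfst hc)
  have h3 : FaaHom.jet (delta g) (k.pt z.snd) (k.pt q') h' = FaaHom.jet (delta g) x.snd q hq := by
    congr 1
  rw [h1, h2, hxf, h3]
  simp only [hf, hs]
  rw [dirJ, pickSum_cons, pickSum_map, Multiset.map_cons, Multiset.map_map]
  refine congrArg₂ (· + ·) rfl (congrArg₂ (· + ·) rfl (pickSum_congr fun i r _ => ?_))
  rw [Multiset.map_cons, Multiset.map_map]
  rfl

/-- The comultiplication commutes with derivatives, on jets. -/
lemma delta_diff_jet (g : P ⟶ Q) {m : ℕ} (x : Pt S (prod (tang P.vec) P))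
    (y : Pt S (tang Q.vec)) (h : x.map ≫ diff g = y.map) (q : Pt S Q)
    (hq : x.snd.map ≫ g = q.map) (t : Fin (m + 1) → Vec (tangMon (P.vec.prod P.vec)) S) :
    FaaHom.jet (delta (Q := tang Q.vec) (diff g)) x y h (Finset.univ.val.map t) =
      dirJ (FaaHom.jet (delta g) x.snd q hq) ⟨x.fst⟩ tfst tsnd (Finset.univ.val.map t) := by
  induction m generalizing S with
  | zero => exact delta_diff_jet_one g x y h q hq (t 0)
  | succ m ih =>
    obtain ⟨c, t, rfl⟩ : ∃ b r, t = Fin.cons b r := ⟨t 0, Fin.tail t, (Fin.cons_self_tail t).symm⟩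
    rw [univ_map_cons]
    refine (delta_jet_cons (Q := tang Q.vec) (diff g) x y h m.succ_pos c t).trans ?_
    obtain ⟨q', hq'⟩ := exists_generic_snd g (m + 1)
    have e := delta_diff_term_of_jet g m.succ_pos
      (fun {S} x y h q hq t => ih (S := S) x y h q hq t) q' hq'
    refine (dirv_eq_dirS (genHom (P := deltaObj (prod (tang P.vec) P)) t x y h)
      (lastVec (m + 1) c) _ e _).trans ?_
    exact dirS_dirJ_generic g x y h q hq c t q' hq'

end DeltaDiff

/-! ### Strict functors -/

section SameArrow

variable {C : Type u} [CartQuiver.{v} C] [CartRestrCat C]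

lemma SameArrow.symm {X Y X' Y' : C} {f : X ⟶ Y} {g : X' ⟶ Y'} (a : SameArrow f g) :
    SameArrow g f := by
  obtain ⟨rfl, rfl, rfl⟩ := a
  exact ⟨rfl, rfl, by simp⟩

lemma SameArrow.heq {X Y X' Y' : C} {f : X ⟶ Y} {g : X' ⟶ Y'} (a : SameArrow f g) :
    HEq f g := by
  obtain ⟨rfl, rfl, rfl⟩ := a
  simp

lemma SameArrow.eq {X Y : C} {f g : X ⟶ Y} (a : SameArrow f g) : f = g := eq_of_heq a.heq

lemma SameArrow.eqToHom_comp {X X' Y : C} (h : X = X') (f : X' ⟶ Y) :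
    SameArrow (eqToHom h ≫ f) f := ⟨h, rfl, by simp⟩

lemma SameArrow.comp_eqToHom {X Y Y' : C} (h : Y = Y') (f : X ⟶ Y) :
    SameArrow (f ≫ eqToHom h) f := ⟨rfl, h.symm, by simp⟩

lemma SameArrow.comp {X Y Z X' Y' Z' : C} {f : X ⟶ Y} {f' : X' ⟶ Y'} {g : Y ⟶ Z} {g' : Y' ⟶ Z'}
    (a : SameArrow f f') (b : SameArrow g g') : SameArrow (f ≫ g) (f' ≫ g') := by
  obtain ⟨rfl, rfl, h⟩ := a
  obtain ⟨_, rfl, h'⟩ := b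
  exact ⟨rfl, rfl, by simp [h, h']⟩

lemma SameArrow.pair {Z X Y Z' X' Y' : C} {f : Z ⟶ X} {f' : Z' ⟶ X'} {g : Z ⟶ Y} {g' : Z' ⟶ Y'}
    (a : SameArrow f f') (b : SameArrow g g') :
    SameArrow (CartRestrCat.pair f g) (CartRestrCat.pair f' g') := by
  obtain ⟨rfl, rfl, h⟩ := a
  obtain ⟨_, rfl, h'⟩ := b
  exact ⟨rfl, rfl, by simp [h, h']⟩

lemma SameArrow.fst {X Y X' Y' : C} (hX : X = X') (hY : Y = Y') :
    SameArrow (CartRestrCat.fst X Y) (CartRestrCat.fst X' Y') := by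
  subst hX hY
  exact SameArrow.rfl' _

lemma SameArrow.snd {X Y X' Y' : C} (hX : X = X') (hY : Y = Y') :
    SameArrow (CartRestrCat.snd X Y) (CartRestrCat.snd X' Y') := by
  subst hX hY
  exact SameArrow.rfl' _

lemma SameArrow.bang {X X' : C} (hX : X = X') :
    SameArrow (CartRestrCat.bang X) (CartRestrCat.bang X') := by
  subst hX
  exact SameArrow.rfl' _

/-- Commutative monoids are equal if they have the same carrier and operations. -/
lemma CMon.eq_of_sameArrow {A B : CMon C} (hc : A.car = B.car) (ha : SameArrow A.add B.add)
    (hz : SameArrow A.zero B.zero) : A = B := CMon.ext hc ha.heq hz.heq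

/-- Maps of the Faà di Bruno category are the same if they have the same terms. -/
lemma FaaHom.sameArrow {P P' Q Q' : FaaObj C} (hP : P = P') (hQ : Q = Q') {f : P ⟶ Q}
    {g : P' ⟶ Q'} (hs : SameArrow (FaaHom.star f) (FaaHom.star g))
    (ht : ∀ n hn, SameArrow (FaaHom.term f n hn) (FaaHom.term g n hn)) : SameArrow f g := by
  subst hP hQ
  exact SameArrow.of_eq (FaaHom.ext hs.eq (funext fun n => funext fun hn => (ht n hn).eq))

end SameArrow

section Functor

variable {C : Type u} [CartQuiver.{v} C] [CartRestrCat C]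
  {D : Type u'} [CartQuiver.{v'} D] [CartRestrCat D] (F : CRFunctor C D)

namespace CRFunctor

lemma ext_sameArrow {F G : CRFunctor C D} (ho : ∀ X, F.obj X = G.obj X)
    (hm : ∀ {X Y : C} (f : X ⟶ Y), SameArrow (F.map f) (G.map f)) : F = G := by
  have h : F.toFunctor = G.toFunctor := CategoryTheory.Functor.ext ho fun X Y f =>
      (hm f).choose_spec.choose_spec
  cases F
  cases G
  cases h
  rfl

/-- The identification of `F X × F Y` with `F (X × Y)`. -/
def μ (X Y : C) : prod (F.obj X) (F.obj Y) ⟶ F.obj (prod X Y) := eqToHom (F.obj_prod X Y).symm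

lemma total_μ (X Y : C) : Total (F.μ X Y) := total_eqToHom _

lemma total_map {X Y : C} {f : X ⟶ Y} (h : Total f) : Total (F.map f) := by
  rw [Total, ← F.map_rst, show rst f = 𝟙 X from h, F.map_id]

lemma μ_fst (X Y : C) : F.μ X Y ≫ F.map (fst X Y) = fst (F.obj X) (F.obj Y) :=
  ((SameArrow.eqToHom_comp _ _).trans' (F.map_fst X Y)).eq

lemma μ_snd (X Y : C) : F.μ X Y ≫ F.map (snd X Y) = snd (F.obj X) (F.obj Y) :=
  ((SameArrow.eqToHom_comp _ _).trans' (F.map_snd X Y)).eq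

lemma pair_μ {Z X Y : C} (f : Z ⟶ X) (g : Z ⟶ Y) :
    pair (F.map f) (F.map g) ≫ F.μ X Y = F.map (pair f g) := by
  have h : F.map (pair f g) ≫ eqToHom (F.obj_prod X Y) = pair (F.map f) (F.map g) := by
    have e1 : eqToHom (F.obj_prod X Y) ≫ fst (F.obj X) (F.obj Y) = F.map (fst X Y) :=
      ((SameArrow.eqToHom_comp _ _).trans' (F.map_fst X Y).symm).eq
    have e2 : eqToHom (F.obj_prod X Y) ≫ snd (F.obj X) (F.obj Y) = F.map (snd X Y) :=
      ((SameArrow.eqToHom_comp _ _).trans' (F.map_snd X Y).symm).eq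
    apply pair_unique'
    · rw [Category.assoc, e1, ← F.map_comp, pair_fst, F.map_comp, F.map_rst]
    · rw [Category.assoc, e2, ← F.map_comp, pair_snd, F.map_comp, F.map_rst]
    · rw [rst_comp_total _ (total_eqToHom _), ← F.map_rst, rst_pair', F.map_comp, F.map_rst,
        F.map_rst]
  rw [← h, Category.assoc, μ, eqToHom_trans, eqToHom_refl, Category.comp_id]

lemma map_pair_sameArrow {Z X Y : C} (f : Z ⟶ X) (g : Z ⟶ Y) :
    SameArrow (F.map (pair f g)) (pair (F.map f) (F.map g)) := by
  rw [← F.pair_μ]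
  exact SameArrow.comp_eqToHom _ _

lemma map_bang_sameArrow (X : C) : SameArrow (F.map (bang X)) (bang (F.obj X)) := by
  refine ⟨rfl, F.obj_one, ?_⟩
  have h : F.map (bang X) ≫ eqToHom F.obj_one = bang (F.obj X) :=
    to_one_unique (total_comp (F.total_map (total_bang X)) (total_eqToHom _)) (total_bang _)
  rw [← h]
  simp

lemma obj_vars (A X : C) (n : ℕ) : F.obj (vars A X n) = vars (F.obj A) (F.obj X) n := by
  induction n with
  | zero => rfl
  | succ n ih => exact (F.obj_prod _ _).trans (congrArg (prod (F.obj A)) ih)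

/-- The identification of `vars (F A) (F X) n` with `F (vars A X n)`. -/
def ν (A X : C) (n : ℕ) : vars (F.obj A) (F.obj X) n ⟶ F.obj (vars A X n) :=
  eqToHom (F.obj_vars A X n).symm

lemma total_ν (A X : C) (n : ℕ) : Total (F.ν A X n) := total_eqToHom _

lemma pair_ν {A X : C} {n : ℕ} {Z : D} (f : Z ⟶ F.obj A) (g : Z ⟶ vars (F.obj A) (F.obj X) n) :
    pair f g ≫ F.ν A X (n + 1) = pair f (g ≫ F.ν A X n) ≫ F.μ A (vars A X n) := by
  exact ((SameArrow.comp_eqToHom (F.obj_vars A X (n + 1)).symm (pair f g)).trans'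
    (((SameArrow.rfl' f).pair (SameArrow.comp_eqToHom (F.obj_vars A X n).symm g)).symm.trans'
    (SameArrow.comp_eqToHom (F.obj_prod A (vars A X n)).symm _).symm)).eq

lemma tuple_ν {A X Z : C} {n : ℕ} (a : Fin n → (Z ⟶ A)) (x : Z ⟶ X) :
    tuple (fun i => F.map (a i)) (F.map x) ≫ F.ν A X n = F.map (tuple a x) := by
  induction n with
  | zero => exact Category.comp_id _
  | succ n ih =>
    refine (F.pair_ν _ _).trans ?_
    rw [ih]
    exact F.pair_μ _ _

lemma ν_fst (A X : C) (n : ℕ) : F.ν A X (n + 1) ≫ F.map (fst A (vars A X n)) =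
    fst (F.obj A) (vars (F.obj A) (F.obj X) n) :=
  ((SameArrow.eqToHom_comp _ _).trans' ((F.map_fst _ _).trans'
    (SameArrow.fst rfl (F.obj_vars A X n)))).eq

lemma ν_snd (A X : C) (n : ℕ) : F.ν A X (n + 1) ≫ F.map (snd A (vars A X n)) =
    snd (F.obj A) (vars (F.obj A) (F.obj X) n) ≫ F.ν A X n :=
  ((SameArrow.eqToHom_comp _ _).trans' ((F.map_snd _ _).trans'
    ((SameArrow.snd rfl (F.obj_vars A X n)).trans' (SameArrow.comp_eqToHom _ _).symm))).eq

lemma ν_base (A X : C) (n : ℕ) :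
    F.ν A X n ≫ F.map (base A X n) = base (F.obj A) (F.obj X) n := by
  induction n with
  | zero => exact (Category.id_comp _).trans (F.map_id _)
  | succ n ih =>
    refine (congrArg (F.ν A X (n + 1) ≫ ·) (F.map_comp _ _)).trans ?_
    rw [← Category.assoc, F.ν_snd, Category.assoc, ih]
    rfl

lemma ν_proj (A X : C) (n : ℕ) (i : Fin n) :
    F.ν A X n ≫ F.map (proj A X n i) = proj (F.obj A) (F.obj X) n i := by
  induction n with
  | zero => exact i.elim0
  | succ n ih =>
    induction i using Fin.cases with
    | zero => exact F.ν_fst A X n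
    | succ i =>
      refine (congrArg (F.ν A X (n + 1) ≫ ·) (F.map_comp _ _)).trans ?_
      rw [← Category.assoc, F.ν_snd, Category.assoc, ih]
      rfl

lemma map_plus_μ (A : CMon C) {Z : C} (f g : Z ⟶ A.car) :
    pair (F.map f) (F.map g) ≫ F.μ A.car A.car ≫ F.map A.add = F.map (A.plus f g) := by
  rw [← Category.assoc, F.pair_μ, ← F.map_comp]
  rfl

/-- The identification of `1` with `F 1`. -/
def η : one ⟶ F.obj one := eqToHom F.obj_one.symm

lemma map_zero_η (A : CMon C) (Z : C) :
    bang (F.obj Z) ≫ F.η ≫ F.map A.zero = F.map (A.zeroMap Z) := by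
  refine Eq.trans ?_ (F.map_comp _ _).symm
  rw [← Category.assoc]
  exact congrArg (· ≫ F.map A.zero)
    ((SameArrow.comp_eqToHom _ _).trans' (F.map_bang_sameArrow Z).symm).eq

/-- The image of a commutative monoid under a functor. -/
@[reducible] def mapMon (A : CMon C) : CMon D where
  car := F.obj A.car
  add := F.μ A.car A.car ≫ F.map A.add
  zero := F.η ≫ F.map A.zero
  add_total := total_comp (F.total_μ _ _) (F.total_map A.add_total)
  zero_total := total_comp (total_eqToHom _) (F.total_map A.zero_total)
  zero_add := by
    rw [F.map_zero_η, ← F.map_id, F.map_plus_μ]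
    exact congrArg F.map A.zero_add
  add_comm := by
    have h : pair (snd _ _) (fst _ _) ≫ F.μ A.car A.car ≫ F.map A.add =
        F.μ _ _ ≫ F.map (A.plus (snd _ _) (fst _ _)) := by
      rw [← F.μ_fst, ← F.μ_snd, ← comp_pair, Category.assoc, F.map_plus_μ]
    rw [h]
    exact congrArg (F.μ _ _ ≫ F.map ·) A.add_comm
  add_assoc := by
    let θ : prod (prod (F.obj A.car) (F.obj A.car)) (F.obj A.car) ⟶
      F.obj (prod (prod A.car A.car) A.car) :=
      eqToHom (((F.obj_prod _ _).trans (congrArg (prod · _) (F.obj_prod _ _))).symm)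
    have e1 : fst (prod (F.obj A.car) (F.obj A.car)) (F.obj A.car) =
        θ ≫ F.map (fst _ _) ≫ eqToHom (F.obj_prod _ _) := by
      refine (((SameArrow.eqToHom_comp _ _).trans' ((SameArrow.comp_eqToHom _ _).trans'
        ((F.map_fst _ _).trans' (SameArrow.fst (F.obj_prod _ _) rfl)))).symm).eq
    have e2 : snd (prod (F.obj A.car) (F.obj A.car)) (F.obj A.car) =
        θ ≫ F.map (snd _ _) := by
      refine (((SameArrow.eqToHom_comp _ _).trans'
        ((F.map_snd _ _).trans' (SameArrow.snd (F.obj_prod _ _) rfl))).symm).eq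
    have e3 : eqToHom (F.obj_prod A.car A.car) ≫ fst _ _ = F.map (fst A.car A.car) :=
      ((SameArrow.eqToHom_comp _ _).trans' (F.map_fst _ _).symm).eq
    have e4 : eqToHom (F.obj_prod A.car A.car) ≫ snd _ _ = F.map (snd A.car A.car) :=
      ((SameArrow.eqToHom_comp _ _).trans' (F.map_snd _ _).symm).eq
    rw [e1, e2, Category.assoc, Category.assoc, Category.assoc, Category.assoc, e3, e4,
      ← comp_pair, Category.assoc, ← F.map_comp, ← F.map_comp, F.map_plus_μ, ← comp_pair,
      Category.assoc, F.map_plus_μ, ← comp_pair, Category.assoc (f := θ),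
      F.map_plus_μ, ← comp_pair, Category.assoc, F.map_plus_μ]
    exact congrArg (θ ≫ F.map ·) A.add_assoc

lemma mapMon_plus (A : CMon C) {Z : C} (f g : Z ⟶ A.car) :
    (F.mapMon A).plus (F.map f) (F.map g) = F.map (A.plus f g) := F.map_plus_μ A f g

lemma mapMon_zeroMap (A : CMon C) (Z : C) :
    (F.mapMon A).zeroMap (F.obj Z) = F.map (A.zeroMap Z) := F.map_zero_η A Z

lemma map_sum (A : CMon C) {Z : C} {ι : Type} [Fintype ι] (g : ι → (Z ⟶ A.car)) :
    F.map (A.sum g) = (F.mapMon A).sum fun i => F.map (g i) := by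
  let := A.homMonoid Z
  let := (F.mapMon A).homMonoid (F.obj Z)
  let φ : (Z ⟶ A.car) →+ (F.obj Z ⟶ (F.mapMon A).car) :=
    { toFun := fun f => F.map f
      map_zero' := (F.mapMon_zeroMap A Z).symm
      map_add' := fun f g => (F.mapMon_plus A f g).symm }
  exact _root_.map_sum φ g Finset.univ

end CRFunctor

end Functor

/-! ### The Faà di Bruno construction on functors -/

section Terms

variable {C : Type u} [CartQuiver.{v} C] [CartRestrCat C] {P Q R : FaaObj C}

lemma tuple_update_proj {A X Z : C} {m : ℕ} (v : Z ⟶ A) (r : Z ⟶ vars A X m) :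
    tuple (Function.update (Fin.cons v (fun i => r ≫ proj A X m i) : Fin (m + 1) → (Z ⟶ A)) 0 v)
      (r ≫ base A X m) = pair v r := by
  refine congrArg (pair v) ?_
  refine (comp_tuple r (proj A X m) (base A X m)).symm.trans ?_
  rw [tuple_proj_base, Category.comp_id]

lemma FaaHom.term_pair_plus (f : FaaHom P Q) {m : ℕ} {Z : C} (p q : Z ⟶ P.vec.car)
    (r : Z ⟶ vars P.vec.car P.pt m) :
    CartRestrCat.pair (P.vec.plus p q) r ≫ f.term (m + 1) m.succ_pos =
      Q.vec.plus (CartRestrCat.pair p r ≫ f.term (m + 1) m.succ_pos) (CartRestrCat.pair q r ≫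
          f.term (m + 1) m.succ_pos) := by
  have h := f.term_plus (m + 1) m.succ_pos
    (Fin.cons p (fun i => r ≫ proj P.vec.car P.pt m i)) (r ≫ base P.vec.car P.pt m) 0 p q
  have e (v : Z ⟶ P.vec.car) : tuple (Function.update (Fin.cons p
      (fun i => r ≫ proj P.vec.car P.pt m i) : Fin (m + 1) → (Z ⟶ P.vec.car)) 0 v)
      (r ≫ base P.vec.car P.pt m) = CartRestrCat.pair v r := by
    rw [← tuple_update_proj v r, Fin.update_cons_zero, Fin.update_cons_zero]
  rw [e, e, e] at h
  exact h

lemma FaaHom.term_pair_zero (f : FaaHom P Q) {m : ℕ} {Z : C} (r : Z ⟶ vars P.vec.car P.pt m) :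
    CartRestrCat.pair (P.vec.zeroMap Z) r ≫ f.term (m + 1) m.succ_pos =
      rst (CartRestrCat.pair (P.vec.zeroMap Z) r ≫ f.term (m + 1) m.succ_pos) ≫ Q.vec.zeroMap Z :=
          by
  have h := f.term_zero (m + 1) m.succ_pos
    (Fin.cons (P.vec.zeroMap Z) (fun i => r ≫ proj P.vec.car P.pt m i))
    (r ≫ base P.vec.car P.pt m) 0
  rw [tuple_update_proj] at h
  exact h

lemma comp_sum_of_total {A : CMon C} {W Z : C} {ι : Type} [Fintype ι] {h : W ⟶ Z} (hh : Total h)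
    (g : ι → (Z ⟶ A.car)) : h ≫ A.sum g = A.sum fun i => h ≫ g i := by
  let := A.homMonoid Z
  let := A.homMonoid W
  let φ : (Z ⟶ A.car) →+ (W ⟶ A.car) :=
    { toFun := fun f => h ≫ f
      map_zero' := by
        refine (A.comp_zeroMap h).trans ?_
        rw [hh, Category.id_comp]
        rfl
      map_add' := fun f g => A.comp_plus h f g }
  exact map_sum φ g Finset.univ

lemma SameArrow.linTerm {A A' X X' : C} {B B' : CMon C} (hX : X = X') (hB : B = B')
    {h : A ⟶ B.car} {h' : A' ⟶ B'.car} (e : SameArrow h h') (n : ℕ) (hn : 0 < n) :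
    SameArrow (FaaDiBruno.linTerm X B h n hn) (FaaDiBruno.linTerm X' B' h' n hn) := by
  subst hX hB
  obtain ⟨rfl, _, e⟩ := e
  simp only [eqToHom_refl, Category.id_comp, Category.comp_id] at e
  subst e
  exact SameArrow.rfl' _

end Terms

namespace CRFunctor

variable {C : Type u} [CartQuiver.{v} C] [CartRestrCat C]
  {D : Type u'} [CartQuiver.{v'} D] [CartRestrCat D] (F : CRFunctor C D) {P Q R : FaaObj C}

/-- The image of an object of the Faà di Bruno category under a functor. -/
abbrev mapObj (P : FaaObj C) : FaaObj D := ⟨F.mapMon P.vec, F.obj P.pt⟩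

/-- The image of a term. -/
abbrev mapTerm (f : FaaHom P Q) (n : ℕ) (hn : 0 < n) :
    vars (F.mapObj P).vec.car (F.mapObj P).pt n ⟶ (F.mapObj Q).vec.car :=
  F.ν P.vec.car P.pt n ≫ F.map (f.term n hn)

lemma rst_mapTerm (f : FaaHom P Q) (n : ℕ) (hn : 0 < n) : rst (F.mapTerm f n hn) =
    rst (base (F.mapObj P).vec.car (F.mapObj P).pt n ≫ F.map f.star) := by
  rw [mapTerm, ← rst_comp_rst, ← F.map_rst, f.rst_term n hn, F.map_rst, rst_comp_rst, F.map_comp,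
    ← Category.assoc, F.ν_base]

lemma mapTerm_symm (f : FaaHom P Q) (n : ℕ) (hn : 0 < n) (σ : Equiv.Perm (Fin n)) :
    tuple (fun i => proj (F.mapObj P).vec.car (F.mapObj P).pt n (σ i))
      (base (F.mapObj P).vec.car (F.mapObj P).pt n) ≫ F.mapTerm f n hn = F.mapTerm f n hn := by
  have h : tuple (fun i => proj (F.mapObj P).vec.car (F.mapObj P).pt n (σ i))
      (base (F.mapObj P).vec.car (F.mapObj P).pt n) = F.ν P.vec.car P.pt n ≫
      tuple (fun i => F.map (proj P.vec.car P.pt n (σ i))) (F.map (base P.vec.car P.pt n)) := by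
    rw [comp_tuple, F.ν_base]
    exact congrArg (tuple · _) (funext fun i => (F.ν_proj _ _ _ _).symm)
  have e := congrArg F.map (f.term_symm n hn σ)
  rw [F.map_comp, ← F.tuple_ν, Category.assoc] at e
  rw [h, mapTerm, Category.assoc]
  exact congrArg (F.ν P.vec.car P.pt n ≫ ·) e

section Additive

variable (f : FaaHom P Q) {m : ℕ} {S : Stage D}

lemma pair_mapTerm {Z : D} (b : Z ⟶ F.obj P.vec.car)
    (r : Z ⟶ vars (F.obj P.vec.car) (F.obj P.pt) m) :
    pair b r ≫ F.mapTerm f (m + 1) m.succ_pos =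
      (pair b (r ≫ F.ν P.vec.car P.pt m) ≫ F.μ P.vec.car (vars P.vec.car P.pt m)) ≫
        F.map (f.term (m + 1) m.succ_pos) := by
  rw [← F.pair_ν, Category.assoc]

/-- A map between images of products, in terms of the identification of products. -/
lemma comp_map_pair {Z W X Y : C} {Z' : D} (k : Z' ⟶ F.obj Z) (p : Z ⟶ X) (q : Z ⟶ Y)
    (t : prod X Y ⟶ W) : k ≫ F.map (pair p q ≫ t) =
      (pair (k ≫ F.map p) (k ≫ F.map q) ≫ F.μ X Y) ≫ F.map t := by
  rw [F.map_comp, ← F.pair_μ, ← comp_pair]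
  simp only [Category.assoc]

/-- Additivity of the image of a term in its first variable, at total elements of a stage, from
additivity at the generic elements of the domain category. -/
lemma mapTerm_plus (b c : Pt S (F.obj P.vec.car))
    (r : Pt S (vars (F.obj P.vec.car) (F.obj P.pt) m)) :
    pair ((F.mapMon P.vec).plus b.map c.map) r.map ≫ F.mapTerm f (m + 1) m.succ_pos =
      (F.mapMon Q.vec).plus (pair b.map r.map ≫ F.mapTerm f (m + 1) m.succ_pos)
        (pair c.map r.map ≫ F.mapTerm f (m + 1) m.succ_pos) := by
  let A := P.vec.car
  let V := vars P.vec.car P.pt m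
  let r' : Pt S (F.obj V) := r.to (F.ν _ _ _) (r.rst_comp_total (F.total_ν _ _ _))
  -- the point `k` of `F (A × (A × V))` sends the generic elements to `b`, `c` and `r`
  let k₀ : Pt S (F.obj (prod A V)) :=
    (c.pair r').to (F.μ A V) (Pt.rst_comp_total _ (F.total_μ _ _))
  let k : Pt S (F.obj (prod A (prod A V))) :=
    (b.pair k₀).to (F.μ A (prod A V)) (Pt.rst_comp_total _ (F.total_μ _ _))
  have hs {X Y : C} (x : Pt S (F.obj X)) (y : Pt S (F.obj Y)) :
      (pair x.map y.map ≫ F.μ X Y) ≫ F.map (snd X Y) = y.map := by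
    rw [Category.assoc, F.μ_snd]
    exact congrArg Pt.map (Pt.snd_pair x y)
  have hf {X Y : C} (x : Pt S (F.obj X)) (y : Pt S (F.obj Y)) :
      (pair x.map y.map ≫ F.μ X Y) ≫ F.map (fst X Y) = x.map := by
    rw [Category.assoc, F.μ_fst]
    exact congrArg Pt.map (Pt.fst_pair x y)
  have hp : k.map ≫ F.map (fst A (prod A V)) = b.map := hf b k₀
  have hq : k.map ≫ F.map (snd A (prod A V) ≫ fst A V) = c.map := by
    rw [F.map_comp, ← Category.assoc]
    exact (congrArg (· ≫ F.map (fst A V)) (hs b k₀)).trans (hf c r')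
  have hr : k.map ≫ F.map (snd A (prod A V) ≫ snd A V) = r.map ≫ F.ν _ _ _ := by
    rw [F.map_comp, ← Category.assoc]
    exact (congrArg (· ≫ F.map (snd A V)) (hs b k₀)).trans (hs c r')
  have h := congrArg (k.map ≫ F.map ·) (f.term_pair_plus (fst A (prod A V))
    (snd A (prod A V) ≫ fst A V) (snd A (prod A V) ≫ snd A V))
  simp only [← F.mapMon_plus, CMon.comp_plus, comp_map_pair] at h
  rw [hp, hq, hr] at h
  rw [F.pair_mapTerm, F.pair_mapTerm, F.pair_mapTerm]
  exact h

/-- The analogue of `mapTerm_plus` for the insertion of zero. -/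
lemma mapTerm_zero (r : Pt S (vars (F.obj P.vec.car) (F.obj P.pt) m))
    (h0 : rst (pair (S.dom ≫ (F.mapMon P.vec).zeroMap S.obj) r.map ≫
      F.mapTerm f (m + 1) m.succ_pos) = S.dom) :
    pair (S.dom ≫ (F.mapMon P.vec).zeroMap S.obj) r.map ≫ F.mapTerm f (m + 1) m.succ_pos =
      S.dom ≫ (F.mapMon Q.vec).zeroMap S.obj := by
  let V := vars P.vec.car P.pt m
  let r' : Pt S (F.obj V) := r.to (F.ν _ _ _) (r.rst_comp_total (F.total_ν _ _ _))
  -- the generic element is the identity of `V`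
  have h := congrArg (r'.map ≫ F.map ·) (f.term_pair_zero (𝟙 V))
  have e : r'.map ≫ F.map (P.vec.zeroMap V) = S.dom ≫ (F.mapMon P.vec).zeroMap S.obj := by
    rw [← F.mapMon_zeroMap, CMon.comp_zeroMap, r'.rst_map]
  have e' : r'.map ≫ F.map (Q.vec.zeroMap V) = S.dom ≫ (F.mapMon Q.vec).zeroMap S.obj := by
    rw [← F.mapMon_zeroMap, CMon.comp_zeroMap, r'.rst_map]
  have key : (pair (S.dom ≫ (F.mapMon P.vec).zeroMap S.obj) r'.map ≫ F.μ P.vec.car V) ≫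
      F.map (f.term (m + 1) m.succ_pos) =
      pair (S.dom ≫ (F.mapMon P.vec).zeroMap S.obj) r.map ≫ F.mapTerm f (m + 1) m.succ_pos :=
    (F.pair_mapTerm f _ r.map).symm
  simp only [F.map_comp (rst _), F.map_rst] at h
  rw [← Category.assoc, comp_rst', Category.assoc, e', comp_map_pair, e, F.map_id,
    Category.comp_id, key, h0, ← Category.assoc S.dom S.dom, S.dom_dom] at h
  exact h

end Additive

/-- The image `(F f_*, F f₁, F f₂, …)` of a map of the Faà di Bruno category. -/
def mapHom (f : FaaHom P Q) : FaaHom (F.mapObj P) (F.mapObj Q) :=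
  FaaHom.ofTerms (F.map f.star) (F.mapTerm f) (F.rst_mapTerm f) (F.mapTerm_symm f)
    (fun x y h n c a b => F.mapTerm_plus f a.toPt b.toPt (vtuple c x))
    (fun {S} x y h n c => F.mapTerm_zero f (vtuple c x)
      (rst_vtuple_comp (Fin.cons (0 : Vec (F.mapObj P).vec S) c) x
        (F.rst_mapTerm f _ n.succ_pos) y h))

lemma mapHom_term (f : FaaHom P Q) (n : ℕ) (hn : 0 < n) :
    (F.mapHom f).term n hn = F.ν P.vec.car P.pt n ≫ F.map (f.term n hn) := rfl

lemma mapHom_term_sameArrow (f : FaaHom P Q) (n : ℕ) (hn : 0 < n) :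
    SameArrow ((F.mapHom f).term n hn) (F.map (f.term n hn)) := SameArrow.eqToHom_comp _ _

lemma mapMon_prod (A B : CMon C) : F.mapMon (A.prod B) = (F.mapMon A).prod (F.mapMon B) := by
  refine CMon.eq_of_sameArrow (F.obj_prod _ _) ?_ ?_
  · refine (SameArrow.eqToHom_comp _ _).trans' ?_
    refine (F.map_pair_sameArrow _ _).trans' ?_
    have hff : SameArrow (F.map (fst (prod A.car B.car) (prod A.car B.car) ≫ fst A.car B.car))
        (fst (prod (F.obj A.car) (F.obj B.car)) (prod (F.obj A.car) (F.obj B.car)) ≫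
          fst (F.obj A.car) (F.obj B.car)) := by
      rw [F.map_comp]
      exact ((F.map_fst _ _).trans' (SameArrow.fst (F.obj_prod _ _) (F.obj_prod _ _))).comp
        (F.map_fst _ _)
    have hsf : SameArrow (F.map (snd (prod A.car B.car) (prod A.car B.car) ≫ fst A.car B.car))
        (snd (prod (F.obj A.car) (F.obj B.car)) (prod (F.obj A.car) (F.obj B.car)) ≫
          fst (F.obj A.car) (F.obj B.car)) := by
      rw [F.map_comp]
      exact ((F.map_snd _ _).trans' (SameArrow.snd (F.obj_prod _ _) (F.obj_prod _ _))).comp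
        (F.map_fst _ _)
    have hfs : SameArrow (F.map (fst (prod A.car B.car) (prod A.car B.car) ≫ snd A.car B.car))
        (fst (prod (F.obj A.car) (F.obj B.car)) (prod (F.obj A.car) (F.obj B.car)) ≫
          snd (F.obj A.car) (F.obj B.car)) := by
      rw [F.map_comp]
      exact ((F.map_fst _ _).trans' (SameArrow.fst (F.obj_prod _ _) (F.obj_prod _ _))).comp
        (F.map_snd _ _)
    have hss : SameArrow (F.map (snd (prod A.car B.car) (prod A.car B.car) ≫ snd A.car B.car))
        (snd (prod (F.obj A.car) (F.obj B.car)) (prod (F.obj A.car) (F.obj B.car)) ≫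
          snd (F.obj A.car) (F.obj B.car)) := by
      rw [F.map_comp]
      exact ((F.map_snd _ _).trans' (SameArrow.snd (F.obj_prod _ _) (F.obj_prod _ _))).comp
        (F.map_snd _ _)
    have hadd (A : CMon C) : SameArrow (F.map A.add) (F.mapMon A).add :=
      (SameArrow.eqToHom_comp _ _).symm
    refine SameArrow.pair ?_ ?_
    · rw [F.map_comp]
      exact ((F.map_pair_sameArrow _ _).trans' (hff.pair hsf)).comp (hadd A)
    · rw [F.map_comp]
      exact ((F.map_pair_sameArrow _ _).trans' (hfs.pair hss)).comp (hadd B)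
  · refine (SameArrow.eqToHom_comp _ _).trans' ?_
    refine (F.map_pair_sameArrow _ _).trans' ?_
    exact ((SameArrow.eqToHom_comp _ _).symm).pair (SameArrow.eqToHom_comp _ _).symm

lemma mapMon_triv : F.mapMon (CMon.triv C) = CMon.triv D := by
  refine CMon.eq_of_sameArrow F.obj_one ?_ ?_
  · refine (SameArrow.eqToHom_comp _ _).trans' ((F.map_bang_sameArrow _).trans' ?_)
    exact SameArrow.bang ((F.obj_prod _ _).trans (congrArg₂ prod F.obj_one F.obj_one))
  · refine (SameArrow.eqToHom_comp _ _).trans' ?_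
    change SameArrow (F.map (𝟙 one)) (𝟙 one)
    rw [F.map_id, F.obj_one]
    exact SameArrow.rfl' _

lemma mapObj_prod (P Q : FaaObj C) : F.mapObj (prod P Q) = prod (F.mapObj P) (F.mapObj Q) :=
  FaaObj.ext (F.mapMon_prod _ _) (heq_of_eq (F.obj_prod _ _)).eq

lemma mapObj_one : F.mapObj one = one := FaaObj.ext F.mapMon_triv F.obj_one

lemma ν_linTerm {A : C} (X : C) (B : CMon C) (h : A ⟶ B.car) (n : ℕ) (hn : 0 < n) :
    F.ν A X n ≫ F.map (linTerm X B h n hn) =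
      linTerm (F.obj X) (F.mapMon B) (F.map h) n hn := by
  unfold linTerm
  split_ifs
  · rw [F.map_comp, ← Category.assoc, F.ν_proj]
  · rw [← F.mapMon_zeroMap, CMon.comp_zeroMap, F.total_ν, Category.id_comp]

lemma map_linTerm_sameArrow {A : C} (X : C) (B : CMon C) (h : A ⟶ B.car) (n : ℕ) (hn : 0 < n) :
    SameArrow (F.map (linTerm X B h n hn)) (linTerm (F.obj X) (F.mapMon B) (F.map h) n hn) := by
  rw [← F.ν_linTerm]
  exact (SameArrow.eqToHom_comp _ _).symm

lemma ν_compTerm (f : FaaHom P Q) (g : FaaHom Q R) (n : ℕ) (hn : 0 < n) :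
    F.ν P.vec.car P.pt n ≫ F.map (compTerm f g n hn) =
      compTerm (F.mapHom f) (F.mapHom g) n hn := by
  unfold compTerm
  rw [F.map_sum]
  refine (comp_sum_of_total (F.total_ν _ _ _) _).trans ?_
  refine congrArg (CMon.sum _) (funext fun c => ?_)
  rw [F.map_comp, ← F.tuple_ν, F.map_comp, ← Category.assoc, ← Category.assoc, comp_tuple,
    ← Category.assoc, F.ν_base, Category.assoc]
  refine congrArg₂ (· ≫ ·) (congrArg₂ tuple (funext fun m => ?_) rfl) rfl
  rw [F.map_comp, ← F.tuple_ν, ← Category.assoc, ← Category.assoc, comp_tuple, F.ν_base]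
  simp only [F.ν_proj]
  rw [Category.assoc]
  rfl

/-- The Faà di Bruno construction on functors. -/
def mapFaa : CRFunctor (FaaObj C) (FaaObj D) where
  obj := F.mapObj
  map f := F.mapHom f
  map_id P := FaaHom.ext (F.map_id _) (funext fun n => funext fun hn => by
    refine (F.mapHom_term _ n hn).trans ?_
    rw [(isFaa C).id_term, F.ν_linTerm, F.map_id]
    exact ((isFaa D).id_term (F.mapObj P) n hn).symm)
  map_comp f g := FaaHom.ext (F.map_comp _ _) (funext fun n => funext fun hn => by
    refine (F.mapHom_term _ n hn).trans ?_
    rw [(isFaa C).comp_term, F.ν_compTerm]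
    exact ((isFaa D).comp_term _ _ n hn).symm)
  map_rst {P Q} f := FaaHom.ext (F.map_rst _) (funext fun n => funext fun hn => by
    refine (F.mapHom_term _ n hn).trans ?_
    rw [(isFaa C).rst_term, F.map_comp, F.map_rst, ← Category.assoc, comp_rst', F.map_comp,
      ← Category.assoc, F.ν_base, Category.assoc, F.ν_linTerm, F.map_id]
    exact ((isFaa D).rst_term (F.mapHom f) n hn).symm)
  obj_one := F.mapObj_one
  obj_prod := F.mapObj_prod
  map_fst P Q := by
    refine FaaHom.sameArrow (F.mapObj_prod _ _) rfl ((F.map_fst _ _).trans' ?_) fun n hn => ?_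
    · rw [(isFaa D).fst_star]
      exact SameArrow.rfl' _
    · refine (F.mapHom_term_sameArrow _ n hn).trans' ?_
      rw [(isFaa C).fst_term, (isFaa D).fst_term]
      refine (F.map_linTerm_sameArrow _ _ _ n hn).trans' ?_
      exact SameArrow.linTerm (F.obj_prod _ _) rfl (F.map_fst _ _) n hn
  map_snd P Q := by
    refine FaaHom.sameArrow (F.mapObj_prod _ _) rfl ((F.map_snd _ _).trans' ?_) fun n hn => ?_
    · rw [(isFaa D).snd_star]
      exact SameArrow.rfl' _
    · refine (F.mapHom_term_sameArrow _ n hn).trans' ?_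
      rw [(isFaa C).snd_term, (isFaa D).snd_term]
      refine (F.map_linTerm_sameArrow _ _ _ n hn).trans' ?_
      exact SameArrow.linTerm (F.obj_prod _ _) rfl (F.map_snd _ _) n hn

lemma isFaaMap_mapFaa {C D : Type u} [CartQuiver.{v} C] [CartRestrCat C] [CartQuiver.{v} D]
    [CartRestrCat D] (F : CRFunctor C D) : IsFaaMap F F.mapFaa where
  obj_pt P := rfl
  obj_car P := rfl
  obj_add P := SameArrow.eqToHom_comp _ _
  obj_zero P := SameArrow.eqToHom_comp _ _
  map_star f := SameArrow.rfl' _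
  map_term f n hn := F.mapHom_term_sameArrow f n hn

end CRFunctor

/-! ### Naturality and the counit laws -/

section MapLaws

variable {C : Type u} [CartQuiver.{v} C] [CartRestrCat C]
  {D : Type u'} [CartQuiver.{v'} D] [CartRestrCat D]
  {E : Type u''} [CartQuiver.{v''} E] [CartRestrCat E]
  (F : CRFunctor C D) (G : CRFunctor D E) {P Q : FaaObj C}

namespace CRFunctor

lemma mapMon_add_sameArrow (A : CMon C) : SameArrow (F.mapMon A).add (F.map A.add) :=
  SameArrow.eqToHom_comp _ _

lemma mapMon_zero_sameArrow (A : CMon C) : SameArrow (F.mapMon A).zero (F.map A.zero) :=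
  SameArrow.eqToHom_comp _ _

lemma mapMon_id (A : CMon C) : (CRFunctor.id C).mapMon A = A :=
  CMon.eq_of_sameArrow rfl (mapMon_add_sameArrow _ A) (mapMon_zero_sameArrow _ A)

lemma mapMon_comp (A : CMon C) : (F.comp G).mapMon A = G.mapMon (F.mapMon A) :=
  CMon.eq_of_sameArrow rfl
    ((mapMon_add_sameArrow _ A).trans' (((F.mapMon_add_sameArrow A).symm.map G.toFunctor).trans'
      (G.mapMon_add_sameArrow _).symm))
    ((mapMon_zero_sameArrow _ A).trans' (((F.mapMon_zero_sameArrow A).symm.map G.toFunctor).trans'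
      (G.mapMon_zero_sameArrow _).symm))

lemma mapObj_id (P : FaaObj C) : (CRFunctor.id C).mapObj P = P :=
  FaaObj.ext (mapMon_id P.vec) rfl

lemma mapObj_comp (P : FaaObj C) : (F.comp G).mapObj P = G.mapObj (F.mapObj P) :=
  FaaObj.ext (F.mapMon_comp G P.vec) rfl

lemma mapFaa_id : (CRFunctor.id C).mapFaa = CRFunctor.id (FaaObj C) :=
  ext_sameArrow mapObj_id fun {P Q} f =>
    FaaHom.sameArrow (f := (CRFunctor.id C).mapHom f) (g := f)
      (mapObj_id P) (mapObj_id Q)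
      (SameArrow.rfl' (FaaHom.star f)) fun n hn => mapHom_term_sameArrow _ f n hn

lemma mapFaa_comp : (F.comp G).mapFaa = F.mapFaa.comp G.mapFaa :=
  ext_sameArrow (F.mapObj_comp G) fun {P Q} f =>
    FaaHom.sameArrow (f := (F.comp G).mapHom f) (g := G.mapHom (F.mapHom f))
      (F.mapObj_comp G P) (F.mapObj_comp G Q)
      (SameArrow.rfl' _) fun n hn => (mapHom_term_sameArrow _ f n hn).trans'
        (((F.mapHom_term_sameArrow f n hn).symm.map G.toFunctor).trans'
          (G.mapHom_term_sameArrow (F.mapHom f) n hn).symm)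

lemma mapFaa_comp_counit : F.mapFaa.comp (counit (isFaa D)) = (counit (isFaa C)).comp F := rfl

lemma mapHom_linear_sameArrow {P' Q' : FaaObj D} (hP : F.mapObj P = P') (hQ : F.mapObj Q = Q')
    {f : P.pt ⟶ Q.pt} (hf : Total f) (φ : CMonHom P.vec Q.vec) {f' : P'.pt ⟶ Q'.pt}
    (hf' : Total f') (φ' : CMonHom P'.vec Q'.vec) (e : SameArrow (F.map f) f')
    (h : SameArrow (F.map φ.map) φ'.map) :
    SameArrow (C := FaaObj D) (F.mapHom (FaaHom.linear f φ)) (FaaHom.linear f' φ') := by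
  subst hP hQ
  refine FaaHom.sameArrow rfl rfl e fun n hn => ?_
  refine (F.mapHom_term_sameArrow _ n hn).trans' ?_
  rw [FaaHom.linear_term_of_total hf, FaaHom.linear_term_of_total hf']
  exact (F.map_linTerm_sameArrow _ _ _ n hn).trans' (SameArrow.linTerm rfl rfl h n hn)

lemma tangMon_mapMon (A : CMon C) : tangMon (F.mapMon A) = F.mapFaa.mapMon (tangMon A) :=
  CMon.eq_of_sameArrow rfl
    ((F.mapHom_linear_sameArrow (P := tang (A.prod A)) (Q := tang A)
      (P' := tang ((F.mapMon A).prod (F.mapMon A))) (Q' := tang (F.mapMon A))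
      (FaaObj.ext (F.mapMon_prod A A) (F.obj_prod _ _)) rfl A.add_total (CMonHom.add A)
      (F.mapMon A).add_total (CMonHom.add (F.mapMon A)) (F.mapMon_add_sameArrow A).symm
      (F.mapMon_add_sameArrow A).symm).symm.trans' (F.mapFaa.mapMon_add_sameArrow (tangMon A)).symm)
    ((F.mapHom_linear_sameArrow (P := tang (CMon.triv C)) (Q := tang A)
      (P' := tang (CMon.triv D)) (Q' := tang (F.mapMon A))
      (FaaObj.ext F.mapMon_triv F.obj_one) rfl A.zero_total (CMonHom.zero A)
      (F.mapMon A).zero_total (CMonHom.zero (F.mapMon A)) (F.mapMon_zero_sameArrow A).symm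
      (F.mapMon_zero_sameArrow A).symm).symm.trans'
        (F.mapFaa.mapMon_zero_sameArrow (tangMon A)).symm)

lemma deltaObj_mapObj (P : FaaObj C) : deltaObj (F.mapObj P) = F.mapFaa.mapObj (deltaObj P) :=
  FaaObj.ext (F.tangMon_mapMon P.vec) rfl

end CRFunctor

lemma eqToHom_proj {X X' Y Y' : C} {n : ℕ} (hX : X = X') (hY : Y = Y')
    (h : vars X Y n = vars X' Y' n) (i : Fin n) :
    eqToHom h ≫ proj X' Y' n i = proj X Y n i ≫ eqToHom hX := by
  subst hX hY
  simp

namespace CRFunctor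

/-- The formula for the comultiplication is preserved by functors. -/
lemma map_deltaTerm (f : FaaHom P Q) (n : ℕ) (hn : 0 < n) (m : ℕ) :
    SameArrow (deltaTerm (F.mapHom f) n hn m) (F.map (deltaTerm f n hn m)) := by
  let U := vars P.vec.car P.vec.car n
  let V := vars P.vec.car P.pt n
  let U' := vars (F.obj P.vec.car) (F.obj P.vec.car) n
  let V' := vars (F.obj P.vec.car) (F.obj P.pt) n
  have hU : U' = F.obj U := (F.obj_vars _ _ n).symm
  have hV : V' = F.obj V := (F.obj_vars _ _ n).symm
  -- the identification of the two sources of the formula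
  let ω : vars U' V' m ⟶ F.obj (vars U V m) :=
    eqToHom (congrArg₂ (vars · · m) hU hV) ≫ F.ν U V m
  have hω : Total ω := total_comp (total_eqToHom _) (F.total_ν _ _ _)
  have hb : ω ≫ F.map (base U V m) = base U' V' m ≫ F.ν _ _ n := by
    rw [Category.assoc, F.ν_base, eqToHom_base hU hV]
    rfl
  have hp (j : Fin m) : ω ≫ F.map (proj U V m j) = proj U' V' m j ≫ F.ν _ _ n := by
    rw [Category.assoc, F.ν_proj, eqToHom_proj hU hV]
    rfl
  have hs : SameArrow (ω ≫ F.map (deltaTerm f n hn m)) (F.map (deltaTerm f n hn m)) := by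
    rw [Category.assoc]
    exact (SameArrow.eqToHom_comp _ _).trans' (SameArrow.eqToHom_comp _ _)
  refine (SameArrow.of_eq ?_).trans' hs
  unfold deltaTerm
  rw [F.map_sum]
  refine Eq.symm ((comp_sum_of_total hω _).trans ?_)
  refine congrArg (CMon.sum _) (funext fun φ => ?_)
  rw [F.map_comp, ← F.tuple_ν, ← Category.assoc, ← Category.assoc, comp_tuple, Category.assoc]
  refine congrArg₂ (· ≫ ·) (congrArg₂ tuple (funext fun i => ?_) ?_) rfl
  · refine Fin.addCases (fun i => ?_) (fun k => ?_) i
    · rw [Fin.append_left, Fin.append_left]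
      cases φ.1 i with
      | none =>
        refine (congrArg (ω ≫ ·) (F.map_comp _ _)).trans ?_
        rw [← Category.assoc]
        refine (congrArg (· ≫ _) hb).trans ?_
        rw [Category.assoc, F.ν_proj]
        rfl
      | some j =>
        refine (congrArg (ω ≫ ·) (F.map_comp _ _)).trans ?_
        rw [← Category.assoc]
        refine (congrArg (· ≫ _) (hp j)).trans ?_
        rw [Category.assoc, F.ν_proj]
        rfl
    · rw [Fin.append_right, Fin.append_right, F.map_comp, ← Category.assoc]
      refine (congrArg (· ≫ _) (hp _)).trans ?_
      rw [Category.assoc, F.ν_base]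
  · rw [F.map_comp, ← Category.assoc]
    refine (congrArg (· ≫ _) hb).trans ?_
    rw [Category.assoc, F.ν_base]

lemma delta_mapHom (f : P ⟶ Q) :
    SameArrow (delta (F.mapHom f : F.mapObj P ⟶ F.mapObj Q)) (F.mapFaa.mapHom (delta f)) := by
  refine FaaHom.sameArrow (F.deltaObj_mapObj P) (F.deltaObj_mapObj Q) (SameArrow.rfl' _)
    fun n hn => ?_
  refine SameArrow.trans' ?_ (F.mapFaa.mapHom_term_sameArrow (delta f) n hn).symm
  refine FaaHom.sameArrow (F.mapFaa.obj_vars (tang P.vec) P n).symm rfl ?_ fun m hm => ?_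
  · exact (delta_term_star _ n hn).trans' ((F.mapHom_term_sameArrow f n hn).trans'
      ((delta_term_star f n hn).symm.map F.toFunctor))
  · refine (delta_term_term _ n hn m hm).trans' ((F.map_deltaTerm f n hn m).trans' ?_)
    exact ((delta_term_term f n hn m hm).symm.map F.toFunctor).trans'
      (F.mapHom_term_sameArrow _ m hm).symm

/-- The comultiplication is natural. -/
lemma mapFaa_comp_deltaFunctor :
    F.mapFaa.comp (deltaFunctor D) = (deltaFunctor C).comp F.mapFaa.mapFaa :=
  ext_sameArrow F.deltaObj_mapObj fun f => F.delta_mapHom f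

variable (C) in
lemma deltaFunctor_comp_counit :
    (deltaFunctor C).comp (counit (isFaa (FaaObj C))) = CRFunctor.id (FaaObj C) := rfl

lemma mapMon_counit (A : CMon C) : (counit (isFaa C)).mapMon (tangMon A) = A :=
  CMon.eq_of_sameArrow rfl (mapMon_add_sameArrow _ (tangMon A))
    (mapMon_zero_sameArrow _ (tangMon A))

lemma mapObj_counit (P : FaaObj C) : (counit (isFaa C)).mapObj (deltaObj P) = P :=
  FaaObj.ext (mapMon_counit P.vec) rfl

variable (C) in
lemma deltaFunctor_comp_mapFaa_counit :
    (deltaFunctor C).comp (counit (isFaa C)).mapFaa = CRFunctor.id (FaaObj C) :=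
  ext_sameArrow mapObj_counit fun {P Q} f =>
    FaaHom.sameArrow (f := (counit (isFaa C)).mapHom (delta f)) (g := f)
      (mapObj_counit P) (mapObj_counit Q)
      (SameArrow.rfl' (FaaHom.star f)) fun n hn =>
        ((counit (isFaa C)).mapHom_term_sameArrow (delta f) n hn).trans' (delta_term_star f n hn)

end CRFunctor

end MapLaws

/-! ### Coassociativity -/

section Coassoc

variable {C : Type u} [CartQuiver.{v} C] [CartRestrCat C] {P Q : FaaObj C}

lemma univ_map_ne_zero {M : Type*} {n : ℕ} (hn : 0 < n) (a : Fin n → M) :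
    Finset.univ.val.map a ≠ 0 := fun h => hn.ne' (by
  have e := Multiset.card_map a Finset.univ.val
  rw [h, Multiset.card_zero, Finset.card_val, Finset.card_univ, Fintype.card_fin] at e
  exact e.symm)

lemma delta_diff_term (g : P ⟶ Q) {n : ℕ} (hn : 0 < n) :
    FaaHom.term (delta (Q := tang Q.vec) (diff g)) n hn =
      FaaHom.term (diff (P := deltaObj P) (Q := deltaObj Q) (delta g)) n hn := by
  obtain ⟨q, hq⟩ := exists_generic_snd g n
  refine (delta_diff_term_of_jet g hn (by
    obtain ⟨m, rfl⟩ := Nat.exists_eq_add_one.2 hn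
    exact fun x y h q hq t => delta_diff_jet g x y h q hq t) q hq).trans ?_
  refine Eq.trans ?_ (FaaHom.term_eq_eval (diff (P := deltaObj P) (Q := deltaObj Q) (delta g))
    n hn).symm
  refine congrArg (fun k : Vec (tangMon Q.vec) _ => k.map) ?_
  refine Eq.trans ?_ (FaaHom.jet_univ (diff (P := deltaObj P) (Q := deltaObj Q) (delta g))
    _ _ _ hn _)
  refine Eq.trans ?_ (diff_jet (P := deltaObj P) (Q := deltaObj Q) (delta g) _ _ _ q hq
    (univ_map_ne_zero hn _)).symm
  refine (dirJ_map _ _ _ _ _ _).trans ?_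
  exact (dirJ_map (FaaHom.jet (delta g)
      (genPt (deltaObj (prod (tang P.vec) P)) (diff g) n).snd q hq)
    ⟨(genPt (deltaObj (prod (tang P.vec) P)) (diff g) n).fst⟩
    (Vec.fst (A := tangMon P.vec) (B := tangMon P.vec))
    (Vec.snd (A := tangMon P.vec) (B := tangMon P.vec))
    (genVec (prod (tang (deltaObj P).vec) (deltaObj P)) (diff g) n) Finset.univ.val).symm

/-- The comultiplication commutes with derivatives. -/
lemma delta_diff (g : P ⟶ Q) : SameArrow (delta (Q := tang Q.vec) (diff g))
    (diff (P := deltaObj P) (Q := deltaObj Q) (delta g)) :=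
  FaaHom.sameArrow (deltaObj_prod (tang P.vec) P) rfl (SameArrow.rfl' (diff g)) fun _ hn =>
    SameArrow.of_eq (delta_diff_term g hn)

lemma SameArrow.diff {P' Q' : FaaObj C} {f : P ⟶ Q} {g : P' ⟶ Q'} (h : SameArrow f g) :
    SameArrow (FaaDiBruno.diff f) (FaaDiBruno.diff g) := by
  obtain ⟨rfl, rfl, h⟩ := h
  simp only [eqToHom_refl, Category.id_comp, Category.comp_id] at h
  subst h
  exact SameArrow.rfl' _

lemma delta_lin_zero (A : CMon C) :
    SameArrow (delta (P := tang (CMon.triv C)) (Q := tang A) (tangMon A).zero)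
      (tangMon (tangMon A)).zero :=
  (SameArrow.of_eq (delta_linear (P := tang (CMon.triv C)) (Q := tang A) _ _)).trans'
    (linear_sameArrow (Q := tang (tangMon A)) tangMon_triv (tangMon A).zero
      (tangHom (CMonHom.zero A)) (CMonHom.zero (tangMon A)) HEq.rfl)

lemma delta_lin_add (A : CMon C) :
    SameArrow (delta (P := tang (A.prod A)) (Q := tang A) (tangMon A).add)
      (tangMon (tangMon A)).add :=
  (SameArrow.of_eq (delta_linear (P := tang (A.prod A)) (Q := tang A) _ _)).trans'
    (linear_sameArrow (Q := tang (tangMon A)) (tangMon_prod A A) (tangMon A).add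
      (tangHom (CMonHom.add A)) (CMonHom.add (tangMon A)) HEq.rfl)

lemma tangMon_tangMon (A : CMon C) : (deltaFunctor C).mapMon (tangMon A) = tangMon (tangMon A) :=
  CMon.eq_of_sameArrow rfl
    (((deltaFunctor C).mapMon_add_sameArrow (tangMon A)).trans' (delta_lin_add A))
    (((deltaFunctor C).mapMon_zero_sameArrow (tangMon A)).trans' (delta_lin_zero A))

lemma lin_lastHom_succ (X : FaaObj C) (n : ℕ) : lin (lastHom X (n + 1)) =
    pair (bang (tang X.vec) ≫ (tangMon X.vec).zero) (lin (lastHom X n)) := by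
  refine (lin_pair _ _).symm.trans ?_
  rw [← lin_comp]
  rfl

lemma delta_lin_lastHom (X : FaaObj C) (n : ℕ) :
    SameArrow (delta (lin (lastHom X n))) (lin (lastHom (deltaObj X) n)) := by
  induction n with
  | zero => exact SameArrow.of_eq ((deltaFunctor C).map_id (tang X.vec))
  | succ n ih =>
    rw [lin_lastHom_succ, lin_lastHom_succ]
    refine ((deltaFunctor C).map_pair_sameArrow (bang (tang X.vec) ≫ (tangMon X.vec).zero)
      (lin (lastHom X n))).trans' (SameArrow.pair ?_ ih)
    refine (SameArrow.of_eq ((deltaFunctor C).map_comp (bang (tang X.vec))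
      (tangMon X.vec).zero)).trans' ?_
    exact ((deltaFunctor C).map_bang_sameArrow (tang X.vec)).comp (delta_lin_zero X.vec)

/-- The comultiplication commutes with the iterated derivatives which are its own terms. -/
lemma delta_deltaT (f : P ⟶ Q) (n : ℕ) : SameArrow (delta (Q := tang Q.vec) (deltaT f n))
    (deltaT (P := deltaObj P) (Q := deltaObj Q) (delta f) n) := by
  induction n with
  | zero => exact delta_diff f
  | succ n ih =>
    let W := vars (tang P.vec) P (n + 1)
    have hW : deltaObj W = vars (tang (deltaObj P).vec) (deltaObj P) (n + 1) :=
      (deltaFunctor C).obj_vars (tang P.vec) P (n + 1)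
    have h1 : SameArrow (delta (fst (tang P.vec) W ≫ lin (lastHom P (n + 1))))
        (fst (tang (deltaObj P).vec) (vars (tang (deltaObj P).vec) (deltaObj P) (n + 1)) ≫
          lin (lastHom (deltaObj P) (n + 1))) :=
      (SameArrow.of_eq ((deltaFunctor C).map_comp (fst (tang P.vec) W)
        (lin (lastHom P (n + 1))))).trans'
        (((delta_fst (tang P.vec) W).trans' (SameArrow.fst rfl hW)).comp
          (delta_lin_lastHom P (n + 1)))
    have h2 : SameArrow (delta (snd (tang P.vec) W))
        (snd (tang (deltaObj P).vec) (vars (tang (deltaObj P).vec) (deltaObj P) (n + 1))) :=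
      (delta_snd (tang P.vec) W).trans' (SameArrow.snd rfl hW)
    have h3 := ((deltaFunctor C).map_pair_sameArrow (fst (tang P.vec) W ≫ lin (lastHom P (n + 1)))
      (snd (tang P.vec) W)).trans' (h1.pair h2)
    refine (SameArrow.of_eq (delta_comp (pair (fst (tang P.vec) W ≫ lin (lastHom P (n + 1)))
      (snd (tang P.vec) W)) (diff (Q := tang Q.vec) (deltaT f n)))).trans' ?_
    exact h3.comp ((delta_diff (Q := tang Q.vec) (deltaT f n)).trans' ih.diff)

lemma deltaObj_deltaObj (P : FaaObj C) :
    (deltaFunctor C).mapObj (deltaObj P) = deltaObj (deltaObj P) :=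
  FaaObj.ext (tangMon_tangMon P.vec) rfl

lemma delta_delta (f : P ⟶ Q) : SameArrow ((deltaFunctor C).mapHom (delta f))
    (delta (P := deltaObj P) (Q := deltaObj Q) (delta f)) := by
  refine FaaHom.sameArrow (deltaObj_deltaObj P) (deltaObj_deltaObj Q) (SameArrow.rfl'
      (delta f)) fun n hn => ?_
  refine ((deltaFunctor C).mapHom_term_sameArrow (delta f) n hn).trans' ?_
  obtain ⟨n, rfl⟩ := Nat.exists_eq_add_one.2 hn
  exact delta_deltaT f n

variable (C) in
/-- The comultiplication is coassociative. -/
lemma deltaFunctor_coassoc : (deltaFunctor C).comp (deltaFunctor C).mapFaa =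
    (deltaFunctor C).comp (deltaFunctor (FaaObj C)) :=
  CRFunctor.ext_sameArrow deltaObj_deltaObj fun f => delta_delta f

end Coassoc

/-! ### The comonad and its cofree coalgebras -/

/-- The Faà di Bruno construction. -/
def faaData : FaaData.{v, u} where
  str X := faaCat
  isFaa X := isFaa X
  map F := CRFunctor.mapFaa F
  isFaaMap F := CRFunctor.isFaaMap_mapFaa F
  comult X := deltaFunctor X
  isComult X := isComult_deltaFunctor X

lemma faaData_isComonad : faaData.{v, u}.IsComonad where
  map_id _ := CRFunctor.mapFaa_id
  map_comp F G := CRFunctor.mapFaa_comp F G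
  ε_naturality F := CRFunctor.mapFaa_comp_counit F
  δ_naturality F := CRFunctor.mapFaa_comp_deltaFunctor F
  coassoc X := deltaFunctor_coassoc X
  left_counit X := CRFunctor.deltaFunctor_comp_counit X
  right_counit X := CRFunctor.deltaFunctor_comp_mapFaa_counit X

/-- The universal property of the cofree coalgebras of a comonad. -/
lemma existsUnique_hom_cofree {A : Type*} [Category A] (G : Comonad A) (Y : G.Coalgebra) {X : A}
    (F : Y.A ⟶ X) :
    ∃! H : Y ⟶ G.cofree.obj X, H.f ≫ G.ε.app X = F := by
  have key (H : Y ⟶ G.cofree.obj X) : (G.adj.homEquiv Y X).symm H = H.f ≫ G.ε.app X := by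
    rw [Adjunction.homEquiv_counit, Comonad.adj_counit]
    rfl
  refine ⟨G.adj.homEquiv Y X F, (key _).symm.trans (Equiv.symm_apply_apply _ F), fun H hH => ?_⟩
  exact (G.adj.homEquiv Y X).symm_apply_eq.1 ((key H).trans hH)

end FaaDiBruno

end

/-- The Faà di Bruno comonad on Cartesian restriction categories exists, and for every Cartesian
restriction category `X`, its cofree coalgebra `(Faà(X), δ)` makes `Faà(X)` a generalized
differential restriction category with `L A = (δ A)₀` and `D f = [δ f]₁`. -/
theorem mainTheorem9 :
    ∃ (T : FaaData.{v, u}) (h : T.IsComonad),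
      ∀ X : CRCat.{v, max u v},
        (
          letI : CartRestrCat (FaaObj X) := T.str X
          letI : CartRestrCat (FaaObj (FaaObj X)) := T.str ⟨FaaObj X⟩
          ∃ G : GenDiffRestr (FaaObj X),
            (∀ A : FaaObj X, G.L A = ((T.comult X).obj A).vec) ∧
            ∀ (A B : FaaObj X) (f : A ⟶ B),
              SameArrow (G.D f) (FaaHom.term ((T.comult X).map f) 1 Nat.one_pos)) ∧
        ∀ (Y : (T.comonad h).Coalgebra) (F : Y.A ⟶ X),
          ∃! H : Y ⟶ (T.comonad h).cofree.obj X, H.f ≫ (T.comonad h).ε.app X = F := by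
  refine ⟨faaData, faaData_isComonad, fun X => ⟨⟨genDiff X, fun A => rfl, fun A B f => ?_⟩,
    fun Y F => existsUnique_hom_cofree _ Y F⟩⟩
  exact SameArrow.rfl' (diff f)
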